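/- **Notation.** Let $\psi$ be a real, odd, primitive Dirichlet character modulo $D$, let $q$ be a prime, $X>0$ a real number, and let $k\in\{1,2\}$. Put $Q=qD/(4\pi^2)$, $(1\star\psi)(n)=\sum_{d\mid n}\psi(d)$, $$\alpha(n)=\prod_{p\mid n}\Big(1+\frac1p\Big)^{-1},\qquad h(n)=\prod_{p\mid n}\Big(1+\frac{\alpha(p)^2\psi(p)}{p}\Big)^{-1},\qquad \rho_1(a)=\big((\alpha\mu)\star(\alpha\mu\psi)\big)(a)\,h(a),$$ $$\rho_2(a)=\sum_{d\le X}\frac1d\sum_{\substack{a_1a_2=a\\ a_1,a_2\le X/d}}\rho_1(da_1)\rho_1(da_2).$$ Let $G$ be an even entire function of rapid decay in every vertical strip with $G(0)=1$, $G(1)=0$ and $G^{(j)}(0)=0$ for $1\le j\le k$, and for $x>0$ let $$V_k(x)=\frac1{2\pi i}\int_{(1)}G(u)\Gamma(1+u)^2x^{-u}\frac{du}{u^{k+1}}.$$ The diagonal term is $$\mathcal M_k^D=(k!)^2\big(1+(-1)^{k+1}\psi(q)\big)^2\sum_{\substack{d_1,d\ge1\\ abg\le X^2}}\frac{\psi(d_1)\psi(d)\mu(g)\psi(g)(1\star\psi)(b)}{d_1dbg^{3/2}}\sum_{\substack{n\ge1\\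 m=agn}}\frac{\rho_2(abg)(1\star\psi)(m)(1\star\psi)(n)}{\sqrt{amn}}V_k\Big(\frac{d_1^2m}{Q}\Big)V_k\Big(\frac{d^2bg^2n}{Q}\Big),$$ where all variables are positive integers, and the singular series is $$\mathfrak S_2=\prod_{p\mid D}\Big(1+\frac1p\Big)^{-2}\prod_{\substack{p\le X\\ p\nmid D}}\Big(\Big(1+\frac1p\Big)^2+\frac{\psi(p)}p\Big)^{-2}\Big(1-\frac{\psi(p)}p\Big)^2 .$$ **Proposition.** There are absolute constants $D_0$ and $\delta>0$ such that the following holds whenever $D\ge D_0$, $L(1,\psi)\log D\le\delta$, $q\ge D^{24}$ and $X\ge D^{24}$. For each $(a,b,g)$ with $abg\le X^2$ the sum over $(d_1,d,n)$ defining $\mathcal M_k^D$ converges absolutely, and, for all $\varepsilon>0$ and $A>0$, $$\mathcal M_1^D=4\big(1+\psi(q)\big)^2\mathfrak S_2L'(1,\psi)^2+O_\varepsilon\big(L(1,\psi)(\log q)^{37+\varepsilon}\big)+O_A\big((\log q)^{-A}\big)+O_\varepsilon\big(q^{-1/4+\varepsilon}D^{-1/4}X^{3/4}\big)$$ and $$\mathcal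 M_2^D=16\big(1-\psi(q)\big)^2\mathfrak S_2\,\big(1+O(\kappa)\big)\Big(L''(1,\psi)+(\log Q-2\gamma)L'(1,\psi)\Big)^2+O_\varepsilon\big(L(1,\psi)(\log q)^{39+\varepsilon}\big)+O_\varepsilon\big(q^{-1/4+\varepsilon}D^{-1/4}X^{3/4}\big),$$ where $$\kappa=\frac{\log\log\big(1/(L(1,\psi)\log D)\big)}{\log\big(1/(L(1,\psi)\log D)\big)}$$ and $\gamma$ is Euler's constant. The implied constants depend only on $G$ and on the displayed subscripts. -/

import Mathlib

open Filter Topology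

noncomputable section

namespace SecondMoment

/-- The weight functions `G` allowed in the approximate functional equation of order `k`: even entire
functions, of rapid decay in every vertical strip, with `G(0) = 1`, `G(1) = 0` and
`G⁽ʲ⁾(0) = 0` for `1 ≤ j ≤ k`. -/
structure IsAdmissibleWeight (k : ℕ) (G : ℂ → ℂ) : Prop where
  entire : Differentiable ℂ G
  even : ∀ u, G (-u) = G u
  map_zero : G 0 = 1
  map_one : G 1 = 0
  deriv_zero : ∀ j : ℕ, 1 ≤ j → j ≤ k → iteratedDeriv j G 0 = 0
  rapid_decay : ∀ (C : ℝ) (N : ℕ), ∃ K : ℝ, ∀ u : ℂ, |u.re| ≤ C → ‖G u‖ * (1 + |u.im|) ^ N ≤ K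

/-- `V_k(x) = (1 / 2πi) ∫_{(1)} G(u) Γ(1+u)² x^{-u} du / u^{k+1}`. Mathlib's `mellinInv σ F x` is
`(1 / 2πi) ∫_{Re u = σ} F(u) x^{-u} du`. -/
def V (G : ℂ → ℂ) (k : ℕ) (x : ℝ) : ℂ :=
  mellinInv 1 (fun u : ℂ => G u * Complex.Gamma (1 + u) ^ 2 / u ^ (k + 1)) x

/-- `α(n) = ∏_{p ∣ n} (1 + 1/p)⁻¹`. -/
def alpha (n : ℕ) : ℝ := ∏ p ∈ n.primeFactors, (1 + 1 / (p : ℝ))⁻¹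

/-- `Q = q D / (4π²)`. -/
def Q (q D : ℕ) : ℝ := (q : ℝ) * D / (4 * Real.pi ^ 2)

section Character

variable {D : ℕ} (ψ : DirichletCharacter ℂ D)

/-- The Dirichlet convolution `(1 ⋆ ψ)(n) = ∑_{d ∣ n} ψ(d)`. -/
def oneConv (n : ℕ) : ℂ := ∑ d ∈ n.divisors, ψ (d : ZMod D)

/-- `h(n) = ∏_{p ∣ n} (1 + α(p)² ψ(p) / p)⁻¹`. -/
def h (n : ℕ) : ℂ :=
  ∏ p ∈ n.primeFactors, (1 + (alpha p : ℂ) ^ 2 * ψ (p : ZMod D) / (p : ℂ))⁻¹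

/-- The mollifier coefficients `ρ₁(a) = ((αμ) ⋆ (αμψ))(a) h(a)`. -/
def rho1 (a : ℕ) : ℂ :=
  (∑ m ∈ a.divisorsAntidiagonal,
    ((alpha m.1 : ℂ) * (ArithmeticFunction.moebius m.1 : ℂ)) *
      ((alpha m.2 : ℂ) * (ArithmeticFunction.moebius m.2 : ℂ) * ψ (m.2 : ZMod D))) * h ψ a

/-- The coefficients of the squared mollifier:
`ρ₂(a) = ∑_{d ≤ X} d⁻¹ ∑_{a₁ a₂ = a, a₁, a₂ ≤ X/d} ρ₁(d a₁) ρ₁(d a₂)`. -/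
def rho2 (X : ℝ) (a : ℕ) : ℂ :=
  ∑ d ∈ Finset.Icc 1 ⌊X⌋₊, (1 / (d : ℂ)) *
    ∑ m ∈ a.divisorsAntidiagonal.filter
        (fun m : ℕ × ℕ => (m.1 : ℝ) ≤ X / d ∧ (m.2 : ℝ) ≤ X / d),
      rho1 ψ (d * m.1) * rho1 ψ (d * m.2)

/-- The triples `(a, b, g)` of positive integers with `a b g ≤ X²`. -/
def triples (X : ℝ) : Finset (ℕ × ℕ × ℕ) :=
  (Finset.Icc 1 ⌊X ^ 2⌋₊ ×ˢ Finset.Icc 1 ⌊X ^ 2⌋₊ ×ˢ Finset.Icc 1 ⌊X ^ 2⌋₊).filter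
    (fun t => ((t.1 * t.2.1 * t.2.2 : ℕ) : ℝ) ≤ X ^ 2)

/-- The summand of `𝓜_k^D` at `(a, b, g)` and `(d₁, d, n)`; here `m = a g n`. -/
def diagTerm (G : ℂ → ℂ) (k q : ℕ) (X : ℝ) (t : ℕ × ℕ × ℕ) (s : ℕ+ × ℕ+ × ℕ+) : ℂ :=
  let a : ℕ := t.1
  let b : ℕ := t.2.1
  let g : ℕ := t.2.2
  let d₁ : ℕ := s.1
  let d : ℕ := s.2.1
  let n : ℕ := s.2.2
  let m : ℕ := a * g * n
  ψ (d₁ : ZMod D) * ψ (d : ZMod D) *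
      ((ArithmeticFunction.moebius g : ℂ) * ψ (g : ZMod D)) * oneConv ψ b
      / ((d₁ : ℂ) * (d : ℂ) * (b : ℂ) * (((g : ℝ) ^ (3 / 2 : ℝ) : ℝ) : ℂ))
    * (rho2 ψ X (a * b * g) * oneConv ψ m * oneConv ψ n
      / ((Real.sqrt ((a : ℝ) * m * n) : ℝ) : ℂ))
    * V G k ((d₁ : ℝ) ^ 2 * m / Q q D)
    * V G k ((d : ℝ) ^ 2 * b * (g : ℝ) ^ 2 * n / Q q D)

/-- The diagonal contribution `𝓜_k^D` to the mollified second moment. -/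
def diagonal (G : ℂ → ℂ) (k q : ℕ) (X : ℝ) : ℂ :=
  ((k.factorial : ℂ)) ^ 2 * (1 + (-1) ^ (k + 1) * ψ (q : ZMod D)) ^ 2 *
    ∑ t ∈ triples X, ∑' s : ℕ+ × ℕ+ × ℕ+, diagTerm ψ G k q X t s

/-- The singular series
`𝔖₂ = ∏_{p ∣ D} (1 + 1/p)⁻² ∏_{p ≤ X, p ∤ D} ((1 + 1/p)² + ψ(p)/p)⁻² (1 - ψ(p)/p)²`. -/
def singularSeries2 (X : ℝ) : ℂ :=
  (∏ p ∈ D.primeFactors, ((1 + 1 / (p : ℂ)) ^ 2)⁻¹) *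
    ∏ p ∈ (Finset.Icc 1 ⌊X⌋₊).filter (fun p => p.Prime ∧ ¬ p ∣ D),
      (((1 + 1 / (p : ℂ)) ^ 2 + ψ (p : ZMod D) / (p : ℂ)) ^ 2)⁻¹ *
        (1 - ψ (p : ZMod D) / (p : ℂ)) ^ 2

variable [NeZero D]

/-- `L(1, ψ)` as a real number (for real non-principal `ψ` the complex value is real). -/
def L1 : ℝ := (ψ.LFunction 1).re

/-- The lacunarity saving
`log log (1 / (L(1, ψ) log D)) / log (1 / (L(1, ψ) log D))`. -/
def kappa : ℝ :=
  Real.log (Real.log (1 / (L1 ψ * Real.log D))) / Real.log (1 / (L1 ψ * Real.log D))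

/-- `L''(1, ψ) + (log Q - 2γ) L'(1, ψ)`. -/
def mainFactor (q : ℕ) : ℂ :=
  iteratedDeriv 2 ψ.LFunction 1 +
    ((Real.log (Q q D) - 2 * Real.eulerMascheroniConstant : ℝ) : ℂ) * deriv ψ.LFunction 1

end Character

end SecondMoment

end

open SecondMoment

/-!
Write `r = 1 ⋆ ψ`. Smallness of `L(1, ψ) log D` makes `r` lacunary: apart from a sparse set, all
primes `p ≤ D^24` are inert (`ψ(p) = -1`, `r(p) = 0`), and `∑_{n > D²} r(n) n^{-1-σ} ≪ L(1, ψ) / σ`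
(`CharData.tail_le`). Everything rests on this and on `L(1, ψ) ≫ 1 / D` (`CharData.L_ge`); both come
from comparing sums of `r(n) e^{-n/x}` with integrals. No zero-free region is used.

Summing over `d₁` and `d` first turns the diagonal term into a sum over tuples `(d, a, b, g, n)`, `d`
being the variable in the definition of `ρ₂`, of an arithmetic weight times two values of the smoothed
character sum `∑ ψ(d)/d V(d² y)` (`diagonal_eq`). Moving the contour of `V` past `0` shows that this
sum is close to `2 (M - l log (y Q))` for small `y`, where `M = L'(1, ψ)`, `l = 0` if `k = 1` and
`M = L''(1, ψ) + (log Q - 2γ) L'(1, ψ)`, `l = L'(1, ψ)` if `k = 2` (`exists_charV_sub_bound`).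

The weight has a jointly multiplicative majorant. Factor every tuple into an inert and a non-inert part:
on inert tuples the majorant vanishes to first order at each prime and converges with room to spare,
on non-inert ones it is bounded by sums of powers of `r`. So the whole sum is at most a power of
`ℓ = log (q X)`, and the tuples outside the box `d a b g ≤ D^24`, `n ≤ D^7` contribute at most `L(1, ψ)`
times a power of `ℓ` (`exists_majorant_log`). In the box the truncations at `X` are invisible and the
smoothed sums may be replaced by their main parts; afterwards the sum is completed to all tuples of
`D^24`-smooth numbers, by Rankin's trick (`exists_evaluation`).

The completed sum is an Euler product whose local factors are those of the singular series. Logarithms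
of the variables cost a factor `∑ log p (r(p)/p + 1/p²)` over `p ≤ D^24`, which is `≪ κ log D`: a
product of `j` non-inert primes has `r ≥ 1`, and `j` is optimized (`exists_lacunarity`). As
`M ≫ l log q` (`CharData.exists_main_ge`), the relative error is `O(κ)` for `k = 2`; for `k = 1` no
logarithm is present. Finally, powers of `log (q X)` are powers of `log q` if `X ≤ q`, while for `X > q`
the error term `q^{-1/4+ε} D^{-1/4} X^{3/4}` exceeds every term of the formula (`exists_error_bound`).
The error `O_A((log q)^{-A})` is never needed, so its constant is taken to be `0`.
-/

noncomputable section

namespace SecondMoment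

open MeasureTheory Complex Set

/-! ### Shifting vertical contours -/

lemma integrable_of_norm_le_inv_one_add_sq {f : ℝ → ℂ} (hf : Continuous f) {K : ℝ}
    (hK : ∀ y, ‖f y‖ ≤ K * (1 + y ^ 2)⁻¹) : Integrable f :=
  (integrable_inv_one_add_sq.const_mul K).mono' hf.aestronglyMeasurable
    (Eventually.of_forall hK)

lemma integral_vertical_sub_eq_zero {f : ℂ → ℂ} {a b : ℝ} (hab : a ≤ b)
    (hf : DifferentiableOn ℂ f (re ⁻¹' Icc a b)) (C : ℝ)
    (hC : ∀ x ∈ Icc a b, ∀ y : ℝ, 1 ≤ |y| → ‖f (x + y * I)‖ ≤ C / |y|)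
    (hi : Integrable fun y : ℝ => f (b + y * I) - f (a + y * I)) :
    ∫ y : ℝ, (f (b + y * I) - f (a + y * I)) = 0 := by
  have hcont : ∀ x ∈ Icc a b, Continuous fun y : ℝ => f (x + y * I) := by
    intro x hx
    have : Continuous fun y : ℝ => ((x : ℂ) + y * I) := by fun_prop
    exact hf.continuousOn.comp_continuous this (fun y => by simpa using hx)
  have ha : a ∈ Icc a b := left_mem_Icc.2 hab
  have hb : b ∈ Icc a b := right_mem_Icc.2 hab
  have key : ∀ T : ℝ, 1 ≤ T →
      ‖∫ y in (-T)..T, (f (b + y * I) - f (a + y * I))‖ ≤ 2 * (C * (b - a)) / T := by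
    intro T hT
    have h := integral_boundary_rect_eq_zero_of_differentiableOn f (a - T * I) (b + T * I)
      (hf.mono (fun z hz => by
        have := hz.1
        simp only [sub_re, ofReal_re, mul_re, I_re, mul_zero, ofReal_im, I_im, sub_zero,
          add_re, add_zero, mem_preimage, mul_one, sub_self, uIcc_of_le hab] at this
        exact this))
    simp only [sub_re, ofReal_re, mul_re, I_re, mul_zero, ofReal_im, I_im, sub_zero,
      add_re, add_zero, sub_im, mul_im, mul_one, zero_sub, add_im, zero_add, sub_self] at h
    rw [intervalIntegral.integral_sub ((hcont b hb).intervalIntegrable _ _)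
      ((hcont a ha).intervalIntegrable _ _)]
    have hbd : ∀ S : ℝ, |S| = T → ‖∫ x in a..b, f (x + S * I)‖ ≤ C / T * |b - a| := by
      intro S hS
      refine intervalIntegral.norm_integral_le_of_norm_le_const (fun x hx => ?_)
      rw [uIoc_of_le hab] at hx
      rw [← hS]
      exact hC x ⟨hx.1.le, hx.2⟩ S (hS ▸ hT)
    have h1 := hbd (-T) (by rw [abs_neg, abs_of_pos (by linarith)])
    have h2 := hbd T (abs_of_pos (by linarith))
    rw [abs_of_nonneg (by linarith)] at h1 h2
    have h3 : I * ((∫ y in (-T)..T, f (b + y * I)) - ∫ y in (-T)..T, f (a + y * I))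
        = (∫ x in a..b, f (x + T * I)) - ∫ x in a..b, f (x + (-T : ℝ) * I) := by
      simp only [smul_eq_mul] at h
      push_cast at h ⊢
      linear_combination h
    have h4 := congrArg norm h3
    rw [norm_mul, norm_I, one_mul] at h4
    rw [h4]
    refine (norm_sub_le _ _).trans ?_
    calc _ ≤ C / T * (b - a) + C / T * (b - a) := add_le_add h2 h1
      _ = _ := by ring
  have hlim := intervalIntegral_tendsto_integral hi tendsto_neg_atTop_atBot tendsto_id
  have hz : Tendsto (fun T : ℝ => ∫ y in (-T)..T, (f (b + y * I) - f (a + y * I))) atTop (𝓝 0) := by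
    refine squeeze_zero_norm' (eventually_atTop.2 ⟨1, key⟩) ?_
    exact tendsto_const_nhds.div_atTop tendsto_id
  exact tendsto_nhds_unique hlim hz

/-- Two vertical lines carry the same integral of a function holomorphic between them that
decays like `|Im u|⁻²`. -/
lemma integral_vertical_eq {f : ℂ → ℂ} {a b : ℝ} (hab : a ≤ b)
    (hf : DifferentiableOn ℂ f (re ⁻¹' Icc a b)) (C : ℝ)
    (hC : ∀ x ∈ Icc a b, ∀ y : ℝ, ‖f (x + y * I)‖ ≤ C * (1 + y ^ 2)⁻¹) :
    ∫ y : ℝ, f (b + y * I) = ∫ y : ℝ, f (a + y * I) := by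
  have hint : ∀ x ∈ Icc a b, Integrable fun y : ℝ => f (x + y * I) := by
    intro x hx
    refine integrable_of_norm_le_inv_one_add_sq ?_ (hC x hx)
    have : Continuous fun y : ℝ => ((x : ℂ) + y * I) := by fun_prop
    exact hf.continuousOn.comp_continuous this (fun y => by simpa using hx)
  have ha := hint a (left_mem_Icc.2 hab)
  have hb := hint b (right_mem_Icc.2 hab)
  have hC0 : 0 ≤ C := by
    have := (norm_nonneg _).trans (hC a (left_mem_Icc.2 hab) 0)
    simpa using this
  have h := integral_vertical_sub_eq_zero hab hf C (fun x hx y hy => (hC x hx y).trans ?_)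
    (hb.sub ha)
  · rw [integral_sub hb ha] at h
    exact sub_eq_zero.1 h
  · rw [div_eq_mul_inv]
    refine mul_le_mul_of_nonneg_left (inv_anti₀ (by linarith) ?_) hC0
    nlinarith [sq_abs y]

lemma vertical_ne_zero {c : ℝ} (hc : c ≠ 0) (y : ℝ) : (c : ℂ) + y * I ≠ 0 := by
  intro h
  have := congrArg re h
  simp at this
  exact hc this

lemma normSq_vertical (c y : ℝ) : ‖(c : ℂ) + y * I‖ ^ 2 = c ^ 2 + y ^ 2 := by
  rw [← Complex.normSq_eq_norm_sq, Complex.normSq_add_mul_I]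

lemma inv_normSq_vertical_le {c : ℝ} (hc : 0 < c ^ 2) (hc1 : c ^ 2 ≤ 1) (y : ℝ) :
    (‖(c : ℂ) + y * I‖ ^ 2)⁻¹ ≤ (c ^ 2)⁻¹ * (1 + y ^ 2)⁻¹ := by
  rw [normSq_vertical, ← mul_inv]
  refine inv_anti₀ (by positivity) ?_
  nlinarith [sq_nonneg y]

lemma tendsto_inv_vertical (c : ℝ) (l : Filter ℝ) (hl : Tendsto (fun y : ℝ => |y|) l atTop) :
    Tendsto (fun y : ℝ => ((c : ℂ) + y * I)⁻¹) l (𝓝 0) := by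
  rw [tendsto_zero_iff_norm_tendsto_zero]
  simp only [norm_inv]
  refine tendsto_inv_atTop_zero.comp (tendsto_atTop_mono (fun y => ?_) hl)
  simpa using Complex.abs_im_le_norm ((c : ℂ) + y * I)

lemma integral_vertical_inv_sq {c : ℝ} (hc : 0 < c ^ 2) (hc1 : c ^ 2 ≤ 1) :
    Integrable (fun y : ℝ => (((c : ℂ) + y * I) ^ 2)⁻¹) ∧
    ∫ y : ℝ, (((c : ℂ) + y * I) ^ 2)⁻¹ = 0 := by
  have hc0 : c ≠ 0 := by rintro rfl; simp at hc
  have hne := vertical_ne_zero hc0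
  have hcont : Continuous fun y : ℝ => (((c : ℂ) + y * I) ^ 2)⁻¹ :=
    Continuous.inv₀ (by fun_prop) (fun y => pow_ne_zero _ (hne y))
  have hint : Integrable (fun y : ℝ => (((c : ℂ) + y * I) ^ 2)⁻¹) :=
    integrable_of_norm_le_inv_one_add_sq hcont (K := (c ^ 2)⁻¹) (fun y => by
      rw [norm_inv, norm_pow]; exact inv_normSq_vertical_le hc hc1 y)
  refine ⟨hint, ?_⟩
  have hd : ∀ y : ℝ, HasDerivAt (fun y : ℝ => I * ((c : ℂ) + y * I)⁻¹)
      ((((c : ℂ) + y * I) ^ 2)⁻¹) y := by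
    intro y
    have h1 : HasDerivAt (fun y : ℝ => (c : ℂ) + y * I) (1 * I) y :=
      ((hasDerivAt_id y).ofReal_comp.mul_const I).const_add _
    have h2 := (h1.inv (hne y)).const_mul I
    refine h2.congr_deriv ?_
    rw [one_mul, ← mul_div_assoc, mul_neg, I_mul_I, neg_neg, one_div]
  have h0 : ∀ l : Filter ℝ, Tendsto (fun y : ℝ => |y|) l atTop →
      Tendsto (fun y : ℝ => I * ((c : ℂ) + y * I)⁻¹) l (𝓝 0) := fun l hl => by
    simpa using (tendsto_inv_vertical c l hl).const_mul I
  simpa using integral_of_hasDerivAt_of_tendsto hd hint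
    (h0 _ tendsto_abs_atBot_atTop) (h0 _ tendsto_abs_atTop_atTop)

lemma integral_vertical_inv_cube {c : ℝ} (hc : 0 < c ^ 2) (hc1 : c ^ 2 ≤ 1) :
    Integrable (fun y : ℝ => (((c : ℂ) + y * I) ^ 3)⁻¹) ∧
    ∫ y : ℝ, (((c : ℂ) + y * I) ^ 3)⁻¹ = 0 := by
  have hc0 : c ≠ 0 := by rintro rfl; simp at hc
  have hne := vertical_ne_zero hc0
  have hcont : Continuous fun y : ℝ => (((c : ℂ) + y * I) ^ 3)⁻¹ :=
    Continuous.inv₀ (by fun_prop) (fun y => pow_ne_zero _ (hne y))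
  have hint : Integrable (fun y : ℝ => (((c : ℂ) + y * I) ^ 3)⁻¹) :=
    integrable_of_norm_le_inv_one_add_sq hcont (K := |c|⁻¹ * (c ^ 2)⁻¹) (fun y => by
      rw [norm_inv, norm_pow, pow_succ' _ 2, mul_inv, mul_assoc]
      refine mul_le_mul (inv_anti₀ (abs_pos.2 hc0) ?_) (inv_normSq_vertical_le hc hc1 y)
        (by positivity) (by positivity)
      simpa using Complex.abs_re_le_norm ((c : ℂ) + y * I))
  refine ⟨hint, ?_⟩
  have hd : ∀ y : ℝ, HasDerivAt (fun y : ℝ => I / 2 * (((c : ℂ) + y * I)⁻¹) ^ 2)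
      ((((c : ℂ) + y * I) ^ 3)⁻¹) y := by
    intro y
    have h1 : HasDerivAt (fun y : ℝ => (c : ℂ) + y * I) (1 * I) y :=
      ((hasDerivAt_id y).ofReal_comp.mul_const I).const_add _
    have h2 := ((h1.inv (hne y)).pow 2).const_mul (I / 2)
    refine h2.congr_deriv ?_
    have hz := hne y
    simp only [Pi.inv_apply]
    generalize (c : ℂ) + y * I = z at hz
    have : I / 2 * (((2 : ℕ) : ℂ) * z⁻¹ ^ (2 - 1) * (-(1 * I) / z ^ 2)) = -(I * I) * (z ^ 3)⁻¹ := by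
      push_cast
      field_simp
    rw [this, I_mul_I, neg_neg, one_mul]
  have h0 : ∀ l : Filter ℝ, Tendsto (fun y : ℝ => |y|) l atTop →
      Tendsto (fun y : ℝ => I / 2 * (((c : ℂ) + y * I)⁻¹) ^ 2) l (𝓝 0) := fun l hl => by
    simpa using ((tendsto_inv_vertical c l hl).pow 2).const_mul (I / 2)
  simpa using integral_of_hasDerivAt_of_tendsto hd hint
    (h0 _ tendsto_abs_atBot_atTop) (h0 _ tendsto_abs_atTop_atTop)

lemma integral_vertical_inv_sub {c : ℝ} (hc : 0 < c) :
    Integrable (fun y : ℝ => ((c : ℂ) + y * I)⁻¹ - ((-c : ℝ) + y * I : ℂ)⁻¹) ∧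
    ∫ y : ℝ, (((c : ℂ) + y * I)⁻¹ - ((-c : ℝ) + y * I : ℂ)⁻¹) = 2 * Real.pi := by
  have hfun : (fun y : ℝ => ((c : ℂ) + y * I)⁻¹ - ((-c : ℝ) + y * I : ℂ)⁻¹)
      = fun y : ℝ => (((2 / c) * (1 + (c⁻¹ * y) ^ 2)⁻¹ : ℝ) : ℂ) := by
    funext y
    have h1 := vertical_ne_zero hc.ne' y
    have h2 := vertical_ne_zero (neg_ne_zero.2 hc.ne') y
    have h3 : (c : ℂ) ≠ 0 := by exact_mod_cast hc.ne'
    have h4 : (1 + (c⁻¹ * y) ^ 2 : ℂ) ≠ 0 := by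
      have : (1 + (c⁻¹ * y) ^ 2 : ℝ) ≠ 0 := by positivity
      exact_mod_cast this
    have h5 : ((c : ℂ) ^ 2 + y ^ 2) ≠ 0 := by
      have : (c ^ 2 + y ^ 2 : ℝ) ≠ 0 := by positivity
      exact_mod_cast this
    push_cast at h2 ⊢
    rw [inv_sub_inv h1 h2]
    have h6 : ((c : ℂ) + y * I) * (-c + y * I) = -(c ^ 2 + y ^ 2) := by
      linear_combination (y : ℂ) ^ 2 * I_sq
    have h7 : (1 + ((c : ℂ)⁻¹ * y) ^ 2) = (c ^ 2 + y ^ 2) / c ^ 2 := by field_simp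
    rw [h6, h7]
    field_simp
    ring
  have hi : Integrable (fun y : ℝ => (2 / c) * (1 + (c⁻¹ * y) ^ 2)⁻¹) :=
    (integrable_inv_one_add_sq.comp_mul_left' (inv_ne_zero hc.ne')).const_mul _
  rw [hfun]
  refine ⟨hi.ofReal, ?_⟩
  rw [integral_complex_ofReal, integral_const_mul,
    Measure.integral_comp_mul_left (fun y : ℝ => (1 + y ^ 2)⁻¹) c⁻¹,
    integral_univ_inv_one_add_sq, inv_inv, abs_of_pos hc, smul_eq_mul]
  have h3 : (c : ℂ) ≠ 0 := by exact_mod_cast hc.ne'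
  push_cast
  field_simp

/-- The residue theorem for a pole of order at most three at `0` between the lines `Re u = ± c`;
`c₂` is the residue of `g(u) / u³`. -/
lemma integral_vertical_residue {c : ℝ} (hc : 0 < c) (hc1 : c ≤ 1) {g φ : ℂ → ℂ} {c₀ c₁ c₂ : ℂ}
    {K : ℝ} (hφ : DifferentiableOn ℂ φ (re ⁻¹' Icc (-c) c))
    (hg : ∀ u ∈ re ⁻¹' Icc (-c) c, g u = c₀ + c₁ * u + c₂ * u ^ 2 + u ^ 3 * φ u)
    (hK : ∀ u ∈ re ⁻¹' Icc (-c) c, ‖g u‖ ≤ K) :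
    (∫ y : ℝ, g (c + y * I) / (c + y * I) ^ 3) - ∫ y : ℝ, g ((-c : ℝ) + y * I) / ((-c : ℝ) + y * I) ^ 3
      = 2 * Real.pi * c₂ := by
  have hc2 : 0 < c ^ 2 := by positivity
  have hc2' : c ^ 2 ≤ 1 := by nlinarith
  have hmem : ∀ x ∈ Icc (-c) c, ∀ y : ℝ, (x : ℂ) + y * I ∈ re ⁻¹' Icc (-c) c :=
    fun x hx y => by simpa using hx
  have hcc : c ∈ Icc (-c) c := ⟨by linarith, le_rfl⟩
  have hcn : -c ∈ Icc (-c) c := ⟨le_rfl, by linarith⟩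
  have hgc : ContinuousOn g (re ⁻¹' Icc (-c) c) := by
    refine ContinuousOn.congr (f := fun u => c₀ + c₁ * u + c₂ * u ^ 2 + u ^ 3 * φ u) ?_ hg
    have := hφ.continuousOn
    fun_prop
  have hK0 : 0 ≤ K := (norm_nonneg _).trans (hK _ (hmem c hcc 0))
  have hgi : ∀ x ∈ Icc (-c) c, x ^ 2 = c ^ 2 →
      Integrable fun y : ℝ => g (x + y * I) / (x + y * I) ^ 3 := by
    intro x hx hxc
    have hx0 : x ≠ 0 := by rintro rfl; simp at hxc; exact hc2.ne hxc
    have hcont : Continuous fun y : ℝ => ((x : ℂ) + y * I) := by fun_prop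
    refine integrable_of_norm_le_inv_one_add_sq (K := K * (|x|⁻¹ * (x ^ 2)⁻¹)) ?_ ?_
    · exact (hgc.comp_continuous hcont (hmem x hx)).div (by fun_prop)
        (fun y => pow_ne_zero _ (vertical_ne_zero hx0 y))
    · intro y
      rw [norm_div, div_eq_mul_inv, norm_pow, pow_succ' _ 2, mul_inv, mul_assoc K]
      refine mul_le_mul (hK _ (hmem x hx y)) ?_ (by positivity) hK0
      rw [mul_assoc]
      refine mul_le_mul (inv_anti₀ (abs_pos.2 hx0) ?_)
        (inv_normSq_vertical_le (hxc ▸ hc2) (hxc ▸ hc2') y) (by positivity) (by positivity)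
      simpa using Complex.abs_re_le_norm ((x : ℂ) + y * I)
  have i1 := hgi c hcc rfl
  have i2 := hgi (-c) hcn (by ring)
  obtain ⟨s1, s1'⟩ := integral_vertical_inv_sq hc2 hc2'
  obtain ⟨s2, s2'⟩ := integral_vertical_inv_sq (c := -c) (by simpa using hc2) (by simpa using hc2')
  obtain ⟨q1, q1'⟩ := integral_vertical_inv_cube hc2 hc2'
  obtain ⟨q2, q2'⟩ := integral_vertical_inv_cube (c := -c) (by simpa using hc2) (by simpa using hc2')
  obtain ⟨l1, l1'⟩ := integral_vertical_inv_sub hc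
  have hφe : ∀ x ∈ Icc (-c) c, x ≠ 0 → ∀ y : ℝ, φ (x + y * I) =
      g (x + y * I) / (x + y * I) ^ 3 - c₀ * (((x : ℂ) + y * I) ^ 3)⁻¹
        - c₁ * (((x : ℂ) + y * I) ^ 2)⁻¹ - c₂ * ((x : ℂ) + y * I)⁻¹ := by
    intro x hx hx0 y
    have h0 := vertical_ne_zero hx0 y
    rw [hg _ (hmem x hx y)]
    field_simp
    ring
  have hdiff : (fun y : ℝ => φ (c + y * I) - φ ((-c : ℝ) + y * I)) = fun y : ℝ =>
      (g (c + y * I) / (c + y * I) ^ 3 - g ((-c : ℝ) + y * I) / ((-c : ℝ) + y * I) ^ 3)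
      - c₀ * ((((c : ℂ) + y * I) ^ 3)⁻¹ - ((((-c : ℝ) : ℂ) + y * I) ^ 3)⁻¹)
      - c₁ * ((((c : ℂ) + y * I) ^ 2)⁻¹ - ((((-c : ℝ) : ℂ) + y * I) ^ 2)⁻¹)
      - c₂ * (((c : ℂ) + y * I)⁻¹ - ((-c : ℝ) + y * I : ℂ)⁻¹) := by
    funext y
    rw [hφe c hcc hc.ne', hφe (-c) hcn (by linarith)]
    ring
  have I1 : Integrable fun y : ℝ => g (c + y * I) / (c + y * I) ^ 3
      - g ((-c : ℝ) + y * I) / ((-c : ℝ) + y * I) ^ 3 := i1.sub i2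
  have I2 : Integrable fun y : ℝ => c₀ * ((((c : ℂ) + y * I) ^ 3)⁻¹
      - ((((-c : ℝ) : ℂ) + y * I) ^ 3)⁻¹) := (q1.sub q2).const_mul c₀
  have I3 : Integrable fun y : ℝ => c₁ * ((((c : ℂ) + y * I) ^ 2)⁻¹
      - ((((-c : ℝ) : ℂ) + y * I) ^ 2)⁻¹) := (s1.sub s2).const_mul c₁
  have I4 := l1.const_mul c₂
  have hz := integral_vertical_sub_eq_zero (by linarith : -c ≤ c) hφ (K + ‖c₀‖ + ‖c₁‖ + ‖c₂‖) ?_ ?_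
  · have I12 := I1.sub I2
    have I123 := I12.sub I3
    simp only [Pi.sub_def] at I12 I123
    rw [hdiff, integral_sub I123 I4, integral_sub I12 I3, integral_sub I1 I2, integral_sub i1 i2, integral_const_mul, integral_const_mul,
      integral_const_mul, integral_sub q1 q2, integral_sub s1 s2, l1', s1', s2', q1', q2'] at hz
    linear_combination hz
  · intro x hx y hy
    set u : ℂ := x + y * I with hu
    have hyu : |y| ≤ ‖u‖ := by simpa [hu] using Complex.abs_im_le_norm u
    have hu1 : 1 ≤ ‖u‖ := hy.trans hyu
    have hu0 : u ≠ 0 := by intro h; rw [h, norm_zero] at hu1; linarith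
    have he : φ u = (g u - c₀ - c₁ * u - c₂ * u ^ 2) / u ^ 3 := by
      rw [hg u (hmem x hx y)]; field_simp; ring
    have hb : ‖g u - c₀ - c₁ * u - c₂ * u ^ 2‖ ≤ (K + ‖c₀‖ + ‖c₁‖ + ‖c₂‖) * ‖u‖ ^ 2 := by
      have h1 : ‖g u - c₀ - c₁ * u - c₂ * u ^ 2‖ ≤ ‖g u‖ + ‖c₀‖ + ‖c₁‖ * ‖u‖ + ‖c₂‖ * ‖u‖ ^ 2 := by
        calc _ ≤ ‖g u - c₀ - c₁ * u‖ + ‖c₂ * u ^ 2‖ := norm_sub_le _ _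
          _ ≤ ‖g u - c₀‖ + ‖c₁ * u‖ + ‖c₂ * u ^ 2‖ := by gcongr; exact norm_sub_le _ _
          _ ≤ ‖g u‖ + ‖c₀‖ + ‖c₁ * u‖ + ‖c₂ * u ^ 2‖ := by gcongr; exact norm_sub_le _ _
          _ = _ := by rw [norm_mul, norm_mul, norm_pow]
      have h2 : ‖u‖ ≤ ‖u‖ ^ 2 := by nlinarith
      have h3 : 1 ≤ ‖u‖ ^ 2 := by nlinarith
      have h4 := hK u (hmem x hx y)
      nlinarith [norm_nonneg c₀, norm_nonneg c₁, norm_nonneg c₂,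
        mul_le_mul_of_nonneg_left h2 (norm_nonneg c₁), mul_le_mul_of_nonneg_left h3 (norm_nonneg c₀),
        mul_le_mul_of_nonneg_left h3 hK0]
    rw [he, norm_div, norm_pow, div_le_div_iff₀ (by positivity) (by linarith)]
    calc _ ≤ (K + ‖c₀‖ + ‖c₁‖ + ‖c₂‖) * ‖u‖ ^ 2 * ‖u‖ :=
          mul_le_mul hb hyu (abs_nonneg _) (by positivity)
      _ = _ := by ring
  · rw [hdiff]
    exact ((I1.sub I2).sub I3).sub I4

/-! ### The weight function `V` -/

lemma exists_taylor_two {f : ℂ → ℂ} {U : Set ℂ} (hU : U ∈ 𝓝 (0 : ℂ)) (hf : DifferentiableOn ℂ f U) :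
    ∃ (h₂ : ℂ) (φ : ℂ → ℂ), DifferentiableOn ℂ φ U ∧
      ∀ u, f u = f 0 + deriv f 0 * u + h₂ * u ^ 2 + u ^ 3 * φ u := by
  refine ⟨deriv (dslope f 0) 0, dslope (dslope (dslope f 0) 0) 0, ?_, fun u => ?_⟩
  · rw [Complex.differentiableOn_dslope hU, Complex.differentiableOn_dslope hU,
      Complex.differentiableOn_dslope hU]
    exact hf
  · have h1 := sub_smul_dslope f 0 u
    have h2 := sub_smul_dslope (dslope f 0) 0 u
    have h3 := sub_smul_dslope (dslope (dslope f 0) 0) 0 u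
    simp only [sub_zero, smul_eq_mul, dslope_same] at h1 h2 h3
    linear_combination -h1 - u * h2 - u ^ 2 * h3

lemma exists_exp_taylor : ∃ φ : ℂ → ℂ, Differentiable ℂ φ ∧
    ∀ w, exp w = 1 + w + w ^ 2 / 2 + w ^ 3 * φ w := by
  obtain ⟨h₂, φ, hφ, h⟩ := exists_taylor_two (f := exp) (U := univ) univ_mem
    differentiable_exp.differentiableOn
  rw [differentiableOn_univ] at hφ
  simp only [exp_zero, Complex.deriv_exp, one_mul] at h
  have hb : ∀ w : ℂ, ‖w‖ ≤ 1 → ‖(h₂ - 1 / 2) * w ^ 2‖ ≤ ‖w‖ ^ 3 * (1 + ‖φ w‖) := by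
    intro w hw
    have h1 := Complex.exp_bound hw (n := 3) (by norm_num)
    have h2 : (h₂ - 1 / 2) * w ^ 2 = (exp w - ∑ m ∈ Finset.range 3, w ^ m / m.factorial)
        - w ^ 3 * φ w := by
      rw [h w]
      simp [Finset.sum_range_succ, Nat.factorial]
      ring
    rw [h2]
    refine (norm_sub_le _ _).trans ?_
    rw [norm_mul, norm_pow, mul_add, mul_one]
    gcongr
    refine h1.trans ?_
    have : ((Nat.succ 3 : ℕ) * ((Nat.factorial 3 : ℕ) * (3 : ℕ) : ℝ)⁻¹ : ℝ) ≤ 1 := by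
      norm_num [Nat.factorial]
    calc _ ≤ ‖w‖ ^ 3 * 1 := mul_le_mul_of_nonneg_left (by exact_mod_cast this) (by positivity)
      _ = _ := mul_one _
  have hlim : Tendsto (fun x : ℝ => |x| * (1 + ‖φ (x : ℂ)‖)) (𝓝[≠] 0) (𝓝 0) := by
    have : Continuous fun x : ℝ => |x| * (1 + ‖φ (x : ℂ)‖) := by
      have := hφ.continuous
      fun_prop
    have h0 := this.tendsto 0
    simp only [abs_zero, zero_mul] at h0
    exact h0.mono_left nhdsWithin_le_nhds
  have hle : ∀ᶠ x : ℝ in 𝓝[≠] 0, ‖h₂ - 1 / 2‖ ≤ |x| * (1 + ‖φ (x : ℂ)‖) := by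
    have h1 : ∀ᶠ x : ℝ in 𝓝[≠] 0, |x| ≤ 1 := by
      have : ∀ᶠ x : ℝ in 𝓝 0, |x| < 1 := by
        have := (continuous_abs.tendsto (0 : ℝ)).eventually (gt_mem_nhds (by simp : |(0 : ℝ)| < 1))
        exact this
      exact (this.filter_mono nhdsWithin_le_nhds).mono fun x hx => hx.le
    filter_upwards [h1, self_mem_nhdsWithin] with x hx hx0
    have hx0' : 0 < |x| := abs_pos.2 hx0
    have := hb x (by simpa using hx)
    rw [norm_mul, norm_pow, Complex.norm_real, Real.norm_eq_abs] at this
    have h3 : |x| ^ 2 * ‖h₂ - 1 / 2‖ ≤ |x| ^ 2 * (|x| * (1 + ‖φ (x : ℂ)‖)) := by linarith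
    exact le_of_mul_le_mul_left h3 (by positivity)
  have h0 : ‖h₂ - 1 / 2‖ ≤ 0 := ge_of_tendsto hlim hle
  have : h₂ = 1 / 2 := sub_eq_zero.1 (norm_le_zero_iff.1 h0)
  refine ⟨φ, hφ, fun w => ?_⟩
  rw [h w, this]
  ring

lemma norm_Gamma_le {s : ℂ} (hs : 0 < s.re) : ‖Gamma s‖ ≤ Real.Gamma s.re := by
  rw [Complex.Gamma_eq_integral hs, Real.Gamma_eq_integral hs, GammaIntegral]
  refine (norm_integral_le_integral_norm _).trans_eq ?_
  refine setIntegral_congr_fun measurableSet_Ioi fun x hx => ?_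
  have hx : 0 < x := hx
  rw [norm_mul, Complex.norm_real, Real.norm_of_nonneg (Real.exp_pos _).le,
    Complex.norm_cpow_eq_rpow_re_of_pos hx]
  simp

/-- The numerator `G(u) Γ(1+u)²` of the integrand defining `V`. -/
def mellinNumerator (G : ℂ → ℂ) (u : ℂ) : ℂ := G u * Gamma (1 + u) ^ 2

/-- The integrand `G(u) Γ(1+u)² / u^{k+1}` whose inverse Mellin transform is `V`. -/
def mellinIntegrand (G : ℂ → ℂ) (k : ℕ) (u : ℂ) : ℂ := mellinNumerator G u / u ^ (k + 1)

lemma V_def (G : ℂ → ℂ) (k : ℕ) (x : ℝ) : V G k x = mellinInv 1 (mellinIntegrand G k) x := rfl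

variable {G : ℂ → ℂ} {k : ℕ}

lemma exists_mellinNumerator_bound (hG : IsAdmissibleWeight k G) : ∃ K : ℝ, 0 ≤ K ∧
    ∀ u : ℂ, -1 / 4 ≤ u.re → u.re ≤ 1 → ‖mellinNumerator G u‖ * (1 + |u.im|) ^ 3 ≤ K := by
  obtain ⟨K, hK⟩ := hG.rapid_decay 1 3
  have hcont : ContinuousOn Real.Gamma (Icc (3 / 4) 2) := by
    intro x hx
    refine (Real.differentiableAt_Gamma fun m => ?_).continuousAt.continuousWithinAt
    have : (0 : ℝ) ≤ m := Nat.cast_nonneg m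
    have := hx.1
    linarith
  obtain ⟨M, hM⟩ := isCompact_Icc.exists_bound_of_continuousOn hcont
  have hM0 : 0 ≤ M := (norm_nonneg _).trans (hM 1 ⟨by norm_num, by norm_num⟩)
  have hK0 : 0 ≤ K := by
    refine le_trans ?_ (hK 0 (by simp))
    positivity
  refine ⟨K * M ^ 2, by positivity, fun u h1 h2 => ?_⟩
  have hΓ : ‖Gamma (1 + u)‖ ≤ M := by
    have hr : (1 + u).re = 1 + u.re := by simp
    refine (norm_Gamma_le (by rw [hr]; linarith)).trans ((le_abs_self _).trans (hM _ ?_))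
    rw [hr]
    constructor <;> linarith
  have hGu := hK u (abs_le.2 ⟨by linarith, h2⟩)
  rw [mellinNumerator, norm_mul, norm_pow]
  calc ‖G u‖ * ‖Gamma (1 + u)‖ ^ 2 * (1 + |u.im|) ^ 3
      = (‖G u‖ * (1 + |u.im|) ^ 3) * ‖Gamma (1 + u)‖ ^ 2 := by ring
    _ ≤ K * M ^ 2 := by gcongr

lemma differentiableOn_mellinNumerator (hG : IsAdmissibleWeight k G) :
    DifferentiableOn ℂ (mellinNumerator G) {u | -1 < u.re} := by
  intro u hu
  have hu : -1 < u.re := hu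
  have h1 : DifferentiableAt ℂ (fun u => Gamma (1 + u)) u := by
    refine DifferentiableAt.comp u (differentiableAt_Gamma _ fun m h => ?_) (by fun_prop)
    have := congrArg re h
    simp at this
    have hm : (0 : ℝ) ≤ m := Nat.cast_nonneg m
    linarith
  exact ((hG.entire u).mul (h1.pow 2)).differentiableWithinAt

lemma deriv_mellinNumerator_zero (hG : IsAdmissibleWeight k G) (hk : 1 ≤ k) :
    deriv (mellinNumerator G) 0 = -2 * Real.eulerMascheroniConstant := by
  have h1 : HasDerivAt G 0 0 := by
    have h := hG.deriv_zero 1 le_rfl hk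
    rw [iteratedDeriv_one] at h
    have h' := (hG.entire 0).hasDerivAt
    rwa [h] at h'
  have h2 : HasDerivAt (fun u : ℂ => Gamma (1 + u)) (-(Real.eulerMascheroniConstant : ℂ)) 0 := by
    have h : HasDerivAt Gamma (-(Real.eulerMascheroniConstant : ℂ)) (1 + 0) := by
      rw [add_zero]; exact hasDerivAt_Gamma_one
    exact h.comp_const_add 1 0
  have h3 := h1.mul (h2.pow 2)
  have h4 := h3.deriv
  have h5 : (G * (fun u : ℂ => Gamma (1 + u)) ^ 2) = mellinNumerator G := rfl
  rw [h5] at h4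
  rw [h4]
  simp [hG.map_zero]

lemma mellinNumerator_zero (hG : IsAdmissibleWeight k G) : mellinNumerator G 0 = 1 := by
  simp [mellinNumerator, hG.map_zero]

lemma one_add_sq_le (y : ℝ) : 1 + y ^ 2 ≤ (1 + |y|) ^ 3 := by
  have h : 0 ≤ |y| := abs_nonneg y
  rw [← sq_abs]
  nlinarith [pow_nonneg h 3, pow_nonneg h 2]

/-- The integrand of `V` moves freely within `Re u > 0`. -/
lemma V_eq_mellinInv (hG : IsAdmissibleWeight k G) {x σ : ℝ} (hx : 0 < x) (hσ : 0 < σ)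
    (hσ1 : σ ≤ 1) : V G k x = mellinInv σ (mellinIntegrand G k) x := by
  obtain ⟨K, hK0, hK⟩ := exists_mellinNumerator_bound hG
  have hx0 : (x : ℂ) ≠ 0 := by exact_mod_cast hx.ne'
  rw [V_def, mellinInv, mellinInv]
  congr 1
  refine integral_vertical_eq (f := fun u => (x : ℂ) ^ (-u) • mellinIntegrand G k u) hσ1 ?_
    (max (x ^ (-σ)) (x ^ (-1 : ℝ)) * (K * (σ ^ (k + 1))⁻¹)) ?_
  · simp only [smul_eq_mul]
    refine DifferentiableOn.mul ?_ ?_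
    · intro u _
      have : DifferentiableAt ℂ (fun u : ℂ => -u) u := by fun_prop
      exact (this.const_cpow (Or.inl hx0)).differentiableWithinAt
    · refine DifferentiableOn.div ((differentiableOn_mellinNumerator hG).mono fun u hu => ?_)
        (by fun_prop) (fun u hu h => ?_)
      · have := hu.1
        simp only [mem_ofPred_eq]
        linarith
      · have h0 := pow_eq_zero_iff (n := k + 1) (by omega) |>.1 h
        have := hu.1
        rw [h0, zero_re] at this
        linarith
  · intro a ha y
    have hre : ((a : ℂ) + y * I).re = a := by simp
    have him : ((a : ℂ) + y * I).im = y := by simp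
    have h1 := hK (a + y * I) (by rw [hre]; linarith [ha.1]) (by rw [hre]; exact ha.2)
    rw [him] at h1
    rw [norm_smul, Complex.norm_cpow_eq_rpow_re_of_pos hx, neg_re, hre, mul_assoc]
    have h2 : x ^ (-a) ≤ max (x ^ (-σ)) (x ^ (-1 : ℝ)) := by
      rcases le_total 1 x with h | h
      · exact le_max_of_le_left (Real.rpow_le_rpow_of_exponent_le h (by linarith [ha.1]))
      · exact le_max_of_le_right (Real.rpow_le_rpow_of_exponent_ge hx h (by linarith [ha.2]))
    refine mul_le_mul h2 ?_ (norm_nonneg _) (by positivity)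
    rw [mellinIntegrand, norm_div, norm_pow, div_eq_mul_inv, mul_right_comm]
    refine mul_le_mul ?_ (inv_anti₀ (by positivity) ?_) (by positivity) (by positivity)
    · rw [← div_eq_mul_inv, le_div_iff₀ (by positivity)]
      exact (mul_le_mul_of_nonneg_left (one_add_sq_le y) (norm_nonneg _)).trans h1
    · refine pow_le_pow_left₀ hσ.le (ha.1.trans ?_) _
      have := Complex.abs_re_le_norm ((a : ℂ) + y * I)
      rw [hre] at this
      exact (le_abs_self a).trans this

lemma integrable_inv_sq_add_sq {σ : ℝ} (hσ : 0 < σ) :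
    Integrable (fun y : ℝ => (σ ^ 2 + y ^ 2)⁻¹) ∧ ∫ y : ℝ, (σ ^ 2 + y ^ 2)⁻¹ = Real.pi / σ := by
  have hfun : (fun y : ℝ => (σ ^ 2 + y ^ 2)⁻¹) =
      fun y : ℝ => (σ ^ 2)⁻¹ * (1 + (σ⁻¹ * y) ^ 2)⁻¹ := by
    funext y
    rw [← mul_inv]
    congr 1
    field_simp
  rw [hfun]
  refine ⟨(integrable_inv_one_add_sq.comp_mul_left' (inv_ne_zero hσ.ne')).const_mul _, ?_⟩
  rw [integral_const_mul, Measure.integral_comp_mul_left (fun y : ℝ => (1 + y ^ 2)⁻¹) σ⁻¹,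
    integral_univ_inv_one_add_sq, inv_inv, abs_of_pos hσ, smul_eq_mul]
  field_simp

lemma exists_V_bound (hG : IsAdmissibleWeight k G) (hk : 1 ≤ k) : ∃ C : ℝ, 0 ≤ C ∧
    ∀ x σ : ℝ, 0 < x → 0 < σ → σ ≤ 1 → ‖V G k x‖ ≤ C * x ^ (-σ) * (σ ^ k)⁻¹ := by
  obtain ⟨K, hK0, hK⟩ := exists_mellinNumerator_bound hG
  refine ⟨K, hK0, fun x σ hx hσ hσ1 => ?_⟩
  obtain ⟨hi, hI⟩ := integrable_inv_sq_add_sq hσ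
  rw [V_eq_mellinInv hG hx hσ hσ1, mellinInv, norm_smul]
  have hb : ∀ y : ℝ, ‖(x : ℂ) ^ (-((σ : ℂ) + y * I)) • mellinIntegrand G k (σ + y * I)‖
      ≤ x ^ (-σ) * (K * (σ ^ (k - 1))⁻¹) * (σ ^ 2 + y ^ 2)⁻¹ := by
    intro y
    have hre : ((σ : ℂ) + y * I).re = σ := by simp
    have him : ((σ : ℂ) + y * I).im = y := by simp
    have h1 := hK (σ + y * I) (by rw [hre]; linarith) (by rw [hre]; exact hσ1)
    rw [norm_smul, Complex.norm_cpow_eq_rpow_re_of_pos hx, neg_re, hre, mul_assoc]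
    refine mul_le_mul_of_nonneg_left ?_ (by positivity)
    rw [mellinIntegrand, norm_div, norm_pow, div_eq_mul_inv, mul_assoc]
    refine mul_le_mul ?_ ?_ (by positivity) hK0
    · refine le_trans ?_ h1
      refine le_mul_of_one_le_right (norm_nonneg _) (one_le_pow₀ ?_)
      linarith [abs_nonneg ((σ : ℂ) + y * I).im]
    · have hkk : k + 1 = (k - 1) + 2 := by omega
      rw [hkk, pow_add, mul_inv, normSq_vertical]
      refine mul_le_mul_of_nonneg_right (inv_anti₀ (by positivity) ?_) (by positivity)
      refine pow_le_pow_left₀ hσ.le ?_ _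
      have := Complex.abs_re_le_norm ((σ : ℂ) + y * I)
      rw [hre] at this
      exact (le_abs_self σ).trans this
  have h := norm_integral_le_of_norm_le (hi.const_mul _) (Eventually.of_forall hb)
  rw [integral_const_mul, hI] at h
  rw [Real.norm_of_nonneg (by positivity)]
  refine (mul_le_mul_of_nonneg_left h (by positivity)).trans ?_
  have hs : σ ^ k = σ ^ (k - 1) * σ := by rw [← pow_succ]; congr 1; omega
  have hp := Real.pi_pos
  have : 1 / (2 * Real.pi) * (x ^ (-σ) * (K * (σ ^ (k - 1))⁻¹) * (Real.pi / σ))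
      = (1 / 2) * (K * x ^ (-σ) * (σ ^ k)⁻¹) := by
    rw [hs]; field_simp
  rw [this]
  have : 0 ≤ K * x ^ (-σ) * (σ ^ k)⁻¹ := by positivity
  linarith

/-- What is left of `V` after the residue at `0` has been removed: the integral over
`Re u = -1/4`. -/
def VRemainder (G : ℂ → ℂ) (k : ℕ) (x : ℝ) : ℂ := mellinInv (-(1 / 4)) (mellinIntegrand G k) x

lemma V_sub_VRemainder (hG : IsAdmissibleWeight k G) (hk2 : k ≤ 2) {x : ℝ} (hx : 0 < x)
    {φ : ℂ → ℂ} {c₀ c₁ c₂ : ℂ} (hφ : DifferentiableOn ℂ φ {u | -1 < u.re})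
    (hg : ∀ u, u ^ (2 - k) * (mellinNumerator G u * (x : ℂ) ^ (-u))
      = c₀ + c₁ * u + c₂ * u ^ 2 + u ^ 3 * φ u) :
    V G k x - VRemainder G k x = c₂ := by
  obtain ⟨K, hK0, hK⟩ := exists_mellinNumerator_bound hG
  have hp : (Real.pi : ℂ) ≠ 0 := by exact_mod_cast Real.pi_ne_zero
  have hsub : re ⁻¹' Icc (-(1 / 4 : ℝ)) (1 / 4) ⊆ {u : ℂ | -1 < u.re} := fun u hu => by
    have := hu.1
    simp only [mem_ofPred_eq]; linarith
  have h := integral_vertical_residue (c := 1 / 4) (by norm_num) (by norm_num) (hφ.mono hsub)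
    (fun u _ => hg u) (K := 3 * K * max (x ^ (-(1 / 4) : ℝ)) (x ^ (1 / 4 : ℝ))) ?_
  · have e : ∀ c : ℝ, c ≠ 0 → mellinInv c (mellinIntegrand G k) x = (1 / (2 * Real.pi) : ℝ) •
        ∫ y : ℝ, ((c : ℂ) + y * I) ^ (2 - k) * (mellinNumerator G (c + y * I)
          * (x : ℂ) ^ (-((c : ℂ) + y * I))) / (c + y * I) ^ 3 := by
      intro c hc
      rw [mellinInv]
      congr 2
      funext y
      have h0 := vertical_ne_zero hc y
      rw [mellinIntegrand, smul_eq_mul]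
      generalize (c : ℂ) + y * I = u at *
      have h3 : u ^ 3 = u ^ (2 - k) * u ^ (k + 1) := by rw [← pow_add]; congr 1; omega
      rw [h3, mul_div_mul_left _ _ (pow_ne_zero _ h0)]
      ring
    rw [V_eq_mellinInv hG hx (by norm_num : (0 : ℝ) < 1 / 4) (by norm_num), VRemainder,
      e (1 / 4) (by norm_num), e (-(1 / 4)) (by norm_num), ← smul_sub, h, Complex.real_smul]
    push_cast
    field_simp
  · intro u hu
    have h1 := hK u (by linarith [hu.1]) (by linarith [hu.2])
    rw [norm_mul, norm_mul, Complex.norm_cpow_eq_rpow_re_of_pos hx, norm_pow, neg_re, ← mul_assoc]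
    have h2 : x ^ (-u.re) ≤ max (x ^ (-(1 / 4) : ℝ)) (x ^ (1 / 4 : ℝ)) := by
      rcases le_total 1 x with h | h
      · exact le_max_of_le_right (Real.rpow_le_rpow_of_exponent_le h (by linarith [hu.1]))
      · exact le_max_of_le_left (Real.rpow_le_rpow_of_exponent_ge hx h (by linarith [hu.2]))
    refine mul_le_mul ?_ h2 (by positivity) (by positivity)
    have h3 : ‖u‖ ≤ 1 + |u.im| := by
      refine (Complex.norm_le_abs_re_add_abs_im u).trans ?_
      have : |u.re| ≤ 1 := abs_le.2 ⟨by linarith [hu.1], by linarith [hu.2]⟩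
      linarith
    have h4 : ‖u‖ ^ (2 - k) ≤ (1 + |u.im|) ^ 3 := by
      have h1 : 1 ≤ 1 + |u.im| := by linarith [abs_nonneg u.im]
      calc ‖u‖ ^ (2 - k) ≤ (1 + |u.im|) ^ (2 - k) := pow_le_pow_left₀ (norm_nonneg _) h3 _
        _ ≤ (1 + |u.im|) ^ 3 := pow_le_pow_right₀ h1 (by omega)
    calc ‖u‖ ^ (2 - k) * ‖mellinNumerator G u‖ ≤ (1 + |u.im|) ^ 3 * ‖mellinNumerator G u‖ := by gcongr
      _ ≤ K := by rw [mul_comm]; exact h1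
      _ ≤ 3 * K := by linarith

lemma exists_mellinNumerator_mul_cpow_taylor (hG : IsAdmissibleWeight k G) (hk : 1 ≤ k) :
    ∃ h₂ : ℂ, ∀ x : ℝ, 0 < x → ∃ φ : ℂ → ℂ, DifferentiableOn ℂ φ {u | -1 < u.re} ∧
      ∀ u, mellinNumerator G u * (x : ℂ) ^ (-u) =
        1 + (-2 * Real.eulerMascheroniConstant - Real.log x) * u
          + (h₂ + 2 * Real.eulerMascheroniConstant * Real.log x + (Real.log x) ^ 2 / 2) * u ^ 2
          + u ^ 3 * φ u := by
  have hU : {u : ℂ | -1 < u.re} ∈ 𝓝 (0 : ℂ) :=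
    (isOpen_lt continuous_const continuous_re).mem_nhds (by simp)
  obtain ⟨h₂, φ, hφ, h⟩ := exists_taylor_two hU (differentiableOn_mellinNumerator hG)
  obtain ⟨e, he, hexp⟩ := exists_exp_taylor
  rw [mellinNumerator_zero hG, deriv_mellinNumerator_zero hG hk] at h
  refine ⟨h₂, fun x hx => ?_⟩
  set l : ℂ := (Real.log x : ℂ) with hl
  set g : ℂ := (Real.eulerMascheroniConstant : ℂ)
  have hcp : ∀ u : ℂ, (x : ℂ) ^ (-u) = 1 - l * u + l ^ 2 / 2 * u ^ 2 + u ^ 3 * (-l ^ 3 * e (-l * u)) := by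
    intro u
    rw [Complex.cpow_def_of_ne_zero (by exact_mod_cast hx.ne'), ← Complex.ofReal_log hx.le, ← hl,
      show l * -u = -l * u by ring, hexp]
    ring
  refine ⟨fun u => (-l * h₂ + -2 * g * l ^ 2 / 2) + u * (h₂ * l ^ 2 / 2)
    + φ u * (1 - l * u + l ^ 2 / 2 * u ^ 2)
    + (1 + -2 * g * u + h₂ * u ^ 2) * (-l ^ 3 * e (-l * u)) + u ^ 3 * φ u * (-l ^ 3 * e (-l * u)),
    ?_, fun u => ?_⟩
  · have : Differentiable ℂ fun u => e (-l * u) := by fun_prop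
    fun_prop
  · rw [h u, hcp u]
    ring

lemma V_one_eq (hG : IsAdmissibleWeight 1 G) {x : ℝ} (hx : 0 < x) :
    V G 1 x = VRemainder G 1 x + (-2 * Real.eulerMascheroniConstant - Real.log x) := by
  obtain ⟨h₂, h⟩ := exists_mellinNumerator_mul_cpow_taylor hG le_rfl
  obtain ⟨φ, hφ, he⟩ := h x hx
  have := V_sub_VRemainder hG (by norm_num) hx (c₀ := 0) (c₁ := 1)
    (c₂ := -2 * Real.eulerMascheroniConstant - Real.log x)
    (φ := fun u => (h₂ + 2 * Real.eulerMascheroniConstant * Real.log x + (Real.log x) ^ 2 / 2)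
      + u * φ u) (by fun_prop) (fun u => by rw [he u]; ring)
  linear_combination this

lemma V_two_eq (hG : IsAdmissibleWeight 2 G) : ∃ h₂ : ℂ, ∀ x : ℝ, 0 < x →
    V G 2 x = VRemainder G 2 x
      + (h₂ + 2 * Real.eulerMascheroniConstant * Real.log x + (Real.log x) ^ 2 / 2) := by
  obtain ⟨h₂, h⟩ := exists_mellinNumerator_mul_cpow_taylor hG (by norm_num)
  refine ⟨h₂, fun x hx => ?_⟩
  obtain ⟨φ, hφ, he⟩ := h x hx
  have := V_sub_VRemainder hG le_rfl hx hφ (fun u => by rw [Nat.sub_self, pow_zero, one_mul, he u])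
  linear_combination this

/-- Cancellation in `∑ aᵢ xᵢ^{-u}` on the line `Re u = -1/4` is inherited by
`∑ aᵢ VRemainder(xᵢ)`. -/
lemma exists_sum_VRemainder_bound (hG : IsAdmissibleWeight k G) : ∃ C : ℝ, 0 ≤ C ∧
    ∀ (s : Finset ℕ) (a : ℕ → ℂ) (x : ℕ → ℝ) (B : ℝ), (∀ i ∈ s, 0 < x i) →
      (∀ y : ℝ, ‖∑ i ∈ s, a i * (x i : ℂ) ^ (-(((-(1 / 4) : ℝ) : ℂ) + y * I))‖ ≤ B * (1 + |y|)) →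
      ‖∑ i ∈ s, a i * VRemainder G k (x i)‖ ≤ C * B := by
  obtain ⟨K, hK0, hK⟩ := exists_mellinNumerator_bound hG
  have hne := vertical_ne_zero (show (-(1 / 4) : ℝ) ≠ 0 by norm_num)
  have hre : ∀ y : ℝ, (((-(1 / 4) : ℝ) : ℂ) + y * I).re = -(1 / 4) := fun y => by
    rw [add_re, ofReal_re]; simp
  have him : ∀ y : ℝ, (((-(1 / 4) : ℝ) : ℂ) + y * I).im = y := fun y => by
    rw [add_im, ofReal_im]; simp
  have hF : ∀ y : ℝ, ‖mellinIntegrand G k (((-(1 / 4) : ℝ) : ℂ) + y * I)‖ * (1 + |y|)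
      ≤ K * 4 ^ (k + 1) * (1 + y ^ 2)⁻¹ := by
    intro y
    have h1 := hK (((-(1 / 4) : ℝ) : ℂ) + y * I) (by rw [hre]; norm_num) (by rw [hre y]; norm_num)
    rw [him] at h1
    rw [mellinIntegrand, norm_div, norm_pow, div_eq_mul_inv, ← div_eq_mul_inv _ (1 + y ^ 2),
      le_div_iff₀ (by positivity)]
    have h2 : (‖((-(1 / 4) : ℝ) : ℂ) + y * I‖ ^ (k + 1))⁻¹ ≤ 4 ^ (k + 1) := by
      rw [← inv_pow]
      refine pow_le_pow_left₀ (by positivity) ?_ _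
      rw [inv_le_comm₀ (norm_pos_iff.2 (hne y)) (by norm_num)]
      have := Complex.abs_re_le_norm (((-(1 / 4) : ℝ) : ℂ) + y * I)
      rw [hre] at this
      norm_num at this ⊢
      exact this
    have h3 : (1 + |y|) * (1 + y ^ 2) ≤ (1 + |y|) ^ 3 := by
      have h : 0 ≤ |y| := abs_nonneg y
      rw [← sq_abs]
      nlinarith [pow_nonneg h 3, pow_nonneg h 2]
    set N := ‖mellinNumerator G (((-(1 / 4) : ℝ) : ℂ) + y * I)‖
    set M := (‖((-(1 / 4) : ℝ) : ℂ) + y * I‖ ^ (k + 1))⁻¹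
    calc N * M * (1 + |y|) * (1 + y ^ 2) = N * ((1 + |y|) * (1 + y ^ 2)) * M := by ring
      _ ≤ N * (1 + |y|) ^ 3 * 4 ^ (k + 1) := by
          refine mul_le_mul (mul_le_mul_of_nonneg_left h3 (norm_nonneg _)) h2 (by positivity)
            (by positivity)
      _ ≤ K * 4 ^ (k + 1) := by gcongr
  have hFc : Continuous fun y : ℝ => mellinIntegrand G k (((-(1 / 4) : ℝ) : ℂ) + y * I) := by
    have hl : Continuous fun y : ℝ => ((-(1 / 4) : ℝ) : ℂ) + y * I := by fun_prop
    refine Continuous.div ?_ (by fun_prop) (fun y => pow_ne_zero _ (hne y))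
    refine (differentiableOn_mellinNumerator hG).continuousOn.comp_continuous hl (fun y => ?_)
    rw [mem_ofPred_eq, hre]; norm_num
  have hFi : Integrable fun y : ℝ =>
      ‖mellinIntegrand G k (((-(1 / 4) : ℝ) : ℂ) + y * I)‖ * (1 + |y|) := by
    refine (integrable_inv_one_add_sq.const_mul (K * 4 ^ (k + 1))).mono'
      (Continuous.aestronglyMeasurable (by fun_prop)) (Eventually.of_forall fun y => ?_)
    rw [Real.norm_of_nonneg (by positivity)]
    exact hF y
  refine ⟨1 / (2 * Real.pi) * ∫ y : ℝ,
    ‖mellinIntegrand G k (((-(1 / 4) : ℝ) : ℂ) + y * I)‖ * (1 + |y|), ?_, ?_⟩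
  · have : 0 ≤ ∫ y : ℝ, ‖mellinIntegrand G k (((-(1 / 4) : ℝ) : ℂ) + y * I)‖ * (1 + |y|) :=
      integral_nonneg fun y => by positivity
    positivity
  intro s a x B hx hB
  have hsum : ∑ i ∈ s, a i * VRemainder G k (x i) = (1 / (2 * Real.pi) : ℝ) • ∫ y : ℝ,
      (∑ i ∈ s, a i * (x i : ℂ) ^ (-(((-(1 / 4) : ℝ) : ℂ) + y * I)))
        * mellinIntegrand G k (((-(1 / 4) : ℝ) : ℂ) + y * I) := by
    simp only [VRemainder, mellinInv, Finset.sum_mul]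
    rw [integral_finsetSum, Finset.smul_sum]
    · refine Finset.sum_congr rfl fun i hi => ?_
      rw [mul_smul_comm, ← integral_const_mul]
      simp only [smul_eq_mul, mul_assoc]
    · intro i hi
      have hx0 : (x i : ℂ) ≠ 0 := by exact_mod_cast (hx i hi).ne'
      have hpc : Continuous fun y : ℝ => (x i : ℂ) ^ (-(((-(1 / 4) : ℝ) : ℂ) + y * I)) :=
        Continuous.const_cpow (by fun_prop) (Or.inl hx0)
      refine (hFi.const_mul (‖a i‖ * x i ^ (1 / 4 : ℝ))).mono'
        (Continuous.aestronglyMeasurable (by fun_prop)) (Eventually.of_forall fun y => ?_)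
      rw [norm_mul, norm_mul, Complex.norm_cpow_eq_rpow_re_of_pos (hx i hi), neg_re, hre, neg_neg]
      refine mul_le_mul_of_nonneg_left ?_ (by have := (hx i hi).le; positivity)
      exact le_mul_of_one_le_right (norm_nonneg _) (by linarith [abs_nonneg y])
  rw [hsum, norm_smul, Real.norm_of_nonneg (by positivity), mul_assoc]
  refine mul_le_mul_of_nonneg_left ?_ (by positivity)
  rw [← integral_mul_const]
  refine norm_integral_le_of_norm_le (hFi.mul_const B) (Eventually.of_forall fun y => ?_)
  rw [norm_mul, mul_comm]
  calc _ ≤ ‖mellinIntegrand G k (((-(1 / 4) : ℝ) : ℂ) + y * I)‖ * (B * (1 + |y|)) :=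
        mul_le_mul_of_nonneg_left (hB y) (norm_nonneg _)
    _ = _ := by ring

end SecondMoment

end

noncomputable section

namespace SecondMoment

open Real (log exp sqrt eulerMascheroniConstant exp_pos log_natCast_nonneg log_le_log norm_eq_abs rpow_natCast exp_add rpow_mul log_pow exp_one_lt_d9 exp_le_exp rpow_add mul_rpow le_log_iff_exp_le log_nonneg rpow_neg norm_of_nonneg exp_neg log_mul rpow_def_of_pos add_one_le_exp rpow_neg_one)
open Finset (range sum_congr sum_le_sum mul_sum Icc mem_filter sum_range_succ sum_mul mem_insert_of_mem mem_Icc mem_range Ico Ioc sum_sub_distrib)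
open ArithmeticFunction (moebius moebius_apply_prime moebius_apply_prime_pow abs_moebius_le_one)

/-! ### Partial sums of a character and values of its `L`-function -/

lemma sum_Ico_mul_eq {R : Type*} [CommRing R] (a g : ℕ → R) {M N : ℕ} (h : M ≤ N) :
    ∑ i ∈ Ico M N, a i * g i = (∑ i ∈ range N, a i) * g N
      - (∑ i ∈ range M, a i) * g M
      - ∑ i ∈ Ico M N, (∑ j ∈ range (i + 1), a j) * (g (i + 1) - g i) := by
  induction N, h using Nat.le_induction with
  | base => simp
  | succ N hN ih =>
    rw [Finset.sum_Ico_succ_top hN, Finset.sum_Ico_succ_top hN, ih, sum_range_succ]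
    ring

/-- Abel summation against a sequence whose variation is controlled by a decreasing majorant. -/
lemma norm_sum_Ico_mul_le {𝕜 : Type*} [NormedField 𝕜] {a g : ℕ → 𝕜} {H : ℕ → ℝ} {B : ℝ}
    (hB : ∀ n, ‖∑ i ∈ range n, a i‖ ≤ B) (hg : ∀ i, ‖g i‖ ≤ H i)
    (hd : ∀ i, ‖g (i + 1) - g i‖ ≤ H i - H (i + 1)) {M N : ℕ} (h : M ≤ N) :
    ‖∑ i ∈ Ico M N, a i * g i‖ ≤ 2 * B * H M := by
  have hB0 : 0 ≤ B := (norm_nonneg _).trans (hB 0)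
  rw [sum_Ico_mul_eq a g h]
  have h1 : ‖∑ i ∈ Ico M N, (∑ j ∈ range (i + 1), a j) * (g (i + 1) - g i)‖
      ≤ B * (H M - H N) := by
    calc _ ≤ ∑ i ∈ Ico M N, B * (H i - H (i + 1)) := by
          refine (norm_sum_le _ _).trans (sum_le_sum fun i _ => ?_)
          rw [norm_mul]
          exact mul_le_mul (hB _) (hd i) (norm_nonneg _) hB0
      _ = B * (H M - H N) := by
          rw [← mul_sum]
          congr 1
          have := Finset.sum_Ico_sub (fun i => -H i) h
          rw [show H M - H N = -H N - -H M by ring, ← this]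
          exact sum_congr rfl fun i _ => by ring
  have h2 : ‖(∑ i ∈ range N, a i) * g N‖ ≤ B * H N := by
    rw [norm_mul]; exact mul_le_mul (hB _) (hg _) (norm_nonneg _) hB0
  have h3 : ‖(∑ i ∈ range M, a i) * g M‖ ≤ B * H M := by
    rw [norm_mul]; exact mul_le_mul (hB _) (hg _) (norm_nonneg _) hB0
  refine (norm_sub_le _ _).trans ?_
  have := norm_sub_le ((∑ i ∈ range N, a i) * g N) ((∑ i ∈ range M, a i) * g M)
  linarith

lemma sum_range_natCast_zmod {D : ℕ} [NeZero D] (f : ZMod D → ℂ) :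
    ∑ i ∈ range D, f (i : ZMod D) = ∑ z, f z := by
  refine Finset.sum_bij' (fun i _ => (i : ZMod D)) (fun z _ => z.val) (by simp)
    (fun z _ => by simpa using z.val_lt) (fun i hi => ?_) (fun z _ => ?_) (by simp)
  · exact ZMod.val_cast_of_lt (mem_range.1 hi)
  · simp

section

variable {D : ℕ} [NeZero D] {ψ : DirichletCharacter ℂ D}

lemma norm_sum_range_char_le (hψ : ψ ≠ 1) (N : ℕ) :
    ‖∑ i ∈ range N, ψ ((i + 1 : ℕ) : ZMod D)‖ ≤ D := by
  induction N using Nat.strong_induction_on with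
  | _ N ih =>
    rcases lt_or_ge N D with h | h
    · calc _ ≤ ∑ i ∈ range N, (1 : ℝ) := by
            refine (norm_sum_le _ _).trans (sum_le_sum fun i _ => ?_)
            exact DirichletCharacter.norm_le_one ψ _
        _ = N := by simp
        _ ≤ D := by exact_mod_cast h.le
    · obtain ⟨M, rfl⟩ := Nat.exists_eq_add_of_le' h
      rw [Finset.sum_range_add]
      have h0 : ∑ x ∈ range D, ψ ((M + x + 1 : ℕ) : ZMod D) = 0 := by
        have := sum_range_natCast_zmod (fun z : ZMod D => ψ ((M + 1 : ZMod D) + z))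
        have h2 := Equiv.sum_comp (Equiv.addLeft (M + 1 : ZMod D)) (fun z => ψ z)
        simp only [Equiv.coe_addLeft] at h2
        rw [h2, MulChar.sum_eq_zero_of_ne_one hψ] at this
        rw [← this]
        refine sum_congr rfl fun x _ => ?_
        push_cast
        congr 1
        ring
      rw [h0, add_zero]
      exact ih M (by have := NeZero.pos D; omega)

open Complex in
lemma norm_cpow_sub_le {s : ℂ} (hs : 0 < s.re) {x : ℝ} (hx : 1 ≤ x) :
    ‖((x + 1 : ℝ) : ℂ) ^ (-s) - (x : ℂ) ^ (-s)‖
      ≤ ‖s‖ / s.re * (x ^ (-s.re) - (x + 1) ^ (-s.re)) := by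
  have hs0 : s ≠ 0 := by rintro rfl; simp at hs
  have h1 : ∀ t ∈ Set.Icc x (x + 1), HasDerivAt (fun t : ℝ => (t : ℂ) ^ (-s) - (x : ℂ) ^ (-s))
      (-s * (t : ℂ) ^ (-s - 1)) t := by
    intro t ht
    have ht0 : t ≠ 0 := by linarith [ht.1]
    exact (hasDerivAt_ofReal_cpow_const ht0 (neg_ne_zero.2 hs0)).sub_const _
  have h2 : ∀ t ∈ Set.Icc x (x + 1), HasDerivAt
      (fun t : ℝ => ‖s‖ / s.re * (x ^ (-s.re) - t ^ (-s.re))) (‖s‖ * t ^ (-s.re - 1)) t := by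
    intro t ht
    have ht0 : t ≠ 0 := by linarith [ht.1]
    refine (((Real.hasDerivAt_rpow_const (p := -s.re) (Or.inl ht0)).const_sub _).const_mul
      _).congr_deriv ?_
    field_simp
  refine image_norm_le_of_norm_deriv_right_le_deriv_boundary'
    (f := fun t : ℝ => (t : ℂ) ^ (-s) - (x : ℂ) ^ (-s)) (f' := fun t : ℝ => -s * (t : ℂ) ^ (-s - 1))
    (B := fun t : ℝ => ‖s‖ / s.re * (x ^ (-s.re) - t ^ (-s.re)))
    (B' := fun t : ℝ => ‖s‖ * t ^ (-s.re - 1)) (a := x) (b := x + 1)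
    (fun t ht => (h1 t ht).continuousAt.continuousWithinAt)
    (fun t ht => (h1 t ⟨ht.1, ht.2.le⟩).hasDerivWithinAt) (by simp)
    (fun t ht => (h2 t ht).continuousAt.continuousWithinAt)
    (fun t ht => (h2 t ⟨ht.1, ht.2.le⟩).hasDerivWithinAt)
    (fun t ht => ?_) ⟨by linarith, le_rfl⟩
  rw [norm_mul, norm_neg, Complex.norm_cpow_eq_rpow_re_of_pos (by linarith [ht.1])]
  simp

/-- The partial sums `∑_{n ≤ N} ψ(n) n^{-s}`. -/
def charSum (ψ : DirichletCharacter ℂ D) (N : ℕ) (s : ℂ) : ℂ :=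
  ∑ i ∈ range N, ψ ((i + 1 : ℕ) : ZMod D) * ((i + 1 : ℕ) : ℂ) ^ (-s)

lemma charSum_sub_le (hψ : ψ ≠ 1) {s : ℂ} (hs : 0 < s.re) {M N : ℕ} (h : M ≤ N) :
    ‖charSum ψ N s - charSum ψ M s‖ ≤
      2 * D * ((1 + ‖s‖ / s.re) * ((M + 1 : ℕ) : ℝ) ^ (-s.re)) := by
  rw [charSum, charSum, ← Finset.sum_Ico_eq_sub _ h]
  refine norm_sum_Ico_mul_le (H := fun i => (1 + ‖s‖ / s.re) * ((i + 1 : ℕ) : ℝ) ^ (-s.re))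
    (norm_sum_range_char_le hψ) (fun i => ?_) (fun i => ?_) h
  · rw [Complex.norm_natCast_cpow_of_pos (by omega), Complex.neg_re]
    refine le_mul_of_one_le_left (by positivity) ?_
    have : 0 ≤ ‖s‖ / s.re := by positivity
    linarith
  · have h1 := norm_cpow_sub_le hs (x := ((i + 1 : ℕ) : ℝ)) (by push_cast; linarith [(Nat.cast_nonneg i : (0:ℝ) ≤ i)])
    have h2 : ((i + 1 + 1 : ℕ) : ℝ) ^ (-s.re) ≤ ((i + 1 : ℕ) : ℝ) ^ (-s.re) :=
      Real.rpow_le_rpow_of_nonpos (by positivity) (by push_cast; linarith) (by linarith)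
    push_cast at h1 h2 ⊢
    calc _ ≤ _ := h1
      _ ≤ _ := by linarith

lemma norm_charSum_le (hψ : ψ ≠ 1) {s : ℂ} (hs : 0 < s.re) (N : ℕ) :
    ‖charSum ψ N s‖ ≤ 2 * D * (1 + ‖s‖ / s.re) := by
  have := charSum_sub_le hψ hs (Nat.zero_le N)
  simpa [charSum] using this

lemma differentiable_charSum (N : ℕ) : Differentiable ℂ (charSum ψ N) := by
  unfold charSum
  refine Differentiable.fun_sum fun i _ => ?_
  refine Differentiable.const_mul ?_ _
  intro s
  exact DifferentiableAt.const_cpow (by fun_prop) (Or.inl (by exact_mod_cast Nat.succ_ne_zero i))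

lemma tendsto_charSum_of_one_lt {s : ℂ} (hs : 1 < s.re) :
    Tendsto (fun N => charSum ψ N s) atTop (𝓝 (ψ.LFunction s)) := by
  rw [DirichletCharacter.LFunction_eq_LSeries ψ hs]
  have h := (ψ.LSeriesSummable_of_one_lt_re hs).hasSum.tendsto_sum_nat
  have h2 := (tendsto_add_atTop_iff_nat 1).2 h
  refine h2.congr fun N => ?_
  rw [Finset.sum_range_succ', LSeries.term_zero, add_zero, charSum]
  refine sum_congr rfl fun i _ => ?_
  rw [LSeries.term_of_ne_zero (by omega), Complex.cpow_neg, div_eq_mul_inv]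

/-- The Dirichlet series of a nontrivial character converges, locally uniformly, to the
`L`-function throughout `Re s > 0`. -/
lemma tendstoLocallyUniformlyOn_charSum (hψ : ψ ≠ 1) :
    TendstoLocallyUniformlyOn (charSum ψ) ψ.LFunction atTop {s | 0 < s.re} := by
  have hopen : IsOpen {s : ℂ | 0 < s.re} := isOpen_lt continuous_const Complex.continuous_re
  have hpow : ∀ σ : ℝ, 0 < σ → Tendsto (fun M : ℕ => ((M + 1 : ℕ) : ℝ) ^ (-σ)) atTop (𝓝 0) := by
    intro σ hσ
    have h1 : Tendsto (fun M : ℕ => ((M + 1 : ℕ) : ℝ)) atTop atTop :=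
      tendsto_natCast_atTop_atTop.comp (tendsto_add_atTop_nat 1)
    exact (tendsto_rpow_neg_atTop hσ).comp h1
  have hlim : ∀ s : ℂ, 0 < s.re → ∃ l, Tendsto (fun N => charSum ψ N s) atTop (𝓝 l) := by
    intro s hs
    refine cauchySeq_tendsto_of_complete (cauchySeq_of_le_tendsto_0'
      (fun M => 2 * D * ((1 + ‖s‖ / s.re) * ((M + 1 : ℕ) : ℝ) ^ (-s.re))) (fun M N h => ?_) ?_)
    · rw [dist_comm, dist_eq_norm]
      exact charSum_sub_le hψ hs h
    · simpa using ((hpow _ hs).const_mul (1 + ‖s‖ / s.re)).const_mul (2 * D : ℝ)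
  choose! l hl using hlim
  have hbound : ∀ s : ℂ, 0 < s.re → ∀ M : ℕ,
      ‖l s - charSum ψ M s‖ ≤ 2 * D * ((1 + ‖s‖ / s.re) * ((M + 1 : ℕ) : ℝ) ^ (-s.re)) := by
    intro s hs M
    refine le_of_tendsto ((hl s hs).sub_const _).norm ?_
    filter_upwards [eventually_ge_atTop M] with N hN
    exact charSum_sub_le hψ hs hN
  have hunif : TendstoLocallyUniformlyOn (charSum ψ) l atTop {s | 0 < s.re} := by
    rw [Metric.tendstoLocallyUniformlyOn_iff]
    intro ε hε s₀ hs₀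
    have hs₀ : 0 < s₀.re := hs₀
    have hW : {s : ℂ | s₀.re / 2 < s.re} ∩ {s : ℂ | ‖s‖ < ‖s₀‖ + 1} ∈ 𝓝[{s | 0 < s.re}] s₀ := by
      refine mem_nhdsWithin_of_mem_nhds (IsOpen.mem_nhds ?_ ⟨?_, ?_⟩)
      · exact (isOpen_lt continuous_const Complex.continuous_re).inter
          (isOpen_lt continuous_norm continuous_const)
      · exact half_lt_self hs₀
      · exact lt_add_one ‖s₀‖
    refine ⟨_, hW, ?_⟩
    have h0 : Tendsto (fun M : ℕ => 2 * D * ((1 + (‖s₀‖ + 1) / (s₀.re / 2)) *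
        ((M + 1 : ℕ) : ℝ) ^ (-(s₀.re / 2)))) atTop (𝓝 0) := by
      simpa using ((hpow _ (half_pos hs₀)).const_mul (1 + (‖s₀‖ + 1) / (s₀.re / 2))).const_mul
        (2 * D : ℝ)
    filter_upwards [h0.eventually (gt_mem_nhds hε)] with M hM s hs
    have hs1 : s₀.re / 2 < s.re := hs.1
    have hs2 : ‖s‖ < ‖s₀‖ + 1 := hs.2
    have hs3 : 0 < s₀.re / 2 := half_pos hs₀
    rw [dist_eq_norm]
    refine lt_of_le_of_lt ((hbound s (by linarith) M).trans ?_) hM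
    have h4 : ((M + 1 : ℕ) : ℝ) ^ (-s.re) ≤ ((M + 1 : ℕ) : ℝ) ^ (-(s₀.re / 2)) :=
      Real.rpow_le_rpow_of_exponent_le (by push_cast; linarith [(Nat.cast_nonneg M : (0:ℝ) ≤ M)])
        (by linarith)
    gcongr
  have hl_diff : DifferentiableOn ℂ l {s | 0 < s.re} :=
    hunif.differentiableOn (Eventually.of_forall fun N => (differentiable_charSum N).differentiableOn)
      hopen
  have heq : Set.EqOn l ψ.LFunction {s | 0 < s.re} := by
    refine AnalyticOnNhd.eqOn_of_preconnected_of_eventuallyEq (z₀ := 2)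
      (hl_diff.analyticOnNhd hopen)
      ((DirichletCharacter.differentiable_LFunction hψ).differentiableOn.analyticOnNhd hopen)
      (convex_halfSpace_re_gt 0).isPreconnected (by simp) ?_
    have hmem : {s : ℂ | 1 < s.re} ∈ 𝓝 (2 : ℂ) :=
      (isOpen_lt continuous_const Complex.continuous_re).mem_nhds (by simp)
    filter_upwards [hmem] with s hs
    have hs : 1 < s.re := hs
    exact tendsto_nhds_unique (hl s (by linarith)) (tendsto_charSum_of_one_lt hs)
  exact hunif.congr_right heq

lemma hasDerivAt_charSum (j N : ℕ) (s : ℂ) : HasDerivAt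
    (fun s => ∑ i ∈ range N, ψ ((i + 1 : ℕ) : ZMod D) * (-Complex.log ((i + 1 : ℕ) : ℂ)) ^ j
      * ((i + 1 : ℕ) : ℂ) ^ (-s))
    (∑ i ∈ range N, ψ ((i + 1 : ℕ) : ZMod D) * (-Complex.log ((i + 1 : ℕ) : ℂ)) ^ (j + 1)
      * ((i + 1 : ℕ) : ℂ) ^ (-s)) s := by
  refine HasDerivAt.fun_sum fun i _ => ?_
  have h := ((hasDerivAt_neg s).const_cpow (c := ((i + 1 : ℕ) : ℂ))
    (Or.inl (by exact_mod_cast Nat.succ_ne_zero i))).const_mul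
    (ψ ((i + 1 : ℕ) : ZMod D) * (-Complex.log ((i + 1 : ℕ) : ℂ)) ^ j)
  refine h.congr_deriv ?_
  ring

/-- `∑ ψ(n) (-log n)^j / n = L^{(j)}(1, ψ)`, as a conditionally convergent sum, for `j ≤ 2`. -/
lemma tendsto_charSum_deriv_one (hψ : ψ ≠ 1) {j : ℕ} (hj : j ≤ 2) :
    Tendsto (fun N => ∑ i ∈ range N, ψ ((i + 1 : ℕ) : ZMod D)
      * (-Complex.log ((i + 1 : ℕ) : ℂ)) ^ j * ((i + 1 : ℕ) : ℂ) ^ (-1 : ℂ)) atTop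
      (𝓝 (iteratedDeriv j ψ.LFunction 1)) := by
  have hopen : IsOpen {s : ℂ | 0 < s.re} := isOpen_lt continuous_const Complex.continuous_re
  have hone : (1 : ℂ) ∈ {s : ℂ | 0 < s.re} := by simp
  have h0 := tendstoLocallyUniformlyOn_charSum hψ
  have e0 : ∀ N, charSum ψ N = fun s => ∑ i ∈ range N, ψ ((i + 1 : ℕ) : ZMod D)
      * (-Complex.log ((i + 1 : ℕ) : ℂ)) ^ 0 * ((i + 1 : ℕ) : ℂ) ^ (-s) := fun N => by
    funext s; simp [charSum]
  have e1 : ∀ N, deriv (charSum ψ N) = fun s => ∑ i ∈ range N, ψ ((i + 1 : ℕ) : ZMod D)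
      * (-Complex.log ((i + 1 : ℕ) : ℂ)) ^ 1 * ((i + 1 : ℕ) : ℂ) ^ (-s) := fun N => by
    funext s; rw [e0]; exact (hasDerivAt_charSum 0 N s).deriv
  have e2 : ∀ N, deriv (deriv (charSum ψ N)) = fun s => ∑ i ∈ range N,
      ψ ((i + 1 : ℕ) : ZMod D) * (-Complex.log ((i + 1 : ℕ) : ℂ)) ^ 2
        * ((i + 1 : ℕ) : ℂ) ^ (-s) := fun N => by
    funext s; rw [e1]; exact (hasDerivAt_charSum 1 N s).deriv
  have hd0 : ∀ N, DifferentiableOn ℂ (charSum ψ N) {s | 0 < s.re} :=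
    fun N => (differentiable_charSum N).differentiableOn
  have h1 := h0.deriv (Eventually.of_forall hd0) hopen
  have h2 := h1.deriv (Eventually.of_forall fun N => (hd0 N).deriv hopen) hopen
  interval_cases j
  · simp only [iteratedDeriv_zero]
    exact (h0.tendsto_at hone).congr fun N => by rw [e0]
  · simp only [iteratedDeriv_one]
    exact (h1.tendsto_at hone).congr fun N => by simp only [Function.comp, e1]
  · rw [iteratedDeriv_succ, iteratedDeriv_one]
    exact (h2.tendsto_at hone).congr fun N => by simp only [Function.comp, e2]

end

/-! ### Multiplicative functions attached to a real character -/

/-- Multiplicativity for plain functions on the naturals. -/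
def IsMult (f : ℕ → ℝ) : Prop := f 1 = 1 ∧ ∀ m n, m.Coprime n → f (m * n) = f m * f n

lemma IsMult.abs_le {f g : ℕ → ℝ} (hf : IsMult f) (hg : IsMult g)
    (h : ∀ p k, p.Prime → 0 < k → |f (p ^ k)| ≤ g (p ^ k)) {n : ℕ} (hn : n ≠ 0) : |f n| ≤ g n := by
  induction n using Nat.recOnPosPrimePosCoprime with
  | zero => exact absurd rfl hn
  | one => rw [hf.1, hg.1, abs_one]
  | prime_pow p k hp hk => exact h p k hp hk
  | coprime a b ha hb hab iha ihb =>
    rw [hf.2 a b hab, hg.2 a b hab, abs_mul]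
    exact mul_le_mul (iha (by omega)) (ihb (by omega)) (abs_nonneg _)
      ((abs_nonneg _).trans (iha (by omega)))

lemma IsMult.mul {f g : ℕ → ℝ} (hf : IsMult f) (hg : IsMult g) : IsMult (fun n => f n * g n) := by
  refine ⟨by simp [hf.1, hg.1], fun m n h => ?_⟩
  simp only [hf.2 m n h, hg.2 m n h]
  ring

lemma IsMult.abs {f : ℕ → ℝ} (hf : IsMult f) : IsMult (fun n => |f n|) :=
  ⟨by simp [hf.1], fun m n h => by simp only [hf.2 m n h, abs_mul]⟩

lemma sum_divisorsAntidiagonal_mul {m n : ℕ} (h : m.Coprime n) (H : ℕ → ℕ → ℝ) :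
    ∑ x ∈ (m * n).divisorsAntidiagonal, H x.1 x.2 =
      ∑ x ∈ m.divisorsAntidiagonal, ∑ y ∈ n.divisorsAntidiagonal, H (x.1 * y.1) (x.2 * y.2) := by
  rw [Nat.sum_divisorsAntidiagonal H, Nat.divisors_mul, Finset.mul_def, Finset.sum_image,
    Finset.sum_product, Nat.sum_divisorsAntidiagonal
      (fun a b => ∑ y ∈ n.divisorsAntidiagonal, H (a * y.1) (b * y.2))]
  · refine sum_congr rfl fun x hx => ?_
    rw [Nat.sum_divisorsAntidiagonal (fun a b => H (x * a) (m / x * b))]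
    refine sum_congr rfl fun y hy => ?_
    rw [Nat.div_mul_div_comm (Nat.dvd_of_mem_divisors hx) (Nat.dvd_of_mem_divisors hy)]
  · exact h.mul_injOn_divisors

lemma IsMult.conv {f g : ℕ → ℝ} (hf : IsMult f) (hg : IsMult g) :
    IsMult (fun n => ∑ x ∈ n.divisorsAntidiagonal, f x.1 * g x.2) := by
  refine ⟨by simp [hf.1, hg.1], fun m n h => ?_⟩
  simp only
  rw [sum_divisorsAntidiagonal_mul h (fun a b => f a * g b), Finset.sum_mul_sum]
  refine sum_congr rfl fun x hx => sum_congr rfl fun y hy => ?_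
  have hx' := (Nat.mem_divisorsAntidiagonal.1 hx).1
  have hy' := (Nat.mem_divisorsAntidiagonal.1 hy).1
  have h1 : x.1.Coprime y.1 :=
    (h.coprime_dvd_left ⟨_, hx'.symm⟩).coprime_dvd_right ⟨_, hy'.symm⟩
  have h2 : x.2.Coprime y.2 :=
    (h.coprime_dvd_left ⟨x.1, by rw [← hx', mul_comm]⟩).coprime_dvd_right ⟨y.1, by rw [← hy', mul_comm]⟩
  rw [hf.2 _ _ h1, hg.2 _ _ h2]
  ring

lemma IsMult.prod_primeFactors (f : ℕ → ℝ) : IsMult (fun n => ∏ p ∈ n.primeFactors, f p) :=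
  ⟨by simp, fun m n h => by
    simp only
    rw [h.primeFactors_mul, Finset.prod_union h.disjoint_primeFactors]⟩

lemma isMult_moebius : IsMult (fun n => (moebius n : ℝ)) :=
  ⟨by simp, fun m n h => by
    simp only
    rw [ArithmeticFunction.isMultiplicative_moebius.2 h, Int.cast_mul]⟩

lemma sum_divisorsAntidiagonal_prime_pow {p : ℕ} (hp : p.Prime) (k : ℕ) (H : ℕ → ℕ → ℝ) :
    ∑ x ∈ (p ^ k).divisorsAntidiagonal, H x.1 x.2 =
      ∑ i ∈ range (k + 1), H (p ^ i) (p ^ (k - i)) := by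
  rw [Nat.sum_divisorsAntidiagonal H, Nat.sum_divisors_prime_pow hp]
  refine sum_congr rfl fun i hi => ?_
  rw [Nat.pow_div (by have := mem_range.1 hi; omega) hp.pos]

/-- A completely multiplicative function with values in `{0, 1, -1}`. -/
def IsTrivalued (χ : ℕ →* ℝ) : Prop := ∀ n, χ n = 0 ∨ χ n = 1 ∨ χ n = -1

lemma IsTrivalued.abs_le_one {χ : ℕ →* ℝ} (hχ : IsTrivalued χ) (n : ℕ) : |χ n| ≤ 1 := by
  rcases hχ n with h | h | h <;> simp [h]

lemma isMult_char (χ : ℕ →* ℝ) : IsMult χ := ⟨map_one χ, fun m n _ => map_mul χ m n⟩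

/-- The convolution `1 ⋆ χ`. -/
def rConv (χ : ℕ →* ℝ) (n : ℕ) : ℝ := ∑ d ∈ n.divisors, χ d

section

variable {χ : ℕ →* ℝ}

lemma rConv_eq (n : ℕ) : rConv χ n = ∑ x ∈ n.divisorsAntidiagonal, χ x.1 * (fun _ => (1 : ℝ)) x.2 := by
  rw [Nat.sum_divisorsAntidiagonal (fun a b => χ a * (fun _ => (1 : ℝ)) b), rConv]
  simp

lemma isMult_rConv : IsMult (rConv χ) := by
  have h1 : IsMult (fun _ => (1 : ℝ)) := ⟨rfl, fun _ _ _ => (one_mul 1).symm⟩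
  have := (isMult_char χ).conv h1
  rwa [show (fun n => ∑ x ∈ n.divisorsAntidiagonal, χ x.1 * (fun _ => (1 : ℝ)) x.2) = rConv χ from
    funext fun n => (rConv_eq n).symm] at this

@[simp] lemma rConv_zero : rConv χ 0 = 0 := by simp [rConv]

@[simp] lemma rConv_one : rConv χ 1 = 1 := isMult_rConv.1

lemma rConv_prime_pow {p : ℕ} (hp : p.Prime) (k : ℕ) :
    rConv χ (p ^ k) = ∑ i ∈ range (k + 1), χ p ^ i := by
  rw [rConv, Nat.sum_divisors_prime_pow hp]
  simp

lemma rConv_prime {p : ℕ} (hp : p.Prime) : rConv χ p = 1 + χ p := by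
  have := rConv_prime_pow (χ := χ) hp 1
  simpa [sum_range_succ] using this

lemma rConv_prime_pow_of_one {p : ℕ} (hp : p.Prime) (h : χ p = 1) (k : ℕ) :
    rConv χ (p ^ k) = k + 1 := by
  rw [rConv_prime_pow hp, h]; simp

lemma rConv_prime_pow_of_zero {p : ℕ} (hp : p.Prime) (h : χ p = 0) (k : ℕ) :
    rConv χ (p ^ k) = 1 := by
  rw [rConv_prime_pow hp, h, Finset.sum_range_succ']; simp

lemma rConv_prime_pow_of_neg {p : ℕ} (hp : p.Prime) (h : χ p = -1) (k : ℕ) :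
    rConv χ (p ^ k) = if Even k then 1 else 0 := by
  rw [rConv_prime_pow hp, h, neg_one_geom_sum]
  by_cases hk : Even k <;> simp [hk, Nat.even_add_one]

lemma rConv_prime_pow_bounds (hχ : IsTrivalued χ) {p : ℕ} (hp : p.Prime) (k : ℕ) :
    0 ≤ rConv χ (p ^ k) ∧ rConv χ (p ^ k) ≤ k + 1 := by
  have hk : (0 : ℝ) ≤ k := Nat.cast_nonneg k
  rcases hχ p with h | h | h
  · rw [rConv_prime_pow_of_zero hp h]; constructor <;> linarith
  · rw [rConv_prime_pow_of_one hp h]; constructor <;> linarith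
  · rw [rConv_prime_pow_of_neg hp h]; split_ifs <;> constructor <;> linarith

lemma rConv_nonneg (hχ : IsTrivalued χ) (n : ℕ) : 0 ≤ rConv χ n := by
  rcases eq_or_ne n 0 with rfl | hn
  · simp
  · exact (abs_nonneg _).trans (isMult_rConv.abs_le isMult_rConv (fun p k hp _ => by
      rw [abs_of_nonneg (rConv_prime_pow_bounds hχ hp k).1]) hn)

lemma one_le_rConv_sq (hχ : IsTrivalued χ) {m : ℕ} (hm : m ≠ 0) : 1 ≤ rConv χ (m ^ 2) := by
  have h1 : IsMult (fun _ => (1 : ℝ)) := ⟨rfl, fun _ _ _ => (one_mul 1).symm⟩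
  have h2 : IsMult (fun m => rConv χ (m ^ 2)) := ⟨by simp, fun a b h => by
    simp only
    rw [mul_pow, isMult_rConv.2 _ _ (h.pow 2 2)]⟩
  have := h1.abs_le h2 (fun p k hp _ => ?_) hm
  · simpa using this
  · rw [abs_one, ← pow_mul]
    have hk : (0 : ℝ) ≤ (k * 2 : ℕ) := Nat.cast_nonneg _
    rcases hχ p with h | h | h
    · rw [rConv_prime_pow_of_zero hp h]
    · rw [rConv_prime_pow_of_one hp h]; linarith
    · rw [rConv_prime_pow_of_neg hp h, if_pos (by simp)]

lemma rConv_le_card (hχ : IsTrivalued χ) (n : ℕ) : rConv χ n ≤ n.divisors.card := by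
  rw [rConv, Finset.card_eq_sum_ones, Nat.cast_sum]
  refine sum_le_sum fun d _ => ?_
  simpa using (le_abs_self _).trans (hχ.abs_le_one d)

/-- No prime factor `p` of `n` is inert, that is, satisfies `χ p = -1`. -/
def IsPlus (χ : ℕ →* ℝ) (n : ℕ) : Prop := ∀ p, p.Prime → p ∣ n → χ p ≠ -1

lemma IsPlus.of_dvd {m n : ℕ} (h : IsPlus χ n) (hmn : m ∣ n) : IsPlus χ m :=
  fun p hp hpm => h p hp (hpm.trans hmn)

lemma IsPlus.mul {m n : ℕ} (hm : IsPlus χ m) (hn : IsPlus χ n) : IsPlus χ (m * n) :=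
  fun p hp h => (hp.dvd_mul.1 h).elim (hm p hp) (hn p hp)

lemma IsPlus.char_nonneg (hχ : IsTrivalued χ) {n : ℕ} (hn : n ≠ 0) (h : IsPlus χ n) : 0 ≤ χ n := by
  induction n using Nat.recOnMul with
  | zero => exact absurd rfl hn
  | one => simp
  | prime p hp =>
    rcases hχ p with h' | h' | h'
    · rw [h']
    · rw [h']; exact zero_le_one
    · exact absurd h' (h p hp dvd_rfl)
  | mul a b iha ihb =>
    rw [map_mul]
    exact mul_nonneg (iha (fun h0 => hn (by simp [h0])) (h.of_dvd (dvd_mul_right _ _)))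
      (ihb (fun h0 => hn (by simp [h0])) (h.of_dvd (dvd_mul_left _ _)))

/-- A sum over divisors of `m n` of nonnegative terms is at most the sum over pairs of divisors. -/
lemma sum_divisors_mul_le {m n : ℕ} {F : ℕ → ℝ} (hF : ∀ d ∈ (m * n).divisors, 0 ≤ F d) :
    ∑ d ∈ (m * n).divisors, F d ≤ ∑ x ∈ m.divisors, ∑ y ∈ n.divisors, F (x * y) := by
  rw [Nat.divisors_mul, Finset.mul_def, ← Finset.sum_product']
  refine Finset.sum_image_le_of_nonneg (s := m.divisors ×ˢ n.divisors) (fun z hz => hF _ ?_)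
  rw [Nat.divisors_mul, Finset.mul_def]
  exact hz

lemma IsPlus.rConv_mul_le (hχ : IsTrivalued χ) {m n : ℕ} (hm : IsPlus χ m) (hn : IsPlus χ n) :
    rConv χ (m * n) ≤ rConv χ m * rConv χ n := by
  rw [rConv, rConv, rConv, Finset.sum_mul_sum]
  refine (sum_divisors_mul_le fun d hd => ?_).trans_eq (by simp)
  exact ((hm.mul hn).of_dvd (Nat.dvd_of_mem_divisors hd)).char_nonneg hχ
    (Nat.pos_of_mem_divisors hd).ne'

/-! ### The mollifier coefficients -/

lemma alpha_prime {p : ℕ} (hp : p.Prime) : alpha p = (1 + 1 / (p : ℝ))⁻¹ := by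
  rw [alpha, hp.primeFactors]; simp

lemma alpha_nonneg (n : ℕ) : 0 ≤ alpha n := Finset.prod_nonneg fun p _ => by positivity

/-- The factor `h` over the reals. -/
def hReal (χ : ℕ →* ℝ) (n : ℕ) : ℝ :=
  ∏ p ∈ n.primeFactors, (1 + alpha p ^ 2 * χ p / p)⁻¹

/-- The mollifier coefficient `ρ₁` over the reals. -/
def rho1Real (χ : ℕ →* ℝ) (a : ℕ) : ℝ :=
  (∑ m ∈ a.divisorsAntidiagonal, (alpha m.1 * (moebius m.1 : ℝ)) *
    (alpha m.2 * (moebius m.2 : ℝ) * χ m.2)) * hReal χ a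

lemma isMult_rho1Real : IsMult (rho1Real χ) := by
  have ha : IsMult alpha := IsMult.prod_primeFactors _
  have h1 := (ha.mul isMult_moebius).conv ((ha.mul isMult_moebius).mul (isMult_char χ))
  exact h1.mul (IsMult.prod_primeFactors _)

@[simp] lemma rho1Real_one : rho1Real χ 1 = 1 := isMult_rho1Real.1

@[simp] lemma rho1Real_zero : rho1Real χ 0 = 0 := by simp [rho1Real]

/-- The local factor `h(p)`. -/
def hLocal (χ : ℕ →* ℝ) (p : ℕ) : ℝ := (1 + alpha p ^ 2 * χ p / p)⁻¹

lemma hReal_prime_pow {p k : ℕ} (hp : p.Prime) (hk : k ≠ 0) : hReal χ (p ^ k) = hLocal χ p := by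
  rw [hReal, Nat.primeFactors_prime_pow hk hp]; simp [hLocal]

lemma rho1Real_prime {p : ℕ} (hp : p.Prime) :
    rho1Real χ p = -(alpha p * (1 + χ p)) * hLocal χ p := by
  have h := hReal_prime_pow (χ := χ) hp one_ne_zero
  rw [pow_one] at h
  have h2 := sum_divisorsAntidiagonal_prime_pow hp 1 (fun a b =>
    (alpha a * (moebius a : ℝ)) *
    (alpha b * (moebius b : ℝ) * χ b))
  rw [pow_one] at h2
  rw [rho1Real, h, h2, sum_range_succ, Finset.sum_range_one]
  have hα : alpha 1 = 1 := by simp [alpha]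
  simp [moebius_apply_prime hp, hα]
  ring

lemma rho1Real_prime_sq {p : ℕ} (hp : p.Prime) :
    rho1Real χ (p ^ 2) = alpha p ^ 2 * χ p * hLocal χ p := by
  rw [rho1Real, hReal_prime_pow hp two_ne_zero, sum_divisorsAntidiagonal_prime_pow hp 2 (fun a b =>
    (alpha a * (moebius a : ℝ)) *
    (alpha b * (moebius b : ℝ) * χ b))]
  rw [sum_range_succ, sum_range_succ, Finset.sum_range_one]
  simp [moebius_apply_prime hp,
    moebius_apply_prime_pow hp two_ne_zero]
  left; ring

lemma rho1Real_prime_pow_of_three_le {p k : ℕ} (hp : p.Prime) (hk : 3 ≤ k) :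
    rho1Real χ (p ^ k) = 0 := by
  rw [rho1Real, sum_divisorsAntidiagonal_prime_pow hp k (fun a b =>
    (alpha a * (moebius a : ℝ)) *
    (alpha b * (moebius b : ℝ) * χ b)), Finset.sum_eq_zero, zero_mul]
  intro i hi
  have hi := mem_range.1 hi
  rcases Nat.lt_or_ge 1 i with h | h
  · rw [moebius_apply_prime_pow hp (k := i) (by omega), if_neg (by omega)]
    simp
  · rw [moebius_apply_prime_pow hp (k := k - i) (by omega), if_neg (by omega)]
    simp

lemma abs_rho1Real_prime_pow_le (hχ : IsTrivalued χ) {p k : ℕ} (hp : p.Prime) :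
    |rho1Real χ (p ^ k)| ≤ rConv χ (p ^ k) := by
  have hp2 : (2 : ℝ) ≤ p := by exact_mod_cast hp.two_le
  have hα : alpha p = (1 + 1 / (p : ℝ))⁻¹ := alpha_prime hp
  have hα0 : 0 ≤ alpha p := alpha_nonneg p
  have hα1 : alpha p ≤ 1 := by
    rw [hα]; exact inv_le_one_of_one_le₀ (by have : 0 ≤ 1 / (p : ℝ) := by positivity
                                             linarith)
  have hr0 := (rConv_prime_pow_bounds hχ hp k).1
  have hhl : 0 ≤ χ p → 0 ≤ hLocal χ p ∧ hLocal χ p ≤ 1 := by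
    intro h0
    have : 0 ≤ alpha p ^ 2 * χ p / p := by positivity
    exact ⟨inv_nonneg.2 (by linarith), inv_le_one_of_one_le₀ (by linarith)⟩
  have hα2 : alpha p ^ 2 ≤ 1 := pow_le_one₀ hα0 hα1
  match k, hr0 with
  | 0, _ => simp
  | 1, _ =>
    rw [pow_one, rho1Real_prime hp, rConv_prime hp]
    rcases hχ p with h | h | h
    · obtain ⟨h1, h2⟩ := hhl h.ge
      rw [h, abs_mul, abs_neg, abs_of_nonneg h1, abs_of_nonneg (by positivity)]
      nlinarith
    · obtain ⟨h1, h2⟩ := hhl (by rw [h]; exact zero_le_one)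
      rw [h, abs_mul, abs_neg, abs_of_nonneg h1, abs_of_nonneg (by positivity)]
      nlinarith
    · rw [h]; simp
  | 2, _ =>
    rw [rho1Real_prime_sq hp]
    rcases hχ p with h | h | h
    · rw [h]; simpa using (rConv_prime_pow_bounds hχ hp 2).1
    · obtain ⟨h1, h2⟩ := hhl (by rw [h]; exact zero_le_one)
      rw [rConv_prime_pow_of_one hp h, h, mul_one, abs_of_nonneg (by positivity)]
      push_cast
      nlinarith
    · rw [rConv_prime_pow_of_neg hp h, if_pos (by decide), hLocal, h, hα]
      have h1 : (((1 + 1 / (p : ℝ))⁻¹) ^ 2 * -1 * (1 + ((1 + 1 / (p : ℝ))⁻¹) ^ 2 * -1 / p)⁻¹)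
          = -((p : ℝ) ^ 2 / (p ^ 2 + p + 1)) := by
        have h2 : (1 + ((1 + 1 / (p : ℝ))⁻¹) ^ 2 * -1 / p) = (p ^ 2 + p + 1) / (p + 1) ^ 2 := by
          field_simp
          ring
        rw [h2]
        field_simp
      rw [h1, abs_neg, abs_of_nonneg (by positivity), div_le_one (by positivity)]
      nlinarith
  | k + 3, h => rw [rho1Real_prime_pow_of_three_le hp (by omega), abs_zero]; exact h

lemma abs_rho1Real_le (hχ : IsTrivalued χ) (n : ℕ) : |rho1Real χ n| ≤ rConv χ n := by
  rcases eq_or_ne n 0 with rfl | hn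
  · simp
  · exact isMult_rho1Real.abs_le isMult_rConv
      (fun p k hp _ => abs_rho1Real_prime_pow_le hχ hp) hn

/-! ### Functions of five variables -/

/-- The variables `(d, a, b, g, n)` of the diagonal sum. -/
abbrev Tup := ℕ × ℕ × ℕ × ℕ × ℕ

/-- The product `d a b g n`. -/
def tN (t : Tup) : ℕ := t.1 * t.2.1 * t.2.2.1 * t.2.2.2.1 * t.2.2.2.2

/-- Joint multiplicativity: `F` is multiplicative on pairs of tuples with coprime products. -/
def IsJointMult (F : Tup → ℝ) : Prop :=
  F 1 = 1 ∧ ∀ t t' : Tup, (tN t).Coprime (tN t') → F (t * t') = F t * F t'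

lemma IsJointMult.mul {F G : Tup → ℝ} (hF : IsJointMult F) (hG : IsJointMult G) :
    IsJointMult (fun t => F t * G t) :=
  ⟨by simp [hF.1, hG.1], fun t t' h => by simp only [hF.2 t t' h, hG.2 t t' h]; ring⟩

/-- A multiplicative function composed with a monomial in the variables. -/
lemma IsMult.comp_tup {f : ℕ → ℝ} (hf : IsMult f) {m : Tup → ℕ} (h1 : m 1 = 1)
    (hm : ∀ t t', m (t * t') = m t * m t') (hdvd : ∀ t, ∃ k, m t ∣ tN t ^ k) :
    IsJointMult (fun t => f (m t)) := by
  refine ⟨by simp [h1, hf.1], fun t t' h => ?_⟩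
  simp only [hm]
  refine hf.2 _ _ ?_
  obtain ⟨k, hk⟩ := hdvd t
  obtain ⟨k', hk'⟩ := hdvd t'
  exact ((h.pow k k').coprime_dvd_left hk).coprime_dvd_right hk'

/-- `∑_{a₁ a₂ = A} w(d a₁) w(d a₂)`. -/
def pairSum (w : ℕ → ℝ) (d A : ℕ) : ℝ :=
  ∑ x ∈ A.divisorsAntidiagonal, w (d * x.1) * w (d * x.2)

lemma pairSum_mul {w : ℕ → ℝ} (hw : IsMult w) {d d' A A' : ℕ} (h : (d * A).Coprime (d' * A')) :
    pairSum w (d * d') (A * A') = pairSum w d A * pairSum w d' A' := by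
  have hA : A.Coprime A' := (h.coprime_dvd_left (dvd_mul_left _ _)).coprime_dvd_right (dvd_mul_left _ _)
  rw [pairSum, sum_divisorsAntidiagonal_mul hA (fun a b => w (d * d' * a) * w (d * d' * b)), pairSum,
    pairSum, Finset.sum_mul_sum]
  refine sum_congr rfl fun x hx => sum_congr rfl fun y hy => ?_
  have hx' := (Nat.mem_divisorsAntidiagonal.1 hx).1
  have hy' := (Nat.mem_divisorsAntidiagonal.1 hy).1
  have h1 : (d * x.1).Coprime (d' * y.1) :=
    (h.coprime_dvd_left (mul_dvd_mul_left d ⟨x.2, hx'.symm⟩)).coprime_dvd_right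
      (mul_dvd_mul_left d' ⟨y.2, hy'.symm⟩)
  have h2 : (d * x.2).Coprime (d' * y.2) :=
    (h.coprime_dvd_left (mul_dvd_mul_left d ⟨x.1, by rw [← hx', mul_comm]⟩)).coprime_dvd_right
      (mul_dvd_mul_left d' ⟨y.1, by rw [← hy', mul_comm]⟩)
  rw [show d * d' * (x.1 * y.1) = (d * x.1) * (d' * y.1) by ring,
    show d * d' * (x.2 * y.2) = (d * x.2) * (d' * y.2) by ring, hw.2 _ _ h1, hw.2 _ _ h2]
  ring

lemma isJointMult_pairSum {w : ℕ → ℝ} (hw : IsMult w) :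
    IsJointMult (fun t => pairSum w t.1 (t.2.1 * t.2.2.1 * t.2.2.2.1)) := by
  refine ⟨by simp [pairSum, hw.1], fun t t' h => ?_⟩
  simp only [Prod.fst_mul, Prod.snd_mul]
  rw [← pairSum_mul hw]
  · congr 1; ring
  · refine (h.coprime_dvd_left ⟨t.2.2.2.2, ?_⟩).coprime_dvd_right ⟨t'.2.2.2.2, ?_⟩ <;>
    · rw [tN]; ring

/-- `d a b g² n`. -/
def tDen (t : Tup) : ℕ := t.1 * t.2.1 * t.2.2.1 * t.2.2.2.1 ^ 2 * t.2.2.2.2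

lemma isMult_inv : IsMult (fun n => ((n : ℝ))⁻¹) :=
  ⟨by simp, fun m n _ => by simp only; push_cast; rw [mul_inv]⟩

lemma tN_mul (t t' : Tup) : tN (t * t') = tN t * tN t' := by
  simp only [tN, Prod.fst_mul, Prod.snd_mul]; ring

lemma tDen_mul (t t' : Tup) : tDen (t * t') = tDen t * tDen t' := by
  simp only [tDen, Prod.fst_mul, Prod.snd_mul]; ring

lemma tDen_dvd (t : Tup) : tDen t ∣ tN t ^ 2 :=
  ⟨t.1 * t.2.1 * t.2.2.1 * t.2.2.2.2, by rw [tDen, tN]; ring⟩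

/-- The arithmetic weight of the tuple `(d, a, b, g, n)` in the completed diagonal sum. -/
def fTup (χ : ℕ →* ℝ) (t : Tup) : ℝ :=
  pairSum (rho1Real χ) t.1 (t.2.1 * t.2.2.1 * t.2.2.2.1) *
    ((moebius t.2.2.2.1 : ℝ) * χ t.2.2.2.1) * rConv χ t.2.2.1 *
    rConv χ (t.2.1 * t.2.2.2.1 * t.2.2.2.2) * rConv χ t.2.2.2.2 * ((tDen t : ℝ))⁻¹

/-- The majorant of `fTup` obtained by taking absolute values throughout. -/
def FTup (χ : ℕ →* ℝ) (t : Tup) : ℝ :=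
  pairSum (fun n => |rho1Real χ n|) t.1 (t.2.1 * t.2.2.1 * t.2.2.2.1) *
    |(moebius t.2.2.2.1 : ℝ)| * rConv χ t.2.2.1 *
    rConv χ (t.2.1 * t.2.2.2.1 * t.2.2.2.2) * rConv χ t.2.2.2.2 * ((tDen t : ℝ))⁻¹

lemma isJointMult_b {f : ℕ → ℝ} (hf : IsMult f) : IsJointMult (fun t => f t.2.2.1) :=
  hf.comp_tup (m := fun t => t.2.2.1) rfl (fun _ _ => rfl)
    fun t => ⟨1, t.1 * t.2.1 * t.2.2.2.1 * t.2.2.2.2, by rw [tN]; ring⟩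

lemma isJointMult_g {f : ℕ → ℝ} (hf : IsMult f) : IsJointMult (fun t => f t.2.2.2.1) :=
  hf.comp_tup (m := fun t => t.2.2.2.1) rfl (fun _ _ => rfl)
    fun t => ⟨1, t.1 * t.2.1 * t.2.2.1 * t.2.2.2.2, by rw [tN]; ring⟩

lemma isJointMult_n {f : ℕ → ℝ} (hf : IsMult f) : IsJointMult (fun t => f t.2.2.2.2) :=
  hf.comp_tup (m := fun t => t.2.2.2.2) rfl (fun _ _ => rfl)
    fun t => ⟨1, t.1 * t.2.1 * t.2.2.1 * t.2.2.2.1, by rw [tN]; ring⟩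

lemma isJointMult_agn {f : ℕ → ℝ} (hf : IsMult f) :
    IsJointMult (fun t => f (t.2.1 * t.2.2.2.1 * t.2.2.2.2)) :=
  hf.comp_tup (m := fun t => t.2.1 * t.2.2.2.1 * t.2.2.2.2) (by simp)
    (fun t t' => by simp only [Prod.fst_mul, Prod.snd_mul]; ring)
    fun t => ⟨1, t.1 * t.2.2.1, by rw [tN]; ring⟩

lemma isJointMult_den : IsJointMult (fun t => ((tDen t : ℕ) : ℝ)⁻¹) :=
  isMult_inv.comp_tup (m := tDen) (by simp [tDen]) tDen_mul fun t => ⟨2, tDen_dvd t⟩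

lemma isJointMult_fTup : IsJointMult (fTup χ) :=
  (((((isJointMult_pairSum isMult_rho1Real).mul
    (isJointMult_g (isMult_moebius.mul (isMult_char χ)))).mul (isJointMult_b isMult_rConv)).mul
    (isJointMult_agn isMult_rConv)).mul (isJointMult_n isMult_rConv)).mul isJointMult_den

lemma isJointMult_FTup : IsJointMult (FTup χ) :=
  (((((isJointMult_pairSum isMult_rho1Real.abs).mul
    (isJointMult_g isMult_moebius.abs)).mul (isJointMult_b isMult_rConv)).mul
    (isJointMult_agn isMult_rConv)).mul (isJointMult_n isMult_rConv)).mul isJointMult_den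

lemma pairSum_abs_nonneg (w : ℕ → ℝ) (d A : ℕ) : 0 ≤ pairSum (fun n => |w n|) d A :=
  Finset.sum_nonneg fun _ _ => by positivity

lemma abs_pairSum_le (w : ℕ → ℝ) (d A : ℕ) : |pairSum w d A| ≤ pairSum (fun n => |w n|) d A := by
  refine (Finset.abs_sum_le_sum_abs _ _).trans (sum_le_sum fun x _ => ?_)
  rw [abs_mul]

lemma FTup_nonneg (hχ : IsTrivalued χ) (t : Tup) : 0 ≤ FTup χ t := by
  have h1 := pairSum_abs_nonneg (rho1Real χ) t.1 (t.2.1 * t.2.2.1 * t.2.2.2.1)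
  have h2 := rConv_nonneg hχ t.2.2.1
  have h3 := rConv_nonneg hχ (t.2.1 * t.2.2.2.1 * t.2.2.2.2)
  have h4 := rConv_nonneg hχ t.2.2.2.2
  unfold FTup
  positivity

lemma abs_fTup_le (hχ : IsTrivalued χ) (t : Tup) : |fTup χ t| ≤ FTup χ t := by
  have h2 := rConv_nonneg hχ t.2.2.1
  have h3 := rConv_nonneg hχ (t.2.1 * t.2.2.2.1 * t.2.2.2.2)
  have h4 := rConv_nonneg hχ t.2.2.2.2
  rw [fTup, FTup, abs_mul, abs_mul, abs_mul, abs_mul, abs_mul, abs_mul, abs_of_nonneg h2,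
    abs_of_nonneg h3, abs_of_nonneg h4, abs_of_nonneg (by positivity : (0 : ℝ) ≤ ((tDen t : ℝ))⁻¹)]
  have h1 := abs_pairSum_le (rho1Real χ) t.1 (t.2.1 * t.2.2.1 * t.2.2.2.1)
  have h5 := hχ.abs_le_one t.2.2.2.1
  have h0 := pairSum_abs_nonneg (rho1Real χ) t.1 (t.2.1 * t.2.2.1 * t.2.2.2.1)
  gcongr
  exact mul_le_of_le_one_right (abs_nonneg _) h5

end

/-! ### Euler products over five variables -/

/-- The tuple of powers `p^e`. -/
def pw (p : ℕ) (e : Tup) : Tup := (p ^ e.1, p ^ e.2.1, p ^ e.2.2.1, p ^ e.2.2.2.1, p ^ e.2.2.2.2)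

/-- The sum of the entries of an exponent vector. -/
def tS (e : Tup) : ℕ := e.1 + e.2.1 + e.2.2.1 + e.2.2.2.1 + e.2.2.2.2

lemma tN_pw (p : ℕ) (e : Tup) : tN (pw p e) = p ^ tS e := by
  simp only [tN, pw, tS, pow_add]

lemma pw_zero (p : ℕ) : pw p 0 = 1 := by simp [pw, Prod.ext_iff]

lemma tS_eq_zero {e : Tup} : tS e = 0 ↔ e = 0 := by
  simp only [tS, Prod.ext_iff, Prod.fst_zero, Prod.snd_zero]
  omega

/-- Tuples all of whose entries have their prime factors in `S`. -/
abbrev FT (S : Finset ℕ) : Type :=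
  Nat.factoredNumbers S × Nat.factoredNumbers S × Nat.factoredNumbers S × Nat.factoredNumbers S ×
    Nat.factoredNumbers S

/-- The underlying tuple of naturals. -/
def FT.toTup {S : Finset ℕ} (t : FT S) : Tup := (t.1, t.2.1, t.2.2.1, t.2.2.2.1, t.2.2.2.2)

lemma FT.toTup_injective {S : Finset ℕ} : Function.Injective (FT.toTup (S := S)) := by
  intro t t' h
  simp only [FT.toTup, Prod.ext_iff] at h
  simpa only [Prod.ext_iff, Subtype.ext_iff] using h

/-- Splitting off the powers of a new prime `p`. -/
def stepEquiv {S : Finset ℕ} {p : ℕ} (hp : p.Prime) (hs : p ∉ S) : Tup × FT S ≃ FT (insert p S) :=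
  let E := Nat.equivProdNatFactoredNumbers hp hs
  (Equiv.prodProdProdComm _ _ _ _).trans (E.prodCongr
    ((Equiv.prodProdProdComm _ _ _ _).trans (E.prodCongr
      ((Equiv.prodProdProdComm _ _ _ _).trans (E.prodCongr
        ((Equiv.prodProdProdComm _ _ _ _).trans (E.prodCongr E)))))))

lemma toTup_stepEquiv {S : Finset ℕ} {p : ℕ} (hp : p.Prime) (hs : p ∉ S) (x : Tup × FT S) :
    (stepEquiv hp hs x).toTup = pw p x.1 * x.2.toTup := by
  simp [FT.toTup, stepEquiv, pw, Nat.equivProdNatFactoredNumbers_apply']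

attribute [irreducible] stepEquiv

lemma tN_toTup_mem {S : Finset ℕ} (t : FT S) : tN t.toTup ∈ Nat.factoredNumbers S := by
  refine Nat.mul_mem_factoredNumbers (Nat.mul_mem_factoredNumbers (Nat.mul_mem_factoredNumbers
    (Nat.mul_mem_factoredNumbers ?_ ?_) ?_) ?_) ?_
  exacts [t.1.2, t.2.1.2, t.2.2.1.2, t.2.2.2.1.2, t.2.2.2.2.2]

lemma coprime_pw_toTup {S : Finset ℕ} {p : ℕ} (hp : p.Prime) (hs : p ∉ S) (e : Tup) (t : FT S) :
    (tN (pw p e)).Coprime (tN t.toTup) := by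
  rw [tN_pw]
  exact (Nat.Prime.factoredNumbers_coprime hp hs (tN_toTup_mem t)).pow_left _

lemma coe_factoredNumbers_empty (x : Nat.factoredNumbers ∅) : (x : ℕ) = 1 :=
  (Set.ext_iff.1 Nat.factoredNumbers_empty _).1 x.2

lemma toTup_empty (t : FT ∅) : t.toTup = 1 := by
  simp [FT.toTup, coe_factoredNumbers_empty, Prod.ext_iff]

noncomputable instance : Unique (FT ∅) where
  default :=
    let x := ⟨1, (Set.ext_iff.1 Nat.factoredNumbers_empty _).2 rfl⟩
    (x, x, x, x, x)
  uniq t := FT.toTup_injective ((toTup_empty t).trans (toTup_empty _).symm)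

/-- Products of absolutely convergent series. -/
lemma hasSum_mul_of_summable_abs {ι ι' : Type} {f : ι → ℝ} {g : ι' → ℝ}
    (hf : Summable fun e => |f e|) (hg : Summable fun t => |g t|) :
    HasSum (fun x : ι × ι' => f x.1 * g x.2) ((∑' e, f e) * ∑' t, g t) := by
  have hf' : Summable fun e => ‖f e‖ := hf
  have hg' : Summable fun e => ‖g e‖ := hg
  rw [tsum_mul_tsum_of_summable_norm hf' hg']
  exact (summable_mul_of_summable_norm hf' hg').hasSum

lemma tN_toTup_pos {S : Finset ℕ} (t : FT S) : 0 < tN t.toTup :=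
  Nat.pos_of_ne_zero (tN_toTup_mem t).1

lemma IsJointMult.step {F : Tup → ℝ} (hF : IsJointMult F) {S : Finset ℕ} {p : ℕ} (hp : p.Prime)
    (hs : p ∉ S) (x : Tup × FT S) :
    F (stepEquiv hp hs x).toTup = F (pw p x.1) * F x.2.toTup := by
  rw [toTup_stepEquiv, hF.2 _ _ (coprime_pw_toTup hp hs _ _)]

lemma IsJointMult.summable_and_tsum {F : Tup → ℝ} (hF : IsJointMult F)
    (S : Finset ℕ) (hloc : ∀ p ∈ S, Summable fun e => |F (pw p e)|)
    (hS : ∀ p ∈ S, p.Prime) : (Summable fun t : FT S => |F t.toTup|) ∧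
      ∑' t : FT S, F t.toTup = ∏ p ∈ S, ∑' e, F (pw p e) := by
  induction S using Finset.induction_on with
  | empty =>
    refine ⟨Summable.of_finite, ?_⟩
    rw [tsum_fintype, Finset.prod_empty, Fintype.sum_unique, toTup_empty, hF.1]
  | insert p S hp ih =>
    have hpp := hS p (Finset.mem_insert_self p S)
    obtain ⟨h1, h2⟩ := ih (fun q hq => hloc q (mem_insert_of_mem hq))
      fun q hq => hS q (mem_insert_of_mem hq)
    have hloc := hloc p (Finset.mem_insert_self p S)
    have h3 : Summable fun x : Tup × FT S => |F (pw p x.1)| * |F x.2.toTup| :=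
      hloc.mul_of_nonneg h1 (fun _ => abs_nonneg _) (fun _ => abs_nonneg _)
    constructor
    · rw [← (stepEquiv hpp hp).summable_iff]
      refine h3.congr fun x => ?_
      rw [Function.comp_apply, hF.step hpp hp, abs_mul]
    · rw [Finset.prod_insert hp, ← h2, ← (stepEquiv hpp hp).tsum_eq,
        ← (hasSum_mul_of_summable_abs hloc h1).tsum_eq]
      exact tsum_congr fun x => hF.step hpp hp x

/-- Bounds for logarithmically weighted sums over `S`-factored tuples, relative to the unweighted
sum. The weights `ℓ₁`, `ℓ₂` are additive, so each weighted sum is a sum over primes of local ones. -/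
lemma IsJointMult.weighted {F ℓ₁ ℓ₂ : Tup → ℝ} (hF : IsJointMult F)
    (h₁0 : ℓ₁ 1 = 0) (h₂0 : ℓ₂ 1 = 0)
    (h₁ : ∀ t t', tN t ≠ 0 → tN t' ≠ 0 → ℓ₁ (t * t') = ℓ₁ t + ℓ₁ t')
    (h₂ : ∀ t t', tN t ≠ 0 → tN t' ≠ 0 → ℓ₂ (t * t') = ℓ₂ t + ℓ₂ t')
    (h₁n : ∀ t, 0 ≤ ℓ₁ t) (h₂n : ∀ t, 0 ≤ ℓ₂ t)
    (hloc : ∀ p, p.Prime → Summable fun e => |F (pw p e)| * ((1 + ℓ₁ (pw p e)) * (1 + ℓ₂ (pw p e))))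
    {κ κ' : ℕ → ℝ} (hE : ∀ p, p.Prime → 0 < ∑' e, F (pw p e))
    (hκ₁ : ∀ p, p.Prime → |∑' e, F (pw p e) * ℓ₁ (pw p e)| ≤ κ p * ∑' e, F (pw p e))
    (hκ₂ : ∀ p, p.Prime → |∑' e, F (pw p e) * ℓ₂ (pw p e)| ≤ κ p * ∑' e, F (pw p e))
    (hκ' : ∀ p, p.Prime →
      |∑' e, F (pw p e) * (ℓ₁ (pw p e) * ℓ₂ (pw p e))| ≤ κ' p * ∑' e, F (pw p e))
    (S : Finset ℕ) (hS : ∀ p ∈ S, p.Prime) :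
    (Summable fun t : FT S => |F t.toTup| * ((1 + ℓ₁ t.toTup) * (1 + ℓ₂ t.toTup))) ∧
    |∑' t : FT S, F t.toTup * ℓ₁ t.toTup| ≤ (∑ p ∈ S, κ p) * ∑' t : FT S, F t.toTup ∧
    |∑' t : FT S, F t.toTup * ℓ₂ t.toTup| ≤ (∑ p ∈ S, κ p) * ∑' t : FT S, F t.toTup ∧
    |∑' t : FT S, F t.toTup * (ℓ₁ t.toTup * ℓ₂ t.toTup)| ≤
      ((∑ p ∈ S, κ p) ^ 2 + ∑ p ∈ S, κ' p) * ∑' t : FT S, F t.toTup := by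
  have dom : ∀ {ι : Type} (A B C : ι → ℝ), (∀ i, 0 ≤ B i) → (∀ i, 0 ≤ C i) →
      Summable (fun i => |A i| * ((1 + B i) * (1 + C i))) →
      Summable (fun i => |A i|) ∧ Summable (fun i => |A i * B i|) ∧
      Summable (fun i => |A i * C i|) ∧ Summable (fun i => |A i * (B i * C i)|) := by
    intro ι A B C hB hC h
    have key : ∀ i, |A i| ≤ |A i| * ((1 + B i) * (1 + C i)) ∧
        |A i * B i| ≤ |A i| * ((1 + B i) * (1 + C i)) ∧
        |A i * C i| ≤ |A i| * ((1 + B i) * (1 + C i)) ∧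
        |A i * (B i * C i)| ≤ |A i| * ((1 + B i) * (1 + C i)) := by
      intro i
      have hb := hB i
      have hc := hC i
      have ha := abs_nonneg (A i)
      simp only [abs_mul, abs_of_nonneg hb, abs_of_nonneg hc]
      have h1 := mul_nonneg ha hb
      have h2 := mul_nonneg ha hc
      have h3 := mul_nonneg ha (mul_nonneg hb hc)
      refine ⟨?_, ?_, ?_, ?_⟩ <;> linarith
    exact ⟨h.of_nonneg_of_le (fun i => abs_nonneg _) fun i => (key i).1,
      h.of_nonneg_of_le (fun i => abs_nonneg _) fun i => (key i).2.1,
      h.of_nonneg_of_le (fun i => abs_nonneg _) fun i => (key i).2.2.1,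
      h.of_nonneg_of_le (fun i => abs_nonneg _) fun i => (key i).2.2.2⟩
  induction S using Finset.induction_on with
  | empty =>
    refine ⟨Summable.of_finite, ?_⟩
    simp [tsum_fintype, toTup_empty, h₁0, h₂0]
  | insert p S hp ih =>
    have hpp := hS p (Finset.mem_insert_self p S)
    obtain ⟨i0, i1, i2, i12⟩ := ih fun q hq => hS q (mem_insert_of_mem hq)
    obtain ⟨a0, a1, a2, a12⟩ := dom _ _ _ (fun e => h₁n (pw p e)) (fun e => h₂n (pw p e)) (hloc p hpp)
    obtain ⟨b0, b1, b2, b12⟩ := dom _ _ _ (fun t : FT S => h₁n t.toTup) (fun t => h₂n t.toTup) i0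
    have hne1 : ∀ e, tN (pw p e) ≠ 0 := fun e => by rw [tN_pw]; exact pow_ne_zero _ hpp.ne_zero
    have hne2 : ∀ t : FT S, tN t.toTup ≠ 0 := fun t => (tN_toTup_pos t).ne'
    have hl1 : ∀ x : Tup × FT S, ℓ₁ (stepEquiv hpp hp x).toTup = ℓ₁ (pw p x.1) + ℓ₁ x.2.toTup :=
      fun x => by rw [toTup_stepEquiv, h₁ _ _ (hne1 _) (hne2 _)]
    have hl2 : ∀ x : Tup × FT S, ℓ₂ (stepEquiv hpp hp x).toTup = ℓ₂ (pw p x.1) + ℓ₂ x.2.toTup :=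
      fun x => by rw [toTup_stepEquiv, h₂ _ _ (hne1 _) (hne2 _)]
    set E0 := ∑' e, F (pw p e)
    set E1 := ∑' e, F (pw p e) * ℓ₁ (pw p e)
    set E2 := ∑' e, F (pw p e) * ℓ₂ (pw p e)
    set E12 := ∑' e, F (pw p e) * (ℓ₁ (pw p e) * ℓ₂ (pw p e))
    set T0 := ∑' t : FT S, F t.toTup
    set T1 := ∑' t : FT S, F t.toTup * ℓ₁ t.toTup
    set T2 := ∑' t : FT S, F t.toTup * ℓ₂ t.toTup
    set T12 := ∑' t : FT S, F t.toTup * (ℓ₁ t.toTup * ℓ₂ t.toTup)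
    have t0 : ∑' t : FT (insert p S), F t.toTup = E0 * T0 := by
      rw [← (stepEquiv hpp hp).tsum_eq]
      exact ((hasSum_mul_of_summable_abs a0 b0).congr_fun fun x => hF.step hpp hp x).tsum_eq
    have t1 : ∑' t : FT (insert p S), F t.toTup * ℓ₁ t.toTup = E1 * T0 + E0 * T1 := by
      rw [← (stepEquiv hpp hp).tsum_eq]
      refine (((hasSum_mul_of_summable_abs a1 b0).add (hasSum_mul_of_summable_abs a0 b1)).congr_fun fun x => ?_).tsum_eq
      rw [hF.step hpp hp, hl1]; ring
    have t2 : ∑' t : FT (insert p S), F t.toTup * ℓ₂ t.toTup = E2 * T0 + E0 * T2 := by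
      rw [← (stepEquiv hpp hp).tsum_eq]
      refine (((hasSum_mul_of_summable_abs a2 b0).add (hasSum_mul_of_summable_abs a0 b2)).congr_fun fun x => ?_).tsum_eq
      rw [hF.step hpp hp, hl2]; ring
    have t12 : ∑' t : FT (insert p S), F t.toTup * (ℓ₁ t.toTup * ℓ₂ t.toTup)
        = E12 * T0 + E1 * T2 + E2 * T1 + E0 * T12 := by
      rw [← (stepEquiv hpp hp).tsum_eq]
      refine (((((hasSum_mul_of_summable_abs a12 b0).add (hasSum_mul_of_summable_abs a1 b2)).add (hasSum_mul_of_summable_abs a2 b1)).add (hasSum_mul_of_summable_abs a0 b12)).congr_fun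
        fun x => ?_).tsum_eq
      rw [hF.step hpp hp, hl1, hl2]; ring
    have hE0 := hE p hpp
    have e1 := hκ₁ p hpp
    have e2 := hκ₂ p hpp
    have e12 := hκ' p hpp
    have hT0 : 0 ≤ T0 := by
      have := (hF.summable_and_tsum S (fun q hq => (dom _ _ _ (fun e => h₁n (pw q e))
        (fun e => h₂n (pw q e)) (hloc q (hS q (mem_insert_of_mem hq)))).1)
        fun q hq => hS q (mem_insert_of_mem hq)).2
      rw [show T0 = _ from this]
      exact Finset.prod_nonneg fun q hq => (hE q (hS q (mem_insert_of_mem hq))).le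
    have hκ0 : 0 ≤ κ p := by
      have := (abs_nonneg _).trans e1
      exact nonneg_of_mul_nonneg_left this hE0
    rw [t0, t1, t2, t12, Finset.sum_insert hp, Finset.sum_insert hp]
    set K := ∑ q ∈ S, κ q
    set K' := ∑ q ∈ S, κ' q
    have m10 : |E1 * T0| ≤ κ p * E0 * T0 := by
      rw [abs_mul, abs_of_nonneg hT0]; gcongr
    have m20 : |E2 * T0| ≤ κ p * E0 * T0 := by
      rw [abs_mul, abs_of_nonneg hT0]; gcongr
    have m01 : |E0 * T1| ≤ E0 * (K * T0) := by rw [abs_mul, abs_of_pos hE0]; gcongr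
    have m02 : |E0 * T2| ≤ E0 * (K * T0) := by rw [abs_mul, abs_of_pos hE0]; gcongr
    refine ⟨?_, ?_, ?_, ?_⟩
    · rw [← (stepEquiv hpp hp).summable_iff]
      refine Summable.of_nonneg_of_le (fun x => ?_) (fun x => ?_)
        ((hloc p hpp).mul_of_nonneg i0 (fun e => ?_) (fun t => ?_))
      · have := h₁n (stepEquiv hpp hp x).toTup
        have := h₂n (stepEquiv hpp hp x).toTup
        simp only [Function.comp_apply]
        positivity
      · simp only [Function.comp_apply]
        rw [hF.step hpp hp, hl1, hl2, abs_mul]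
        have u1 := h₁n (pw p x.1)
        have u2 := h₂n (pw p x.1)
        have v1 := h₁n x.2.toTup
        have v2 := h₂n x.2.toTup
        calc |F (pw p x.1)| * |F x.2.toTup| *
              ((1 + (ℓ₁ (pw p x.1) + ℓ₁ x.2.toTup)) * (1 + (ℓ₂ (pw p x.1) + ℓ₂ x.2.toTup)))
            ≤ |F (pw p x.1)| * |F x.2.toTup| *
              (((1 + ℓ₁ (pw p x.1)) * (1 + ℓ₁ x.2.toTup)) *
                ((1 + ℓ₂ (pw p x.1)) * (1 + ℓ₂ x.2.toTup))) := by
              gcongr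
              · nlinarith [mul_nonneg u1 v1]
              · nlinarith [mul_nonneg u2 v2]
          _ = _ := by ring
      · have := h₁n (pw p e)
        have := h₂n (pw p e)
        positivity
      · have := h₁n t.toTup
        have := h₂n t.toTup
        positivity
    · refine (abs_add_le _ _).trans ?_
      linarith
    · refine (abs_add_le _ _).trans ?_
      linarith
    · have m12 : |E12 * T0| ≤ κ' p * E0 * T0 := by
        rw [abs_mul, abs_of_nonneg hT0]; gcongr
      have m1 : |E1 * T2| ≤ (κ p * E0) * (K * T0) := by
        rw [abs_mul]
        exact mul_le_mul e1 i2 (abs_nonneg _) (by positivity)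
      have m2 : |E2 * T1| ≤ (κ p * E0) * (K * T0) := by
        rw [abs_mul]
        exact mul_le_mul e2 i1 (abs_nonneg _) (by positivity)
      have m3 : |E0 * T12| ≤ E0 * ((K ^ 2 + K') * T0) := by rw [abs_mul, abs_of_pos hE0]; gcongr
      have s1 := abs_add_le (E12 * T0 + E1 * T2 + E2 * T1) (E0 * T12)
      have s2 := abs_add_le (E12 * T0 + E1 * T2) (E2 * T1)
      have s3 := abs_add_le (E12 * T0) (E1 * T2)
      have s4 : 0 ≤ κ p ^ 2 * (E0 * T0) := by positivity
      linarith

/-! ### Bounds for the local factors -/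

lemma summable_poly_geometric (B : ℕ) {ρ : ℝ} (h0 : 0 ≤ ρ) (h1 : ρ < 1) :
    Summable fun e : ℕ => (1 + (e : ℝ)) ^ B * ρ ^ e := by
  have h := summable_pow_mul_geometric_of_norm_lt_one (r := ρ) B
    (by rwa [norm_eq_abs, abs_of_nonneg h0])
  have h2 := ((h.mul_left (2 ^ B)).add (summable_geometric_of_lt_one h0 h1))
  refine h2.of_nonneg_of_le (fun e => by positivity) fun e => ?_
  rcases Nat.eq_zero_or_pos e with rfl | he
  · simp
  · have : (1 + (e : ℝ)) ^ B ≤ (2 * e) ^ B := by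
      have : (1 : ℝ) ≤ e := by exact_mod_cast he
      gcongr; linarith
    have h3 : (1 + (e : ℝ)) ^ B * ρ ^ e ≤ (2 * e) ^ B * ρ ^ e := by gcongr
    have h4 : 0 ≤ ρ ^ e := by positivity
    rw [mul_pow] at h3
    linarith

lemma summable_tup_poly_geometric (B : ℕ) {ρ : ℝ} (h0 : 0 ≤ ρ) (h1 : ρ < 1) :
    Summable fun e : Tup => (1 + (tS e : ℝ)) ^ B * ρ ^ tS e := by
  have h := summable_poly_geometric B h0 h1
  have hn : ∀ e : ℕ, 0 ≤ (1 + (e : ℝ)) ^ B * ρ ^ e := fun e => by positivity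
  have h2 := h.mul_of_nonneg h hn hn
  have h3 := h.mul_of_nonneg h2 hn fun x => mul_nonneg (hn _) (hn _)
  have h4 := h.mul_of_nonneg h3 hn fun x => mul_nonneg (hn _) (mul_nonneg (hn _) (hn _))
  have h5 := h.mul_of_nonneg h4 hn fun x =>
    mul_nonneg (hn _) (mul_nonneg (hn _) (mul_nonneg (hn _) (hn _)))
  refine h5.of_nonneg_of_le (fun e => by positivity) fun e => ?_
  obtain ⟨a, b, c, d, f⟩ := e
  simp only [tS]
  have key : (1 + ((a + b + c + d + f : ℕ) : ℝ)) ≤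
      (1 + (a : ℝ)) * ((1 + (b : ℝ)) * ((1 + (c : ℝ)) * ((1 + (d : ℝ)) * (1 + (f : ℝ))))) := by
    have : 1 + (a + b + c + d + f) ≤ (1 + a) * ((1 + b) * ((1 + c) * ((1 + d) * (1 + f)))) := by
      have e1 : 1 + (d + f) ≤ (1 + d) * (1 + f) := by nlinarith
      have e2 : 1 + (c + (d + f)) ≤ (1 + c) * ((1 + d) * (1 + f)) := by nlinarith
      have e3 : 1 + (b + (c + (d + f))) ≤ (1 + b) * ((1 + c) * ((1 + d) * (1 + f))) := by nlinarith
      nlinarith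
    exact_mod_cast this
  calc _ ≤ ((1 + (a : ℝ)) * ((1 + (b : ℝ)) * ((1 + (c : ℝ)) * ((1 + (d : ℝ)) * (1 + (f : ℝ)))))) ^ B
        * ρ ^ (a + b + c + d + f) := by gcongr
    _ = _ := by simp only [mul_pow, pow_add]; ring

/-- A local sum whose terms of total degree one are at most `c`, and whose terms of degree `E ≥ 2`
are at most `(1 + E)^B y^E`, differs from its constant term by `O(c + y²)`. -/
lemma exists_local_sum_bound (B : ℕ) {ρ : ℝ} (h0 : 0 < ρ) (h1 : ρ < 1) :
    ∃ C : ℝ, 0 ≤ C ∧ ∀ (a : Tup → ℝ) (y c : ℝ), 0 ≤ y → y ≤ ρ → 0 ≤ c →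
      (∀ e, tS e = 1 → |a e| ≤ c) → (∀ e, 2 ≤ tS e → |a e| ≤ (1 + (tS e : ℝ)) ^ B * y ^ tS e) →
      (Summable fun e => |a e|) ∧ |∑' e, a e - a 0| ≤ C * (c + y ^ 2) ∧
        ∑' e, |a e| ≤ |a 0| + C * (c + y ^ 2) := by
  have hK := summable_tup_poly_geometric B h0.le h1
  set K : Tup → ℝ := fun e => (1 + (tS e : ℝ)) ^ B * ρ ^ tS e with hKdef
  have hK0 : ∀ e, 0 ≤ K e := fun e => by positivity
  refine ⟨(ρ ^ 2)⁻¹ * ∑' e, K e, mul_nonneg (by positivity) (tsum_nonneg hK0), ?_⟩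
  intro a y c hy hyρ hc ha1 ha2
  have hb : ∀ e, e ≠ 0 → |a e| ≤ (c + y ^ 2) * (ρ ^ 2)⁻¹ * K e := by
    intro e he
    have hρ2 : 0 < ρ ^ 2 := by positivity
    have he' : tS e ≠ 0 := fun h => he (tS_eq_zero.1 h)
    rcases Nat.lt_or_ge (tS e) 2 with h | h
    · have hS : tS e = 1 := by omega
      have h2 : ρ ^ 2 ≤ K e := by
        simp only [hKdef, hS]
        have : (1 : ℝ) ≤ (1 + ((1 : ℕ) : ℝ)) ^ B := one_le_pow₀ (by norm_num)
        nlinarith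
      calc |a e| ≤ c := ha1 e hS
        _ ≤ c + y ^ 2 := by nlinarith
        _ = (c + y ^ 2) * (ρ ^ 2)⁻¹ * ρ ^ 2 := by field_simp
        _ ≤ _ := by gcongr
    · refine (ha2 e h).trans ?_
      have h3 : y ^ tS e ≤ y ^ 2 * (ρ ^ 2)⁻¹ * ρ ^ tS e := by
        obtain ⟨m, hm⟩ := Nat.exists_eq_add_of_le h
        rw [hm, pow_add, pow_add]
        have : y ^ m ≤ ρ ^ m := by gcongr
        calc y ^ 2 * y ^ m ≤ y ^ 2 * ρ ^ m := by gcongr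
          _ = _ := by field_simp
      calc (1 + (tS e : ℝ)) ^ B * y ^ tS e ≤ (1 + (tS e : ℝ)) ^ B * (y ^ 2 * (ρ ^ 2)⁻¹ * ρ ^ tS e) := by
            gcongr
        _ = y ^ 2 * (ρ ^ 2)⁻¹ * K e := by simp only [hKdef]; ring
        _ ≤ _ := by gcongr; linarith
  set g : Tup → ℝ := fun e => if e = 0 then 0 else |a e|
  have hg0 : ∀ e, 0 ≤ g e := fun e => by simp only [g]; split_ifs <;> positivity
  have hgK : ∀ e, g e ≤ (c + y ^ 2) * (ρ ^ 2)⁻¹ * K e := fun e => by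
    simp only [g]; split_ifs with h
    · have := hK0 e; positivity
    · exact hb e h
  have hgs : Summable g := (hK.mul_left _).of_nonneg_of_le hg0 hgK
  have hgt : ∑' e, g e ≤ (ρ ^ 2)⁻¹ * (∑' e, K e) * (c + y ^ 2) := by
    refine (hgs.tsum_le_tsum hgK (hK.mul_left _)).trans_eq ?_
    rw [tsum_mul_left]; ring
  have hs1 : HasSum (fun e : Tup => if e = 0 then |a 0| else 0) |a 0| := hasSum_ite_eq 0 _
  have heq : (fun e => |a e|) = fun e => (if e = 0 then |a 0| else 0) + g e := by
    funext e; by_cases h : e = 0 <;> simp [g, h]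
  have hsum : HasSum (fun e => |a e|) (|a 0| + ∑' e, g e) := by
    rw [heq]; exact hs1.add hgs.hasSum
  refine ⟨hsum.summable, ?_, ?_⟩
  · have hs2 : HasSum (fun e : Tup => if e = 0 then a 0 else 0) (a 0) := hasSum_ite_eq 0 _
    have hs3 := hsum.summable.of_abs.hasSum.sub hs2
    rw [← hs3.tsum_eq]
    refine le_trans ?_ hgt
    have h5 : ∀ e, ‖a e - (if e = 0 then a 0 else 0)‖ = g e := fun e => by
      by_cases h : e = 0 <;> simp [g, h]
    have := tsum_of_norm_bounded hgs.hasSum (fun e => (h5 e).le)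
    simpa using this
  · rw [hsum.tsum_eq]; linarith

section

variable {χ : ℕ →* ℝ}

lemma FTup_pw_le (hχ : IsTrivalued χ) {p : ℕ} (hp : p.Prime) (e : Tup) :
    FTup χ (pw p e) ≤ (1 + (tS e : ℝ)) ^ 6 * ((p : ℝ)⁻¹) ^ tS e := by
  obtain ⟨d, a, b, g, n⟩ := e
  have hr : ∀ k, k ≤ d + a + b + g + n → rConv χ (p ^ k) ≤ 1 + ((d + a + b + g + n : ℕ) : ℝ) := by
    intro k hk
    have : (k : ℝ) ≤ ((d + a + b + g + n : ℕ) : ℝ) := by exact_mod_cast hk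
    linarith [(rConv_prime_pow_bounds hχ hp k).2]
  have hr0 : ∀ k, 0 ≤ rConv χ (p ^ k) := fun k => rConv_nonneg hχ _
  have hρ : ∀ k, k ≤ d + a + b + g + n → |rho1Real χ (p ^ k)| ≤ 1 + ((d + a + b + g + n : ℕ) : ℝ) :=
    fun k hk => (abs_rho1Real_le hχ _).trans (hr k hk)
  have hp1 : (1 : ℝ) ≤ p := by exact_mod_cast hp.one_le
  set E : ℝ := 1 + ((d + a + b + g + n : ℕ) : ℝ) with hE
  have hE1 : 1 ≤ E := by rw [hE]; have : (0 : ℝ) ≤ ((d + a + b + g + n : ℕ) : ℝ) := Nat.cast_nonneg _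
                         linarith
  have hps : pairSum (fun n => |rho1Real χ n|) (p ^ d) (p ^ (a + b + g)) ≤ E * (E * E) := by
    rw [pairSum, sum_divisorsAntidiagonal_prime_pow hp (a + b + g)
      (fun x y => |rho1Real χ (p ^ d * x)| * |rho1Real χ (p ^ d * y)|)]
    calc _ ≤ ∑ i ∈ range (a + b + g + 1), E * E := by
          refine sum_le_sum fun i hi => ?_
          have hi := mem_range.1 hi
          rw [← pow_add, ← pow_add]
          exact mul_le_mul (hρ _ (by omega)) (hρ _ (by omega)) (abs_nonneg _) (by linarith)
      _ ≤ _ := by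
          rw [Finset.sum_const, Finset.card_range, nsmul_eq_mul]
          gcongr
          rw [hE, add_comm 1]; push_cast
          have : (0 : ℝ) ≤ d := Nat.cast_nonneg _
          have : (0 : ℝ) ≤ n := Nat.cast_nonneg _
          linarith
  have hμ : |(moebius (p ^ g) : ℝ)| ≤ 1 := by
    rw [← Int.cast_abs]; exact_mod_cast abs_moebius_le_one
  have hden : ((tDen (pw p (d, a, b, g, n)) : ℝ))⁻¹ ≤ ((p : ℝ)⁻¹) ^ (d + a + b + g + n) := by
    rw [inv_pow]
    refine inv_anti₀ (by positivity) ?_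
    rw [show tDen (pw p (d, a, b, g, n)) = p ^ (d + a + b + g + n) * p ^ g by
      simp only [tDen, pw]; ring]
    push_cast
    have : (1 : ℝ) ≤ (p : ℝ) ^ g := one_le_pow₀ hp1
    have h2 : (0 : ℝ) ≤ (p : ℝ) ^ (d + a + b + g + n) := by positivity
    nlinarith
  have h0 := pairSum_abs_nonneg (rho1Real χ) (p ^ d) (p ^ (a + b + g))
  simp only [FTup, pw, tS, ← pow_add]
  calc _ ≤ E * (E * E) * 1 * E * E * E * ((p : ℝ)⁻¹) ^ (d + a + b + g + n) := by
        have i1 := hr b (by omega)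
        have i2 := hr (a + g + n) (by omega)
        have i3 := hr n (by omega)
        have j1 := hr0 b
        have j2 := hr0 (a + g + n)
        have j3 := hr0 n
        have hd0 : 0 ≤ ((tDen (pw p (d, a, b, g, n)) : ℝ))⁻¹ := by positivity
        have hE0 : 0 ≤ E := by linarith
        exact mul_le_mul (mul_le_mul (mul_le_mul (mul_le_mul (mul_le_mul hps hμ (abs_nonneg _)
          (by positivity)) i1 j1 (by positivity)) i2 j2 (by positivity)) i3 j3 (by positivity))
          hden hd0 (by positivity)
    _ = _ := by ring

lemma FTup_pw_le_of_one (hχ : IsTrivalued χ) {p : ℕ} (hp : p.Prime) {e : Tup} (he : tS e = 1) :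
    FTup χ (pw p e) ≤ 4 * (rConv χ p / p) := by
  obtain ⟨d, a, b, g, n⟩ := e
  have hr : 0 ≤ rConv χ p := rConv_nonneg hχ _
  have hr2 : rConv χ p ≤ 2 := by
    have := (rConv_prime_pow_bounds hχ hp 1).2
    rw [pow_one] at this; norm_num at this; linarith
  have hρ : |rho1Real χ p| ≤ rConv χ p := abs_rho1Real_le hχ _
  have hρ0 := abs_nonneg (rho1Real χ p)
  have hp1 : (1 : ℝ) ≤ p := by exact_mod_cast hp.one_le
  have hpi : 0 < (p : ℝ)⁻¹ := by positivity
  have hpi1 : (p : ℝ)⁻¹ ≤ 1 := inv_le_one_of_one_le₀ hp1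
  have hpair : pairSum (fun n => |rho1Real χ n|) 1 p = 2 * |rho1Real χ p| := by
    have := sum_divisorsAntidiagonal_prime_pow hp 1 (fun x y => |rho1Real χ (1 * x)| * |rho1Real χ (1 * y)|)
    rw [pow_one] at this
    rw [pairSum, this, sum_range_succ, Finset.sum_range_one]
    simp; ring
  have hpair1 : ∀ d, pairSum (fun n => |rho1Real χ n|) d 1 = |rho1Real χ d| ^ 2 := by
    intro d; simp [pairSum, pow_two]
  have hμ : |(moebius p : ℝ)| = 1 := by
    rw [moebius_apply_prime hp]; simp
  rw [div_eq_mul_inv]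
  have m1 : |rho1Real χ p| * rConv χ p ≤ 2 * rConv χ p := by nlinarith
  have m2 : |rho1Real χ p| ^ 2 ≤ 2 * rConv χ p := by nlinarith
  have m3 : rConv χ p * rConv χ p ≤ 2 * rConv χ p := by nlinarith
  have hc : (d = 1 ∧ a = 0 ∧ b = 0 ∧ g = 0 ∧ n = 0) ∨ (d = 0 ∧ a = 1 ∧ b = 0 ∧ g = 0 ∧ n = 0) ∨
      (d = 0 ∧ a = 0 ∧ b = 1 ∧ g = 0 ∧ n = 0) ∨ (d = 0 ∧ a = 0 ∧ b = 0 ∧ g = 1 ∧ n = 0) ∨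
      (d = 0 ∧ a = 0 ∧ b = 0 ∧ g = 0 ∧ n = 1) := by
    simp only [tS] at he; omega
  rcases hc with ⟨rfl, rfl, rfl, rfl, rfl⟩ | ⟨rfl, rfl, rfl, rfl, rfl⟩ | ⟨rfl, rfl, rfl, rfl, rfl⟩ |
    ⟨rfl, rfl, rfl, rfl, rfl⟩ | ⟨rfl, rfl, rfl, rfl, rfl⟩ <;>
  simp only [FTup, pw, tDen, pow_zero, pow_one, one_mul, mul_one, hpair, hpair1, rConv_one,
    ArithmeticFunction.moebius_apply_one, Int.cast_one, abs_one, hμ, rho1Real_one, one_pow]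
  · nlinarith
  · nlinarith
  · nlinarith
  · push_cast
    rw [pow_two, mul_inv]
    have : 2 * |rho1Real χ p| * rConv χ p * ((p : ℝ)⁻¹ * (p : ℝ)⁻¹) ≤
      2 * |rho1Real χ p| * rConv χ p * (p : ℝ)⁻¹ := by gcongr; nlinarith
    nlinarith
  · nlinarith

end

end SecondMoment

end

noncomputable section

namespace SecondMoment

open MeasureTheory intervalIntegral
open Real (log exp sqrt eulerMascheroniConstant exp_pos log_natCast_nonneg log_le_log norm_eq_abs rpow_natCast exp_add rpow_mul log_pow exp_one_lt_d9 exp_le_exp rpow_add mul_rpow le_log_iff_exp_le log_nonneg rpow_neg norm_of_nonneg exp_neg log_mul rpow_def_of_pos add_one_le_exp rpow_neg_one)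
open Finset (range sum_congr sum_le_sum mul_sum Icc mem_filter sum_range_succ sum_mul mem_insert_of_mem mem_Icc mem_range Ico Ioc sum_sub_distrib)

/-! ### Smooth kernels for the convolution `1 ⋆ χ` -/

/-- The mean over `(0, t]` of an antitone function. -/
lemma mean_antitone {F : ℝ → ℝ} (hF : AntitoneOn F (Set.Ioi 0)) (h0 : ∀ t, 0 < t → 0 ≤ F t)
    (h1 : ∀ t, 0 < t → F t ≤ 1) (hm : Measurable F) :
    (∀ a b, 0 ≤ a → a ≤ b → IntervalIntegrable F volume a b) ∧
    AntitoneOn (fun t => (∫ v in (0 : ℝ)..t, F v) / t) (Set.Ioi 0) ∧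
    (∀ t, 0 < t → 0 ≤ (∫ v in (0 : ℝ)..t, F v) / t) ∧
    ∀ t, 0 < t → (∫ v in (0 : ℝ)..t, F v) / t ≤ 1 := by
  have hint : ∀ a b, 0 ≤ a → a ≤ b → IntervalIntegrable F volume a b := by
    intro a b ha hab
    rw [intervalIntegrable_iff_integrableOn_Ioc_of_le hab]
    refine Measure.integrableOn_of_bounded (M := 1) (by simp) hm.aestronglyMeasurable ?_
    refine (ae_restrict_iff' measurableSet_Ioc).2 (Eventually.of_forall fun x hx => ?_)
    have hx0 : 0 < x := ha.trans_lt hx.1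
    rw [norm_eq_abs, abs_of_nonneg (h0 x hx0)]
    exact h1 x hx0
  refine ⟨hint, ?_, ?_, ?_⟩
  · intro s hs t ht hst
    have hs : 0 < s := hs
    have ht : 0 < t := ht
    simp only
    rw [div_le_div_iff₀ ht hs, ← integral_add_adjacent_intervals (hint 0 s le_rfl hs.le)
      (hint s t hs.le hst)]
    have e1 : ∫ v in s..t, F v ≤ (t - s) * F s := by
      have := integral_mono_on hst (hint s t hs.le hst) (intervalIntegrable_const (c := F s))
        fun x hx => hF (Set.mem_Ioi.2 hs) (Set.mem_Ioi.2 (hs.trans_le hx.1)) hx.1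
      simpa using this
    have e2 : s * F s ≤ ∫ v in (0 : ℝ)..s, F v := by
      have := integral_mono_on_of_le_Ioo hs.le (intervalIntegrable_const (c := F s))
        (hint 0 s le_rfl hs.le)
        fun x hx => hF (Set.mem_Ioi.2 hx.1) (Set.mem_Ioi.2 hs) hx.2.le
      simpa using this
    nlinarith [mul_le_mul_of_nonneg_left e1 hs.le, mul_le_mul_of_nonneg_left e2 (sub_nonneg.2 hst)]
  · intro t ht
    refine div_nonneg (integral_nonneg_of_ae_restrict ht.le ?_) ht.le
    rw [← restrict_Ioo_eq_restrict_Icc]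
    exact (ae_restrict_iff' measurableSet_Ioo).2 (Eventually.of_forall fun x hx => h0 x hx.1)
  · intro t ht
    rw [div_le_one ht]
    have := integral_mono_on_of_le_Ioo ht.le (hint 0 t le_rfl ht.le)
      (intervalIntegrable_const (c := (1 : ℝ))) fun x hx => h1 x hx.1
    simpa using this

/-- `1/t - 1/(eᵗ - 1)`. -/
def kernelZero (t : ℝ) : ℝ := 1 / t - 1 / (exp t - 1)

lemma exp_sub_one_pos {t : ℝ} (ht : 0 < t) : 0 < exp t - 1 := by
  have := Real.add_one_lt_exp ht.ne'; linarith

lemma kernelZero_nonneg {t : ℝ} (ht : 0 < t) : 0 ≤ kernelZero t := by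
  rw [kernelZero, sub_nonneg]
  refine one_div_le_one_div_of_le ht ?_
  have := add_one_le_exp t; linarith

lemma kernelZero_le_one {t : ℝ} (ht : 0 < t) : kernelZero t ≤ 1 := by
  have h := exp_sub_one_pos ht
  have h2 : exp t * (1 - t) ≤ 1 := by
    have h3 := add_one_le_exp (-t)
    have h4 : exp t * (1 - t) ≤ exp t * exp (-t) := by
      gcongr; linarith
    rwa [← exp_add, add_neg_cancel, Real.exp_zero] at h4
  rw [kernelZero, div_sub_div _ _ ht.ne' h.ne', div_le_one (by positivity)]
  nlinarith

lemma kernelZero_antitone : AntitoneOn kernelZero (Set.Ioi 0) := by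
  have hd : ∀ t ∈ Set.Ioi (0 : ℝ), HasDerivAt kernelZero
      (-(t ^ 2)⁻¹ + exp t / (exp t - 1) ^ 2) t := by
    intro t ht
    have ht : 0 < t := ht
    have h := exp_sub_one_pos ht
    have h1 := (hasDerivAt_inv ht.ne').sub (((Real.hasDerivAt_exp t).sub_const 1).inv h.ne')
    refine (h1.congr_deriv (by ring)).congr_of_eventuallyEq (Eventually.of_forall fun x => ?_)
    simp [kernelZero]
  refine antitoneOn_of_deriv_nonpos (convex_Ioi 0)
    (fun t ht => (hd t ht).continuousAt.continuousWithinAt) ?_ ?_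
  · rw [interior_Ioi]; exact fun t ht => (hd t ht).differentiableAt.differentiableWithinAt
  · rw [interior_Ioi]
    intro t ht
    rw [(hd t ht).deriv]
    have ht : 0 < t := ht
    have h := exp_sub_one_pos ht
    have key : t ^ 2 * exp t ≤ (exp t - 1) ^ 2 := by
      have h1 := Real.self_le_sinh_iff.2 (by positivity : 0 ≤ t / 2)
      rw [Real.sinh_eq] at h1
      have h2 : t * exp (t / 2) ≤ exp t - 1 := by
        have h3 := mul_le_mul_of_nonneg_right h1 (exp_pos (t / 2)).le
        have h4 : exp (t / 2) * exp (t / 2) = exp t := by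
          rw [← exp_add]; ring_nf
        have h5 : exp (-(t / 2)) * exp (t / 2) = 1 := by
          rw [← exp_add]; simp
        nlinarith
      have h4 : exp (t / 2) ^ 2 = exp t := by rw [← Real.exp_nat_mul]; ring_nf
      rw [← h4, ← mul_pow]
      have : 0 ≤ t * exp (t / 2) := by positivity
      rw [h4]
      gcongr
    have h5 : exp t / (exp t - 1) ^ 2 ≤ (t ^ 2)⁻¹ := by
      rw [div_le_iff₀ (by positivity), inv_mul_eq_div, le_div_iff₀ (by positivity)]
      linarith
    linarith

lemma measurable_kernelZero : Measurable kernelZero := by unfold kernelZero; fun_prop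

/-- `-log(1 - e^{-t}) = ∑_{m ≥ 1} e^{-mt}/m`. -/
def logKernel (t : ℝ) : ℝ := -log (1 - exp (-t))

lemma one_sub_exp_pos {t : ℝ} (ht : 0 < t) : 0 < 1 - exp (-t) := by
  have : exp (-t) < 1 := Real.exp_lt_one_iff.2 (by linarith)
  linarith

lemma hasDerivAt_logKernel {t : ℝ} (ht : 0 < t) :
    HasDerivAt logKernel (-(1 / (exp t - 1))) t := by
  have h := one_sub_exp_pos ht
  have h1 : HasDerivAt (fun t => 1 - exp (-t)) (exp (-t)) t := by
    have := ((Real.hasDerivAt_exp (-t)).comp t (hasDerivAt_neg t)).const_sub 1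
    simpa using this
  refine (h1.log h.ne').neg.congr_deriv ?_
  have h2 := exp_sub_one_pos ht
  have h3 : exp (-t) = (exp t)⁻¹ := exp_neg t
  rw [h3] at h ⊢
  have h4 := exp_pos t
  have h5 : 1 - (exp t)⁻¹ = (exp t - 1) / exp t := by field_simp
  rw [h5]; field_simp

/-- The mean of `kernelZero`, equal to `(log t + logKernel t)/t` for `t > 0`. -/
def kernelOne (t : ℝ) : ℝ := (log t + logKernel t) / t

lemma integral_kernelZero {t : ℝ} (ht : 0 < t) :
    ∫ v in (0 : ℝ)..t, kernelZero v = log t + logKernel t := by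
  have hm := mean_antitone kernelZero_antitone (fun _ => kernelZero_nonneg)
    (fun _ => kernelZero_le_one) measurable_kernelZero
  have hd : ∀ x, 0 < x → HasDerivAt (fun x => log x + logKernel x) (kernelZero x) x := by
    intro x hx
    refine ((Real.hasDerivAt_log hx.ne').add (hasDerivAt_logKernel hx)).congr_deriv ?_
    rw [kernelZero]; ring
  have h0 : Tendsto (fun x => log x + logKernel x) (𝓝[>] 0) (𝓝 0) := by
    have hid : Tendsto (fun x : ℝ => x) (𝓝[>] 0) (𝓝 0) := tendsto_nhdsWithin_of_tendsto_nhds tendsto_id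
    refine tendsto_of_tendsto_of_tendsto_of_le_of_le' tendsto_const_nhds hid ?_ ?_
    · filter_upwards [self_mem_nhdsWithin] with x hx
      have hx : 0 < x := hx
      have h1 := one_sub_exp_pos hx
      have h2 := add_one_le_exp (-x)
      have := log_le_log h1 (by linarith : 1 - exp (-x) ≤ x)
      rw [logKernel]; linarith
    · filter_upwards [self_mem_nhdsWithin] with x hx
      have hx : 0 < x := hx
      have h2 : x * exp (-x) ≤ 1 - exp (-x) := by
        have h3 := add_one_le_exp x
        have h4 : exp x * exp (-x) = 1 := by rw [← exp_add]; simp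
        nlinarith [exp_pos (-x)]
      have := log_le_log (by positivity) h2
      rw [log_mul hx.ne' (exp_pos _).ne', Real.log_exp] at this
      rw [logKernel]; linarith
  have := integral_eq_sub_of_hasDerivAt_of_tendsto ht (fun x hx => hd x hx.1)
    (hm.1 0 t le_rfl ht.le) h0 ((hd t ht).continuousAt.tendsto.mono_left nhdsWithin_le_nhds)
  rw [this, sub_zero]

lemma kernelOne_props : AntitoneOn kernelOne (Set.Ioi 0) ∧ (∀ t, 0 < t → 0 ≤ kernelOne t) ∧
    (∀ t, 0 < t → kernelOne t ≤ 1) ∧ Measurable kernelOne := by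
  have hm := mean_antitone kernelZero_antitone (fun _ => kernelZero_nonneg)
    (fun _ => kernelZero_le_one) measurable_kernelZero
  have he : ∀ t, 0 < t → (∫ v in (0 : ℝ)..t, kernelZero v) / t = kernelOne t := fun t ht => by
    rw [integral_kernelZero ht, kernelOne]
  refine ⟨fun s hs t ht hst => ?_, fun t ht => ?_, fun t ht => ?_, ?_⟩
  · rw [← he s hs, ← he t ht]; exact hm.2.1 hs ht hst
  · rw [← he t ht]; exact hm.2.2.1 t ht
  · rw [← he t ht]; exact hm.2.2.2 t ht
  · unfold kernelOne logKernel; fun_prop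

/-- The mean of `kernelOne` over `(0, t]`. -/
def kernelTwo (t : ℝ) : ℝ := (∫ v in (0 : ℝ)..t, kernelOne v) / t

lemma kernelTwo_props : AntitoneOn kernelTwo (Set.Ioi 0) ∧ (∀ t, 0 < t → 0 ≤ kernelTwo t) ∧
    (∀ t, 0 < t → kernelTwo t ≤ 1) := by
  have hm := mean_antitone kernelOne_props.1 kernelOne_props.2.1 kernelOne_props.2.2.1
    kernelOne_props.2.2.2
  exact hm.2

lemma logKernel_nonneg {t : ℝ} (ht : 0 < t) : 0 ≤ logKernel t := by
  have h := one_sub_exp_pos ht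
  rw [logKernel, neg_nonneg]
  exact Real.log_nonpos h.le (by have := exp_pos (-t); linarith)

lemma logKernel_le {t : ℝ} (ht : 0 < t) : logKernel t ≤ 2 / t ^ 2 := by
  have h := one_sub_exp_pos ht
  have h1 := Real.one_sub_inv_le_log_of_pos h
  have h2 : logKernel t ≤ 1 / (exp t - 1) := by
    have h3 : (1 - exp (-t))⁻¹ = 1 + 1 / (exp t - 1) := by
      have h2 := exp_sub_one_pos ht
      have h4 := exp_pos t
      rw [exp_neg, show 1 - (exp t)⁻¹ = (exp t - 1) / exp t by field_simp]
      field_simp; ring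
    rw [logKernel]; linarith
  refine h2.trans ?_
  have h3 := Real.quadratic_le_exp_of_nonneg ht.le
  rw [div_le_div_iff₀ (exp_sub_one_pos ht) (by positivity)]
  nlinarith

lemma hasSum_logKernel {t : ℝ} (ht : 0 < t) :
    HasSum (fun m : ℕ => exp (-(t * ((m + 1 : ℕ) : ℝ))) / ((m + 1 : ℕ) : ℝ)) (logKernel t) := by
  have h := Real.hasSum_pow_div_log_of_abs_lt_one (x := exp (-t))
    (by rw [abs_of_pos (exp_pos _)]; exact Real.exp_lt_one_iff.2 (by linarith))
  refine h.congr_fun fun m => ?_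
  rw [← Real.exp_nat_mul]
  push_cast
  congr 2; ring

lemma measurable_logKernel : Measurable logKernel := by unfold logKernel; fun_prop

/-- `∫_1^∞ logKernel(tv) dv/v`. -/
def logKernelTwo (t : ℝ) : ℝ := ∫ v in Set.Ioi (1 : ℝ), logKernel (t * v) / v

lemma integrableOn_logKernel {t : ℝ} (ht : 0 < t) :
    IntegrableOn (fun v => logKernel (t * v) / v) (Set.Ioi 1) := by
  have h := (integrableOn_Ioi_rpow_of_lt (by norm_num : (-3 : ℝ) < -1) one_pos).const_mul (2 / t ^ 2)
  refine Integrable.mono' h ((measurable_logKernel.comp (measurable_const_mul t)).div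
    measurable_id).aestronglyMeasurable ?_
  refine (ae_restrict_iff' measurableSet_Ioi).2 (Eventually.of_forall fun v hv => ?_)
  have hv : (1 : ℝ) < v := hv
  have hv0 : 0 < v := by linarith
  have h1 := logKernel_le (mul_pos ht hv0)
  rw [norm_eq_abs, abs_of_nonneg (div_nonneg (logKernel_nonneg (mul_pos ht hv0)) hv0.le),
    show (-3 : ℝ) = ((-3 : ℤ) : ℝ) by norm_num, Real.rpow_intCast, div_le_iff₀ hv0]
  refine h1.trans_eq ?_
  rw [show (-3 : ℤ) = -((3 : ℕ) : ℤ) by norm_num, zpow_neg, zpow_natCast]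
  field_simp

lemma logKernelTwo_eq_integral {t : ℝ} (ht : 0 < t) :
    logKernelTwo t = ∫ u in Set.Ioi t, logKernel u / u := by
  have h := integral_comp_mul_left_Ioi (fun u => logKernel u / u) 1 ht
  rw [mul_one, smul_eq_mul] at h
  have h2 : logKernelTwo t = t * ∫ v in Set.Ioi (1 : ℝ), logKernel (t * v) / (t * v) := by
    rw [logKernelTwo, ← MeasureTheory.integral_const_mul]
    congr 1; funext v; field_simp
  rw [h2, h]; field_simp

lemma exists_logKernelTwo_eq : ∃ c : ℝ, ∀ t, 0 < t →
    logKernelTwo t = log t ^ 2 / 2 + c - t * kernelTwo t := by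
  have hm := mean_antitone kernelOne_props.1 kernelOne_props.2.1 kernelOne_props.2.2.1
    kernelOne_props.2.2.2
  refine ⟨logKernelTwo 1 + ∫ v in (0 : ℝ)..1, kernelOne v, fun t ht => ?_⟩
  have hii : ∀ t, 0 < t → IntegrableOn (fun u => logKernel u / u) (Set.Ioi t) := by
    intro t ht
    have h := integrableOn_logKernel ht
    have h2 := (integrableOn_Ioi_comp_mul_left_iff (fun u => logKernel u / u) 1 ht).1
    rw [mul_one] at h2
    refine h2 ?_
    refine (h.const_mul t⁻¹).congr (Eventually.of_forall fun v => ?_)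
    simp only; field_simp
  have h1 : logKernelTwo t - logKernelTwo 1 = ∫ u in t..1, logKernel u / u := by
    rw [logKernelTwo_eq_integral ht, logKernelTwo_eq_integral one_pos]
    exact integral_Ioi_sub_Ioi' (hii t ht) (hii 1 one_pos)
  have hlog : ∀ x ∈ Set.uIcc t 1, HasDerivAt (fun x => log x ^ 2 / 2) (log x / x) x := by
    intro x hx
    have hx0 : 0 < x := (lt_min ht one_pos).trans_le hx.1
    refine (((Real.hasDerivAt_log hx0.ne').pow 2).div_const 2).congr_deriv ?_
    field_simp
    norm_num
  have hcont : ContinuousOn (fun x => log x / x) (Set.uIcc t 1) := by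
    have hne : ∀ x ∈ Set.uIcc t 1, x ≠ 0 := fun x hx => ((lt_min ht one_pos).trans_le hx.1).ne'
    exact (ContinuousOn.log continuousOn_id hne).div continuousOn_id hne
  have h2 := integral_eq_sub_of_hasDerivAt hlog hcont.intervalIntegrable
  have h3 : ∫ u in t..1, logKernel u / u = ∫ u in t..1, (kernelOne u - log u / u) := by
    refine integral_congr fun u hu => ?_
    simp only [kernelOne]; ring
  have hik : IntervalIntegrable kernelOne volume t 1 := by
    rcases le_total t 1 with h | h
    · exact hm.1 t 1 ht.le h
    · exact (hm.1 1 t zero_le_one h).symm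
  have h4 : ∫ u in t..1, (kernelOne u - log u / u) = (∫ u in t..1, kernelOne u) -
      ∫ u in t..1, log u / u := integral_sub hik hcont.intervalIntegrable
  have h5 := integral_add_adjacent_intervals (hm.1 0 t le_rfl ht.le) hik
  have h6 : t * kernelTwo t = ∫ v in (0 : ℝ)..t, kernelOne v := by rw [kernelTwo]; field_simp
  rw [h6]
  simp only [Real.log_one] at h2
  linarith

/-! ### Lacunarity of the convolution `1 ⋆ χ` -/

/-- The properties of a real character of modulus `D` used below: its partial sums are bounded, and
`L`, `L'`, `L''` are the values at `1` of its `L`-series and of the first two derivatives. -/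
structure CharData (χ : ℕ →* ℝ) (D : ℕ) (L L' L'' : ℝ) : Prop where
  two_le : 2 ≤ D
  tri : IsTrivalued χ
  psum : ∀ N, |∑ i ∈ range N, χ (i + 1)| ≤ D
  lim0 : Tendsto (fun N => ∑ i ∈ range N, χ (i + 1) / ((i + 1 : ℕ) : ℝ)) atTop (𝓝 L)
  lim1 : Tendsto (fun N => ∑ i ∈ range N,
    χ (i + 1) * log ((i + 1 : ℕ) : ℝ) / ((i + 1 : ℕ) : ℝ)) atTop (𝓝 (-L'))
  lim2 : Tendsto (fun N => ∑ i ∈ range N,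
    χ (i + 1) * log ((i + 1 : ℕ) : ℝ) ^ 2 / ((i + 1 : ℕ) : ℝ)) atTop (𝓝 L'')

lemma one_le_log {x : ℝ} (hx : 3 ≤ x) : 1 ≤ log x := by
  rw [le_log_iff_exp_le (by linarith)]
  linarith [exp_one_lt_d9]

lemma le_exp_neg_one : 0.36 ≤ exp (-1) := by
  rw [exp_neg, le_inv_comm₀ (by norm_num) (exp_pos 1)]
  linarith [exp_one_lt_d9, (by norm_num : (2.72 : ℝ) ≤ 0.36⁻¹)]

section

variable {χ : ℕ →* ℝ}

/-- Grouping a double series by the product of the two variables. -/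
lemma hasSum_rConv_mul (hχ : IsTrivalued χ) {w : ℕ → ℝ} (hw : ∀ n, 0 ≤ w n)
    (hs : Summable fun x : ℕ × ℕ => w ((x.1 + 1) * (x.2 + 1))) :
    ∃ S, HasSum (fun n => rConv χ n * w n) S ∧
      Tendsto (fun N => ∑ i ∈ range N, χ (i + 1) * ∑' j, w ((i + 1) * (j + 1))) atTop (𝓝 S) := by
  have hs' : Summable fun x : ℕ × ℕ => χ (x.1 + 1) * w ((x.1 + 1) * (x.2 + 1)) := by
    refine Summable.of_norm_bounded hs fun x => ?_
    rw [norm_mul, norm_eq_abs, norm_eq_abs, abs_of_nonneg (hw _)]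
    exact mul_le_of_le_one_left (hw _) (hχ.abs_le_one _)
  refine ⟨∑' x : ℕ × ℕ, χ (x.1 + 1) * w ((x.1 + 1) * (x.2 + 1)), ?_, ?_⟩
  rotate_left
  · have h := hs'.hasSum.prod_fiberwise (g := fun i => χ (i + 1) * ∑' j, w ((i + 1) * (j + 1)))
      (fun i => (hs.prod_factor i).hasSum.mul_left _)
    exact h.tendsto_sum_nat
  · have h := hs'.hasSum.tsum_fiberwise (fun x : ℕ × ℕ => (x.1 + 1) * (x.2 + 1))
    refine h.congr_fun fun n => ?_
    have hset : ((fun x : ℕ × ℕ => (x.1 + 1) * (x.2 + 1)) ⁻¹' {n}) =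
        ((n.divisorsAntidiagonal.image fun x => (x.1 - 1, x.2 - 1) : Finset (ℕ × ℕ)) : Set (ℕ × ℕ)) := by
      ext ⟨i, j⟩
      simp only [Set.mem_preimage, Set.mem_singleton_iff, Finset.coe_image, Set.mem_image,
        Finset.mem_coe, Nat.mem_divisorsAntidiagonal, Prod.mk.injEq, Prod.exists]
      constructor
      · rintro rfl
        exact ⟨i + 1, j + 1, ⟨rfl, by positivity⟩, by simp⟩
      · rintro ⟨a, b, ⟨h1, h2⟩, rfl, rfl⟩
        have ha : a ≠ 0 := by rintro rfl; simp at h1; exact h2 h1.symm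
        have hb : b ≠ 0 := by rintro rfl; simp at h1; exact h2 h1.symm
        rw [Nat.sub_add_cancel (Nat.pos_of_ne_zero ha), Nat.sub_add_cancel (Nat.pos_of_ne_zero hb), h1]
    rw [hset, Finset.tsum_subtype' _ (fun x : ℕ × ℕ => χ (x.1 + 1) * w ((x.1 + 1) * (x.2 + 1))),
      Finset.sum_image]
    · rw [rConv, ← Nat.sum_divisorsAntidiagonal (fun a _ => χ a), sum_mul]
      refine sum_congr rfl fun x hx => ?_
      obtain ⟨h1, h2⟩ := Nat.mem_divisorsAntidiagonal.1 hx
      have ha : x.1 ≠ 0 := fun h => h2 (by rw [← h1, h, zero_mul])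
      have hb : x.2 ≠ 0 := fun h => h2 (by rw [← h1, h, mul_zero])
      simp only [Nat.sub_add_cancel (Nat.pos_of_ne_zero ha),
        Nat.sub_add_cancel (Nat.pos_of_ne_zero hb), h1]
    · intro x hx y hy hxy
      have hx := Finset.mem_coe.1 hx
      have hy := Finset.mem_coe.1 hy
      obtain ⟨h1, h2⟩ := Nat.mem_divisorsAntidiagonal.1 hx
      obtain ⟨h3, h4⟩ := Nat.mem_divisorsAntidiagonal.1 hy
      have ha : x.1 ≠ 0 := fun h => h2 (by rw [← h1, h, zero_mul])
      have hb : x.2 ≠ 0 := fun h => h2 (by rw [← h1, h, mul_zero])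
      have hc : y.1 ≠ 0 := fun h => h4 (by rw [← h3, h, zero_mul])
      have hd : y.2 ≠ 0 := fun h => h4 (by rw [← h3, h, mul_zero])
      simp only [Prod.mk.injEq] at hxy
      ext <;> omega

lemma tsum_exp_eq {t : ℝ} (ht : 0 < t) :
    HasSum (fun j : ℕ => exp (-(t * ((j + 1 : ℕ) : ℝ)))) (1 / t - kernelZero t) := by
  have h1 : exp (-t) < 1 := Real.exp_lt_one_iff.2 (by linarith)
  have h := (hasSum_geometric_of_lt_one (exp_pos (-t)).le h1).mul_left (exp (-t))
  have he : exp (-t) * (1 - exp (-t))⁻¹ = 1 / t - kernelZero t := by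
    have h2 := exp_sub_one_pos ht
    have h4 := exp_pos t
    rw [kernelZero, sub_sub_cancel, exp_neg,
      show 1 - (exp t)⁻¹ = (exp t - 1) / exp t by field_simp]
    field_simp
  rw [← he]
  refine h.congr_fun fun j => ?_
  rw [← Real.exp_nat_mul, ← exp_add]
  congr 1; push_cast; ring

lemma summable_exp_prod {x : ℝ} (hx : 0 < x) :
    Summable fun y : ℕ × ℕ => exp (-((((y.1 + 1) * (y.2 + 1) : ℕ) : ℝ) / x)) := by
  have he : ∀ i : ℕ, HasSum (fun j : ℕ => exp (-((((i + 1) * (j + 1) : ℕ) : ℝ) / x)))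
      (1 / (((i + 1 : ℕ) : ℝ) / x) - kernelZero (((i + 1 : ℕ) : ℝ) / x)) := by
    intro i
    refine (tsum_exp_eq (t := ((i + 1 : ℕ) : ℝ) / x) (by positivity)).congr_fun fun j => ?_
    congr 2; push_cast; ring
  refine (summable_prod_of_nonneg fun y => (exp_pos _).le).2 ⟨fun i => (he i).summable, ?_⟩
  have h2 : Summable fun i : ℕ => 2 * x ^ 2 * (1 / ((i + 1 : ℕ) : ℝ) ^ 2) :=
    ((summable_nat_add_iff 1).2 (Real.summable_one_div_nat_pow.2 one_lt_two)).mul_left _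
  refine h2.of_nonneg_of_le (fun i => tsum_nonneg fun j => (exp_pos _).le) fun i => ?_
  rw [(he i).tsum_eq, kernelZero, sub_sub_cancel]
  have ht : 0 < ((i + 1 : ℕ) : ℝ) / x := by positivity
  have h3 := Real.quadratic_le_exp_of_nonneg ht.le
  have h4 := exp_sub_one_pos ht
  calc 1 / (exp (((i + 1 : ℕ) : ℝ) / x) - 1) ≤ 1 / ((((i + 1 : ℕ) : ℝ) / x) ^ 2 / 2) := by
        apply one_div_le_one_div_of_le (by positivity); linarith
    _ = _ := by field_simp

namespace CharData

variable {D : ℕ} {L L' L'' : ℝ}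

lemma two_le_cast (h : CharData χ D L L' L'') : (2 : ℝ) ≤ D := by exact_mod_cast h.two_le

lemma psum_antitone (h : CharData χ D L L' L'') {F : ℝ → ℝ} (hF : AntitoneOn F (Set.Ioi 0))
    (h0 : ∀ t, 0 < t → 0 ≤ F t) (h1 : ∀ t, 0 < t → F t ≤ 1) {x : ℝ} (hx : 0 < x) (N : ℕ) :
    |∑ i ∈ range N, χ (i + 1) * F (((i + 1 : ℕ) : ℝ) / x)| ≤ 2 * D := by
  have hp : ∀ i : ℕ, 0 < ((i + 1 : ℕ) : ℝ) / x := fun i => by positivity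
  have := norm_sum_Ico_mul_le (a := fun i => χ (i + 1)) (g := fun i => F (((i + 1 : ℕ) : ℝ) / x))
    (H := fun i => F (((i + 1 : ℕ) : ℝ) / x)) (B := D) h.psum
    (fun i => by rw [norm_eq_abs, abs_of_nonneg (h0 _ (hp i))])
    (fun i => by
      have : F (((i + 1 + 1 : ℕ) : ℝ) / x) ≤ F (((i + 1 : ℕ) : ℝ) / x) :=
        hF (hp i) (hp (i + 1)) (by gcongr; simp)
      rw [norm_eq_abs, abs_sub_comm, abs_of_nonneg (by linarith)]) (Nat.zero_le N)
  rw [Finset.range_eq_Ico]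
  refine this.trans ?_
  have hD : (0 : ℝ) ≤ D := Nat.cast_nonneg D
  nlinarith [h1 _ (hp 0)]

/-- `∑ r(n) e^{-n/x} = x L + O(D)`. -/
lemma hasSum_exp (h : CharData χ D L L' L'') {x : ℝ} (hx : 0 < x) :
    ∃ S, HasSum (fun n => rConv χ n * exp (-((n : ℝ) / x))) S ∧ |S - x * L| ≤ 2 * D := by
  obtain ⟨S, hS, hl⟩ := hasSum_rConv_mul h.tri (w := fun n => exp (-((n : ℝ) / x)))
    (fun n => (exp_pos _).le) (summable_exp_prod hx)
  refine ⟨S, hS, ?_⟩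
  have h2 := hl.sub (h.lim0.const_mul x)
  refine le_of_tendsto h2.abs (Eventually.of_forall fun N => ?_)
  have h3 := h.psum_antitone kernelZero_antitone (fun _ => kernelZero_nonneg)
    (fun _ => kernelZero_le_one) hx N
  rw [← abs_neg] at h3
  refine le_trans (le_of_eq ?_) h3
  congr 1
  rw [mul_sum, ← sum_sub_distrib, ← Finset.sum_neg_distrib]
  refine sum_congr rfl fun i _ => ?_
  have h4 := (tsum_exp_eq (t := ((i + 1 : ℕ) : ℝ) / x) (by positivity)).tsum_eq
  rw [show (fun j : ℕ => exp (-((((i + 1) * (j + 1) : ℕ) : ℝ) / x))) =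
    fun j : ℕ => exp (-(((i + 1 : ℕ) : ℝ) / x * ((j + 1 : ℕ) : ℝ))) by
      funext j; congr 2; push_cast; ring, h4]
  have : ((i + 1 : ℕ) : ℝ) ≠ 0 := by positivity
  field_simp
  ring

/-- `∑_{d} χ(d)/d · logKernel(d/x) = ∑ r(n)/n e^{-n/x}`. -/
lemma hasSum_exp_div (hχ : IsTrivalued χ) {x : ℝ} (hx : 0 < x) :
    ∃ S, HasSum (fun n => rConv χ n * (exp (-((n : ℝ) / x)) / n)) S ∧
      Tendsto (fun N => ∑ i ∈ range N,
        χ (i + 1) * (logKernel (((i + 1 : ℕ) : ℝ) / x) / ((i + 1 : ℕ) : ℝ))) atTop (𝓝 S) := by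
  obtain ⟨S, hS, hl⟩ := hasSum_rConv_mul hχ (w := fun n => exp (-((n : ℝ) / x)) / n)
    (fun n => by positivity) ((summable_exp_prod hx).of_nonneg_of_le (fun y => by positivity)
      fun y => by
        refine div_le_self (exp_pos _).le ?_
        exact_mod_cast Nat.succ_le_iff.2 (by positivity : 0 < (y.1 + 1) * (y.2 + 1)))
  refine ⟨S, hS, hl.congr fun N => sum_congr rfl fun i _ => ?_⟩
  congr 1
  have h4 := ((hasSum_logKernel (t := ((i + 1 : ℕ) : ℝ) / x) (by positivity)).div_const
    ((i + 1 : ℕ) : ℝ)).tsum_eq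
  rw [← h4]
  refine tsum_congr fun j => ?_
  have : ((i + 1 : ℕ) : ℝ) ≠ 0 := by positivity
  rw [div_div]
  congr 1
  · congr 2; push_cast; ring
  · push_cast; ring

/-- `∑ r(n)/n e^{-n/x} = L log x + L' + O(D/x)`. -/
lemma hasSum_exp_div_eq (h : CharData χ D L L' L'') {x : ℝ} (hx : 0 < x) :
    ∃ S, HasSum (fun n => rConv χ n * (exp (-((n : ℝ) / x)) / n)) S ∧
      |S - (L * log x + L')| ≤ 2 * D / x := by
  obtain ⟨S, hS, hl⟩ := hasSum_exp_div h.tri hx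
  refine ⟨S, hS, ?_⟩
  have h2 := hl.sub ((h.lim0.mul_const (log x)).sub h.lim1)
  rw [sub_neg_eq_add] at h2
  refine le_of_tendsto h2.abs (Eventually.of_forall fun N => ?_)
  have h3 := h.psum_antitone kernelOne_props.1 kernelOne_props.2.1 kernelOne_props.2.2.1 hx N
  rw [le_div_iff₀ hx]
  refine le_trans (le_of_eq ?_) h3
  rw [← abs_of_pos hx, ← abs_mul, abs_of_pos hx]
  congr 1
  rw [sum_mul, ← sum_sub_distrib, ← sum_sub_distrib, sum_mul]
  refine sum_congr rfl fun i _ => ?_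
  have : ((i + 1 : ℕ) : ℝ) ≠ 0 := by positivity
  rw [kernelOne, Real.log_div this hx.ne']
  field_simp
  ring

/-- Positivity of a doubly logarithmic mean of `r(n)/n`, which bounds `L''` from below. -/
lemma exists_deriv_two_ge : ∃ c : ℝ, ∀ {χ : ℕ →* ℝ} {D : ℕ} {L L' L'' : ℝ},
    CharData χ D L L' L'' → ∀ x, 0 < x →
    -(2 * D / x) ≤ L'' / 2 + L' * log x + L * log x ^ 2 / 2 + c * L := by
  obtain ⟨c, hc⟩ := exists_logKernelTwo_eq
  refine ⟨c, fun {χ D L L' L''} h x hx => ?_⟩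
  set τ : ℕ → ℝ := fun N => ∑' i : ℕ, 1 / ((i + N + 1 : ℕ) : ℝ) ^ 3
  have hs3 : Summable fun i : ℕ => 1 / ((i + 1 : ℕ) : ℝ) ^ 3 :=
    (summable_nat_add_iff 1).2 (Real.summable_one_div_nat_pow.2 (by norm_num))
  have hτ : Tendsto τ atTop (𝓝 0) := tendsto_sum_nat_add fun i : ℕ => 1 / ((i + 1 : ℕ) : ℝ) ^ 3
  set P : ℕ → ℝ := fun N => ∑ i ∈ range N,
    χ (i + 1) * (logKernelTwo (((i + 1 : ℕ) : ℝ) / x) / ((i + 1 : ℕ) : ℝ))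
  have hP : ∀ N, -(x ^ 2 * τ N) ≤ P N := by
    intro N
    have hint : ∀ i : ℕ, IntegrableOn (fun v => χ (i + 1) / ((i + 1 : ℕ) : ℝ) *
        (logKernel (((i + 1 : ℕ) : ℝ) / x * v) / v)) (Set.Ioi 1) := fun i =>
      (integrableOn_logKernel (by positivity)).const_mul _
    have hPe : P N = ∫ v in Set.Ioi (1 : ℝ), ∑ i ∈ range N, χ (i + 1) / ((i + 1 : ℕ) : ℝ) *
        (logKernel (((i + 1 : ℕ) : ℝ) / x * v) / v) := by
      rw [integral_finsetSum _ fun i _ => hint i]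
      refine sum_congr rfl fun i _ => ?_
      rw [MeasureTheory.integral_const_mul, logKernelTwo]; ring
    have hlow : ∫ v in Set.Ioi (1 : ℝ), -(2 * x ^ 2 * τ N) * v ^ (-3 : ℝ) = -(x ^ 2 * τ N) := by
      rw [MeasureTheory.integral_const_mul, integral_Ioi_rpow_of_lt (by norm_num) one_pos]
      norm_num
      ring
    rw [← hlow, hPe]
    refine setIntegral_mono_on ((integrableOn_Ioi_rpow_of_lt (by norm_num) one_pos).const_mul _)
      (integrable_finsetSum _ fun i _ => hint i) measurableSet_Ioi fun v hv => ?_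
    have hv : (1 : ℝ) < v := hv
    have hv0 : 0 < v := by linarith
    obtain ⟨S, hS, hl⟩ := hasSum_exp_div h.tri (div_pos hx hv0)
    have hS0 : 0 ≤ S := hS.nonneg fun n => mul_nonneg (rConv_nonneg h.tri n) (by positivity)
    -- The partial sum up to `N` exceeds the (nonnegative) full sum minus the tail.
    have hQ : ∀ M, N ≤ M → ∑ i ∈ range M,
        χ (i + 1) * (logKernel (((i + 1 : ℕ) : ℝ) / (x / v)) / ((i + 1 : ℕ) : ℝ)) -
        2 * (x / v) ^ 2 * τ N ≤ ∑ i ∈ range N,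
        χ (i + 1) * (logKernel (((i + 1 : ℕ) : ℝ) / (x / v)) / ((i + 1 : ℕ) : ℝ)) := by
      intro M hM
      obtain ⟨k, rfl⟩ := Nat.exists_eq_add_of_le hM
      rw [Finset.sum_range_add, add_sub_assoc, add_le_iff_nonpos_right, sub_nonpos]
      have hsN := (summable_nat_add_iff N).2 hs3
      calc _ ≤ ∑ i ∈ range k, 2 * (x / v) ^ 2 * (1 / ((i + N + 1 : ℕ) : ℝ) ^ 3) := by
            refine sum_le_sum fun i _ => ?_
            have hpos : (0 : ℝ) < ((N + i + 1 : ℕ) : ℝ) := by positivity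
            have hq : 0 < ((N + i + 1 : ℕ) : ℝ) / (x / v) := by positivity
            have h1 := logKernel_le hq
            have h2 := logKernel_nonneg hq
            have h3 : χ (N + i + 1) ≤ 1 := (le_abs_self _).trans (h.tri.abs_le_one _)
            rw [show i + N + 1 = N + i + 1 by ring]
            calc _ ≤ 1 * (2 / (((N + i + 1 : ℕ) : ℝ) / (x / v)) ^ 2 / ((N + i + 1 : ℕ) : ℝ)) := by
                  gcongr
              _ = _ := by field_simp
        _ ≤ _ := by
            rw [← mul_sum]
            gcongr
            exact hsN.sum_le_tsum _ fun i _ => by positivity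
    have hQ2 : -(2 * (x / v) ^ 2 * τ N) ≤ ∑ i ∈ range N,
        χ (i + 1) * (logKernel (((i + 1 : ℕ) : ℝ) / (x / v)) / ((i + 1 : ℕ) : ℝ)) := by
      have := ge_of_tendsto (hl.sub_const (2 * (x / v) ^ 2 * τ N)).neg
        (b := -∑ i ∈ range N,
        χ (i + 1) * (logKernel (((i + 1 : ℕ) : ℝ) / (x / v)) / ((i + 1 : ℕ) : ℝ)))
        ((eventually_ge_atTop N).mono fun M hM => by linarith [hQ M hM])
      linarith
    have hv3 : v ^ (-3 : ℝ) = (v ^ 3)⁻¹ := by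
      rw [show (-3 : ℝ) = -((3 : ℕ) : ℝ) by norm_num, rpow_neg hv0.le, rpow_natCast]
    calc -(2 * x ^ 2 * τ N) * v ^ (-3 : ℝ) = -(2 * (x / v) ^ 2 * τ N) / v := by
          rw [hv3]; field_simp
      _ ≤ _ := div_le_div_of_nonneg_right hQ2 hv0.le
      _ = _ := by
          rw [Finset.sum_div]
          refine sum_congr rfl fun i _ => ?_
          rw [show ((i + 1 : ℕ) : ℝ) / (x / v) = ((i + 1 : ℕ) : ℝ) / x * v by field_simp]
          ring
  have hlim := (((h.lim2.div_const 2).sub (h.lim1.const_mul (log x))).add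
    (h.lim0.const_mul (log x ^ 2 / 2 + c)))
  have hPle : ∀ N, P N ≤ (∑ i ∈ range N,
      χ (i + 1) * log ((i + 1 : ℕ) : ℝ) ^ 2 / ((i + 1 : ℕ) : ℝ)) / 2 -
      log x * (∑ i ∈ range N, χ (i + 1) * log ((i + 1 : ℕ) : ℝ) / ((i + 1 : ℕ) : ℝ)) +
      (log x ^ 2 / 2 + c) * (∑ i ∈ range N, χ (i + 1) / ((i + 1 : ℕ) : ℝ)) + 2 * D / x := by
    intro N
    have h3 := (abs_le.1 (h.psum_antitone kernelTwo_props.1 kernelTwo_props.2.1 kernelTwo_props.2.2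
      hx N)).1
    have h4 : P N = (∑ i ∈ range N,
      χ (i + 1) * log ((i + 1 : ℕ) : ℝ) ^ 2 / ((i + 1 : ℕ) : ℝ)) / 2 -
      log x * (∑ i ∈ range N, χ (i + 1) * log ((i + 1 : ℕ) : ℝ) / ((i + 1 : ℕ) : ℝ)) +
      (log x ^ 2 / 2 + c) * (∑ i ∈ range N, χ (i + 1) / ((i + 1 : ℕ) : ℝ)) -
      (∑ i ∈ range N, χ (i + 1) * kernelTwo (((i + 1 : ℕ) : ℝ) / x)) / x := by
      rw [Finset.sum_div, mul_sum, mul_sum, Finset.sum_div, ← sum_sub_distrib,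
        ← Finset.sum_add_distrib, ← sum_sub_distrib]
      refine sum_congr rfl fun i _ => ?_
      have : ((i + 1 : ℕ) : ℝ) ≠ 0 := by positivity
      rw [hc _ (by positivity), Real.log_div this hx.ne']
      field_simp
      ring
    have h5 : -(2 * D / x) ≤
      (∑ i ∈ range N, χ (i + 1) * kernelTwo (((i + 1 : ℕ) : ℝ) / x)) / x := by
      rw [← neg_div]; exact div_le_div_of_nonneg_right h3 hx.le
    linarith
  have hfin := le_of_tendsto_of_tendsto' (hτ.const_mul (x ^ 2)).neg (hlim.add_const (2 * (D : ℝ) / x))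
    fun N => (hP N).trans (hPle N)
  rw [mul_zero, neg_zero] at hfin
  linarith

end CharData

end

end SecondMoment

end

noncomputable section

namespace SecondMoment

open scoped ENNReal
open Real (log exp sqrt eulerMascheroniConstant exp_pos log_natCast_nonneg log_le_log norm_eq_abs rpow_natCast exp_add rpow_mul log_pow exp_one_lt_d9 exp_le_exp rpow_add mul_rpow le_log_iff_exp_le log_nonneg rpow_neg norm_of_nonneg exp_neg log_mul rpow_def_of_pos add_one_le_exp rpow_neg_one)
open Finset (range sum_congr sum_le_sum mul_sum Icc mem_filter sum_range_succ sum_mul mem_insert_of_mem mem_Icc mem_range Ico Ioc sum_sub_distrib)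
open ENNReal (ofReal ofReal_le_ofReal ofReal_mul)
open ArithmeticFunction (moebius moebius_apply_prime moebius_apply_prime_pow abs_moebius_le_one)

section

variable {χ : ℕ →* ℝ}

/-- The terms `r(n) n^{-1-σ}` as extended nonnegative reals. -/
def rE (χ : ℕ →* ℝ) (σ : ℝ) (n : ℕ) : ℝ≥0∞ :=
  ofReal (rConv χ n * (n : ℝ) ^ (-1 - σ))

namespace CharData

variable {D : ℕ} {L L' L'' : ℝ}

/-- Since `r` is at least one at squares, `L(1,χ) ≫ 1/D`. -/
lemma L_ge (h : CharData χ D L L' L'') : 1 / (128 * (D : ℝ)) ≤ L := by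
  have hD2 := h.two_le_cast
  set M : ℕ := 8 * D with hM
  have hM0 : 0 < M := by have := h.two_le; omega
  have hMr : (M : ℝ) = 8 * D := by rw [hM]; push_cast; ring
  have hx : (0 : ℝ) < (M : ℝ) ^ 2 := by positivity
  obtain ⟨S, hS, hSL⟩ := h.hasSum_exp hx
  have h1 : (M : ℝ) * exp (-1) ≤ S := by
    have h2 := sum_le_hasSum ((Icc 1 M).image fun m => m ^ 2)
      (fun n _ => mul_nonneg (rConv_nonneg h.tri n) (exp_pos _).le) hS
    rw [Finset.sum_image (by intro a _ b _ hab; exact (Nat.pow_left_injective two_ne_zero) hab)] at h2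
    refine le_trans ?_ h2
    calc (M : ℝ) * exp (-1) = ∑ m ∈ Icc 1 M, exp (-1) := by simp
      _ ≤ _ := by
          refine sum_le_sum fun m hm => ?_
          obtain ⟨hm1, hm2⟩ := mem_Icc.1 hm
          have h3 := one_le_rConv_sq h.tri (m := m) (by omega)
          have h4 : ((m ^ 2 : ℕ) : ℝ) / (M : ℝ) ^ 2 ≤ 1 := by
            rw [div_le_one hx]; exact_mod_cast Nat.pow_le_pow_left hm2 2
          have h5 : exp (-1) ≤ exp (-(((m ^ 2 : ℕ) : ℝ) / (M : ℝ) ^ 2)) :=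
            exp_le_exp.2 (by linarith)
          nlinarith [exp_pos (-1)]
  have he := le_exp_neg_one
  have h3 := (abs_le.1 hSL).2
  rw [hMr] at h1 h3
  rw [div_le_iff₀ (by positivity)]
  nlinarith

lemma L_pos (h : CharData χ D L L' L'') : 0 < L := by
  have hD2 := h.two_le_cast
  exact lt_of_lt_of_le (by positivity) h.L_ge

lemma sum_exp_le (h : CharData χ D L L' L'') {x : ℝ} (hx : (D : ℝ) ^ 2 ≤ x) :
    ∃ S, HasSum (fun n => rConv χ n * exp (-((n : ℝ) / x))) S ∧ S ≤ 257 * x * L := by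
  have hD2 := h.two_le_cast
  have hx0 : 0 < x := by nlinarith
  obtain ⟨S, hS, hSL⟩ := h.hasSum_exp hx0
  refine ⟨S, hS, ?_⟩
  have h1 := (abs_le.1 hSL).2
  have h2 := h.L_ge
  have h3 := h.L_pos
  rw [div_le_iff₀ (by positivity)] at h2
  have h4 : 2 * (D : ℝ) ≤ 256 * (D : ℝ) ^ 2 * L := by nlinarith
  have h5 : (D : ℝ) ^ 2 * L ≤ x * L := by gcongr
  linarith

/-- The sum of `r(n) n^{-1-σ}` beyond `D²` is `O(L(1,χ)/σ)`. -/
lemma tail_le (h : CharData χ D L L' L'') {σ : ℝ} (hσ : 0 < σ) (hσ1 : σ ≤ 1) :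
    ∑' n : ℕ, (if D ^ 2 < n then rE χ σ n else 0) ≤ ofReal (12336 * L / σ) := by
  have hD2 := h.two_le_cast
  have hL := h.L_pos
  set x : ℕ → ℝ := fun j => 2 ^ j * (D : ℝ) ^ 2 with hxdef
  have hx0 : ∀ j, 0 < x j := fun j => by positivity
  have hxD : ∀ j, (D : ℝ) ^ 2 ≤ x j := fun j => le_mul_of_one_le_left (by positivity) (one_le_pow₀ one_le_two)
  have hterm : ∀ n : ℕ, (if D ^ 2 < n then rE χ σ n else 0) ≤
      ∑' j : ℕ, ofReal (12 * x j ^ (-1 - σ)) *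
        ofReal (rConv χ n * exp (-((n : ℝ) / x j))) := by
    intro n
    split_ifs with hn
    swap
    · exact zero_le
    have hn0 : (0 : ℝ) < n := by exact_mod_cast (Nat.zero_le _).trans_lt hn
    have hex : ∃ j, n ≤ 2 ^ j * D ^ 2 := ⟨n, by
      have h1 : n ≤ 2 ^ n := Nat.lt_two_pow_self.le
      have h2 : 1 ≤ D ^ 2 := Nat.one_le_pow _ _ (by have := h.two_le; omega)
      nlinarith⟩
    classical
    set j := Nat.find hex
    have hj : n ≤ 2 ^ j * D ^ 2 := Nat.find_spec hex
    have hj0 : j ≠ 0 := by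
      intro h0
      rw [h0, pow_zero, one_mul] at hj
      omega
    obtain ⟨i, hi⟩ := Nat.exists_eq_succ_of_ne_zero hj0
    have hji : ¬ n ≤ 2 ^ i * D ^ 2 := Nat.find_min hex (by omega)
    have h1 : (n : ℝ) ≤ x j := by simp only [hxdef]; exact_mod_cast hj
    have h2 : x j ≤ 2 * n := by
      simp only [hxdef]
      rw [hi, pow_succ]
      have : ((2 ^ i * D ^ 2 : ℕ) : ℝ) ≤ n := by exact_mod_cast (not_le.1 hji).le
      push_cast at this
      linarith
    refine le_trans ?_ (ENNReal.le_tsum j)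
    rw [rE, ← ofReal_mul (by have := hx0 j; positivity)]
    refine ofReal_le_ofReal ?_
    have h3 : (n : ℝ) ^ (-1 - σ) ≤ 4 * x j ^ (-1 - σ) := by
      have h4 : (2 * (n : ℝ)) ^ (-1 - σ) ≤ x j ^ (-1 - σ) :=
        Real.rpow_le_rpow_of_nonpos (hx0 j) h2 (by linarith)
      rw [mul_rpow zero_le_two hn0.le] at h4
      have h5 : (1 : ℝ) / 4 ≤ (2 : ℝ) ^ (-1 - σ) := by
        calc (1 : ℝ) / 4 = (2 : ℝ) ^ (-2 : ℝ) := by norm_num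
          _ ≤ _ := Real.rpow_le_rpow_of_exponent_le one_le_two (by linarith)
      have h6 : 0 < (n : ℝ) ^ (-1 - σ) := by positivity
      nlinarith
    have h7 : 1 / 3 ≤ exp (-((n : ℝ) / x j)) := by
      have : (n : ℝ) / x j ≤ 1 := (div_le_one (hx0 j)).2 h1
      calc (1 : ℝ) / 3 ≤ exp (-1) := by linarith [le_exp_neg_one]
        _ ≤ _ := exp_le_exp.2 (by linarith)
    have hr := rConv_nonneg h.tri n
    have h8 : 0 < x j ^ (-1 - σ) := Real.rpow_pos_of_pos (hx0 j) _
    calc rConv χ n * (n : ℝ) ^ (-1 - σ) ≤ rConv χ n * (4 * x j ^ (-1 - σ)) := by gcongr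
      _ = 12 * x j ^ (-1 - σ) * (rConv χ n * (1 / 3)) := by ring
      _ ≤ _ := by gcongr
  refine (ENNReal.tsum_le_tsum hterm).trans ?_
  rw [ENNReal.tsum_comm]
  have hq1 : (2 : ℝ) ^ (-σ) ≤ 1 - σ / 4 := by
    have h1 : (1 + σ * log 2) * (2 : ℝ) ^ (-σ) ≤ 1 := by
      have h2 : 1 + σ * log 2 ≤ (2 : ℝ) ^ σ := by
        rw [rpow_def_of_pos two_pos]
        have := add_one_le_exp (log 2 * σ)
        linarith
      calc _ ≤ (2 : ℝ) ^ σ * (2 : ℝ) ^ (-σ) := by gcongr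
        _ = 1 := by rw [← rpow_add two_pos, add_neg_cancel, Real.rpow_zero]
    have h3 := Real.log_two_gt_d9
    have h4 : 0 < (2 : ℝ) ^ (-σ) := by positivity
    have h5 : 1 ≤ (1 - σ / 4) * (1 + σ * log 2) := by
      have h6 : 0 ≤ σ * (log 2 - 1 / 4 - σ * log 2 / 4) := by
        refine mul_nonneg hσ.le ?_
        nlinarith
      linarith
    by_contra h6
    push Not at h6
    have h7 : 0 < 1 + σ * log 2 := by positivity
    nlinarith
  have hq0 : 0 < (2 : ℝ) ^ (-σ) := by positivity
  calc _ ≤ ∑' j : ℕ, ofReal (3084 * L * ((2 : ℝ) ^ (-σ)) ^ j) := by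
        refine ENNReal.tsum_le_tsum fun j => ?_
        obtain ⟨S, hS, hSL⟩ := h.sum_exp_le (hxD j)
        rw [ENNReal.tsum_mul_left, ← ENNReal.ofReal_tsum_of_nonneg (fun n =>
          mul_nonneg (rConv_nonneg h.tri n) (exp_pos _).le) hS.summable, hS.tsum_eq,
          ← ofReal_mul (by have := hx0 j; positivity)]
        refine ofReal_le_ofReal ?_
        have h8 : 0 < x j ^ (-1 - σ) := Real.rpow_pos_of_pos (hx0 j) _
        have h9 : x j ^ (-1 - σ) * x j ≤ ((2 : ℝ) ^ (-σ)) ^ j := by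
          have : x j ^ (-1 - σ) * x j = x j ^ (-σ) := by
            rw [← Real.rpow_add_one (hx0 j).ne']; congr 1; ring
          rw [this, ← rpow_natCast, ← rpow_mul zero_le_two, mul_comm (-σ), rpow_mul
            zero_le_two, rpow_natCast]
          refine Real.rpow_le_rpow_of_nonpos (by positivity) ?_ (by linarith)
          exact le_mul_of_one_le_right (by positivity) (by nlinarith)
        calc 12 * x j ^ (-1 - σ) * S ≤ 12 * x j ^ (-1 - σ) * (257 * x j * L) := by gcongr
          _ = 3084 * L * (x j ^ (-1 - σ) * x j) := by ring
          _ ≤ _ := by gcongr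
    _ = ofReal (3084 * L * (1 - (2 : ℝ) ^ (-σ))⁻¹) := by
        have hg := (hasSum_geometric_of_lt_one hq0.le (by linarith : (2 : ℝ) ^ (-σ) < 1)).mul_left
          (3084 * L)
        rw [← ENNReal.ofReal_tsum_of_nonneg (fun j => by positivity) hg.summable, hg.tsum_eq]
    _ ≤ _ := by
        refine ofReal_le_ofReal ?_
        have h1 : (1 - (2 : ℝ) ^ (-σ))⁻¹ ≤ (σ / 4)⁻¹ := inv_anti₀ (by positivity) (by linarith)
        calc 3084 * L * (1 - (2 : ℝ) ^ (-σ))⁻¹ ≤ 3084 * L * (σ / 4)⁻¹ := by gcongr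
          _ = _ := by field_simp; norm_num

end CharData

lemma sum_inv_Icc_le (N : ℕ) : ∑ n ∈ Icc 1 N, ((n : ℝ))⁻¹ ≤ 1 + log N := by
  have := harmonic_le_one_add_log N
  rw [harmonic_eq_sum_Icc] at this
  push_cast at this
  exact this

lemma sum_rConv_div_le (hχ : IsTrivalued χ) (N : ℕ) :
    ∑ n ∈ Icc 1 N, rConv χ n * ((n : ℝ))⁻¹ ≤ (1 + log N) ^ 2 := by
  have hdis : Set.PairwiseDisjoint (↑(Icc 1 N)) (fun n : ℕ => n.divisorsAntidiagonal) := by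
    intro a _ b _ hab
    refine Finset.disjoint_left.2 fun x hx hx' => hab ?_
    rw [← (Nat.mem_divisorsAntidiagonal.1 hx).1, ← (Nat.mem_divisorsAntidiagonal.1 hx').1]
  calc _ ≤ ∑ n ∈ Icc 1 N, ∑ x ∈ n.divisorsAntidiagonal, ((x.1 : ℝ))⁻¹ * ((x.2 : ℝ))⁻¹ := by
        refine sum_le_sum fun n hn => ?_
        rw [rConv, ← Nat.sum_divisorsAntidiagonal (fun a _ => χ a), sum_mul]
        refine sum_le_sum fun x hx => ?_
        rw [← (Nat.mem_divisorsAntidiagonal.1 hx).1, Nat.cast_mul, mul_inv]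
        exact mul_le_of_le_one_left (by positivity) ((le_abs_self _).trans (hχ.abs_le_one _))
    _ = ∑ x ∈ (Icc 1 N).biUnion fun n : ℕ => n.divisorsAntidiagonal,
          ((x.1 : ℝ))⁻¹ * ((x.2 : ℝ))⁻¹ := (Finset.sum_biUnion hdis).symm
    _ ≤ ∑ x ∈ Icc 1 N ×ˢ Icc 1 N, ((x.1 : ℝ))⁻¹ * ((x.2 : ℝ))⁻¹ := by
        refine Finset.sum_le_sum_of_subset_of_nonneg (fun x hx => ?_) fun _ _ _ => by positivity
        obtain ⟨n, hn, hx⟩ := Finset.mem_biUnion.1 hx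
        obtain ⟨h1, h2⟩ := Nat.mem_divisorsAntidiagonal.1 hx
        have hn := mem_Icc.1 hn
        have ha : x.1 ≠ 0 := fun h => h2 (by rw [← h1, h, zero_mul])
        have hb : x.2 ≠ 0 := fun h => h2 (by rw [← h1, h, mul_zero])
        have ha' : x.1 ≤ n := Nat.le_of_dvd (by omega) ⟨_, h1.symm⟩
        have hb' : x.2 ≤ n := Nat.le_of_dvd (by omega) ⟨x.1, by rw [← h1, mul_comm]⟩
        simp only [Finset.mem_product, mem_Icc]
        omega
    _ = (∑ n ∈ Icc 1 N, ((n : ℝ))⁻¹) ^ 2 := by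
        rw [Finset.sum_product, pow_two, Finset.sum_mul_sum]
    _ ≤ _ := by
        gcongr
        exact sum_inv_Icc_le N

namespace CharData

variable {D : ℕ} {L L' L'' : ℝ}

/-- The whole sum of `r(n) n^{-1-σ}` is `O((log D)² + L(1,χ)/σ)`. -/
lemma total_le (h : CharData χ D L L' L'') {σ : ℝ} (hσ : 0 < σ) (hσ1 : σ ≤ 1) :
    ∑' n : ℕ, rE χ σ n ≤ ofReal (12336 * (log D ^ 2 + L / σ)) := by
  have hD2 := h.two_le_cast
  have hsplit : ∀ n, rE χ σ n = (if n ∈ Icc 1 (D ^ 2) then rE χ σ n else 0) +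
      (if D ^ 2 < n then rE χ σ n else 0) := by
    intro n
    rcases Nat.eq_zero_or_pos n with rfl | hn
    · simp [rE]
    · by_cases h1 : D ^ 2 < n
      · rw [if_neg (by rw [mem_Icc]; omega), if_pos h1, zero_add]
      · rw [if_pos (by rw [mem_Icc]; omega), if_neg h1, add_zero]
  rw [tsum_congr hsplit, ENNReal.tsum_add]
  have h1 : ∑' n : ℕ, (if n ∈ Icc 1 (D ^ 2) then rE χ σ n else 0) ≤
      ofReal (12336 * log D ^ 2) := by
    rw [tsum_eq_sum (s := Icc 1 (D ^ 2)) (fun n hn => if_neg hn),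
      sum_congr rfl (fun n hn => if_pos hn)]
    unfold rE
    rw [← ENNReal.ofReal_sum_of_nonneg
      (fun n _ => mul_nonneg (rConv_nonneg h.tri n) (by positivity))]
    refine ofReal_le_ofReal ?_
    calc _ ≤ ∑ n ∈ Icc 1 (D ^ 2), rConv χ n * ((n : ℝ))⁻¹ := by
          refine sum_le_sum fun n hn => ?_
          have hn := mem_Icc.1 hn
          have hn1 : (1 : ℝ) ≤ n := by exact_mod_cast hn.1
          refine mul_le_mul_of_nonneg_left ?_ (rConv_nonneg h.tri n)
          rw [← rpow_neg_one]
          exact Real.rpow_le_rpow_of_exponent_le hn1 (by linarith)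
      _ ≤ (1 + log ((D ^ 2 : ℕ) : ℝ)) ^ 2 := sum_rConv_div_le h.tri _
      _ ≤ _ := by
          push_cast
          rw [log_pow]
          have h2 := Real.log_two_gt_d9
          have h3 := log_le_log two_pos hD2
          push_cast
          nlinarith
  have h2 := h.tail_le hσ hσ1
  refine (add_le_add h1 h2).trans ?_
  have := h.L_pos
  rw [← ENNReal.ofReal_add (by positivity) (by positivity)]
  refine ofReal_le_ofReal (le_of_eq ?_)
  ring

lemma deriv_one_ge (h : CharData χ D L L' L'') (hL : L * log D ≤ 1 / 40) : 1 / 4 ≤ L' := by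
  have hD2 := h.two_le_cast
  have hL0 := h.L_pos
  have hx : (0 : ℝ) < 16 * D := by positivity
  obtain ⟨S, hS, hSL⟩ := h.hasSum_exp_div_eq hx
  have h1 := sum_le_hasSum {1} (fun n _ => mul_nonneg (rConv_nonneg h.tri n) (by positivity)) hS
  simp only [Finset.sum_singleton, rConv_one, Nat.cast_one, one_mul, div_one] at h1
  have h2 := add_one_le_exp (-(1 / (16 * (D : ℝ))))
  have h3 : 1 / (16 * (D : ℝ)) ≤ 1 / 32 := by
    apply one_div_le_one_div_of_le <;> linarith
  have h4 : 2 * (D : ℝ) / (16 * D) = 1 / 8 := by field_simp; norm_num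
  rw [h4] at hSL
  have h5 := (abs_le.1 hSL).2
  have h6 : log (16 * (D : ℝ)) ≤ 5 * log D := by
    have : (16 : ℝ) * D ≤ D ^ 5 := by
      have : (2 : ℝ) ^ 4 ≤ D ^ 4 := by gcongr
      nlinarith
    calc _ ≤ log ((D : ℝ) ^ 5) := log_le_log hx this
      _ = _ := by rw [log_pow]; norm_num
  have h7 : L * log (16 * (D : ℝ)) ≤ L * (5 * log D) := by gcongr
  linarith

/-- The factor `L'' + (log Q - 2γ) L'` is of the order of `L' log q`. -/
lemma exists_main_ge : ∃ D₀ : ℕ, ∀ {χ : ℕ →* ℝ} {D : ℕ} {L L' L'' : ℝ}, CharData χ D L L' L'' →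
    D₀ ≤ D → L * log D ≤ 1 / 40 → ∀ q : ℕ, (D : ℝ) ^ 24 ≤ q →
    log q * L' / 2 ≤ L'' + (log (Q q D) - 2 * eulerMascheroniConstant) * L' := by
  obtain ⟨c, hc⟩ := exists_deriv_two_ge
  refine ⟨⌈exp (8 * |c| + 22)⌉₊, fun {χ D L L' L''} h hD₀ hL q hq => ?_⟩
  have hD2 := h.two_le_cast
  have hD0 : (0 : ℝ) < D := by linarith
  have hlD : 8 * |c| + 22 ≤ log D := by
    rw [le_log_iff_exp_le hD0]
    exact (Nat.le_ceil _).trans (by exact_mod_cast hD₀)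
  have hc0 := abs_nonneg c
  have hL0 := h.L_pos
  have hL1 : L ≤ 1 := by nlinarith
  have hL'4 := h.deriv_one_ge hL
  have hq0 : (0 : ℝ) < q := lt_of_lt_of_le (by positivity) hq
  have hlq : 24 * log D ≤ log q := by
    have := log_le_log (by positivity) hq
    rw [log_pow] at this
    exact_mod_cast this
  have hQ : log q + log D - 4 ≤ log (Q q D) := by
    have hpi : (0 : ℝ) < 4 * Real.pi ^ 2 := by positivity
    have h1 : log (4 * Real.pi ^ 2) ≤ 4 := by
      rw [Real.log_le_iff_le_exp hpi]
      have h2 := Real.pi_lt_d2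
      have h3 := Real.pi_pos
      have h4 : (2.7 : ℝ) ^ 4 ≤ exp 4 := by
        rw [show (4 : ℝ) = (4 : ℕ) * 1 by norm_num, Real.exp_nat_mul]
        have := Real.exp_one_gt_d9
        gcongr; linarith
      nlinarith
    rw [Q, Real.log_div (by positivity) hpi.ne', log_mul hq0.ne' hD0.ne']
    linarith
  have hγ := Real.eulerMascheroniConstant_lt_two_thirds
  have h1 := hc h D hD0
  rw [mul_div_assoc, div_self hD0.ne', mul_one] at h1
  have h2 : L * log D ^ 2 ≤ log D / 40 := by nlinarith
  have h3 : c * L ≤ |c| := by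
    have := le_abs_self c
    nlinarith
  have h4 : (log q - log D * 1.1 - (8 * |c| + 22)) * L' ≤
      L'' + (log (Q q D) - 2 * eulerMascheroniConstant) * L' := by
    have e1 : (log q + log D - 6) * L' ≤
        (log (Q q D) - 2 * eulerMascheroniConstant) * L' := by
      exact mul_le_mul_of_nonneg_right (by linarith) (by linarith)
    have e2 : log D / 40 ≤ log D * 0.1 * L' := by nlinarith
    have e3 : 2 * |c| ≤ 8 * |c| * L' := by nlinarith
    nlinarith
  have h5 : log q / 2 * L' ≤ (log q - log D * 1.1 - (8 * |c| + 22)) * L' := by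
    have : 0 ≤ L' := by linarith
    gcongr; nlinarith
  linarith

/-- Bounds for the derivatives at `1`, from the trivial bound up to `D²` and partial summation
beyond. -/
lemma abs_lim_le (h : CharData χ D L L' L'') (hD3 : 3 ≤ D) {j : ℕ} (hj1 : 1 ≤ j) (hj2 : j ≤ 2) {ℓ : ℝ}
    (hl : Tendsto (fun N => ∑ i ∈ range N,
      χ (i + 1) * (log ((i + 1 : ℕ) : ℝ) ^ j / ((i + 1 : ℕ) : ℝ))) atTop (𝓝 ℓ)) :
    |ℓ| ≤ 100 * log D ^ (j + 1) := by
  have hD3' : (3 : ℝ) ≤ D := by exact_mod_cast hD3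
  have hlD := one_le_log hD3'
  set g : ℝ → ℝ := fun u => log u ^ j / u
  have hg0 : ∀ u, 1 ≤ u → 0 ≤ g u := fun u hu =>
    div_nonneg (pow_nonneg (log_nonneg hu) _) (by linarith)
  have hganti : ∀ u v, 8 ≤ u → u ≤ v → g v ≤ g u := by
    intro u v hu huv
    have hj0 : (0 : ℝ) < j := by exact_mod_cast hj1
    have h1 : exp (1 / (1 / (j : ℝ))) ≤ u := by
      rw [one_div_one_div]
      have hj2' : (j : ℝ) ≤ 2 := by exact_mod_cast hj2
      refine (exp_le_exp.2 hj2').trans ?_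
      have := exp_one_lt_d9
      have h3 : exp 2 = exp 1 * exp 1 := by rw [← exp_add]; norm_num
      rw [h3]
      nlinarith [exp_pos 1]
    have h2 := Real.log_div_self_rpow_antitoneOn (a := 1 / (j : ℝ)) (by positivity)
      (Set.mem_Ici.2 (by simpa using h1)) (Set.mem_Ici.2 (by simpa using h1.trans huv)) huv
    have hgen : ∀ w : ℝ, 8 ≤ w → g w = (log w / w ^ (1 / (j : ℝ))) ^ j := by
      intro w hw
      have hw0 : 0 ≤ w := by linarith
      simp only [g]
      rw [div_pow, ← rpow_natCast (w ^ (1 / (j : ℝ))), ← rpow_mul hw0,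
        one_div_mul_cancel hj0.ne', Real.rpow_one]
    rw [hgen u hu, hgen v (hu.trans huv)]
    have hv1 : 1 ≤ v := by linarith
    refine pow_le_pow_left₀ (div_nonneg (log_nonneg hv1) (by positivity)) h2 j
  set M : ℕ := D ^ 2
  have hM : (M : ℝ) = (D : ℝ) ^ 2 := by simp [M]
  have hM8 : 8 ≤ M := by simp only [M]; nlinarith
  have htail : ∀ N, M ≤ N → |∑ i ∈ Ico M N, χ (i + 1) * g ((i + 1 : ℕ) : ℝ)| ≤ 2 * D * g M := by
    intro N hN
    have h1 := norm_sum_Ico_mul_le (a := fun i => χ (i + 1))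
      (g := fun i => g ((max M (i + 1) : ℕ) : ℝ)) (H := fun i => g ((max M (i + 1) : ℕ) : ℝ)) (B := D)
      h.psum (fun i => by
        rw [norm_eq_abs, abs_of_nonneg (hg0 _ ?_)]
        exact_mod_cast (by omega : 1 ≤ max M (i + 1)))
      (fun i => by
        rw [norm_eq_abs, abs_sub_comm, abs_of_nonneg]
        rw [sub_nonneg]
        refine hganti _ _ ?_ ?_
        · exact_mod_cast (by omega : 8 ≤ max M (i + 1))
        · exact_mod_cast (by omega : max M (i + 1) ≤ max M (i + 1 + 1))) hN
    rw [norm_eq_abs] at h1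
    refine (le_of_eq ?_).trans (h1.trans ?_)
    · congr 1
      refine sum_congr rfl fun i hi => ?_
      rw [max_eq_right (by have := (Finset.mem_Ico.1 hi).1; omega)]
    · have : g ((max M (M + 1) : ℕ) : ℝ) ≤ g M := by
        refine hganti _ _ (by exact_mod_cast hM8) ?_
        exact_mod_cast le_max_left _ _
      gcongr
  have hhead : |∑ i ∈ range M, χ (i + 1) * g ((i + 1 : ℕ) : ℝ)| ≤
      log M ^ j * (1 + log M) := by
    refine (Finset.abs_sum_le_sum_abs _ _).trans ?_
    calc _ ≤ ∑ i ∈ range M, log M ^ j * (((i + 1 : ℕ) : ℝ))⁻¹ := by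
          refine sum_le_sum fun i hi => ?_
          have hi1 : (1 : ℝ) ≤ ((i + 1 : ℕ) : ℝ) := by exact_mod_cast Nat.succ_le_succ (Nat.zero_le i)
          have hiM : ((i + 1 : ℕ) : ℝ) ≤ M := by exact_mod_cast mem_range.1 hi
          rw [abs_mul, abs_of_nonneg (hg0 _ hi1)]
          refine (mul_le_of_le_one_left (hg0 _ hi1) (h.tri.abs_le_one _)).trans ?_
          simp only [g]
          rw [div_eq_mul_inv]
          have := log_nonneg hi1
          gcongr
      _ = log M ^ j * ∑ n ∈ Icc 1 M, ((n : ℝ))⁻¹ := by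
          rw [← mul_sum]
          congr 1
          rw [← Finset.Ico_add_one_right_eq_Icc, Finset.sum_Ico_eq_sum_range]
          refine sum_congr (by simp) fun i _ => by rw [add_comm]
      _ ≤ _ := by
          have : 0 ≤ log M ^ j := pow_nonneg (log_natCast_nonneg M) _
          gcongr
          exact sum_inv_Icc_le M
  have hall : ∀ N, M ≤ N → |∑ i ∈ range N, χ (i + 1) * g ((i + 1 : ℕ) : ℝ)| ≤
      log M ^ j * (1 + log M) + 2 * D * g M := by
    intro N hN
    rw [← Finset.sum_range_add_sum_Ico _ hN]
    exact (abs_add_le _ _).trans (add_le_add hhead (htail N hN))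
  have h1 := le_of_tendsto hl.abs ((eventually_ge_atTop M).mono hall)
  refine h1.trans ?_
  have hlM : log M = 2 * log D := by rw [hM, log_pow]; norm_num
  have hgM : 2 * D * g M ≤ log M ^ j := by
    simp only [g]
    rw [hM]
    have h0 : 0 ≤ log ((D : ℝ) ^ 2) ^ j := pow_nonneg (log_nonneg (by nlinarith)) _
    rw [← mul_div_assoc, div_le_iff₀ (by positivity), mul_comm]
    exact mul_le_mul_of_nonneg_left (by nlinarith) h0
  have h2 : log M ^ j * (1 + log M) + log M ^ j ≤ 100 * log D ^ (j + 1) := by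
    rw [hlM, mul_pow, pow_succ (log D)]
    have h3 : (2 : ℝ) ^ j ≤ 2 ^ 2 := pow_le_pow_right₀ one_le_two hj2
    have h4 : 1 ≤ log D ^ j := one_le_pow₀ hlD
    calc _ = 2 ^ j * log D ^ j * (2 + 2 * log D) := by ring
      _ ≤ 2 ^ 2 * log D ^ j * (4 * log D) := by gcongr; linarith
      _ ≤ _ := by nlinarith
  linarith

lemma abs_deriv_le (h : CharData χ D L L' L'') (hD3 : 3 ≤ D) :
    |L'| ≤ 100 * log D ^ 2 ∧ |L''| ≤ 100 * log D ^ 3 := by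
  constructor
  · rw [← abs_neg]
    refine h.abs_lim_le hD3 le_rfl (by norm_num) (h.lim1.congr fun N => ?_)
    exact sum_congr rfl fun i _ => by rw [pow_one, mul_div_assoc]
  · refine h.abs_lim_le hD3 one_le_two le_rfl (h.lim2.congr fun N => ?_)
    exact sum_congr rfl fun i _ => by rw [mul_div_assoc]

end CharData

end

/-! ### Splitting off the inert primes -/

section

variable {χ : ℕ →* ℝ}

open scoped Classical in
/-- The largest divisor of `n` without inert prime factors. -/
def plusPart (χ : ℕ →* ℝ) (n : ℕ) : ℕ :=
  ∏ p ∈ n.primeFactors.filter (fun p => χ p ≠ -1), p ^ n.factorization p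

open scoped Classical in
/-- The largest divisor of `n` all of whose prime factors are inert. -/
def minusPart (χ : ℕ →* ℝ) (n : ℕ) : ℕ :=
  ∏ p ∈ n.primeFactors.filter (fun p => ¬ χ p ≠ -1), p ^ n.factorization p

/-- All prime factors of `n` are inert. -/
def IsMinus (χ : ℕ →* ℝ) (n : ℕ) : Prop := n ≠ 0 ∧ ∀ p, p.Prime → p ∣ n → χ p = -1

lemma plusPart_mul_minusPart {n : ℕ} (hn : n ≠ 0) : plusPart χ n * minusPart χ n = n := by
  rw [plusPart, minusPart, Finset.prod_filter_mul_prod_filter_not]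
  exact (Nat.prod_primeFactors_pow_factorization hn).symm

lemma isPlus_plusPart (n : ℕ) : IsPlus χ (plusPart χ n) := by
  intro p hp hdvd
  obtain ⟨q, hq, hpq⟩ := (hp.prime.dvd_finsetProd_iff _).1 hdvd
  obtain ⟨hq1, hq2⟩ := mem_filter.1 hq
  rwa [(Nat.prime_dvd_prime_iff_eq hp (Nat.prime_of_mem_primeFactors hq1)).1 (hp.dvd_of_dvd_pow hpq)]

lemma isMinus_minusPart (n : ℕ) : IsMinus χ (minusPart χ n) := by
  refine ⟨Finset.prod_ne_zero_iff.2 fun p hp => pow_ne_zero _ ?_, fun p hp hdvd => ?_⟩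
  · exact (Nat.prime_of_mem_primeFactors (mem_filter.1 hp).1).ne_zero
  obtain ⟨q, hq, hpq⟩ := (hp.prime.dvd_finsetProd_iff _).1 hdvd
  obtain ⟨hq1, hq2⟩ := mem_filter.1 hq
  rw [(Nat.prime_dvd_prime_iff_eq hp (Nat.prime_of_mem_primeFactors hq1)).1 (hp.dvd_of_dvd_pow hpq)]
  exact not_not.1 hq2

lemma plusPart_ne_zero (n : ℕ) : plusPart χ n ≠ 0 :=
  Finset.prod_ne_zero_iff.2 fun _ hp => pow_ne_zero _
    (Nat.prime_of_mem_primeFactors (mem_filter.1 hp).1).ne_zero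

lemma IsMinus.mul {m n : ℕ} (hm : IsMinus χ m) (hn : IsMinus χ n) : IsMinus χ (m * n) :=
  ⟨mul_ne_zero hm.1 hn.1, fun p hp h => (hp.dvd_mul.1 h).elim (hm.2 p hp) (hn.2 p hp)⟩

lemma IsPlus.coprime {m n : ℕ} (hm : IsPlus χ m) (hn : IsMinus χ n) : m.Coprime n :=
  Nat.Coprime.symm <| Nat.coprime_of_dvd fun p hp h1 h2 => hm p hp h2 (hn.2 p hp h1)

/-- The splitting of a tuple into its non-inert part and its inert part. -/
def tSplit (χ : ℕ →* ℝ) (t : Tup) : Tup × Tup :=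
  ((plusPart χ t.1, plusPart χ t.2.1, plusPart χ t.2.2.1, plusPart χ t.2.2.2.1, plusPart χ t.2.2.2.2),
   (minusPart χ t.1, minusPart χ t.2.1, minusPart χ t.2.2.1, minusPart χ t.2.2.2.1,
    minusPart χ t.2.2.2.2))

/-- `IsPlus` in every entry. -/
def TPlus (χ : ℕ →* ℝ) (t : Tup) : Prop :=
  IsPlus χ t.1 ∧ IsPlus χ t.2.1 ∧ IsPlus χ t.2.2.1 ∧ IsPlus χ t.2.2.2.1 ∧ IsPlus χ t.2.2.2.2

/-- `IsMinus` in every entry. -/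
def TMinus (χ : ℕ →* ℝ) (t : Tup) : Prop :=
  IsMinus χ t.1 ∧ IsMinus χ t.2.1 ∧ IsMinus χ t.2.2.1 ∧ IsMinus χ t.2.2.2.1 ∧ IsMinus χ t.2.2.2.2

lemma tN_ne_zero {t : Tup} : tN t ≠ 0 ↔
    t.1 ≠ 0 ∧ t.2.1 ≠ 0 ∧ t.2.2.1 ≠ 0 ∧ t.2.2.2.1 ≠ 0 ∧ t.2.2.2.2 ≠ 0 := by
  simp only [tN, mul_ne_zero_iff]; tauto

lemma tSplit_mul {t : Tup} (ht : tN t ≠ 0) : (tSplit χ t).1 * (tSplit χ t).2 = t := by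
  obtain ⟨h1, h2, h3, h4, h5⟩ := tN_ne_zero.1 ht
  simp only [tSplit, Prod.mk_mul_mk]
  rw [plusPart_mul_minusPart h1, plusPart_mul_minusPart h2, plusPart_mul_minusPart h3,
    plusPart_mul_minusPart h4, plusPart_mul_minusPart h5]

lemma tPlus_tSplit (t : Tup) : TPlus χ (tSplit χ t).1 :=
  ⟨isPlus_plusPart _, isPlus_plusPart _, isPlus_plusPart _, isPlus_plusPart _, isPlus_plusPart _⟩

lemma tMinus_tSplit (t : Tup) : TMinus χ (tSplit χ t).2 :=
  ⟨isMinus_minusPart _, isMinus_minusPart _, isMinus_minusPart _, isMinus_minusPart _,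
    isMinus_minusPart _⟩

lemma TPlus.isPlus_tN {t : Tup} (h : TPlus χ t) : IsPlus χ (tN t) :=
  (((h.1.mul h.2.1).mul h.2.2.1).mul h.2.2.2.1).mul h.2.2.2.2

lemma TMinus.isMinus_tN {t : Tup} (h : TMinus χ t) : IsMinus χ (tN t) :=
  (((h.1.mul h.2.1).mul h.2.2.1).mul h.2.2.2.1).mul h.2.2.2.2

/-! ### The non-inert part of the majorant -/

/-- The convolution square of `1 ⋆ χ`. -/
def rrConv (χ : ℕ →* ℝ) (n : ℕ) : ℝ :=
  ∑ x ∈ n.divisorsAntidiagonal, rConv χ x.1 * rConv χ x.2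

lemma rrConv_nonneg (hχ : IsTrivalued χ) (n : ℕ) : 0 ≤ rrConv χ n :=
  Finset.sum_nonneg fun _ _ => mul_nonneg (rConv_nonneg hχ _) (rConv_nonneg hχ _)

lemma IsPlus.rrConv_mul_le (hχ : IsTrivalued χ) {m n : ℕ} (hm : IsPlus χ m) (hn : IsPlus χ n) :
    rrConv χ (m * n) ≤ rrConv χ m * rrConv χ n := by
  have hr := rConv_nonneg hχ
  rw [rrConv, rrConv, rrConv, Nat.sum_divisorsAntidiagonal (fun a b => rConv χ a * rConv χ b),
    Nat.sum_divisorsAntidiagonal (fun a b => rConv χ a * rConv χ b),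
    Nat.sum_divisorsAntidiagonal (fun a b => rConv χ a * rConv χ b), Finset.sum_mul_sum]
  refine (sum_divisors_mul_le fun d _ => mul_nonneg (hr _) (hr _)).trans ?_
  refine sum_le_sum fun x hx => sum_le_sum fun y hy => ?_
  have hx' := Nat.dvd_of_mem_divisors hx
  have hy' := Nat.dvd_of_mem_divisors hy
  rw [← Nat.div_mul_div_comm hx' hy']
  have h1 := (hm.of_dvd hx').rConv_mul_le hχ (hn.of_dvd hy')
  have h2 := (hm.of_dvd (Nat.div_dvd_of_dvd hx')).rConv_mul_le hχ (hn.of_dvd (Nat.div_dvd_of_dvd hy'))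
  calc _ ≤ (rConv χ x * rConv χ y) * (rConv χ (m / x) * rConv χ (n / y)) :=
        mul_le_mul h1 h2 (hr _) (mul_nonneg (hr _) (hr _))
    _ = _ := by ring

/-- `r² ≤ r ⋆ r` on integers without inert prime factors. -/
lemma IsPlus.rConv_sq_le (hχ : IsTrivalued χ) {n : ℕ} (hn : IsPlus χ n) :
    rConv χ n ^ 2 ≤ rrConv χ n := by
  have hr := rConv_nonneg hχ
  rw [rrConv, Nat.sum_divisorsAntidiagonal (fun a b => rConv χ a * rConv χ b), pow_two]
  nth_rewrite 1 [rConv]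
  rw [sum_mul]
  refine sum_le_sum fun d hd => ?_
  have hd' := Nat.dvd_of_mem_divisors hd
  have h1 := (hn.of_dvd hd').rConv_mul_le hχ (hn.of_dvd (Nat.div_dvd_of_dvd hd'))
  rw [Nat.mul_div_cancel' hd'] at h1
  refine le_trans ?_ h1
  exact mul_le_of_le_one_left (hr _) ((le_abs_self _).trans (hχ.abs_le_one _))

lemma IsPlus.rrConv_mul_rConv_le (hχ : IsTrivalued χ) {n : ℕ} (hn : IsPlus χ n) :
    rrConv χ n * rConv χ n ≤ ∑ x ∈ n.divisorsAntidiagonal, rConv χ x.1 ^ 2 * rConv χ x.2 ^ 2 := by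
  have hr := rConv_nonneg hχ
  rw [rrConv, sum_mul]
  refine sum_le_sum fun x hx => ?_
  have hx' := (Nat.mem_divisorsAntidiagonal.1 hx).1
  have h1 := (hn.of_dvd ⟨x.2, hx'.symm⟩).rConv_mul_le hχ (hn.of_dvd ⟨x.1, by rw [← hx', mul_comm]⟩)
  rw [hx'] at h1
  calc _ ≤ rConv χ x.1 * rConv χ x.2 * (rConv χ x.1 * rConv χ x.2) :=
        mul_le_mul_of_nonneg_left h1 (mul_nonneg (hr _) (hr _))
    _ = _ := by ring

lemma FTup_le_of_tPlus (hχ : IsTrivalued χ) {t : Tup} (ht : TPlus χ t) :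
    FTup χ t ≤ rConv χ t.1 ^ 2 * (rrConv χ t.2.1 * rConv χ t.2.1) *
      (rrConv χ t.2.2.1 * rConv χ t.2.2.1) * (rrConv χ t.2.2.2.1 * rConv χ t.2.2.2.1) *
      rConv χ t.2.2.2.2 ^ 2 * ((tDen t : ℝ))⁻¹ := by
  obtain ⟨d, a, b, g, n⟩ := t
  obtain ⟨hd, ha, hb, hg, hn⟩ := ht
  simp only at hd ha hb hg hn
  have hr := rConv_nonneg hχ
  have hrr := rrConv_nonneg hχ
  have hA : IsPlus χ (a * b * g) := (ha.mul hb).mul hg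
  have h1 : pairSum (fun n => |rho1Real χ n|) d (a * b * g) ≤
      rConv χ d ^ 2 * (rrConv χ a * rrConv χ b * rrConv χ g) := by
    calc _ ≤ rConv χ d ^ 2 * rrConv χ (a * b * g) := by
          rw [pairSum, rrConv, mul_sum]
          refine sum_le_sum fun x hx => ?_
          have hx' := (Nat.mem_divisorsAntidiagonal.1 hx).1
          have i1 := (abs_rho1Real_le hχ (d * x.1)).trans (hd.rConv_mul_le hχ (hA.of_dvd ⟨x.2, hx'.symm⟩))
          have i2 := (abs_rho1Real_le hχ (d * x.2)).trans
            (hd.rConv_mul_le hχ (hA.of_dvd ⟨x.1, by rw [← hx', mul_comm]⟩))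
          calc _ ≤ (rConv χ d * rConv χ x.1) * (rConv χ d * rConv χ x.2) :=
                mul_le_mul i1 i2 (abs_nonneg _) (mul_nonneg (hr _) (hr _))
            _ = _ := by ring
      _ ≤ _ := by
          refine mul_le_mul_of_nonneg_left ?_ (by positivity)
          exact ((ha.mul hb).rrConv_mul_le hχ hg).trans
            (mul_le_mul_of_nonneg_right (ha.rrConv_mul_le hχ hb) (hrr _))
  have h2 : |(moebius g : ℝ)| ≤ 1 := by
    rw [← Int.cast_abs]; exact_mod_cast abs_moebius_le_one
  have h3 : rConv χ (a * g * n) ≤ rConv χ a * rConv χ g * rConv χ n :=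
    ((ha.mul hg).rConv_mul_le hχ hn).trans
      (mul_le_mul_of_nonneg_right (ha.rConv_mul_le hχ hg) (hr _))
  have h0 := pairSum_abs_nonneg (rho1Real χ) d (a * b * g)
  have ra := hr a
  have rb := hr b
  have rg := hr g
  have rn := hr n
  have rra := hrr a
  have rrb := hrr b
  have rrg := hrr g
  have rd := hr d
  simp only [FTup]
  calc _ ≤ rConv χ d ^ 2 * (rrConv χ a * rrConv χ b * rrConv χ g) * 1 * rConv χ b *
        (rConv χ a * rConv χ g * rConv χ n) * rConv χ n * ((tDen (d, a, b, g, n) : ℝ))⁻¹ := by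
        have := hr (a * g * n)
        gcongr
    _ = _ := by ring

open scoped Classical in
/-- The weight `r(n)² n^{-1-σ}` on integers without inert prime factors. -/
def sqE (χ : ℕ →* ℝ) (σ : ℝ) (n : ℕ) : ℝ≥0∞ :=
  if IsPlus χ n then ofReal (rConv χ n ^ 2 * (n : ℝ) ^ (-1 - σ)) else 0

open scoped Classical in
/-- The weight `(r ⋆ r)(n) r(n) n^{-1-σ}` on integers without inert prime factors. -/
def cubeE (χ : ℕ →* ℝ) (σ : ℝ) (n : ℕ) : ℝ≥0∞ :=
  if IsPlus χ n then ofReal (rrConv χ n * rConv χ n * (n : ℝ) ^ (-1 - σ)) else 0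

lemma tsum_antidiag_le (G : ℕ × ℕ → ℝ≥0∞) :
    ∑' n : ℕ, ∑ x ∈ n.divisorsAntidiagonal, G x ≤ ∑' x, G x := by
  have h1 : ∀ n : ℕ, ∑ x ∈ n.divisorsAntidiagonal, G x = ∑' x : n.divisorsAntidiagonal, G x :=
    fun n => (Finset.tsum_subtype _ _).symm
  simp only [h1]
  rw [← ENNReal.tsum_sigma' (fun y : Σ n : ℕ, n.divisorsAntidiagonal => G y.2)]
  refine ENNReal.tsum_comp_le_tsum_of_injective (f := fun y : Σ n : ℕ, n.divisorsAntidiagonal =>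
    (y.2 : ℕ × ℕ)) ?_ G
  rintro ⟨n, x, hx⟩ ⟨m, y, hy⟩ hxy
  simp only at hxy
  subst hxy
  have h2 := (Nat.mem_divisorsAntidiagonal.1 hx).1
  have h3 := (Nat.mem_divisorsAntidiagonal.1 hy).1
  obtain rfl : n = m := by rw [← h2, ← h3]
  rfl

lemma tsum_prod_mul {α β : Type} (f : α → ℝ≥0∞) (g : β → ℝ≥0∞) :
    ∑' x : α × β, f x.1 * g x.2 = (∑' n, f n) * ∑' n, g n := by
  rw [ENNReal.tsum_prod (f := fun a b => f a * g b)]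
  simp_rw [ENNReal.tsum_mul_left, ENNReal.tsum_mul_right]

/-- A function dominated by a convolution `f ⋆ f`: its sum is at most the square, and its tail is
controlled by the tail of `f`. -/
lemma tsum_le_of_conv {f F : ℕ → ℝ≥0∞} (h : ∀ n, F n ≤ ∑ x ∈ n.divisorsAntidiagonal, f x.1 * f x.2)
    (y : ℕ) : ∑' n, F n ≤ (∑' n, f n) ^ 2 ∧
      ∑' n, (if y ^ 2 < n then F n else 0) ≤
        2 * (∑' n, f n) * ∑' n, (if y < n then f n else 0) := by
  refine ⟨(ENNReal.tsum_le_tsum h).trans ((tsum_antidiag_le fun x => f x.1 * f x.2).trans_eq ?_), ?_⟩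
  · rw [tsum_prod_mul, pow_two]
  · set g : ℕ → ℝ≥0∞ := fun n => if y < n then f n else 0
    calc _ ≤ ∑' n : ℕ, ∑ x ∈ n.divisorsAntidiagonal, (g x.1 * f x.2 + f x.1 * g x.2) := by
          refine ENNReal.tsum_le_tsum fun n => ?_
          split_ifs with hn
          · refine (h n).trans (sum_le_sum fun x hx => ?_)
            have hx' := (Nat.mem_divisorsAntidiagonal.1 hx).1
            by_cases h1 : y < x.1
            · simp only [g, if_pos h1]; exact le_self_add
            · have h2 : y < x.2 := by
                by_contra h2
                have : x.1 * x.2 ≤ y * y := Nat.mul_le_mul (not_lt.1 h1) (not_lt.1 h2)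
                nlinarith
              simp only [g, if_pos h2]; exact le_add_self
          · exact zero_le
      _ ≤ ∑' x : ℕ × ℕ, (g x.1 * f x.2 + f x.1 * g x.2) := tsum_antidiag_le _
      _ = _ := by
          rw [ENNReal.tsum_add, tsum_prod_mul, tsum_prod_mul]; ring

lemma rpow_mul_antidiag {n : ℕ} {x : ℕ × ℕ} (hx : x ∈ n.divisorsAntidiagonal) (s : ℝ) :
    (n : ℝ) ^ s = (x.1 : ℝ) ^ s * (x.2 : ℝ) ^ s := by
  rw [← (Nat.mem_divisorsAntidiagonal.1 hx).1, Nat.cast_mul,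
    mul_rpow (Nat.cast_nonneg _) (Nat.cast_nonneg _)]

lemma sqE_le (hχ : IsTrivalued χ) (σ : ℝ) (n : ℕ) :
    sqE χ σ n ≤ ∑ x ∈ n.divisorsAntidiagonal, rE χ σ x.1 * rE χ σ x.2 := by
  rw [sqE]
  split_ifs with hn
  · have hr := rConv_nonneg hχ
    unfold rE
    rw [sum_congr rfl (fun x _ => (ofReal_mul (mul_nonneg (hr x.1)
      (Real.rpow_nonneg (Nat.cast_nonneg _) _))).symm), ← ENNReal.ofReal_sum_of_nonneg
        (fun x _ => mul_nonneg (mul_nonneg (hr _) (Real.rpow_nonneg (Nat.cast_nonneg _) _))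
          (mul_nonneg (hr _) (Real.rpow_nonneg (Nat.cast_nonneg _) _)))]
    refine ofReal_le_ofReal ?_
    refine (mul_le_mul_of_nonneg_right (hn.rConv_sq_le hχ)
      (Real.rpow_nonneg (Nat.cast_nonneg _) _)).trans_eq ?_
    rw [rrConv, sum_mul]
    exact sum_congr rfl fun x hx => by rw [rpow_mul_antidiag hx]; ring
  · exact zero_le

lemma cubeE_le (hχ : IsTrivalued χ) (σ : ℝ) (n : ℕ) :
    cubeE χ σ n ≤ ∑ x ∈ n.divisorsAntidiagonal, sqE χ σ x.1 * sqE χ σ x.2 := by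
  rw [cubeE]
  split_ifs with hn
  · have hr := rConv_nonneg hχ
    have hterm : ∀ x ∈ n.divisorsAntidiagonal, sqE χ σ x.1 * sqE χ σ x.2 =
        ofReal (rConv χ x.1 ^ 2 * (x.1 : ℝ) ^ (-1 - σ) *
          (rConv χ x.2 ^ 2 * (x.2 : ℝ) ^ (-1 - σ))) := by
      intro x hx
      have hx' := (Nat.mem_divisorsAntidiagonal.1 hx).1
      rw [sqE, sqE, if_pos (hn.of_dvd ⟨x.2, hx'.symm⟩),
        if_pos (hn.of_dvd ⟨x.1, by rw [← hx', mul_comm]⟩), ← ofReal_mul (by positivity)]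
    rw [sum_congr rfl hterm, ← ENNReal.ofReal_sum_of_nonneg (fun x _ => by positivity)]
    refine ofReal_le_ofReal ?_
    refine (mul_le_mul_of_nonneg_right (hn.rrConv_mul_rConv_le hχ)
      (Real.rpow_nonneg (Nat.cast_nonneg _) _)).trans_eq ?_
    rw [sum_mul]
    exact sum_congr rfl fun x hx => by rw [rpow_mul_antidiag hx]; ring
  · exact zero_le

/-- For fixed positive `σ` the sum of `r(n) n^{-1-σ}` is bounded independently of `χ`. -/
lemma exists_rE_le {σ : ℝ} (hσ : 0 < σ) : ∃ C : ℝ≥0∞, C ≠ ⊤ ∧ ∀ χ : ℕ →* ℝ, IsTrivalued χ →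
    ∑' n, rE χ σ n ≤ C := by
  set z : ℕ → ℝ≥0∞ := fun n => ofReal ((n : ℝ) ^ (-1 - σ))
  have hz : ∑' n, z n ≠ ⊤ := by
    have := Real.summable_nat_rpow.2 (by linarith : -1 - σ < -1)
    rw [← ENNReal.ofReal_tsum_of_nonneg (fun n => by positivity) this]
    exact ENNReal.ofReal_ne_top
  refine ⟨(∑' n, z n) ^ 2, ENNReal.pow_ne_top hz, fun χ hχ => ?_⟩
  refine (tsum_le_of_conv (f := z) (fun n => ?_) 0).1
  simp only [z, rE]
  rw [sum_congr rfl (fun x hx => by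
    rw [← ofReal_mul (by positivity), ← rpow_mul_antidiag hx]), Finset.sum_const,
    nsmul_eq_mul, ← ENNReal.ofReal_natCast, ← ofReal_mul (Nat.cast_nonneg _)]
  refine ofReal_le_ofReal ?_
  have h1 : n.divisorsAntidiagonal.card = n.divisors.card := by
    rw [← Nat.map_div_right_divisors, Finset.card_map]
  rw [h1]
  exact mul_le_mul_of_nonneg_right (rConv_le_card hχ n) (by positivity)

lemma tsum_tup_mul (f₁ f₂ f₃ f₄ f₅ : ℕ → ℝ≥0∞) :
    ∑' t : Tup, f₁ t.1 * (f₂ t.2.1 * (f₃ t.2.2.1 * (f₄ t.2.2.2.1 * f₅ t.2.2.2.2))) =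
      (∑' n, f₁ n) * ((∑' n, f₂ n) * ((∑' n, f₃ n) * ((∑' n, f₄ n) * ∑' n, f₅ n))) := by
  rw [tsum_prod_mul f₁ (fun t : ℕ × ℕ × ℕ × ℕ => f₂ t.1 * (f₃ t.2.1 * (f₄ t.2.2.1 * f₅ t.2.2.2))),
    tsum_prod_mul f₂ (fun t : ℕ × ℕ × ℕ => f₃ t.1 * (f₄ t.2.1 * f₅ t.2.2)),
    tsum_prod_mul f₃ (fun t : ℕ × ℕ => f₄ t.1 * f₅ t.2), tsum_prod_mul f₄ f₅]

/-- The majorant twisted by `(d a b g n)^{-σ}`. -/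
def FE (χ : ℕ →* ℝ) (σ : ℝ) (t : Tup) : ℝ≥0∞ :=
  ofReal (FTup χ t * (tN t : ℝ) ^ (-σ))

lemma FE_le_of_tPlus (hχ : IsTrivalued χ) {t : Tup} (ht : TPlus χ t) (h0 : tN t ≠ 0) {σ : ℝ}
    (hσ : 0 < σ) : FE χ σ t ≤ sqE χ σ t.1 * (cubeE χ σ t.2.1 * (cubeE χ σ t.2.2.1 *
      (ofReal (((t.2.2.2.1 : ℝ)) ^ (-(2 / 3) : ℝ)) * cubeE χ (1 / 3) t.2.2.2.1 *
        sqE χ σ t.2.2.2.2))) := by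
  have h1 := FTup_le_of_tPlus hχ ht
  have hr := rConv_nonneg hχ
  have hrr := rrConv_nonneg hχ
  obtain ⟨d, a, b, g, n⟩ := t
  obtain ⟨hd, ha, hb, hg, hn⟩ := ht
  obtain ⟨d0, a0, b0, g0, n0⟩ := tN_ne_zero.1 h0
  simp only at hd ha hb hg hn h1 d0 a0 b0 g0 n0
  have ra := hr a
  have rb := hr b
  have rg := hr g
  have rra := hrr a
  have rrb := hrr b
  have rrg := hrr g
  simp only [sqE, cubeE, if_pos hd, if_pos ha, if_pos hb, if_pos hg, if_pos hn, FE]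
  rw [← ofReal_mul (by positivity), ← ofReal_mul (by positivity),
    ← ofReal_mul (by positivity), ← ofReal_mul (by positivity),
    ← ofReal_mul (by positivity)]
  refine ofReal_le_ofReal ?_
  have hs : ∀ m : ℕ, m ≠ 0 → (m : ℝ) ^ (-1 - σ) = ((m : ℝ))⁻¹ * (m : ℝ) ^ (-σ) := fun m hm => by
    have : (0 : ℝ) < m := by exact_mod_cast Nat.pos_of_ne_zero hm
    rw [sub_eq_add_neg, rpow_add this, rpow_neg_one]
  have hg' : (g : ℝ) ^ (-(2 / 3) : ℝ) * (g : ℝ) ^ (-1 - 1 / 3 : ℝ) = ((g : ℝ) ^ 2)⁻¹ := by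
    have : (0 : ℝ) < g := by exact_mod_cast Nat.pos_of_ne_zero g0
    rw [← rpow_add this, ← rpow_natCast, ← rpow_neg this.le]
    norm_num
  have hgσ : (g : ℝ) ^ (-σ) ≤ 1 :=
    Real.rpow_le_one_of_one_le_of_nonpos (by exact_mod_cast Nat.pos_of_ne_zero g0) (by linarith)
  have hN : (tN (d, a, b, g, n) : ℝ) ^ (-σ) = (d : ℝ) ^ (-σ) * (a : ℝ) ^ (-σ) * (b : ℝ) ^ (-σ) *
      (g : ℝ) ^ (-σ) * (n : ℝ) ^ (-σ) := by
    simp only [tN]; push_cast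
    rw [mul_rpow (by positivity) (by positivity), mul_rpow (by positivity) (by positivity),
      mul_rpow (by positivity) (by positivity), mul_rpow (by positivity) (by positivity)]
  calc FTup χ (d, a, b, g, n) * (tN (d, a, b, g, n) : ℝ) ^ (-σ)
      ≤ rConv χ d ^ 2 * (rrConv χ a * rConv χ a) * (rrConv χ b * rConv χ b) *
        (rrConv χ g * rConv χ g) * rConv χ n ^ 2 * ((tDen (d, a, b, g, n) : ℝ))⁻¹ *
        ((d : ℝ) ^ (-σ) * (a : ℝ) ^ (-σ) * (b : ℝ) ^ (-σ) * 1 * (n : ℝ) ^ (-σ)) := by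
        rw [hN]
        gcongr
    _ = rConv χ d ^ 2 * (d : ℝ) ^ (-1 - σ) * (rrConv χ a * rConv χ a * (a : ℝ) ^ (-1 - σ) *
        (rrConv χ b * rConv χ b * (b : ℝ) ^ (-1 - σ) *
        (((g : ℝ) ^ (-(2 / 3) : ℝ) * (g : ℝ) ^ (-1 - 1 / 3 : ℝ)) * (rrConv χ g * rConv χ g) *
        (rConv χ n ^ 2 * (n : ℝ) ^ (-1 - σ))))) := by
        rw [hg', hs d d0, hs a a0, hs b b0, hs n n0]
        simp only [tDen]; push_cast
        rw [mul_inv, mul_inv, mul_inv, mul_inv]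
        ring
    _ = _ := by ring

end

section

variable {χ : ℕ →* ℝ}

/-! ### The inert part of the majorant, and Rankin's trick over smooth tuples -/

/-- The majorant twisted by `(d a b g n)^s`. -/
def HTup (χ : ℕ →* ℝ) (s : ℝ) (t : Tup) : ℝ := FTup χ t * (tN t : ℝ) ^ s

lemma isMult_rpow (s : ℝ) : IsMult (fun n => (n : ℝ) ^ s) :=
  ⟨by simp, fun m n _ => by
    simp only; push_cast; rw [mul_rpow (Nat.cast_nonneg _) (Nat.cast_nonneg _)]⟩

lemma isJointMult_HTup (s : ℝ) : IsJointMult (HTup χ s) :=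
  isJointMult_FTup.mul ((isMult_rpow s).comp_tup (m := tN) (by simp [tN]) tN_mul
    fun t => ⟨1, by rw [pow_one]⟩)

lemma HTup_nonneg (hχ : IsTrivalued χ) (s : ℝ) (t : Tup) : 0 ≤ HTup χ s t :=
  mul_nonneg (FTup_nonneg hχ t) (by positivity)

lemma exists_local_twist {ρ : ℝ} (h0 : 0 < ρ) (h1 : ρ < 1) : ∃ C : ℝ, 0 ≤ C ∧
    ∀ (χ : ℕ →* ℝ), IsTrivalued χ → ∀ p : ℕ, p.Prime → ∀ s : ℝ, (p : ℝ) ^ s / p ≤ ρ →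
      (Summable fun e => |HTup χ s (pw p e)|) ∧ ∑' e, HTup χ s (pw p e) ≤
        1 + C * (4 * rConv χ p * ((p : ℝ) ^ s / p) + ((p : ℝ) ^ s / p) ^ 2) := by
  obtain ⟨C, hC, hloc⟩ := exists_local_sum_bound 6 h0 h1
  refine ⟨C, hC, fun χ hχ p hp s hs => ?_⟩
  have hp0 : (0 : ℝ) < p := by exact_mod_cast hp.pos
  have hr := rConv_nonneg hχ p
  have hpow : ∀ e : Tup, ((tN (pw p e) : ℕ) : ℝ) ^ s = ((p : ℝ) ^ s) ^ tS e := fun e => by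
    rw [tN_pw]; push_cast
    rw [← rpow_natCast, ← rpow_natCast, ← rpow_mul hp0.le, ← rpow_mul hp0.le,
      mul_comm]
  obtain ⟨i1, -, i3⟩ := hloc (fun e => HTup χ s (pw p e)) ((p : ℝ) ^ s / p)
    (4 * rConv χ p * ((p : ℝ) ^ s / p)) (by positivity) hs (by positivity)
    (fun e he => by
      rw [abs_of_nonneg (HTup_nonneg hχ s _), HTup, hpow, he, pow_one]
      calc _ ≤ 4 * (rConv χ p / p) * (p : ℝ) ^ s := by
            gcongr; exact FTup_pw_le_of_one hχ hp he
        _ = _ := by ring)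
    (fun e _ => by
      rw [abs_of_nonneg (HTup_nonneg hχ s _), HTup, hpow]
      calc _ ≤ (1 + (tS e : ℝ)) ^ 6 * ((p : ℝ)⁻¹) ^ tS e * ((p : ℝ) ^ s) ^ tS e := by
            gcongr; exact FTup_pw_le hχ hp e
        _ = _ := by rw [mul_assoc, ← mul_pow]; congr 2; ring)
  refine ⟨i1, ?_⟩
  simp only [abs_of_nonneg (HTup_nonneg hχ s _)] at i3
  rwa [pw_zero, (isJointMult_HTup s).1] at i3

/-- The set of primes up to `Z`. -/
def primesUpTo (Z : ℕ) : Finset ℕ := (Icc 1 Z).filter Nat.Prime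

lemma prime_of_mem_primesUpTo {Z p : ℕ} (h : p ∈ primesUpTo Z) : p.Prime := (mem_filter.1 h).2

lemma le_of_mem_primesUpTo {Z p : ℕ} (h : p ∈ primesUpTo Z) : p ≤ Z :=
  (mem_Icc.1 (mem_filter.1 h).1).2

/-- The `FT S`-sum of a nonnegative jointly multiplicative function. -/
lemma tsum_FT_le {F : Tup → ℝ} (hF : IsJointMult F) (hF0 : ∀ t, 0 ≤ F t) (S : Finset ℕ)
    (hS : ∀ p ∈ S, p.Prime) (x : ℕ → ℝ)
    (hloc : ∀ p ∈ S, (Summable fun e => |F (pw p e)|) ∧ ∑' e, F (pw p e) ≤ 1 + x p) :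
    ∑' t : FT S, ofReal (F t.toTup) ≤ ofReal (exp (∑ p ∈ S, x p)) := by
  obtain ⟨h1, h2⟩ := hF.summable_and_tsum S (fun p hp => (hloc p hp).1) hS
  simp only [abs_of_nonneg (hF0 _)] at h1
  rw [← ENNReal.ofReal_tsum_of_nonneg (fun t => hF0 _) h1, h2]
  refine ofReal_le_ofReal ?_
  rw [Real.exp_sum]
  refine Finset.prod_le_prod (fun p _ => tsum_nonneg fun e => hF0 _) fun p hp => ?_
  exact (hloc p hp).2.trans (by have := add_one_le_exp (x p); linarith)

/-- Rankin's bound: over `Z`-smooth tuples, the majorant twisted by `N^s` with `Z^s ≤ 3/2` is at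
most a power of `Z`. -/
lemma exists_smooth_twist_bound : ∃ C : ℝ, 0 ≤ C ∧ ∀ (χ : ℕ →* ℝ), IsTrivalued χ → ∀ (Z : ℕ) (s : ℝ),
    0 ≤ s → (Z : ℝ) ^ s ≤ 3 / 2 →
    ∑' t : FT (primesUpTo Z), ofReal (HTup χ s t.toTup) ≤
      ofReal (exp (C * (1 + log Z))) := by
  obtain ⟨C, hC, hloc⟩ := exists_local_twist (ρ := 3 / 4) (by norm_num) (by norm_num)
  refine ⟨C * 14, by positivity, fun χ hχ Z s hs hZ => ?_⟩
  refine (tsum_FT_le (isJointMult_HTup s) (HTup_nonneg hχ s) _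
    (fun p hp => prime_of_mem_primesUpTo hp) (fun p => C * (14 * ((p : ℝ))⁻¹)) fun p hp => ?_).trans ?_
  · have hpp := prime_of_mem_primesUpTo hp
    have hp2 : (2 : ℝ) ≤ p := by exact_mod_cast hpp.two_le
    have hps : (p : ℝ) ^ s ≤ 3 / 2 := le_trans
      (Real.rpow_le_rpow (by linarith) (by exact_mod_cast le_of_mem_primesUpTo hp) hs) hZ
    have hy : (p : ℝ) ^ s / p ≤ 3 / 2 * (p : ℝ)⁻¹ := by
      rw [div_eq_mul_inv]; gcongr
    have hpi : (p : ℝ)⁻¹ ≤ 1 / 2 := by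
      rw [inv_le_comm₀ (by linarith) (by norm_num)]; norm_num; exact hpp.two_le
    obtain ⟨i1, i2⟩ := hloc χ hχ p hpp s (by linarith)
    refine ⟨i1, i2.trans ?_⟩
    have hr := rConv_nonneg hχ p
    have hr2 : rConv χ p ≤ 2 := by
      have := (rConv_prime_pow_bounds hχ hpp 1).2
      rw [pow_one] at this; norm_num at this; linarith
    have hy0 : 0 ≤ (p : ℝ) ^ s / p := by positivity
    have hpi0 : 0 < (p : ℝ)⁻¹ := by positivity
    gcongr
    nlinarith
  · refine ofReal_le_ofReal (exp_le_exp.2 ?_)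
    rw [← mul_sum, ← mul_sum, mul_assoc]
    gcongr
    refine le_trans ?_ (sum_inv_Icc_le Z)
    exact Finset.sum_le_sum_of_subset_of_nonneg (Finset.filter_subset _ _) fun _ _ _ => by positivity

open scoped Classical in
/-- The majorant twisted by `N^{2/5}`, on tuples with inert prime factors only. -/
def minusE (χ : ℕ →* ℝ) (t : Tup) : ℝ≥0∞ :=
  if TMinus χ t then ofReal (HTup χ (2 / 5) t) else 0

/-- At inert primes the majorant vanishes to first order, so its sum over inert tuples converges
with room to spare. -/
lemma exists_minus_bound : ∃ C : ℝ≥0∞, C ≠ ⊤ ∧ ∀ (χ : ℕ →* ℝ), IsTrivalued χ →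
    ∑' t, minusE χ t ≤ C := by
  have hρ1 : (2 : ℝ) ^ (-(3 / 5) : ℝ) < 1 := Real.rpow_lt_one_of_one_lt_of_neg one_lt_two (by norm_num)
  obtain ⟨C, hC, hloc⟩ := exists_local_twist (ρ := (2 : ℝ) ^ (-(3 / 5) : ℝ)) (by positivity) hρ1
  have hsum : Summable fun n : ℕ => C * (n : ℝ) ^ (-(6 / 5) : ℝ) :=
    (Real.summable_nat_rpow.2 (by norm_num)).mul_left C
  refine ⟨ofReal (exp (∑' n : ℕ, C * (n : ℝ) ^ (-(6 / 5) : ℝ))), ENNReal.ofReal_ne_top,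
    fun χ hχ => ?_⟩
  rw [ENNReal.tsum_eq_iSup_sum]
  refine iSup_le fun s => ?_
  classical
  set S : Finset ℕ := (s.biUnion fun t => (tN t).primeFactors).filter fun p => χ p = -1
  have hS : ∀ p ∈ S, p.Prime := fun p hp => by
    obtain ⟨t, _, ht⟩ := Finset.mem_biUnion.1 (mem_filter.1 hp).1
    exact Nat.prime_of_mem_primeFactors ht
  have hmem : ∀ t ∈ s, TMinus χ t → t ∈ Set.range (FT.toTup (S := S)) := by
    intro t hts ht
    have hN := ht.isMinus_tN
    have hm : ∀ m, IsMinus χ m → m ∣ tN t → m ∈ Nat.factoredNumbers S := by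
      intro m hm hmt
      refine Nat.mem_factoredNumbers_iff_forall_le.2 ⟨hm.1, fun p _ hp hpm => ?_⟩
      refine mem_filter.2 ⟨Finset.mem_biUnion.2 ⟨t, hts, ?_⟩, hm.2 p hp hpm⟩
      exact Nat.mem_primeFactors.2 ⟨hp, hpm.trans hmt, hN.1⟩
    obtain ⟨d, a, b, g, n⟩ := t
    refine ⟨(⟨d, hm d ht.1 ⟨a * b * g * n, ?_⟩⟩, ⟨a, hm a ht.2.1 ⟨d * b * g * n, ?_⟩⟩,
      ⟨b, hm b ht.2.2.1 ⟨d * a * g * n, ?_⟩⟩, ⟨g, hm g ht.2.2.2.1 ⟨d * a * b * n, ?_⟩⟩,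
      ⟨n, hm n ht.2.2.2.2 ⟨d * a * b * g, ?_⟩⟩), rfl⟩ <;> simp only [tN] <;> ring
  calc ∑ t ∈ s, minusE χ t ≤ ∑ t ∈ s,
        (Set.range (FT.toTup (S := S))).indicator (fun t => ofReal (HTup χ (2 / 5) t)) t := by
        refine sum_le_sum fun t ht => ?_
        rw [minusE]
        split_ifs with h
        · rw [Set.indicator_of_mem (hmem t ht h)]
        · exact zero_le
    _ ≤ ∑' t, (Set.range (FT.toTup (S := S))).indicator
          (fun t => ofReal (HTup χ (2 / 5) t)) t := ENNReal.sum_le_tsum _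
    _ = ∑' t : FT S, ofReal (HTup χ (2 / 5) t.toTup) := by
        rw [← tsum_subtype, tsum_range (fun t => ofReal (HTup χ (2 / 5) t))
          FT.toTup_injective]
    _ ≤ ofReal (exp (∑ p ∈ S, C * (p : ℝ) ^ (-(6 / 5) : ℝ))) := by
        refine tsum_FT_le (isJointMult_HTup _) (HTup_nonneg hχ _) S hS _ fun p hp => ?_
        have hpp := hS p hp
        have hp0 : (0 : ℝ) < p := by exact_mod_cast hpp.pos
        have hy : (p : ℝ) ^ (2 / 5 : ℝ) / p = (p : ℝ) ^ (-(3 / 5) : ℝ) := by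
          rw [← Real.rpow_sub_one hp0.ne']; norm_num
        obtain ⟨i1, i2⟩ := hloc χ hχ p hpp (2 / 5) (by
          rw [hy]
          exact Real.rpow_le_rpow_of_nonpos two_pos (by exact_mod_cast hpp.two_le) (by norm_num))
        refine ⟨i1, i2.trans_eq ?_⟩
        rw [rConv_prime hpp, (mem_filter.1 hp).2, hy, ← rpow_natCast, ← rpow_mul hp0.le]
        norm_num
    _ ≤ _ := by
        refine ofReal_le_ofReal (exp_le_exp.2 ?_)
        exact hsum.sum_le_tsum _ fun n _ => by positivity

/-! ### The majorant inside and outside a box -/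

/-- The tuples with `d a b g ≤ D²⁴` and `n ≤ D⁷`. -/
def InBox (D : ℕ) (t : Tup) : Prop :=
  t.1 * t.2.1 * t.2.2.1 * t.2.2.2.1 ≤ D ^ 24 ∧ t.2.2.2.2 ≤ D ^ 7

lemma inBox_mul {D : ℕ} {x y : Tup} (hy : tN y ≠ 0) (h0 : tN y ^ 2 ≤ D ^ 5) (h1 : x.1 ≤ D ^ 4)
    (h2 : x.2.1 ≤ D ^ 8) (h3 : x.2.2.1 ≤ D ^ 8) (h4 : x.2.2.2.1 ^ 2 ≤ D ^ 3) (h5 : x.2.2.2.2 ≤ D ^ 4)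
    (hD : 1 ≤ D) : InBox D (x * y) := by
  obtain ⟨y1, y2, y3, y4, y5⟩ := tN_ne_zero.1 hy
  set M := y.1 * y.2.1 * y.2.2.1 * y.2.2.2.1
  have hN : tN y = M * y.2.2.2.2 := rfl
  have hM : M ≤ tN y := by rw [hN]; exact Nat.le_mul_of_pos_right _ (Nat.pos_of_ne_zero y5)
  have hn : y.2.2.2.2 ≤ tN y := by
    rw [hN]; refine Nat.le_mul_of_pos_left _ (Nat.pos_of_ne_zero ?_)
    exact mul_ne_zero (mul_ne_zero (mul_ne_zero y1 y2) y3) y4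
  constructor
  · refine (Nat.pow_le_pow_iff_left two_ne_zero).1 ?_
    calc _ = (x.1 * x.2.1 * x.2.2.1) ^ 2 * x.2.2.2.1 ^ 2 * M ^ 2 := by
          simp only [Prod.fst_mul, Prod.snd_mul, M]; ring
      _ ≤ (D ^ 4 * D ^ 8 * D ^ 8) ^ 2 * D ^ 3 * D ^ 5 :=
          Nat.mul_le_mul (by gcongr) ((Nat.pow_le_pow_left hM 2).trans h0)
      _ = (D ^ 24) ^ 2 := by ring
  · refine (Nat.pow_le_pow_iff_left two_ne_zero).1 ?_
    calc _ = x.2.2.2.2 ^ 2 * y.2.2.2.2 ^ 2 := by simp only [Prod.snd_mul]; ring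
      _ ≤ (D ^ 4) ^ 2 * D ^ 5 :=
          Nat.mul_le_mul (by gcongr) ((Nat.pow_le_pow_left hn 2).trans h0)
      _ ≤ (D ^ 4) ^ 2 * D ^ 6 := by gcongr; norm_num
      _ = (D ^ 7) ^ 2 := by ring

lemma FE_tSplit (t : Tup) (ht : tN t ≠ 0) (hχ : IsTrivalued χ) (σ : ℝ) :
    FE χ σ t = FE χ σ (tSplit χ t).1 * FE χ σ (tSplit χ t).2 := by
  have h := (isJointMult_HTup (χ := χ) (-σ)).2 _ _
    ((tPlus_tSplit (χ := χ) t).isPlus_tN.coprime (tMinus_tSplit (χ := χ) t).isMinus_tN)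
  rw [tSplit_mul ht] at h
  change ofReal (HTup χ (-σ) t) = ofReal (HTup χ (-σ) _) *
    ofReal (HTup χ (-σ) _)
  rw [← ofReal_mul (HTup_nonneg hχ (-σ) _), h]

/-- Total mass of the majorant, and its mass outside the box, in terms of the sum `R` of
`r(n) n^{-1-σ}` and its tail `T` beyond `D²`. -/
lemma exists_majorant : ∃ C : ℝ≥0∞, C ≠ ⊤ ∧ ∀ (χ : ℕ →* ℝ), IsTrivalued χ → ∀ D : ℕ, 1 ≤ D →
    ∀ σ : ℝ, 0 < σ → ∀ R T : ℝ≥0∞, ∑' n, rE χ σ n = R →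
    ∑' n, (if D ^ 2 < n then rE χ σ n else 0) = T →
    ∑' t, FE χ σ t ≤ C * R ^ 12 ∧
    ∑' t, {t | InBox D t}ᶜ.indicator (FE χ σ) t ≤
      C * (R ^ 11 * T + R ^ 12 * ofReal (1 / D)) := by
  obtain ⟨Cm, hCm, hminus⟩ := exists_minus_bound
  obtain ⟨Cr, hCr, hrE⟩ := exists_rE_le (σ := 1 / 3) (by norm_num)
  refine ⟨20 * Cm * Cr ^ 4, by finiteness, fun χ hχ D hD σ hσ R T hR hT => ?_⟩
  have hDr : (1 : ℝ) ≤ D := by exact_mod_cast hD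
  set δ : ℝ≥0∞ := ofReal (1 / D)
  -- one-variable sums and tails
  obtain ⟨s1, s2⟩ := tsum_le_of_conv (sqE_le hχ σ) (D ^ 2)
  obtain ⟨c1, c2⟩ := tsum_le_of_conv (cubeE_le hχ σ) (D ^ 4)
  rw [hR] at s1 s2
  rw [hT, ← pow_mul] at s2
  rw [← pow_mul] at c2
  norm_num at s2 c2
  set γ : ℕ → ℝ≥0∞ := fun g => ofReal ((g : ℝ) ^ (-(2 / 3) : ℝ)) * cubeE χ (1 / 3) g
  have hc3 : ∑' n, cubeE χ (1 / 3) n ≤ Cr ^ 4 := by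
    have a1 := (tsum_le_of_conv (sqE_le hχ (1 / 3)) 0).1
    have a2 := (tsum_le_of_conv (cubeE_le hχ (1 / 3)) 0).1
    calc _ ≤ _ := a2
      _ ≤ ((∑' n, rE χ (1 / 3) n) ^ 2) ^ 2 := by gcongr
      _ ≤ (Cr ^ 2) ^ 2 := by gcongr; exact hrE χ hχ
      _ = Cr ^ 4 := by ring
  have hγ1 : ∑' n, γ n ≤ Cr ^ 4 := by
    refine le_trans (ENNReal.tsum_le_tsum fun g => ?_) hc3
    rcases Nat.eq_zero_or_pos g with rfl | hg
    · simp only [γ]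
      rw [Nat.cast_zero, Real.zero_rpow (by norm_num)]; simp
    · refine mul_le_of_le_one_left' ?_
      rw [← ENNReal.ofReal_one]
      exact ofReal_le_ofReal (Real.rpow_le_one_of_one_le_of_nonpos
        (by exact_mod_cast hg) (by norm_num))
  have hγ2 : ∑' n, (if D ^ 3 < n ^ 2 then γ n else 0) ≤ δ * Cr ^ 4 := by
    refine le_trans (ENNReal.tsum_le_tsum (g := fun g => δ * cubeE χ (1 / 3) g) fun g => ?_)
      (by rw [ENNReal.tsum_mul_left]; gcongr)
    split_ifs with hg
    · simp only [γ]
      gcongr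
      refine ofReal_le_ofReal ?_
      have hg' : ((D : ℝ) ^ 3) ≤ (g : ℝ) ^ 2 := by exact_mod_cast hg.le
      have h2 : (D : ℝ) ≤ (g : ℝ) ^ (2 / 3 : ℝ) := by
        have h3 := Real.rpow_le_rpow (by positivity) hg' (by norm_num : (0 : ℝ) ≤ 1 / 3)
        rw [← rpow_natCast, ← rpow_natCast, ← rpow_mul (by positivity),
          ← rpow_mul (by positivity)] at h3
        norm_num at h3
        exact h3
      rw [rpow_neg (by positivity), one_div]
      exact inv_anti₀ (by positivity) h2
    · exact zero_le
  -- the pointwise bound for the non-inert part, with an indicator on one variable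
  set A : (ℕ → ℝ≥0∞) → (ℕ → ℝ≥0∞) → (ℕ → ℝ≥0∞) → (ℕ → ℝ≥0∞) → (ℕ → ℝ≥0∞) → Tup → ℝ≥0∞ :=
    fun f₁ f₂ f₃ f₄ f₅ t => f₁ t.1 * (f₂ t.2.1 * (f₃ t.2.2.1 * (f₄ t.2.2.2.1 * f₅ t.2.2.2.2)))
  set α := sqE χ σ
  set β := cubeE χ σ
  set α' : ℕ → ℝ≥0∞ := fun n => if D ^ 4 < n then α n else 0
  set β' : ℕ → ℝ≥0∞ := fun n => if D ^ 8 < n then β n else 0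
  set γ' : ℕ → ℝ≥0∞ := fun n => if D ^ 3 < n ^ 2 then γ n else 0
  have hβ : ∑' n, β n ≤ R ^ 4 := by
    calc _ ≤ _ := c1
      _ ≤ (R ^ 2) ^ 2 := by gcongr
      _ = _ := by ring
  have hβ' : ∑' n, β' n ≤ 4 * R ^ 3 * T := by
    calc _ ≤ _ := c2
      _ ≤ 2 * R ^ 2 * (2 * R * T) := by gcongr
      _ = _ := by ring
  have hA0 : ∑' t, A α β β γ α t ≤ Cr ^ 4 * R ^ 12 := by
    rw [tsum_tup_mul]
    calc _ ≤ R ^ 2 * (R ^ 4 * (R ^ 4 * (Cr ^ 4 * R ^ 2))) := by gcongr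
      _ = _ := by ring
  have hA1 : ∑' t, A α' β β γ α t ≤ Cr ^ 4 * (2 * (R ^ 11 * T)) := by
    rw [tsum_tup_mul]
    calc _ ≤ (2 * R * T) * (R ^ 4 * (R ^ 4 * (Cr ^ 4 * R ^ 2))) := by gcongr
      _ = _ := by ring
  have hA2 : ∑' t, A α β' β γ α t ≤ Cr ^ 4 * (4 * (R ^ 11 * T)) := by
    rw [tsum_tup_mul]
    calc _ ≤ R ^ 2 * ((4 * R ^ 3 * T) * (R ^ 4 * (Cr ^ 4 * R ^ 2))) := by gcongr
      _ = _ := by ring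
  have hA3 : ∑' t, A α β β' γ α t ≤ Cr ^ 4 * (4 * (R ^ 11 * T)) := by
    rw [tsum_tup_mul]
    calc _ ≤ R ^ 2 * (R ^ 4 * ((4 * R ^ 3 * T) * (Cr ^ 4 * R ^ 2))) := by gcongr
      _ = _ := by ring
  have hA4 : ∑' t, A α β β γ' α t ≤ Cr ^ 4 * (R ^ 12 * δ) := by
    rw [tsum_tup_mul]
    calc _ ≤ R ^ 2 * (R ^ 4 * (R ^ 4 * ((δ * Cr ^ 4) * R ^ 2))) := by gcongr
      _ = _ := by ring
  have hA5 : ∑' t, A α β β γ α' t ≤ Cr ^ 4 * (2 * (R ^ 11 * T)) := by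
    rw [tsum_tup_mul]
    calc _ ≤ R ^ 2 * (R ^ 4 * (R ^ 4 * (Cr ^ 4 * (2 * R * T)))) := by gcongr
      _ = _ := by ring
  have hplus : ∀ t : Tup, tN t ≠ 0 → FE χ σ (tSplit χ t).1 ≤ A α β β γ α (tSplit χ t).1 := by
    intro t ht
    refine FE_le_of_tPlus hχ (tPlus_tSplit t) ?_ hσ
    exact tN_ne_zero.2 ⟨plusPart_ne_zero _, plusPart_ne_zero _, plusPart_ne_zero _,
      plusPart_ne_zero _, plusPart_ne_zero _⟩
  have hmE : ∀ t : Tup, minusE χ (tSplit χ t).2 = ofReal (HTup χ (2 / 5) (tSplit χ t).2) :=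
    fun t => if_pos (tMinus_tSplit t)
  have hone : ∀ t : Tup, (1 : ℝ) ≤ (tN (tSplit χ t).2 : ℝ) := fun t => by
    exact_mod_cast Nat.pos_of_ne_zero (tMinus_tSplit t).isMinus_tN.1
  have hm1 : ∀ t : Tup, FE χ σ (tSplit χ t).2 ≤ minusE χ (tSplit χ t).2 := by
    intro t
    rw [hmE, FE, HTup]
    refine ofReal_le_ofReal (mul_le_mul_of_nonneg_left ?_ (FTup_nonneg hχ _))
    exact Real.rpow_le_rpow_of_exponent_le (hone t) (by linarith)
  have hm2 : ∀ t : Tup, D ^ 5 < tN (tSplit χ t).2 ^ 2 →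
      FE χ σ (tSplit χ t).2 ≤ δ * minusE χ (tSplit χ t).2 := by
    intro t ht
    rw [hmE, FE, HTup, ← ofReal_mul (by positivity)]
    refine ofReal_le_ofReal ?_
    have h1 : (D : ℝ) ≤ (tN (tSplit χ t).2 : ℝ) ^ (2 / 5 : ℝ) := by
      have h2 : (D : ℝ) ^ 5 ≤ (tN (tSplit χ t).2 : ℝ) ^ 2 := by exact_mod_cast ht.le
      have h3 := Real.rpow_le_rpow (by positivity) h2 (by norm_num : (0 : ℝ) ≤ 1 / 5)
      rw [← rpow_natCast, ← rpow_natCast, ← rpow_mul (by positivity),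
        ← rpow_mul (by positivity)] at h3
      norm_num at h3
      exact h3
    have h4 : (tN (tSplit χ t).2 : ℝ) ^ (-σ) ≤ 1 :=
      Real.rpow_le_one_of_one_le_of_nonpos (hone t) (by linarith)
    have h5 : 1 ≤ 1 / (D : ℝ) * (tN (tSplit χ t).2 : ℝ) ^ (2 / 5 : ℝ) := by
      rw [one_div_mul_eq_div, one_le_div (by linarith)]; exact h1
    have h6 := FTup_nonneg hχ (tSplit χ t).2
    calc _ ≤ FTup χ (tSplit χ t).2 * 1 := by gcongr
      _ ≤ FTup χ (tSplit χ t).2 * (1 / (D : ℝ) * (tN (tSplit χ t).2 : ℝ) ^ (2 / 5 : ℝ)) := by gcongr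
      _ = _ := by ring
  -- summation over all pairs of a non-inert and an inert tuple
  have hpairs : ∀ (H : Tup → ℝ≥0∞) (B : Tup → ℝ≥0∞), (∀ t, tN t = 0 → H t = 0) →
      (∀ t, tN t ≠ 0 → H t ≤ B (tSplit χ t).1 * minusE χ (tSplit χ t).2) →
      ∑' t, H t ≤ (∑' t, B t) * Cm := by
    intro H B hH0 hHB
    have hinj : Function.Injective fun t : {t : Tup | tN t ≠ 0} => tSplit χ (t : Tup) := by
      intro t t' h
      simp only at h
      exact Subtype.ext (by rw [← tSplit_mul (χ := χ) t.2, ← tSplit_mul (χ := χ) t'.2, h])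
    calc ∑' t, H t = ∑' t : {t : Tup | tN t ≠ 0}, H t := by
          rw [tsum_subtype]
          refine tsum_congr fun t => ?_
          by_cases h : tN t = 0
          · rw [hH0 t h]; simp [Set.indicator, h]
          · rw [Set.indicator_of_mem (show t ∈ {t : Tup | tN t ≠ 0} from h)]
      _ ≤ ∑' t : {t : Tup | tN t ≠ 0}, B (tSplit χ (t : Tup)).1 * minusE χ (tSplit χ (t : Tup)).2 :=
          ENNReal.tsum_le_tsum fun t => hHB t t.2
      _ ≤ ∑' x : Tup × Tup, B x.1 * minusE χ x.2 :=
          ENNReal.tsum_comp_le_tsum_of_injective hinj fun x : Tup × Tup => B x.1 * minusE χ x.2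
      _ = (∑' t, B t) * ∑' t, minusE χ t := tsum_prod_mul _ _
      _ ≤ _ := by gcongr; exact hminus χ hχ
  have hFE0 : ∀ t, tN t = 0 → FE χ σ t = 0 := by
    intro t ht
    rw [FE, ht, Nat.cast_zero, Real.zero_rpow (by linarith), mul_zero, ENNReal.ofReal_zero]
  constructor
  · refine (hpairs _ (A α β β γ α) hFE0 fun t ht => ?_).trans ?_
    · rw [FE_tSplit t ht hχ]
      exact mul_le_mul' (hplus t ht) (hm1 t)
    · calc _ ≤ Cr ^ 4 * R ^ 12 * Cm := by gcongr
        _ = 1 * Cm * Cr ^ 4 * R ^ 12 := by ring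
        _ ≤ _ := by gcongr; norm_num
  · set B : Tup → ℝ≥0∞ := fun t => δ * A α β β γ α t + A α' β β γ α t + A α β' β γ α t +
      A α β β' γ α t + A α β β γ' α t + A α β β γ α' t
    refine (hpairs _ B (fun t ht => ?_) fun t ht => ?_).trans ?_
    · by_cases h : t ∈ {t | InBox D t}ᶜ
      · rw [Set.indicator_of_mem h, hFE0 t ht]
      · rw [Set.indicator_of_notMem h]
    · by_cases h : InBox D t
      · rw [Set.indicator_of_notMem (by simpa using h)]; exact zero_le
      rw [Set.indicator_of_mem (by simpa using h), FE_tSplit t ht hχ]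
      have h1 := hplus t ht
      have h2 := hm1 t
      set x := (tSplit χ t).1 with hx
      set y := (tSplit χ t).2 with hy
      have key : ∀ A' : ℝ≥0∞, A α β β γ α x = A' → A' ≤ B x →
          FE χ σ x * FE χ σ y ≤ B x * minusE χ y := fun A' e hA' =>
        mul_le_mul' ((h1.trans e.le).trans hA') h2
      by_cases b0 : D ^ 5 < tN y ^ 2
      · calc _ ≤ A α β β γ α x * (δ * minusE χ y) := mul_le_mul' h1 (hm2 t b0)
          _ = δ * A α β β γ α x * minusE χ y := by ring
          _ ≤ _ := by
              gcongr
              simp only [B, add_assoc]; exact le_self_add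
      by_cases b1 : D ^ 4 < x.1
      · refine key (A α' β β γ α x) (by simp only [A, α', if_pos b1]) ?_
        simp only [B, add_assoc]
        exact le_add_left le_self_add
      by_cases b2 : D ^ 8 < x.2.1
      · refine key (A α β' β γ α x) (by simp only [A, β', if_pos b2]) ?_
        simp only [B, add_assoc]
        exact le_add_left (le_add_left le_self_add)
      by_cases b3 : D ^ 8 < x.2.2.1
      · refine key (A α β β' γ α x) (by simp only [A, β', if_pos b3]) ?_
        simp only [B, add_assoc]
        exact le_add_left (le_add_left (le_add_left le_self_add))
      by_cases b4 : D ^ 3 < x.2.2.2.1 ^ 2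
      · refine key (A α β β γ' α x) (by simp only [A, γ', if_pos b4]) ?_
        simp only [B, add_assoc]
        exact le_add_left (le_add_left (le_add_left (le_add_left le_self_add)))
      by_cases b5 : D ^ 4 < x.2.2.2.2
      · refine key (A α β β γ α' x) (by simp only [A, α', if_pos b5]) ?_
        simp only [B, add_assoc]
        exact le_add_left (le_add_left (le_add_left (le_add_left le_add_self)))
      exfalso
      refine h ?_
      rw [← tSplit_mul (χ := χ) ht]
      exact inBox_mul (tMinus_tSplit t).isMinus_tN.1 (not_lt.1 b0) (not_lt.1 b1) (not_lt.1 b2)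
        (not_lt.1 b3) (not_lt.1 b4) (not_lt.1 b5) hD
    · simp only [B]
      rw [ENNReal.tsum_add, ENNReal.tsum_add, ENNReal.tsum_add, ENNReal.tsum_add, ENNReal.tsum_add,
        ENNReal.tsum_mul_left]
      calc _ ≤ (δ * (Cr ^ 4 * R ^ 12) + Cr ^ 4 * (2 * (R ^ 11 * T)) + Cr ^ 4 * (4 * (R ^ 11 * T)) +
            Cr ^ 4 * (4 * (R ^ 11 * T)) + Cr ^ 4 * (R ^ 12 * δ) + Cr ^ 4 * (2 * (R ^ 11 * T))) * Cm := by
            gcongr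
        _ = 12 * (Cm * Cr ^ 4 * (R ^ 11 * T)) + 2 * (Cm * Cr ^ 4 * (R ^ 12 * δ)) := by ring
        _ ≤ 20 * (Cm * Cr ^ 4 * (R ^ 11 * T)) + 20 * (Cm * Cr ^ 4 * (R ^ 12 * δ)) := by
            gcongr <;> norm_num
        _ = _ := by ring

end

/-- The majorant at exponents `σ ≫ ℓ⁻²`, where `ℓ` dominates `log D`: its mass is a power of `ℓ`, and
outside the box there is an additional factor `L(1,χ)`. -/
lemma exists_majorant_log {B : ℝ} (hB : 1 ≤ B) : ∃ C : ℝ, 0 ≤ C ∧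
    ∀ {χ : ℕ →* ℝ} {D : ℕ} {L L' L'' : ℝ}, CharData χ D L L' L'' → L ≤ 1 → ∀ ℓ σ : ℝ, 1 ≤ ℓ →
    log D ≤ ℓ → 0 < σ → σ ≤ 1 → 1 / σ ≤ B * ℓ ^ 2 →
    ∑' t, FE χ σ t ≤ ofReal (C * ℓ ^ 24) ∧
    ∑' t, {t | InBox D t}ᶜ.indicator (FE χ σ) t ≤ ofReal (C * (L * ℓ ^ 24)) := by
  obtain ⟨C, hC, hmaj⟩ := exists_majorant
  set c : ℝ := C.toReal
  have hCc : C = ofReal c := (ENNReal.ofReal_toReal hC).symm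
  have hc : 0 ≤ c := ENNReal.toReal_nonneg
  set A : ℝ := 12336 * (1 + B) with hA
  have hA0 : 0 ≤ A := by positivity
  refine ⟨c * A ^ 12 * 200, by positivity, fun {χ D L L' L''} h hL1 ℓ σ hℓ hDℓ hσ hσ1 hσB => ?_⟩
  have hD2 := h.two_le_cast
  have hL0 := h.L_pos
  have hlD : 0 ≤ log D := log_natCast_nonneg D
  obtain ⟨m1, m2⟩ := hmaj χ h.tri D (by have := h.two_le; omega) σ hσ _ _ rfl rfl
  have hR : ∑' n, rE χ σ n ≤ ofReal (A * ℓ ^ 2) := by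
    refine (h.total_le hσ hσ1).trans (ofReal_le_ofReal ?_)
    have h1 : log D ^ 2 ≤ ℓ ^ 2 := by gcongr
    have h2 : L / σ ≤ B * ℓ ^ 2 := by
      calc L / σ ≤ 1 / σ := by gcongr
        _ ≤ _ := hσB
    rw [hA]; nlinarith
  have hT : ∑' n, (if D ^ 2 < n then rE χ σ n else 0) ≤ ofReal (A * (L * ℓ ^ 2)) := by
    refine (h.tail_le hσ hσ1).trans (ofReal_le_ofReal ?_)
    rw [hA, mul_div_assoc, div_eq_mul_one_div]
    have : 0 ≤ L * ℓ ^ 2 := by positivity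
    have h3 : L * (1 / σ) ≤ L * (B * ℓ ^ 2) := by gcongr
    nlinarith
  have hDL : 1 / (D : ℝ) ≤ 128 * L := by
    have := h.L_ge
    rw [div_le_iff₀ (by positivity)] at this ⊢
    linarith
  constructor
  · refine m1.trans ?_
    calc C * (∑' n, rE χ σ n) ^ 12 ≤ ofReal c * (ofReal (A * ℓ ^ 2)) ^ 12 := by
          rw [hCc]; gcongr
      _ = ofReal (c * (A * ℓ ^ 2) ^ 12) := by
          rw [← ENNReal.ofReal_pow (by positivity), ← ofReal_mul hc]
      _ ≤ _ := by
          refine ofReal_le_ofReal ?_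
          have : 0 ≤ c * A ^ 12 * ℓ ^ 24 := by positivity
          nlinarith
  · refine m2.trans ?_
    calc _ ≤ ofReal c * ((ofReal (A * ℓ ^ 2)) ^ 11 * ofReal (A * (L * ℓ ^ 2)) +
          (ofReal (A * ℓ ^ 2)) ^ 12 * ofReal (128 * L)) := by
          rw [hCc]; gcongr
      _ = ofReal (c * ((A * ℓ ^ 2) ^ 11 * (A * (L * ℓ ^ 2)) + (A * ℓ ^ 2) ^ 12 * (128 * L))) := by
          rw [← ENNReal.ofReal_pow (by positivity), ← ENNReal.ofReal_pow (by positivity),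
            ← ofReal_mul (by positivity), ← ofReal_mul (by positivity),
            ← ENNReal.ofReal_add (by positivity) (by positivity), ← ofReal_mul hc]
      _ ≤ _ := by
          refine ofReal_le_ofReal ?_
          have : 0 ≤ c * A ^ 12 * (L * ℓ ^ 24) := by positivity
          nlinarith

lemma log_weight_le {ℓ v s : ℝ} (hℓ : 1 ≤ ℓ) (hs : 2 / 5 / ℓ ≤ s) (hv : 1 ≤ v) :
    (1 + v) ^ 2 * exp (-(s * v)) ≤ 200 * ℓ ^ 2 * exp (-(v / (5 * ℓ))) := by
  have hℓ0 : 0 < ℓ := by linarith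
  set x := v / (5 * ℓ) with hx
  have hx0 : 0 < x := by positivity
  have hvx : v = 5 * ℓ * x := by rw [hx]; field_simp
  have h1 : exp (-(s * v)) ≤ exp (-x) * exp (-x) := by
    rw [← exp_add]
    refine exp_le_exp.2 ?_
    have h2 : 2 / 5 / ℓ * v ≤ s * v := by gcongr
    have h3 : 2 / 5 / ℓ * v = 2 * x := by rw [hx]; field_simp
    linarith
  have h4 : (1 + v) ^ 2 ≤ 100 * ℓ ^ 2 * x ^ 2 := by
    have : (1 + v) ^ 2 ≤ (2 * v) ^ 2 := by gcongr; linarith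
    rw [hvx] at this ⊢
    nlinarith
  have h5 : x ^ 2 * exp (-x) ≤ 2 := by
    have h6 := Real.quadratic_le_exp_of_nonneg hx0.le
    have h7 : exp x * exp (-x) = 1 := by rw [← exp_add]; simp
    have h8 := exp_pos (-x)
    nlinarith
  have h9 := exp_pos (-x)
  calc _ ≤ 100 * ℓ ^ 2 * x ^ 2 * (exp (-x) * exp (-x)) := by gcongr
    _ = 100 * ℓ ^ 2 * (x ^ 2 * exp (-x)) * exp (-x) := by ring
    _ ≤ 100 * ℓ ^ 2 * 2 * exp (-x) := by gcongr
    _ = _ := by ring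

/-- Over `D²⁴`-smooth tuples outside the box, the majorant with a logarithmic weight has mass
`O(L(1,χ) ℓ²⁸)`. Tuples with `log N ≤ B ℓ²` are handled by the bound for general tuples, the others
by Rankin's trick. -/
lemma exists_smooth_outside : ∃ C : ℝ, 0 ≤ C ∧
    ∀ {χ : ℕ →* ℝ} {D : ℕ} {L L' L'' : ℝ}, CharData χ D L L' L'' → L ≤ 1 → ∀ ℓ : ℝ, 1 ≤ ℓ →
    24 * log D ≤ ℓ →
    ∑' t : FT (primesUpTo (D ^ 24)), {t | InBox D t}ᶜ.indicator
      (fun t => ofReal (FTup χ t * (1 + log (tN t)) ^ 2)) t.toTup ≤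
      ofReal (C * (L * ℓ ^ 28)) := by
  obtain ⟨C₁, hC₁, hsm⟩ := exists_smooth_twist_bound
  set B : ℝ := 5 * (2 * C₁ + 1) with hB
  have hB1 : 1 ≤ B := by rw [hB]; linarith
  obtain ⟨C₂, hC₂, hmaj⟩ := exists_majorant_log hB1
  refine ⟨4 * B ^ 2 * 3 * C₂ + 200 * 128, by positivity, fun {χ D L L' L''} h hL1 ℓ hℓ hDℓ => ?_⟩
  have hD2 := h.two_le_cast
  have hL0 := h.L_pos
  have hℓ0 : 0 < ℓ := by linarith
  have hlD : log 2 ≤ log D := log_le_log two_pos hD2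
  have hl2 := Real.log_two_gt_d9
  have hZ : log ((D ^ 24 : ℕ) : ℝ) = 24 * log D := by
    push_cast; rw [log_pow]; norm_num
  have hlZ0 : 0 < log ((D ^ 24 : ℕ) : ℝ) := by rw [hZ]; linarith
  have hDL : 1 / (D : ℝ) ≤ 128 * L := by
    have := h.L_ge
    rw [div_le_iff₀ (by positivity)] at this ⊢
    linarith
  have hDpos : (0 : ℝ) < D := by linarith
  have hZpos : (0 : ℝ) < ((D ^ 24 : ℕ) : ℝ) := by push_cast; positivity
  set s : ℝ := log (3 / 2) / log ((D ^ 24 : ℕ) : ℝ) with hs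
  have hl32 : (2 : ℝ) / 5 ≤ log (3 / 2) := by
    rw [le_log_iff_exp_le (by norm_num)]
    have h1 : exp (2 / 5) ^ 5 ≤ (3 / 2 : ℝ) ^ 5 := by
      rw [← Real.exp_nat_mul]
      have h2 : exp ((5 : ℕ) * (2 / 5)) = exp 1 * exp 1 := by
        rw [← exp_add]; norm_num
      rw [h2]
      have := exp_one_lt_d9
      have h3 : exp 1 * exp 1 ≤ 2.7182818286 * 2.7182818286 := by
        gcongr
      norm_num at h3 ⊢
      linarith
    exact le_of_pow_le_pow_left₀ (by norm_num) (by norm_num) h1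
  have hs0 : 0 ≤ s := by positivity
  have hsℓ : 2 / 5 / ℓ ≤ s := by
    rw [hs, div_le_div_iff₀ hℓ0 hlZ0, hZ]
    nlinarith
  have hZs : (((D ^ 24 : ℕ) : ℕ) : ℝ) ^ s ≤ 3 / 2 := by
    rw [rpow_def_of_pos hZpos, hs, mul_div_cancel₀ _ hlZ0.ne',
      Real.exp_log (by norm_num)]
  have hsm' := hsm χ h.tri (D ^ 24) s hs0 hZs
  set σ : ℝ := 1 / (B * ℓ ^ 2) with hσ
  have hℓ2 : 1 ≤ ℓ ^ 2 := one_le_pow₀ hℓ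
  have hBℓ : 1 ≤ B * ℓ ^ 2 := by nlinarith
  have hσ0 : 0 < σ := by positivity
  have hσ1 : σ ≤ 1 := by rw [hσ, div_le_one (by positivity)]; exact hBℓ
  have hmaj' := (hmaj h hL1 ℓ σ hℓ (by linarith) hσ0 hσ1 (by rw [hσ, one_div_one_div])).2
  set ω : ℝ := 200 * ℓ ^ 2 * exp (-((2 * C₁ + 1) * ℓ)) with hω
  have hpt : ∀ t : FT (primesUpTo (D ^ 24)), {t | InBox D t}ᶜ.indicator
      (fun t => ofReal (FTup χ t * (1 + log (tN t)) ^ 2)) t.toTup ≤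
      ofReal (4 * B ^ 2 * ℓ ^ 4 * 3) * {t | InBox D t}ᶜ.indicator (FE χ σ) t.toTup +
        ofReal ω * ofReal (HTup χ s t.toTup) := by
    intro t
    by_cases hb : t.toTup ∈ {t | InBox D t}ᶜ
    swap
    · rw [Set.indicator_of_notMem hb]; exact zero_le
    rw [Set.indicator_of_mem hb, Set.indicator_of_mem hb]
    have hN : (1 : ℝ) ≤ tN t.toTup := by exact_mod_cast tN_toTup_pos t
    have hN0 : (0 : ℝ) < tN t.toTup := by linarith
    have hF := FTup_nonneg h.tri t.toTup
    set v := log (tN t.toTup) with hv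
    have hv0 : 0 ≤ v := log_nonneg hN
    rcases le_total v (B * ℓ ^ 2) with hvB | hvB
    · refine le_add_right ?_
      rw [FE, ← ofReal_mul (by positivity)]
      refine ofReal_le_ofReal ?_
      have h1 : (1 : ℝ) ≤ 3 * (tN t.toTup : ℝ) ^ (-σ) := by
        rw [rpow_def_of_pos hN0, ← hv]
        have h2 : v * -σ ≥ -1 := by
          rw [hσ]
          have : v * (1 / (B * ℓ ^ 2)) ≤ 1 := by
            rw [mul_one_div, div_le_one (by positivity)]; exact hvB
          linarith
        have h3 : exp (-1) ≤ exp (v * -σ) := exp_le_exp.2 h2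
        have h4 : 1 ≤ 3 * exp (-1) := by linarith [le_exp_neg_one]
        linarith
      have h2 : (1 + v) ^ 2 ≤ 4 * B ^ 2 * ℓ ^ 4 := by
        calc (1 + v) ^ 2 ≤ (2 * (B * ℓ ^ 2)) ^ 2 := by gcongr; linarith
          _ = _ := by ring
      calc FTup χ t.toTup * (1 + v) ^ 2 ≤ FTup χ t.toTup * (4 * B ^ 2 * ℓ ^ 4) *
            (3 * (tN t.toTup : ℝ) ^ (-σ)) := by
            have h3 : FTup χ t.toTup * (1 + v) ^ 2 ≤ FTup χ t.toTup * (4 * B ^ 2 * ℓ ^ 4) := by gcongr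
            exact h3.trans (le_mul_of_one_le_right (by positivity) h1)
        _ = _ := by ring
    · refine le_add_left ?_
      rw [← ofReal_mul (by positivity), HTup]
      refine ofReal_le_ofReal ?_
      have h1 := log_weight_le hℓ hsℓ (by linarith : 1 ≤ v)
      have h2 : exp (-(v / (5 * ℓ))) ≤ exp (-((2 * C₁ + 1) * ℓ)) := by
        refine exp_le_exp.2 (neg_le_neg ?_)
        rw [le_div_iff₀ (by positivity)]
        calc _ = B * ℓ ^ 2 := by rw [hB]; ring
          _ ≤ v := hvB
      have h3 : (tN t.toTup : ℝ) ^ s = exp (s * v) := by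
        rw [rpow_def_of_pos hN0, ← hv, mul_comm]
      have h4 : exp (-(s * v)) * exp (s * v) = 1 := by rw [← exp_add]; simp
      have h5 : (1 + v) ^ 2 * exp (-(s * v)) ≤ ω := by
        refine h1.trans ?_
        rw [hω]; gcongr
      rw [h3]
      calc FTup χ t.toTup * (1 + v) ^ 2 = FTup χ t.toTup * ((1 + v) ^ 2 * exp (-(s * v))) *
            exp (s * v) := by
            rw [mul_assoc _ _ (exp (s * v)), mul_assoc ((1 + v) ^ 2), h4, mul_one]
        _ ≤ FTup χ t.toTup * ω * exp (s * v) := by gcongr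
        _ = _ := by ring
  refine (ENNReal.tsum_le_tsum hpt).trans ?_
  rw [ENNReal.tsum_add, ENNReal.tsum_mul_left, ENNReal.tsum_mul_left]
  have hA : ∑' t : FT (primesUpTo (D ^ 24)), {t | InBox D t}ᶜ.indicator (FE χ σ) t.toTup ≤
      ofReal (C₂ * (L * ℓ ^ 24)) :=
    (ENNReal.tsum_comp_le_tsum_of_injective FT.toTup_injective _).trans hmaj'
  calc _ ≤ ofReal (4 * B ^ 2 * ℓ ^ 4 * 3) * ofReal (C₂ * (L * ℓ ^ 24)) +
        ofReal ω * ofReal (exp (C₁ * (1 + log ((D ^ 24 : ℕ) : ℝ)))) := by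
        gcongr
    _ = ofReal (4 * B ^ 2 * ℓ ^ 4 * 3 * (C₂ * (L * ℓ ^ 24)) +
        ω * exp (C₁ * (1 + log ((D ^ 24 : ℕ) : ℝ)))) := by
        rw [← ofReal_mul (by positivity), ← ofReal_mul (by positivity),
          ← ENNReal.ofReal_add (by positivity) (by positivity)]
    _ ≤ _ := by
        refine ofReal_le_ofReal ?_
        have h1 : ω * exp (C₁ * (1 + log ((D ^ 24 : ℕ) : ℝ))) ≤ 200 * ℓ ^ 2 * (128 * L) := by
          rw [hω, mul_assoc, ← exp_add]
          have h2 : exp (-((2 * C₁ + 1) * ℓ) + C₁ * (1 + log ((D ^ 24 : ℕ) : ℝ))) ≤ 128 * L := by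
            refine le_trans ?_ hDL
            rw [one_div, ← Real.exp_log hDpos, ← exp_neg]
            refine exp_le_exp.2 ?_
            rw [hZ]
            have : C₁ * (1 + 24 * log D) ≤ C₁ * (ℓ + ℓ) := by gcongr
            linarith
          gcongr
        have h3 : ℓ ^ 2 ≤ ℓ ^ 28 := pow_le_pow_right₀ hℓ (by norm_num)
        have h4 : L * ℓ ^ 2 ≤ L * ℓ ^ 28 := by gcongr
        nlinarith

/-! ### The local factors of the singular series -/

lemma hasSum_prod_range {β : Type} {f : ℕ × β → ℝ} {K : ℕ} {s : ℕ → ℝ}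
    (h : ∀ i < K, HasSum (fun b => f (i, b)) (s i)) (h0 : ∀ i, K ≤ i → ∀ b, f (i, b) = 0) :
    HasSum f (∑ i ∈ range K, s i) := by
  have h1 : ∀ i ∈ range K, HasSum (fun x : ℕ × β => if x.1 = i then f x else 0) (s i) := by
    intro i hi
    have hinj : Function.Injective (Prod.mk i : β → ℕ × β) := Prod.mk_right_injective i
    rw [← hinj.hasSum_iff]
    · simpa [Function.comp_def] using h i (mem_range.1 hi)
    · rintro ⟨j, b⟩ hj
      refine if_neg fun hji => hj ⟨b, ?_⟩
      simp only at hji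
      rw [hji]
  refine (hasSum_sum h1).congr_fun fun x => ?_
  by_cases hx : x.1 < K
  · rw [Finset.sum_ite_eq, if_pos (mem_range.2 hx)]
  · rw [Finset.sum_ite_eq, if_neg (by simpa using hx)]
    exact h0 x.1 (not_lt.1 hx) x.2

/-- The values of `pairSum` at prime powers. -/
def pairTable (R₁ R₂ : ℝ) : ℕ → ℕ → ℝ
  | 0, 0 => 1
  | 0, 1 => 2 * R₁
  | 0, 2 => R₁ ^ 2 + 2 * R₂
  | 0, 3 => 2 * R₁ * R₂
  | 0, 4 => R₂ ^ 2
  | 1, 0 => R₁ ^ 2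
  | 1, 1 => 2 * R₁ * R₂
  | 1, 2 => R₂ ^ 2
  | 2, 0 => R₂ ^ 2
  | _, _ => 0

lemma pairTable_eq_zero (R₁ R₂ : ℝ) {d A : ℕ} (h : 4 < 2 * d + A) : pairTable R₁ R₂ d A = 0 := by
  unfold pairTable
  split <;> first | omega | rfl

section

variable {χ : ℕ →* ℝ}

lemma pairSum_prime_pow {p : ℕ} (hp : p.Prime) (d A : ℕ) :
    pairSum (rho1Real χ) (p ^ d) (p ^ A) =
      pairTable (rho1Real χ p) (rho1Real χ (p ^ 2)) d A := by
  rw [pairSum, sum_divisorsAntidiagonal_prime_pow hp A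
    (fun x y => rho1Real χ (p ^ d * x) * rho1Real χ (p ^ d * y))]
  simp only [← pow_add]
  by_cases h : 4 < 2 * d + A
  · rw [pairTable_eq_zero _ _ h]
    refine Finset.sum_eq_zero fun i hi => ?_
    have hi := mem_range.1 hi
    by_cases h3 : 3 ≤ d + i
    · rw [rho1Real_prime_pow_of_three_le hp h3, zero_mul]
    · rw [rho1Real_prime_pow_of_three_le hp (by omega : 3 ≤ d + (A - i)), mul_zero]
  · have hd : d ≤ 2 := by omega
    have hA : A ≤ 4 := by omega
    have z3 : rho1Real χ (p ^ 3) = 0 := rho1Real_prime_pow_of_three_le hp le_rfl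
    have z4 : rho1Real χ (p ^ 4) = 0 := rho1Real_prime_pow_of_three_le hp (by norm_num)
    interval_cases d <;> interval_cases A <;> first | omega | skip
    all_goals
      simp [sum_range_succ, pairTable, z3, z4]
      try ring

/-- The local factor as a finite combination of the sums over the powers of `p` dividing `n`. -/
lemma hasSum_local {p : ℕ} (hp : p.Prime) {N : ℕ → ℝ}
    (hN : ∀ i, HasSum (fun n => rConv χ (p ^ (i + n)) * rConv χ (p ^ n) * ((p : ℝ)⁻¹) ^ n) (N i)) :
    HasSum (fun e => fTup χ (pw p e))
      (∑ d ∈ range 3, ∑ a ∈ range 5, ∑ b ∈ range 5, ∑ g ∈ range 2,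
        pairTable (rho1Real χ p) (rho1Real χ (p ^ 2)) d (a + b + g) * (-χ p) ^ g * rConv χ (p ^ b) *
          ((p : ℝ)⁻¹) ^ (d + a + b + 2 * g) * N (a + g)) := by
  have hf : ∀ d a b g n, fTup χ (pw p (d, a, b, g, n)) =
      pairTable (rho1Real χ p) (rho1Real χ (p ^ 2)) d (a + b + g) *
      ((moebius (p ^ g) : ℝ) * χ p ^ g) * rConv χ (p ^ b) *
      ((p : ℝ)⁻¹) ^ (d + a + b + 2 * g) *
      (rConv χ (p ^ (a + g + n)) * rConv χ (p ^ n) * ((p : ℝ)⁻¹) ^ n) := by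
    intro d a b g n
    simp only [fTup, pw, ← pow_add, pairSum_prime_pow hp, map_pow]
    have : tDen (p ^ d, p ^ a, p ^ b, p ^ g, p ^ n) = p ^ (d + a + b + 2 * g + n) := by
      simp only [tDen]; ring
    rw [this]; push_cast
    rw [inv_pow, inv_pow, pow_add _ (d + a + b + 2 * g) n, mul_inv]
    ring
  refine hasSum_prod_range (fun d _ => hasSum_prod_range (fun a _ => hasSum_prod_range (fun b _ =>
    hasSum_prod_range (fun g hg => ?_) ?_) ?_) ?_) ?_
  · have hμ : (moebius (p ^ g) : ℝ) * χ p ^ g = (-χ p) ^ g := by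
      interval_cases g
      · simp
      · simp [moebius_apply_prime hp]
    simp only [hf, hμ]
    exact (hN (a + g)).mul_left _
  · intro g hg n
    rw [hf, moebius_apply_prime_pow hp (by omega), if_neg (by omega)]
    simp
  · rintro b hb ⟨g, n⟩
    rw [hf, pairTable_eq_zero _ _ (by omega)]; simp
  · rintro a ha ⟨b, g, n⟩
    rw [hf, pairTable_eq_zero _ _ (by omega)]; simp
  · rintro d hd ⟨a, b, g, n⟩
    rw [hf, pairTable_eq_zero _ _ (by omega)]; simp

lemma hasSum_geometric_conv_one {p : ℕ} (hp : p.Prime) (h : χ p = 1) (i : ℕ) :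
    HasSum (fun n => rConv χ (p ^ (i + n)) * rConv χ (p ^ n) * ((p : ℝ)⁻¹) ^ n)
      ((1 + (p : ℝ)⁻¹) / (1 - (p : ℝ)⁻¹) ^ 3 + i / (1 - (p : ℝ)⁻¹) ^ 2) := by
  have hp1 : (1 : ℝ) < p := by exact_mod_cast hp.one_lt
  have hx1 : (p : ℝ)⁻¹ < 1 := inv_lt_one_of_one_lt₀ hp1
  have hx : ‖(p : ℝ)⁻¹‖ < 1 := by rwa [norm_of_nonneg (by positivity)]
  have h1 := hasSum_choose_mul_geometric_of_norm_lt_one 1 hx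
  have h2 := hasSum_choose_mul_geometric_of_norm_lt_one 2 hx
  have h3 := (h2.mul_left 2).add (h1.mul_left ((i : ℝ) - 1))
  have hne : 1 - (p : ℝ)⁻¹ ≠ 0 := by linarith
  have h4 : HasSum (fun n => rConv χ (p ^ (i + n)) * rConv χ (p ^ n) * ((p : ℝ)⁻¹) ^ n)
      (2 * (1 / (1 - (p : ℝ)⁻¹) ^ (2 + 1)) + ((i : ℝ) - 1) * (1 / (1 - (p : ℝ)⁻¹) ^ (1 + 1))) := by
    refine h3.congr_fun fun n => ?_
    rw [rConv_prime_pow_of_one hp h, rConv_prime_pow_of_one hp h, Nat.choose_one_right,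
      Nat.cast_choose_two]
    push_cast
    ring
  convert h4 using 1
  obtain ⟨y, hy⟩ : ∃ y, y = 1 - (p : ℝ)⁻¹ := ⟨_, rfl⟩
  rw [show (p : ℝ)⁻¹ = 1 - y by rw [hy]; ring, show 1 - (1 - y) = y by ring]
  rw [← hy] at hne
  field_simp
  ring

lemma hasSum_geometric_conv_zero {p : ℕ} (hp : p.Prime) (h : χ p = 0) (i : ℕ) :
    HasSum (fun n => rConv χ (p ^ (i + n)) * rConv χ (p ^ n) * ((p : ℝ)⁻¹) ^ n)
      (1 - (p : ℝ)⁻¹)⁻¹ := by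
  have hp1 : (1 : ℝ) < p := by exact_mod_cast hp.one_lt
  refine (hasSum_geometric_of_lt_one (by positivity) (inv_lt_one_of_one_lt₀ hp1)).congr_fun
    fun n => ?_
  rw [rConv_prime_pow_of_zero hp h, rConv_prime_pow_of_zero hp h]
  ring

lemma hasSum_geometric_conv_neg {p : ℕ} (hp : p.Prime) (h : χ p = -1) (i : ℕ) :
    HasSum (fun n => rConv χ (p ^ (i + n)) * rConv χ (p ^ n) * ((p : ℝ)⁻¹) ^ n)
      (if Even i then (1 - (p : ℝ)⁻¹ ^ 2)⁻¹ else 0) := by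
  have hp1 : (1 : ℝ) < p := by exact_mod_cast hp.one_lt
  have hx1 : (p : ℝ)⁻¹ < 1 := inv_lt_one_of_one_lt₀ hp1
  have hx2 : (p : ℝ)⁻¹ ^ 2 < 1 := pow_lt_one₀ (by positivity) hx1 two_ne_zero
  have h1 := hasSum_geometric_of_lt_one (by positivity) hx2
  simp only [rConv_prime_pow_of_neg hp h]
  by_cases hi : Even i
  · rw [if_pos hi]
    have hinj : Function.Injective (fun n : ℕ => 2 * n) := mul_right_injective₀ two_ne_zero
    rw [← hinj.hasSum_iff]
    · refine h1.congr_fun fun n => ?_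
      simp [Nat.even_add, hi, pow_mul]
    · intro n hn
      rw [if_neg (c := Even n), mul_zero, zero_mul]
      rintro ⟨m, hm⟩
      exact hn ⟨m, by simp only; omega⟩
  · rw [if_neg hi]
    refine (hasSum_zero (α := ℝ) (β := ℕ)).congr_fun fun n => ?_
    by_cases hn : Even n <;> simp [Nat.even_add, hi, hn]

/-- The local factor of the singular series. -/
def localFactor (χ : ℕ →* ℝ) (p : ℕ) : ℝ :=
  if χ p = 0 then ((1 + 1 / (p : ℝ)) ^ 2)⁻¹ else
    (((1 + 1 / (p : ℝ)) ^ 2 + χ p / p) ^ 2)⁻¹ * (1 - χ p / p) ^ 2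

lemma hasSum_localFactor_of_zero {p : ℕ} (hp : p.Prime) (h : χ p = 0) :
    HasSum (fun e => fTup χ (pw p e)) (localFactor χ p) := by
  have hp1 : (1 : ℝ) < p := by exact_mod_cast hp.one_lt
  have hp' : (p : ℝ) - 1 ≠ 0 := by linarith
  have hx1 : (p : ℝ)⁻¹ < 1 := inv_lt_one_of_one_lt₀ hp1
  convert hasSum_local hp (hasSum_geometric_conv_zero hp h) using 1
  rw [localFactor, if_pos h]
  simp only [rho1Real_prime hp, rho1Real_prime_sq hp, rConv_prime_pow_of_zero hp h, h, hLocal,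
    alpha_prime hp]
  simp [sum_range_succ, pairTable]
  field_simp
  ring

lemma hasSum_localFactor_of_one {p : ℕ} (hp : p.Prime) (h : χ p = 1) :
    HasSum (fun e => fTup χ (pw p e)) (localFactor χ p) := by
  have hp1 : (1 : ℝ) < p := by exact_mod_cast hp.one_lt
  have hp' : (p : ℝ) - 1 ≠ 0 := by linarith
  have hx1 : (p : ℝ)⁻¹ < 1 := inv_lt_one_of_one_lt₀ hp1
  convert hasSum_local hp (hasSum_geometric_conv_one hp h) using 1
  have hh : hLocal χ p = (p + 1) ^ 2 * p / (p * (p + 1) ^ 2 + p ^ 2) := by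
    rw [hLocal, h, alpha_prime hp]; field_simp
  rw [localFactor, if_neg (by rw [h]; norm_num)]
  simp only [rho1Real_prime hp, rho1Real_prime_sq hp, rConv_prime_pow_of_one hp h, h, hh,
    alpha_prime hp]
  simp [sum_range_succ, pairTable]
  field_simp
  ring

lemma hasSum_localFactor_of_neg {p : ℕ} (hp : p.Prime) (h : χ p = -1) :
    HasSum (fun e => fTup χ (pw p e)) (localFactor χ p) := by
  have hp1 : (1 : ℝ) < p := by exact_mod_cast hp.one_lt
  have hp' : (p : ℝ) - 1 ≠ 0 := by linarith
  have hx1 : (p : ℝ)⁻¹ < 1 := inv_lt_one_of_one_lt₀ hp1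
  convert hasSum_local hp (hasSum_geometric_conv_neg hp h) using 1
  have hq : (0 : ℝ) < p ^ 2 + p + 1 := by positivity
  have hh : hLocal χ p = (p + 1) ^ 2 / (p ^ 2 + p + 1) := by
    rw [hLocal, h, alpha_prime hp]
    have : (1 + (1 + 1 / (p : ℝ))⁻¹ ^ 2 * -1 / p) = (p ^ 2 + p + 1) / (p + 1) ^ 2 := by
      field_simp; ring
    rw [this, inv_div]
  have hR1 : rho1Real χ p = 0 := by rw [rho1Real_prime hp, h]; ring
  have hR2 : rho1Real χ (p ^ 2) = -(p ^ 2 / (p ^ 2 + p + 1)) := by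
    rw [rho1Real_prime_sq hp, hh, h, alpha_prime hp]; field_simp
  have hL : ((1 + 1 / (p : ℝ)) ^ 2 + -1 / p) = (p ^ 2 + p + 1) / p ^ 2 := by field_simp; ring
  rw [localFactor, if_neg (by rw [h]; norm_num)]
  simp only [hR1, hR2, rConv_prime_pow_of_neg hp h, h, hL]
  have e3 : ¬ Even 3 := by decide
  have e4 : Even 4 := by decide
  have o3 : Odd 3 := by decide
  have hm : (p : ℝ) ^ 2 - 1 ≠ 0 := by nlinarith
  simp [sum_range_succ, pairTable, e3, e4, o3, Nat.even_add_one]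
  field_simp
  ring

lemma hasSum_localFactor (hχ : IsTrivalued χ) {p : ℕ} (hp : p.Prime) :
    HasSum (fun e => fTup χ (pw p e)) (localFactor χ p) := by
  rcases hχ p with h | h | h
  exacts [hasSum_localFactor_of_zero hp h, hasSum_localFactor_of_one hp h,
    hasSum_localFactor_of_neg hp h]

end

/-! ### Logarithmic weights in the smooth sum -/

/-- The logarithm of `a g n`. -/
def logAGN (t : Tup) : ℝ := log ((t.2.1 * t.2.2.2.1 * t.2.2.2.2 : ℕ) : ℝ)

/-- The logarithm of `b g² n`. -/
def logBGN (t : Tup) : ℝ := log ((t.2.2.1 * t.2.2.2.1 ^ 2 * t.2.2.2.2 : ℕ) : ℝ)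

lemma logAGN_nonneg (t : Tup) : 0 ≤ logAGN t := log_natCast_nonneg _

lemma logBGN_nonneg (t : Tup) : 0 ≤ logBGN t := log_natCast_nonneg _

lemma logAGN_one : logAGN 1 = 0 := by simp [logAGN]

lemma logBGN_one : logBGN 1 = 0 := by simp [logBGN]

lemma logAGN_mul (t t' : Tup) (h : tN t ≠ 0) (h' : tN t' ≠ 0) :
    logAGN (t * t') = logAGN t + logAGN t' := by
  simp only [tN, mul_ne_zero_iff] at h h'
  obtain ⟨⟨⟨⟨_, h1⟩, _⟩, h2⟩, h3⟩ := h
  obtain ⟨⟨⟨⟨_, h1'⟩, _⟩, h2'⟩, h3'⟩ := h'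
  simp only [logAGN, Prod.fst_mul, Prod.snd_mul]
  rw [← log_mul (by positivity) (by positivity)]
  congr 1; push_cast; ring

lemma logBGN_mul (t t' : Tup) (h : tN t ≠ 0) (h' : tN t' ≠ 0) :
    logBGN (t * t') = logBGN t + logBGN t' := by
  simp only [tN, mul_ne_zero_iff] at h h'
  obtain ⟨⟨⟨⟨_, _⟩, h1⟩, h2⟩, h3⟩ := h
  obtain ⟨⟨⟨⟨_, _⟩, h1'⟩, h2'⟩, h3'⟩ := h'
  simp only [logBGN, Prod.fst_mul, Prod.snd_mul]
  rw [← log_mul (by positivity) (by positivity)]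
  congr 1; push_cast; ring

lemma logAGN_pw_le (p : ℕ) (e : Tup) : logAGN (pw p e) ≤ 2 * (tS e * log p) := by
  have : (p ^ e.2.1 * p ^ e.2.2.2.1 * p ^ e.2.2.2.2 : ℕ) = p ^ (e.2.1 + e.2.2.2.1 + e.2.2.2.2) := by
    ring
  simp only [logAGN, pw, this, Nat.cast_pow, log_pow]
  have h0 : 0 ≤ log p := log_natCast_nonneg _
  have h1 : ((e.2.1 + e.2.2.2.1 + e.2.2.2.2 : ℕ) : ℝ) ≤ ((2 * tS e : ℕ) : ℝ) := by
    exact_mod_cast (by unfold tS; omega)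
  push_cast at h1 ⊢
  nlinarith

lemma logBGN_pw_le (p : ℕ) (e : Tup) : logBGN (pw p e) ≤ 2 * (tS e * log p) := by
  have : (p ^ e.2.2.1 * (p ^ e.2.2.2.1) ^ 2 * p ^ e.2.2.2.2 : ℕ) =
      p ^ (e.2.2.1 + 2 * e.2.2.2.1 + e.2.2.2.2) := by
    ring
  simp only [logBGN, pw, this, Nat.cast_pow, log_pow]
  have h0 : 0 ≤ log p := log_natCast_nonneg _
  have h1 : ((e.2.2.1 + 2 * e.2.2.2.1 + e.2.2.2.2 : ℕ) : ℝ) ≤ ((2 * tS e : ℕ) : ℝ) := by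
    exact_mod_cast (by unfold tS; omega)
  push_cast at h1 ⊢
  nlinarith

lemma fTup_one (χ : ℕ →* ℝ) : fTup χ 1 = 1 := isJointMult_fTup.1

/-- Weighted local sums at `p` are small: only tuples with `tS e = 1` contribute to first order, and
these carry a factor `r(p)`. -/
lemma exists_local_weighted_bound : ∃ C : ℝ, 0 ≤ C ∧ ∀ {χ : ℕ →* ℝ}, IsTrivalued χ →
    ∀ {p : ℕ}, p.Prime → ∀ (w : Tup → ℝ) (B : ℝ), 0 ≤ B →
      (∀ e, 0 ≤ w e ∧ w e ≤ B * (1 + tS e : ℝ) ^ 2) →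
      (Summable fun e => |fTup χ (pw p e) * w e|) ∧
      |∑' e, fTup χ (pw p e) * w e - w 0| ≤ B * (C * (rConv χ p / p + ((p : ℝ)⁻¹) ^ 2)) := by
  obtain ⟨C, hC, hb⟩ := exists_local_sum_bound 8 (ρ := 1 / 2) (by norm_num) (by norm_num)
  refine ⟨C * 16, by positivity, fun {χ} hχ {p} hp w B hB hw => ?_⟩
  have hp2 : (2 : ℝ) ≤ p := by exact_mod_cast hp.two_le
  have hr := rConv_nonneg hχ p
  rcases hB.eq_or_lt with rfl | hB
  · have hw0 : ∀ e, w e = 0 := fun e => le_antisymm (by simpa using (hw e).2) (hw e).1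
    simp [hw0]
  have hw1 : ∀ e, |w e / B| ≤ (1 + tS e : ℝ) ^ 2 := fun e => by
    rw [abs_of_nonneg (div_nonneg (hw e).1 hB.le), div_le_iff₀ hB]
    linarith [(hw e).2]
  obtain ⟨h1, h2, -⟩ := hb (fun e => fTup χ (pw p e) * (w e / B)) ((p : ℝ)⁻¹) (16 * (rConv χ p / p))
    (by positivity) (by rw [one_div]; exact inv_anti₀ (by norm_num) hp2) (by positivity)
    (fun e he => by
      rw [abs_mul]
      have := mul_le_mul ((abs_fTup_le hχ _).trans (FTup_pw_le_of_one hχ hp he)) (hw1 e)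
        (abs_nonneg _) (by positivity)
      refine this.trans_eq ?_
      rw [he]; norm_num; ring)
    (fun e _ => by
      rw [abs_mul]
      have := mul_le_mul ((abs_fTup_le hχ _).trans (FTup_pw_le hχ hp e)) (hw1 e)
        (abs_nonneg _) (by positivity)
      refine this.trans_eq ?_
      ring)
  have hs : ∀ e, fTup χ (pw p e) * w e = B * (fTup χ (pw p e) * (w e / B)) := fun e => by
    field_simp
  constructor
  · simp only [hs, abs_mul B]
    exact h1.mul_left _
  · simp only [hs]
    rw [tsum_mul_left]
    have e0 : fTup χ (pw p 0) * (w 0 / B) = w 0 / B := by rw [pw_zero, fTup_one, one_mul]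
    rw [e0] at h2
    rw [show B * ∑' e, fTup χ (pw p e) * (w e / B) - w 0 =
      B * (∑' e, fTup χ (pw p e) * (w e / B) - w 0 / B) by field_simp, abs_mul, abs_of_pos hB]
    gcongr
    refine h2.trans ?_
    have : 0 ≤ ((p : ℝ)⁻¹) ^ 2 := by positivity
    nlinarith

lemma localFactor_bounds {χ : ℕ →* ℝ} (hχ : IsTrivalued χ) {p : ℕ} (hp : p.Prime) :
    1 / 64 ≤ localFactor χ p ∧ localFactor χ p ≤ 1 := by
  have hp2 : (2 : ℝ) ≤ p := by exact_mod_cast hp.two_le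
  obtain ⟨x, hx⟩ : ∃ x : ℝ, x = 1 / p := ⟨_, rfl⟩
  have hx0 : 0 < x := by rw [hx]; positivity
  have hx1 : x ≤ 1 / 2 := by rw [hx]; exact one_div_le_one_div_of_le (by norm_num) hp2
  rcases hχ p with h | h | h
  · rw [localFactor, if_pos h, ← hx]
    constructor
    · rw [one_div, inv_le_inv₀ (by norm_num) (by positivity)]; nlinarith
    · exact inv_le_one_of_one_le₀ (by nlinarith)
  · rw [localFactor, if_neg (by rw [h]; norm_num), h, ← hx, ← div_eq_inv_mul]
    constructor
    · rw [div_le_div_iff₀ (by norm_num) (by positivity)]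
      have h1 : (1 + x) ^ 2 + x ≤ 11 / 4 := by nlinarith
      have h2 : ((1 + x) ^ 2 + x) ^ 2 ≤ (11 / 4) ^ 2 := by gcongr
      nlinarith
    · rw [div_le_one (by positivity)]
      have h1 : 1 ≤ (1 + x) ^ 2 + x := by nlinarith
      nlinarith
  · rw [localFactor, if_neg (by rw [h]; norm_num), h, neg_div, ← hx, ← div_eq_inv_mul]
    have h0 : 1 ≤ (1 + x) ^ 2 + -x := by nlinarith
    constructor
    · rw [div_le_div_iff₀ (by norm_num) (by positivity)]
      have h1 : (1 + x) ^ 2 + -x ≤ 11 / 4 := by nlinarith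
      have h2 : ((1 + x) ^ 2 + -x) ^ 2 ≤ (11 / 4) ^ 2 := by gcongr
      nlinarith
    · rw [div_le_one (by positivity)]
      refine pow_le_pow_left₀ (by linarith) (by nlinarith) 2

/-- The first-order size of the local data at `p`: they are trivial to first order unless `r(p) ≠ 0`. -/
def primeWeight (χ : ℕ →* ℝ) (p : ℕ) : ℝ := rConv χ p / p + ((p : ℝ)⁻¹) ^ 2

lemma primeWeight_nonneg {χ : ℕ →* ℝ} (hχ : IsTrivalued χ) (p : ℕ) : 0 ≤ primeWeight χ p := by
  have := rConv_nonneg hχ p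
  unfold primeWeight
  positivity

lemma exists_one_sub_localFactor_le : ∃ C : ℝ, 0 ≤ C ∧ ∀ {χ : ℕ →* ℝ}, IsTrivalued χ →
    ∀ {p : ℕ}, p.Prime → 1 - localFactor χ p ≤ C * primeWeight χ p := by
  obtain ⟨C, hC, hb⟩ := exists_local_weighted_bound
  refine ⟨C, hC, fun {χ} hχ {p} hp => ?_⟩
  obtain ⟨-, h⟩ := hb hχ hp (fun _ => 1) 1 zero_le_one (fun e => ⟨zero_le_one, by
    rw [one_mul]; exact one_le_pow₀ (by have : (0 : ℝ) ≤ tS e := Nat.cast_nonneg _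
                                        linarith)⟩)
  simp only [mul_one, one_mul, (hasSum_localFactor hχ hp).tsum_eq] at h
  have := neg_abs_le (localFactor χ p - 1)
  rw [primeWeight]; linarith

/-- The smooth sum is an Euler product, and its logarithmic moments are controlled by
`∑ log p (r(p)/p + 1/p²)` and `∑ log² p (r(p)/p + 1/p²)`. -/
lemma exists_smooth_moments : ∃ C : ℝ, 0 ≤ C ∧ ∀ {χ : ℕ →* ℝ}, IsTrivalued χ → ∀ S : Finset ℕ,
    (∀ p ∈ S, p.Prime) →
    (Summable fun t : FT S => |fTup χ t.toTup| * ((1 + logAGN t.toTup) * (1 + logBGN t.toTup))) ∧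
    ∑' t : FT S, fTup χ t.toTup = ∏ p ∈ S, localFactor χ p ∧
    |∑' t : FT S, fTup χ t.toTup * logAGN t.toTup| ≤
      C * (∑ p ∈ S, log p * primeWeight χ p) * ∏ p ∈ S, localFactor χ p ∧
    |∑' t : FT S, fTup χ t.toTup * logBGN t.toTup| ≤
      C * (∑ p ∈ S, log p * primeWeight χ p) * ∏ p ∈ S, localFactor χ p ∧
    |∑' t : FT S, fTup χ t.toTup * (logAGN t.toTup * logBGN t.toTup)| ≤
      ((C * ∑ p ∈ S, log p * primeWeight χ p) ^ 2 +
        C * ∑ p ∈ S, log p ^ 2 * primeWeight χ p) * ∏ p ∈ S, localFactor χ p := by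
  obtain ⟨C, hC, hb⟩ := exists_local_weighted_bound
  refine ⟨4 * C * 64, by positivity, fun {χ} hχ S hS => ?_⟩
  have hloc : ∀ p, p.Prime → Summable fun e => |fTup χ (pw p e)| *
      ((1 + logAGN (pw p e)) * (1 + logBGN (pw p e))) := by
    intro p hp
    have hl0 : 0 ≤ log p := log_natCast_nonneg _
    have h := (hb hχ hp (fun e => (1 + logAGN (pw p e)) * (1 + logBGN (pw p e)))
      ((1 + 2 * log p) ^ 2) (by positivity) (fun e => ?_)).1
    · refine h.congr fun e => ?_
      have h1 := logAGN_nonneg (pw p e)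
      have h2 := logBGN_nonneg (pw p e)
      rw [abs_mul, abs_of_nonneg (by positivity : 0 ≤ (1 + logAGN (pw p e)) * (1 + logBGN (pw p e)))]
    · have h1 := logAGN_nonneg (pw p e)
      have h2 := logBGN_nonneg (pw p e)
      have h3 := logAGN_pw_le p e
      have h4 := logBGN_pw_le p e
      have ht : (0 : ℝ) ≤ tS e := Nat.cast_nonneg _
      have key : ∀ x : ℝ, x ≤ 2 * (tS e * log p) → 1 + x ≤ (1 + 2 * log p) * (1 + tS e) := by
        intro x hx; nlinarith
      refine ⟨by positivity, ?_⟩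
      calc _ ≤ ((1 + 2 * log p) * (1 + tS e)) * ((1 + 2 * log p) * (1 + tS e)) :=
            mul_le_mul (key _ h3) (key _ h4) (by positivity) (by positivity)
        _ = _ := by ring
  have hE : ∀ p, p.Prime → ∑' e, fTup χ (pw p e) = localFactor χ p :=
    fun p hp => (hasSum_localFactor hχ hp).tsum_eq
  have one : ∀ (ℓ : Tup → ℝ), (∀ t, 0 ≤ ℓ t) → ℓ 1 = 0 →
      (∀ p e, ℓ (pw p e) ≤ 2 * (tS e * log p)) → ∀ p, p.Prime →
      |∑' e, fTup χ (pw p e) * ℓ (pw p e)| ≤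
        4 * C * 64 * (log p * primeWeight χ p) * ∑' e, fTup χ (pw p e) := by
    intro ℓ h0 h1 hle p hp
    have hl0 : 0 ≤ log p := log_natCast_nonneg _
    have h := (hb hχ hp (fun e => ℓ (pw p e)) (2 * log p) (by positivity) (fun e => ?_)).2
    · simp only [pw_zero, h1, sub_zero] at h
      refine h.trans ?_
      rw [hE p hp]
      have hF := (localFactor_bounds hχ hp).1
      have hw := primeWeight_nonneg hχ p
      rw [← primeWeight]
      calc 2 * log p * (C * primeWeight χ p)
          ≤ 4 * C * 64 * (log p * primeWeight χ p) * (1 / 64) := by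
            have : 0 ≤ log p * (C * primeWeight χ p) := by positivity
            nlinarith
        _ ≤ _ := by gcongr
    · refine ⟨h0 _, (hle p e).trans ?_⟩
      have ht : (0 : ℝ) ≤ tS e := Nat.cast_nonneg _
      nlinarith [mul_nonneg hl0 ht, mul_nonneg hl0 (sq_nonneg (tS e : ℝ))]
  have two : ∀ p, p.Prime →
      |∑' e, fTup χ (pw p e) * (logAGN (pw p e) * logBGN (pw p e))| ≤
        4 * C * 64 * (log p ^ 2 * primeWeight χ p) * ∑' e, fTup χ (pw p e) := by
    intro p hp
    have hl0 : 0 ≤ log p := log_natCast_nonneg _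
    have h := (hb hχ hp (fun e => logAGN (pw p e) * logBGN (pw p e)) (4 * log p ^ 2)
      (by positivity) (fun e => ?_)).2
    · simp only [pw_zero, logAGN_one, zero_mul, sub_zero] at h
      refine h.trans ?_
      rw [hE p hp]
      have hF := (localFactor_bounds hχ hp).1
      have hw := primeWeight_nonneg hχ p
      rw [← primeWeight]
      calc 4 * log p ^ 2 * (C * primeWeight χ p)
          = 4 * C * 64 * (log p ^ 2 * primeWeight χ p) * (1 / 64) := by ring
        _ ≤ _ := by gcongr
    · have h1 := logAGN_nonneg (pw p e)
      have h2 := logBGN_nonneg (pw p e)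
      have h3 := logAGN_pw_le p e
      have h4 := logBGN_pw_le p e
      have ht : (0 : ℝ) ≤ tS e := Nat.cast_nonneg _
      refine ⟨by positivity, (mul_le_mul h3 h4 h2 (by positivity)).trans ?_⟩
      have : (tS e : ℝ) ^ 2 ≤ (1 + tS e) ^ 2 := by gcongr; linarith
      nlinarith [mul_le_mul_of_nonneg_left this (sq_nonneg (log p))]
  obtain ⟨h1, h2, h3, h4⟩ := isJointMult_fTup.weighted logAGN_one logBGN_one logAGN_mul logBGN_mul
    logAGN_nonneg logBGN_nonneg hloc
    (fun p hp => by rw [hE p hp]; linarith [(localFactor_bounds hχ hp).1])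
    (one logAGN logAGN_nonneg logAGN_one logAGN_pw_le)
    (one logBGN logBGN_nonneg logBGN_one logBGN_pw_le) two S hS
  have hP : ∑' t : FT S, fTup χ t.toTup = ∏ p ∈ S, localFactor χ p := by
    rw [(isJointMult_fTup.summable_and_tsum S (fun p hp =>
      (hasSum_localFactor hχ (hS p hp)).summable.abs) hS).2]
    exact Finset.prod_congr rfl fun p hp => hE p (hS p hp)
  rw [hP] at h2 h3 h4
  simp only [← mul_sum] at h2 h3 h4
  exact ⟨h1, hP, h2, h3, h4⟩

lemma prod_localFactor_sub_le {χ : ℕ →* ℝ} (hχ : IsTrivalued χ) {S T : Finset ℕ} (hST : S ⊆ T)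
    (hT : ∀ p ∈ T, p.Prime) :
    |∏ p ∈ S, localFactor χ p - ∏ p ∈ T, localFactor χ p| ≤
      ∑ p ∈ T \ S, (1 - localFactor χ p) := by
  have h01 : ∀ p ∈ T, 0 ≤ localFactor χ p ∧ localFactor χ p ≤ 1 := fun p hp => by
    have := localFactor_bounds hχ (hT p hp)
    constructor <;> linarith
  have key : ∀ U : Finset ℕ, U ⊆ T → 1 - ∏ p ∈ U, localFactor χ p ≤ ∑ p ∈ U, (1 - localFactor χ p) := by
    intro U
    induction U using Finset.induction_on with
    | empty => simp
    | insert p U hp ih =>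
      intro hU
      rw [Finset.prod_insert hp, Finset.sum_insert hp]
      have i1 := ih fun q hq => hU (mem_insert_of_mem hq)
      have i2 := h01 p (hU (Finset.mem_insert_self p U))
      have i3 : ∏ p ∈ U, localFactor χ p ≤ 1 := Finset.prod_le_one
        (fun q hq => (h01 q (hU (mem_insert_of_mem hq))).1)
        fun q hq => (h01 q (hU (mem_insert_of_mem hq))).2
      nlinarith
  rw [← Finset.prod_sdiff hST]
  have k := key (T \ S) Finset.sdiff_subset
  have a1 : ∏ p ∈ T \ S, localFactor χ p ≤ 1 := Finset.prod_le_one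
    (fun q hq => (h01 q (Finset.sdiff_subset hq)).1) fun q hq => (h01 q (Finset.sdiff_subset hq)).2
  have a2 : ∏ p ∈ S, localFactor χ p ≤ 1 := Finset.prod_le_one
    (fun q hq => (h01 q (hST hq)).1) fun q hq => (h01 q (hST hq)).2
  have a3 : 0 ≤ ∏ p ∈ S, localFactor χ p := Finset.prod_nonneg fun q hq => (h01 q (hST hq)).1
  rw [abs_of_nonneg (by nlinarith)]
  nlinarith

/-! ### Lacunarity: few primes are not inert -/

lemma log_prod_primeFactors_le {n : ℕ} (hn : n ≠ 0) :
    ∑ p ∈ n.primeFactors, log p ≤ log n := by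
  rw [← Real.log_prod (fun p hp => by
    have := (Nat.prime_of_mem_primeFactors hp).pos; positivity), ← Nat.cast_prod]
  have h1 := Nat.prod_primeFactors_dvd n
  refine log_le_log ?_ (by exact_mod_cast Nat.le_of_dvd (Nat.pos_of_ne_zero hn) h1)
  have := Nat.pos_of_dvd_of_pos h1 (Nat.pos_of_ne_zero hn)
  exact_mod_cast this

/-- A weak form of Mertens' first theorem. -/
lemma sum_log_div_prime_le {N : ℕ} (hN : 1 ≤ N) :
    ∑ p ∈ primesUpTo N, log p / p ≤ 2 * log N := by
  have hN0 : (0 : ℝ) < N := by exact_mod_cast hN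
  have h1 : ∑ n ∈ Ioc 0 N, ∑ p ∈ n.primeFactors, log p ≤ N * log N := by
    calc _ ≤ ∑ n ∈ Ioc 0 N, log N := by
          refine sum_le_sum fun n hn => ?_
          obtain ⟨h0, h1⟩ := Finset.mem_Ioc.1 hn
          exact (log_prod_primeFactors_le (by omega)).trans
            (log_le_log (by exact_mod_cast h0) (by exact_mod_cast h1))
      _ = _ := by simp
  have h2 : ∑ n ∈ Ioc 0 N, ∑ p ∈ n.primeFactors, log p =
      ∑ p ∈ primesUpTo N, ((N / p : ℕ) : ℝ) * log p := by
    rw [Finset.sum_comm' (t' := primesUpTo N) (s' := fun p => (Ioc 0 N).filter (p ∣ ·))]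
    · refine sum_congr rfl fun p hp => ?_
      rw [Finset.sum_const, Nat.Ioc_filter_dvd_card_eq_div, nsmul_eq_mul]
    · intro n p
      simp only [Finset.mem_Ioc, Nat.mem_primeFactors, primesUpTo, mem_filter, mem_Icc]
      constructor
      · rintro ⟨⟨h0, h1⟩, hp, hd, -⟩
        exact ⟨⟨⟨h0, h1⟩, hd⟩, ⟨hp.one_le, (Nat.le_of_dvd h0 hd).trans h1⟩, hp⟩
      · rintro ⟨⟨⟨h0, h1⟩, hd⟩, -, hp⟩
        exact ⟨⟨h0, h1⟩, hp, hd, h0.ne'⟩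
  have h3 : ∑ p ∈ primesUpTo N, log p / p * (N / 2) ≤
      ∑ p ∈ primesUpTo N, ((N / p : ℕ) : ℝ) * log p := by
    refine sum_le_sum fun p hp => ?_
    have hpp := prime_of_mem_primesUpTo hp
    have hp0 : (0 : ℝ) < p := by exact_mod_cast hpp.pos
    have h4 : 1 ≤ N / p := Nat.div_pos (le_of_mem_primesUpTo hp) hpp.pos
    have h5 : (N : ℝ) / p < ((N / p : ℕ) : ℝ) + 1 := by
      rw [div_lt_iff₀ hp0]
      exact_mod_cast Nat.lt_mul_div_succ N hpp.pos |>.trans_eq (mul_comm _ _)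
    have h6 : (1 : ℝ) ≤ ((N / p : ℕ) : ℝ) := by exact_mod_cast h4
    have hl : 0 ≤ log p := log_natCast_nonneg _
    calc log p / p * (N / 2) = (N / p) / 2 * log p := by ring
      _ ≤ _ := by gcongr; linarith
  rw [← sum_mul] at h3
  have h4 : (∑ p ∈ primesUpTo N, log p / p) * (N / 2) ≤ N * log N := by linarith
  have h5 : (∑ p ∈ primesUpTo N, log p / p) * (N / 2) ≤ (2 * log N) * (N / 2) := by linarith
  exact le_of_mul_le_mul_right h5 (by positivity)

lemma countPerms_le_factorial (m : Multiset ℕ) : m.countPerms ≤ m.card.factorial := by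
  rw [Multiset.countPerms, Finsupp.multinomial]
  refine (Nat.div_le_self _ _).trans (le_of_eq ?_)
  congr 1
  conv_rhs => rw [← Multiset.toFinsupp_toMultiset m]
  rw [Finsupp.card_toMultiset]

lemma multiset_prod_map_inv (m : Multiset ℕ) :
    (m.map fun p : ℕ => ((p : ℝ))⁻¹).prod = ((m.prod : ℕ) : ℝ)⁻¹ := by
  induction m using Multiset.induction_on with
  | empty => simp
  | cons a s ih => simp [ih, mul_comm]

lemma one_le_rConv_of_isPlus {χ : ℕ →* ℝ} (hχ : IsTrivalued χ) {n : ℕ} (hn : n ≠ 0)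
    (h : IsPlus χ n) : 1 ≤ rConv χ n := by
  rw [rConv]
  refine le_trans (by simp) (Finset.single_le_sum (f := fun d => χ d) (fun d hd => ?_)
    (Nat.one_mem_divisors.2 hn))
  exact (h.of_dvd (Nat.dvd_of_mem_divisors hd)).char_nonneg hχ (Nat.pos_of_mem_divisors hd).ne'

/-- Products of `j` non-inert primes give integers with `r ≥ 1`, whose density is controlled by
`L(1, χ)`. -/
lemma CharData.pow_sum_inv_le {χ : ℕ →* ℝ} {D : ℕ} {L L' L'' : ℝ} (h : CharData χ D L L' L'')
    {T : Finset ℕ} {m j Z : ℕ} (hT : ∀ p ∈ T, p.Prime ∧ χ p ≠ -1 ∧ m ≤ p ∧ p ≤ Z)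
    (hm : D ^ 2 < m ^ j) (hj : 1 ≤ j) (hZ : 1 ≤ log Z) :
    (∑ p ∈ T, ((p : ℝ))⁻¹) ^ j ≤
      (j : ℝ) ^ j * (exp 1 * (12336 * L * (j * log Z))) := by
  have hL := h.L_pos
  have hj1 : (1 : ℝ) ≤ j := by exact_mod_cast hj
  have hZ0 : Z ≠ 0 := by rintro rfl; norm_num at hZ
  have hZpos : (0 : ℝ) < Z := by positivity
  set σ : ℝ := 1 / (j * log Z) with hσ
  have hjZ : 1 ≤ j * log Z := by nlinarith
  have hσ0 : 0 < σ := by positivity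
  have hσ1 : σ ≤ 1 := by rw [hσ, div_le_one (by positivity)]; exact hjZ
  have htail := h.tail_le hσ0 hσ1
  set s := T.sym j
  have hmem : ∀ k ∈ s, ∀ p ∈ k.1, p ∈ T := fun k hk p hp => Finset.mem_sym_iff.1 hk p hp
  have hprime : ∀ k ∈ s, ∀ p ∈ k.1, p.Prime := fun k hk p hp => (hT p (hmem k hk p hp)).1
  have hinj : Set.InjOn (fun k : Sym ℕ j => (k.1.prod : ℕ)) s := by
    intro k hk k' hk' hkk
    have e1 := UniqueFactorizationMonoid.normalizedFactors_prod_of_prime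
      (m := k.1) fun p hp => (hprime k hk p hp).prime
    have e2 := UniqueFactorizationMonoid.normalizedFactors_prod_of_prime
      (m := k'.1) fun p hp => (hprime k' hk' p hp).prime
    simp only at hkk
    rw [hkk] at e1
    exact Subtype.ext (e1.symm.trans e2)
  have hpos : ∀ k ∈ s, 0 < k.1.prod := fun k hk => Nat.pos_of_ne_zero fun h0 =>
    (hprime k hk 0 (Multiset.prod_eq_zero_iff.1 h0)).ne_zero rfl
  have hlow : ∀ k ∈ s, D ^ 2 < k.1.prod := by
    intro k hk
    refine hm.trans_le ?_
    have := Multiset.pow_card_le_prod (s := k.1) (a := m) fun p hp => (hT p (hmem k hk p hp)).2.2.1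
    rwa [k.2] at this
  have hup : ∀ k ∈ s, k.1.prod ≤ Z ^ j := by
    intro k hk
    have := Multiset.prod_le_pow_card k.1 Z fun p hp => (hT p (hmem k hk p hp)).2.2.2
    rwa [k.2] at this
  have hplus : ∀ k ∈ s, 1 ≤ rConv χ k.1.prod := by
    intro k hk
    refine one_le_rConv_of_isPlus h.tri (hpos k hk).ne' fun p hp hd => ?_
    obtain ⟨q, hq, hpq⟩ := hp.prime.exists_mem_multiset_dvd hd
    rw [(Nat.prime_dvd_prime_iff_eq hp (hprime k hk q hq)).1 hpq]
    exact (hT q (hmem k hk q hq)).2.1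
  have hterm : ∀ k ∈ s, ((k.1.prod : ℕ) : ℝ)⁻¹ ≤
      exp 1 * (rConv χ k.1.prod * ((k.1.prod : ℕ) : ℝ) ^ (-1 - σ)) := by
    intro k hk
    have hp0 : (0 : ℝ) < ((k.1.prod : ℕ) : ℝ) := by exact_mod_cast hpos k hk
    have h1 : exp (-1) ≤ ((k.1.prod : ℕ) : ℝ) ^ (-σ) := by
      rw [rpow_def_of_pos hp0]
      apply exp_le_exp.2
      have h2 : log ((k.1.prod : ℕ) : ℝ) ≤ j * log Z := by
        rw [← log_pow]
        exact log_le_log hp0 (by exact_mod_cast hup k hk)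
      have h3 : σ * (j * log Z) = 1 := by rw [hσ]; field_simp
      nlinarith
    rw [sub_eq_add_neg, rpow_add hp0, rpow_neg_one]
    have h4 : 1 ≤ exp 1 * ((k.1.prod : ℕ) : ℝ) ^ (-σ) := by
      have := mul_le_mul_of_nonneg_left h1 (exp_pos 1).le
      rwa [← exp_add, add_neg_cancel, Real.exp_zero] at this
    have h5 := hplus k hk
    have h6 : 0 ≤ ((k.1.prod : ℕ) : ℝ)⁻¹ := by positivity
    have h7 : 0 ≤ exp 1 * ((k.1.prod : ℕ) : ℝ) ^ (-σ) := by linarith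
    calc ((k.1.prod : ℕ) : ℝ)⁻¹ = ((k.1.prod : ℕ) : ℝ)⁻¹ * (1 * 1) := by ring
      _ ≤ ((k.1.prod : ℕ) : ℝ)⁻¹ * (rConv χ k.1.prod * (exp 1 * ((k.1.prod : ℕ) : ℝ) ^ (-σ))) := by
        gcongr
      _ = _ := by ring
  have hsum : ∑ k ∈ s, rConv χ k.1.prod * ((k.1.prod : ℕ) : ℝ) ^ (-1 - σ) ≤ 12336 * L / σ := by
    have h0 : ∀ k ∈ s, 0 ≤ rConv χ k.1.prod * ((k.1.prod : ℕ) : ℝ) ^ (-1 - σ) := fun k hk =>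
      mul_nonneg (rConv_nonneg h.tri _) (by positivity)
    rw [← ENNReal.ofReal_le_ofReal_iff (by positivity), ENNReal.ofReal_sum_of_nonneg h0]
    refine le_trans ?_ htail
    calc ∑ k ∈ s, ofReal (rConv χ k.1.prod * ((k.1.prod : ℕ) : ℝ) ^ (-1 - σ))
        = ∑ k ∈ s, (if D ^ 2 < k.1.prod then rE χ σ k.1.prod else 0) := by
          refine sum_congr rfl fun k hk => ?_
          rw [if_pos (hlow k hk), rE]
      _ = ∑ n ∈ s.image (fun k : Sym ℕ j => (k.1.prod : ℕ)), (if D ^ 2 < n then rE χ σ n else 0) :=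
          (Finset.sum_image (f := fun n => if D ^ 2 < n then rE χ σ n else 0) hinj).symm
      _ ≤ _ := ENNReal.sum_le_tsum _
  rw [Finset.sum_pow]
  calc ∑ k ∈ s, (k.1.countPerms : ℝ) * (k.1.map fun p : ℕ => ((p : ℝ))⁻¹).prod
      ≤ ∑ k ∈ s, (j : ℝ) ^ j * (exp 1 * (rConv χ k.1.prod * ((k.1.prod : ℕ) : ℝ) ^ (-1 - σ))) := by
        refine sum_le_sum fun k hk => ?_
        rw [multiset_prod_map_inv]
        have h1 : (k.1.countPerms : ℝ) ≤ (j : ℝ) ^ j := by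
          have := (countPerms_le_factorial k.1).trans (le_of_eq (by rw [k.2]))
          exact_mod_cast this.trans (Nat.factorial_le_pow j)
        exact mul_le_mul h1 (hterm k hk) (by positivity) (by positivity)
    _ = (j : ℝ) ^ j * (exp 1 * ∑ k ∈ s, (rConv χ k.1.prod * ((k.1.prod : ℕ) : ℝ) ^ (-1 - σ))) := by
        rw [← mul_sum, ← mul_sum]
    _ ≤ (j : ℝ) ^ j * (exp 1 * (12336 * L / σ)) := by gcongr
    _ = _ := by
        congr 2
        rw [hσ]; field_simp

/-- The primes up to `D^24` that are not inert, weighted by `log p / p`, for an arbitrary splitting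
parameter `j`. -/
lemma CharData.sum_log_div_le_of_split {χ : ℕ →* ℝ} {D : ℕ} {L L' L'' : ℝ}
    (h : CharData χ D L L' L'') (hD : 3 ≤ D) {j : ℕ} (hj : 1 ≤ j) :
    ∑ p ∈ (primesUpTo (D ^ 24)).filter (fun p => χ p ≠ -1), log p / p ≤
      4 * log D / j +
        24 * log D * (j * (exp 1 * (12336 * 24 * (L * log D) * j)) ^ (1 / (j : ℝ))) := by
  have hL := h.L_pos
  have hD3 : (3 : ℝ) ≤ D := by exact_mod_cast hD
  have hlD : 1 ≤ log D := one_le_log (by linarith)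
  have hj1 : (1 : ℝ) ≤ j := by exact_mod_cast hj
  set y : ℝ := (D : ℝ) ^ (2 / (j : ℝ)) with hy
  have hy1 : 1 ≤ y := Real.one_le_rpow (by linarith) (by positivity)
  set m : ℕ := ⌊y⌋₊ + 1 with hm
  have hym : y < m := by rw [hm]; push_cast; exact Nat.lt_floor_add_one y
  have hmj : D ^ 2 < m ^ j := by
    have h1 : y ^ j = (D : ℝ) ^ 2 := by
      rw [hy, ← rpow_natCast, ← rpow_mul (by linarith), div_mul_cancel₀ _ (by positivity)]
      norm_num
    have h2 : y ^ j < (m : ℝ) ^ j := pow_lt_pow_left₀ hym (by linarith) (by omega)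
    rw [h1] at h2
    exact_mod_cast h2
  set S := (primesUpTo (D ^ 24)).filter (fun p => χ p ≠ -1)
  rw [← Finset.sum_filter_add_sum_filter_not S (fun p => p < m)]
  have hlZ : log ((D ^ 24 : ℕ) : ℝ) = 24 * log D := by
    push_cast; rw [log_pow]; norm_num
  refine add_le_add ?_ ?_
  · have hfl : 1 ≤ ⌊y⌋₊ := Nat.le_floor (by exact_mod_cast hy1)
    calc _ ≤ ∑ p ∈ primesUpTo ⌊y⌋₊, log p / p := by
          refine Finset.sum_le_sum_of_subset_of_nonneg (fun p hp => ?_)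
            fun p _ _ => div_nonneg (log_natCast_nonneg _) (Nat.cast_nonneg _)
          obtain ⟨h1, h2⟩ := mem_filter.1 hp
          have h3 := (mem_filter.1 h1).1
          have h4 := prime_of_mem_primesUpTo h3
          exact mem_filter.2 ⟨mem_Icc.2 ⟨h4.one_le, by omega⟩, h4⟩
      _ ≤ 2 * log ⌊y⌋₊ := sum_log_div_prime_le hfl
      _ ≤ 2 * log y := by
          gcongr
          exact Nat.floor_le (by linarith)
      _ = _ := by rw [hy, Real.log_rpow (by linarith)]; ring
  · set T := S.filter fun p => ¬ p < m
    have hT : ∀ p ∈ T, p.Prime ∧ χ p ≠ -1 ∧ m ≤ p ∧ p ≤ D ^ 24 := by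
      intro p hp
      obtain ⟨h1, h2⟩ := mem_filter.1 hp
      obtain ⟨h3, h4⟩ := mem_filter.1 h1
      exact ⟨prime_of_mem_primesUpTo h3, h4, not_lt.1 h2, le_of_mem_primesUpTo h3⟩
    have hpow := h.pow_sum_inv_le hT hmj hj (by rw [hlZ]; linarith)
    rw [hlZ] at hpow
    have hS0 : 0 ≤ ∑ p ∈ T, ((p : ℝ))⁻¹ := Finset.sum_nonneg fun p _ => by positivity
    have h1 : ∑ p ∈ T, ((p : ℝ))⁻¹ ≤
        j * (exp 1 * (12336 * 24 * (L * log D) * j)) ^ (1 / (j : ℝ)) := by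
      have hA : 0 ≤ exp 1 * (12336 * 24 * (L * log D) * j) := by positivity
      refine le_of_pow_le_pow_left₀ (n := j) (by omega) (by positivity) (hpow.trans_eq ?_)
      rw [mul_pow, ← rpow_natCast ((exp 1 * _) ^ _), ← rpow_mul hA,
        one_div_mul_cancel (by positivity), Real.rpow_one]
      ring
    calc ∑ p ∈ T, log p / p ≤ ∑ p ∈ T, (24 * log D) * ((p : ℝ))⁻¹ := by
          refine sum_le_sum fun p hp => ?_
          rw [div_eq_mul_inv]
          gcongr
          rw [← hlZ]
          have := (hT p hp).1.pos
          exact log_le_log (by exact_mod_cast this) (by exact_mod_cast (hT p hp).2.2.2)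
      _ = (24 * log D) * ∑ p ∈ T, ((p : ℝ))⁻¹ := by rw [mul_sum]
      _ ≤ _ := by gcongr

/-- The choice of the splitting parameter: `j ≈ Λ / (4 log Λ)` with `Λ = log (1/η)`. -/
lemma exists_split (C : ℝ) (hC : 0 ≤ C) : ∃ Λ₀ : ℝ, 3 ≤ Λ₀ ∧ ∀ Λ, Λ₀ ≤ Λ → ∃ j : ℕ, 1 ≤ j ∧
    1 ≤ log Λ ∧
    1 / (j : ℝ) ≤ 8 * (log Λ / Λ) ∧
    j * (C * exp (-Λ) * j) ^ (1 / (j : ℝ)) ≤ log Λ / Λ := by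
  have h1 : ∀ᶠ Λ : ℝ in atTop, 4 * log Λ ≤ Λ := by
    have := (Real.isLittleO_log_id_atTop.bound (by norm_num : (0 : ℝ) < 1 / 4))
    filter_upwards [this, eventually_ge_atTop 1] with x hx hx1
    rw [id, norm_of_nonneg (log_nonneg hx1), norm_of_nonneg (by linarith)] at hx
    linarith
  have h2 : ∀ᶠ Λ : ℝ in atTop, C * Λ ≤ exp (Λ / 2) := by
    have h3 := (Real.tendsto_pow_mul_exp_neg_atTop_nhds_zero 1).comp
      (tendsto_id.atTop_div_const (by norm_num : (0 : ℝ) < 2))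
    have h4 := (h3.const_mul (2 * C)).eventually (gt_mem_nhds (by norm_num : 2 * C * 0 < (1 : ℝ)))
    filter_upwards [h4] with x hx
    simp only [Function.comp_apply, id, pow_one] at hx
    rw [exp_neg] at hx
    have := exp_pos (x / 2)
    rw [← mul_assoc, mul_inv_lt_iff₀ this] at hx
    linarith
  obtain ⟨Λ₁, hΛ₁⟩ := eventually_atTop.1 (h1.and h2)
  refine ⟨max 3 Λ₁, le_max_left _ _, fun Λ hΛ => ?_⟩
  have hΛ3 : 3 ≤ Λ := (le_max_left _ _).trans hΛ
  obtain ⟨g1, g2⟩ := hΛ₁ Λ ((le_max_right _ _).trans hΛ)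
  have hl : 1 ≤ log Λ := one_le_log (by linarith)
  set x : ℝ := Λ / (4 * log Λ) with hx
  have hx1 : 1 ≤ x := by rw [hx, le_div_iff₀ (by linarith)]; linarith
  have hj1 : 1 ≤ ⌊x⌋₊ := Nat.le_floor (by exact_mod_cast hx1)
  have hj1' : (1 : ℝ) ≤ ⌊x⌋₊ := by exact_mod_cast hj1
  have hjx : (⌊x⌋₊ : ℝ) ≤ x := Nat.floor_le (by linarith)
  have hxj : x < ⌊x⌋₊ + 1 := Nat.lt_floor_add_one x
  have hxΛ : x ≤ Λ := by rw [hx]; exact div_le_self (by linarith) (by linarith)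
  refine ⟨⌊x⌋₊, hj1, hl, ?_, ?_⟩
  · have h5 : 8 * (log Λ / Λ) = 1 / (x / 2) := by rw [hx]; field_simp; norm_num
    rw [h5]
    exact one_div_le_one_div_of_le (by linarith) (by linarith)
  · have h6 : C * exp (-Λ) * ⌊x⌋₊ ≤ exp (-(Λ / 2)) := by
      calc C * exp (-Λ) * ⌊x⌋₊ ≤ C * exp (-Λ) * Λ := by gcongr; linarith
        _ = (C * Λ) * exp (-Λ) := by ring
        _ ≤ exp (Λ / 2) * exp (-Λ) := by gcongr
        _ = _ := by rw [← exp_add]; ring_nf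
    have h7 : (C * exp (-Λ) * ⌊x⌋₊) ^ (1 / (⌊x⌋₊ : ℝ)) ≤ (Λ ^ 2)⁻¹ := by
      calc _ ≤ exp (-(Λ / 2)) ^ (1 / (⌊x⌋₊ : ℝ)) := by gcongr
        _ = exp (-(Λ / 2) * (1 / (⌊x⌋₊ : ℝ))) := (Real.exp_mul _ _).symm
        _ ≤ exp (-(2 * log Λ)) := by
            apply exp_le_exp.2
            have h8 : 2 * log Λ = Λ / 2 * (1 / x) := by rw [hx]; field_simp; norm_num
            rw [h8, neg_mul, neg_le_neg_iff]
            gcongr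
        _ = (Λ ^ 2)⁻¹ := by
            rw [exp_neg, show 2 * log Λ = log (Λ ^ 2) by rw [log_pow]; norm_num,
              Real.exp_log (by positivity)]
    calc _ ≤ Λ * (Λ ^ 2)⁻¹ := mul_le_mul (by linarith) h7 (by positivity) (by linarith)
      _ = 1 / Λ := by field_simp
      _ ≤ log Λ / Λ := by gcongr

lemma summable_log_div_sq : Summable fun n : ℕ => log n * ((n : ℝ)⁻¹) ^ 2 := by
  have h := (Real.summable_nat_rpow_inv.2 (by norm_num : (1 : ℝ) < 3 / 2)).mul_left 2
  refine h.of_nonneg_of_le (fun n => mul_nonneg (log_natCast_nonneg n) (by positivity)) fun n => ?_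
  rcases Nat.eq_zero_or_pos n with rfl | hn
  · simp
  have hn0 : (0 : ℝ) < n := by exact_mod_cast hn
  have h1 := Real.log_le_rpow_div hn0.le (by norm_num : (0 : ℝ) < 1 / 2)
  have h2 : ((n : ℝ) ^ (3 / 2 : ℝ))⁻¹ = (n : ℝ) ^ (1 / 2 : ℝ) * ((n : ℝ)⁻¹) ^ 2 := by
    rw [inv_pow, ← rpow_natCast, ← rpow_neg hn0.le, ← rpow_neg hn0.le,
      ← rpow_add hn0]
    norm_num
  rw [h2]
  have : 0 ≤ ((n : ℝ)⁻¹) ^ 2 := by positivity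
  nlinarith

/-- The lacunarity saving `κ`: `∑_{p ≤ D^24} log p (r(p)/p + 1/p²) ≪ κ log D`. -/
lemma exists_lacunarity : ∃ C η₀ : ℝ, 0 ≤ C ∧ 0 < η₀ ∧ η₀ ≤ 1 ∧
    ∀ {χ : ℕ →* ℝ} {D : ℕ} {L L' L'' : ℝ}, CharData χ D L L' L'' → 128 ≤ D →
      L * log D ≤ η₀ →
      0 ≤ log (log (1 / (L * log D))) / log (1 / (L * log D)) ∧
      log (log (1 / (L * log D))) / log (1 / (L * log D)) ≤ 1 ∧
      ∑ p ∈ primesUpTo (D ^ 24), log p * primeWeight χ p ≤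
        C * (log (log (1 / (L * log D))) / log (1 / (L * log D))) *
          log D := by
  obtain ⟨Λ₀, hΛ₀, hsplit⟩ := exists_split (exp 1 * (12336 * 24)) (by positivity)
  set B := ∑' n : ℕ, log n * ((n : ℝ)⁻¹) ^ 2 with hB
  have hB0 : 0 ≤ B := tsum_nonneg fun n => mul_nonneg (log_natCast_nonneg n) (by positivity)
  refine ⟨2 * (32 + 24) + 2 * B, exp (-Λ₀), by positivity, exp_pos _,
    Real.exp_le_one_iff.2 (by linarith), ?_⟩
  intro χ D L L' L'' h hD hη
  have hL := h.L_pos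
  have hD128 : (128 : ℝ) ≤ D := by exact_mod_cast hD
  have hlD : 1 ≤ log D := one_le_log (by linarith)
  set η := L * log D with hηd
  have hη0 : 0 < η := by positivity
  set Λ := log (1 / η) with hΛd
  have hΛη : exp (-Λ) = η := by
    rw [hΛd, one_div, Real.log_inv, neg_neg, Real.exp_log hη0]
  have hΛ : Λ₀ ≤ Λ := by
    have : exp (-Λ) ≤ exp (-Λ₀) := by rw [hΛη]; exact hη
    linarith [exp_le_exp.1 this]
  obtain ⟨j, hj, hl, hj1, hj2⟩ := hsplit Λ hΛ
  have hΛpos : 0 < Λ := by linarith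
  set κ := log Λ / Λ with hκ
  have hκ0 : 0 ≤ κ := by positivity
  refine ⟨hκ0, ?_, ?_⟩
  · rw [hκ, div_le_one hΛpos]; exact Real.log_le_self hΛpos.le
  -- the saving never beats `1 / log D`, since `L ≫ 1 / D`
  have hκD : 1 ≤ 2 * (κ * log D) := by
    have h1 : Λ ≤ 2 * log D := by
      have h2 : 1 / η ≤ (D : ℝ) ^ 2 := by
        rw [div_le_iff₀ hη0]
        have h3 := h.L_ge
        have h4 : (D : ℝ) ^ 2 * (1 / (128 * D)) ≤ (D : ℝ) ^ 2 * η := by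
          gcongr
          nlinarith
        refine le_trans ?_ h4
        rw [mul_one_div, le_div_iff₀ (by positivity)]
        nlinarith
      calc Λ ≤ log ((D : ℝ) ^ 2) := log_le_log (by positivity) h2
        _ = _ := by rw [log_pow]; norm_num
    have h5 : 1 ≤ κ * Λ := by rw [hκ, div_mul_cancel₀ _ hΛpos.ne']; exact hl
    nlinarith
  have hsp := h.sum_log_div_le_of_split (by omega) hj
  rw [show exp 1 * (12336 * 24 * (L * log D) * (j : ℝ)) =
    exp 1 * (12336 * 24) * exp (-Λ) * j by rw [hΛη, hηd]; ring] at hsp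
  have hsp2 : ∑ p ∈ (primesUpTo (D ^ 24)).filter (fun p => χ p ≠ -1), log p / p ≤
      (32 + 24) * (κ * log D) := by
    refine hsp.trans ?_
    have e1 : 4 * log D / j = 4 * log D * (1 / j) := by ring
    rw [e1]
    have e2 := mul_le_mul_of_nonneg_left hj1 (by positivity : 0 ≤ 4 * log D)
    have e3 := mul_le_mul_of_nonneg_left hj2 (by positivity : 0 ≤ 24 * log D)
    linarith
  have h1 : ∑ p ∈ primesUpTo (D ^ 24), log p * (rConv χ p / p) ≤
      2 * ∑ p ∈ (primesUpTo (D ^ 24)).filter (fun p => χ p ≠ -1), log p / p := by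
    rw [mul_sum, Finset.sum_filter]
    refine sum_le_sum fun p hp => ?_
    have hpp := prime_of_mem_primesUpTo hp
    have hlp : 0 ≤ log p := log_natCast_nonneg _
    rw [rConv_prime hpp]
    split_ifs with hc
    · have := (abs_le.1 (h.tri.abs_le_one p)).2
      calc log p * ((1 + χ p) / p) ≤ log p * ((1 + 1) / p) := by gcongr
        _ = _ := by ring
    · rw [not_not.1 hc]; simp
  have h2 : ∑ p ∈ primesUpTo (D ^ 24), log p * ((p : ℝ)⁻¹) ^ 2 ≤ B :=
    summable_log_div_sq.sum_le_tsum _ fun n _ =>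
      mul_nonneg (log_natCast_nonneg n) (by positivity)
  simp only [primeWeight, mul_add, Finset.sum_add_distrib]
  nlinarith

/-! ### Real characters -/

section

variable {D : ℕ} {ψ : DirichletCharacter ℂ D}

lemma ofReal_re_of_isQuadratic (h : ψ.IsQuadratic) (a : ZMod D) : (((ψ a).re : ℝ) : ℂ) = ψ a := by
  rcases h a with h | h | h <;> simp [h]

/-- The values of a quadratic character on the naturals, as real numbers. -/
def realChar (ψ : DirichletCharacter ℂ D) (h : ψ.IsQuadratic) : ℕ →* ℝ where
  toFun n := (ψ (n : ZMod D)).re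
  map_one' := by simp
  map_mul' m n := by
    apply Complex.ofReal_injective
    rw [Complex.ofReal_mul, ofReal_re_of_isQuadratic h, ofReal_re_of_isQuadratic h,
      ofReal_re_of_isQuadratic h]
    push_cast
    rw [map_mul]

lemma realChar_cast (h : ψ.IsQuadratic) (n : ℕ) : ((realChar ψ h n : ℝ) : ℂ) = ψ (n : ZMod D) :=
  ofReal_re_of_isQuadratic h _

lemma isTrivalued_realChar (h : ψ.IsQuadratic) : IsTrivalued (realChar ψ h) := by
  intro n
  rcases h (n : ZMod D) with h' | h' | h' <;> simp [realChar, h']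

lemma oneConv_eq (h : ψ.IsQuadratic) (n : ℕ) : oneConv ψ n = (rConv (realChar ψ h) n : ℝ) := by
  simp only [oneConv, rConv, Complex.ofReal_sum, realChar_cast]

lemma h_eq (h : ψ.IsQuadratic) (n : ℕ) :
    SecondMoment.h ψ n = (hReal (realChar ψ h) n : ℝ) := by
  simp only [SecondMoment.h, hReal]
  push_cast
  simp only [realChar_cast]

lemma rho1_eq (h : ψ.IsQuadratic) (n : ℕ) : rho1 ψ n = (rho1Real (realChar ψ h) n : ℝ) := by
  simp only [rho1, rho1Real, h_eq h]
  push_cast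
  simp only [realChar_cast]

lemma realChar_eq_zero_iff (h : ψ.IsQuadratic) {p : ℕ} (hp : p.Prime) :
    realChar ψ h p = 0 ↔ p ∣ D := by
  have h1 : realChar ψ h p = 0 ↔ ψ (p : ZMod D) = 0 := by
    rw [← realChar_cast h, Complex.ofReal_eq_zero]
  rw [h1, ← not_iff_not, ← hp.coprime_iff_not_dvd, ← ZMod.isUnit_iff_coprime]
  constructor
  · intro h2
    by_contra h3
    exact h2 (ψ.map_nonunit h3)
  · intro h2
    exact (h2.map ψ).ne_zero

lemma singularSeries2_eq (h : ψ.IsQuadratic) (hD : D ≠ 0) {X : ℝ} (hX : (D : ℝ) ≤ X) :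
    singularSeries2 ψ X = ((∏ p ∈ primesUpTo ⌊X⌋₊, localFactor (realChar ψ h) p : ℝ) : ℂ) := by
  rw [singularSeries2, ← Finset.prod_filter_mul_prod_filter_not (primesUpTo ⌊X⌋₊) (fun p => p ∣ D),
    Complex.ofReal_mul, Complex.ofReal_prod, Complex.ofReal_prod]
  congr 1
  · refine Finset.prod_congr ?_ fun p hp => ?_
    · ext p
      simp only [Nat.mem_primeFactors, primesUpTo, mem_filter, mem_Icc]
      constructor
      · rintro ⟨hp, hd, -⟩
        refine ⟨⟨⟨hp.one_le, Nat.le_floor (le_trans ?_ hX)⟩, hp⟩, hd⟩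
        exact_mod_cast Nat.le_of_dvd (Nat.pos_of_ne_zero hD) hd
      · rintro ⟨⟨-, hp⟩, hd⟩
        exact ⟨hp, hd, hD⟩
    · obtain ⟨hp1, hd⟩ := mem_filter.1 hp
      rw [localFactor, if_pos ((realChar_eq_zero_iff h (prime_of_mem_primesUpTo hp1)).2 hd)]
      push_cast
      rfl
  · refine Finset.prod_congr ?_ fun p hp => ?_
    · rw [primesUpTo, Finset.filter_filter]
    · obtain ⟨hp1, hd⟩ := mem_filter.1 hp
      rw [localFactor, if_neg (fun h0 => hd ((realChar_eq_zero_iff h (prime_of_mem_primesUpTo hp1)).1 h0))]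
      push_cast
      rw [realChar_cast]

lemma ne_one_of_odd (h : ψ.Odd) : ψ ≠ 1 := by
  rintro rfl
  have h1 : (1 : DirichletCharacter ℂ D) (-1) = -1 := h
  rw [MulChar.one_apply (by exact isUnit_one.neg)] at h1
  norm_num at h1

lemma tendsto_re_and_im_eq_zero {u : ℕ → ℝ} {z : ℂ}
    (h : Tendsto (fun N => ((u N : ℝ) : ℂ)) atTop (𝓝 z)) :
    Tendsto u atTop (𝓝 z.re) ∧ ((z.re : ℝ) : ℂ) = z := by
  have h1 := (Complex.continuous_re.tendsto z).comp h
  have h2 := (Complex.continuous_im.tendsto z).comp h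
  simp only [Function.comp_def, Complex.ofReal_re, Complex.ofReal_im] at h1 h2
  refine ⟨h1, ?_⟩
  have := tendsto_nhds_unique h2 tendsto_const_nhds
  exact Complex.ext (by simp) (by simpa using this.symm)

variable [NeZero D]

/-- The analytic data of a real odd character. -/
lemma charData_realChar (h : ψ.IsQuadratic) (hodd : ψ.Odd) (hD : 2 ≤ D) :
    CharData (realChar ψ h) D (L1 ψ) (deriv ψ.LFunction 1).re (iteratedDeriv 2 ψ.LFunction 1).re ∧
      ((L1 ψ : ℝ) : ℂ) = ψ.LFunction 1 ∧
      (((deriv ψ.LFunction 1).re : ℝ) : ℂ) = deriv ψ.LFunction 1 ∧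
      (((iteratedDeriv 2 ψ.LFunction 1).re : ℝ) : ℂ) = iteratedDeriv 2 ψ.LFunction 1 := by
  have hψ := ne_one_of_odd hodd
  have key : ∀ j : ℕ, j ≤ 2 → Tendsto (fun N => ((∑ i ∈ range N,
      realChar ψ h (i + 1) * (-log ((i + 1 : ℕ) : ℝ)) ^ j / ((i + 1 : ℕ) : ℝ) : ℝ) : ℂ)) atTop
      (𝓝 (iteratedDeriv j ψ.LFunction 1)) := by
    intro j hj
    refine (tendsto_charSum_deriv_one hψ hj).congr fun N => ?_
    rw [Complex.ofReal_sum]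
    refine sum_congr rfl fun i _ => ?_
    rw [Complex.cpow_neg_one, Complex.ofReal_div, Complex.ofReal_mul, realChar_cast,
      ← Complex.ofReal_natCast (i + 1), ← Complex.ofReal_log (Nat.cast_nonneg _)]
    push_cast
    ring
  obtain ⟨a0, b0⟩ := tendsto_re_and_im_eq_zero (key 0 (by norm_num))
  obtain ⟨a1, b1⟩ := tendsto_re_and_im_eq_zero (key 1 (by norm_num))
  obtain ⟨a2, b2⟩ := tendsto_re_and_im_eq_zero (key 2 le_rfl)
  rw [iteratedDeriv_zero] at a0 b0
  rw [iteratedDeriv_one] at a1 b1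
  refine ⟨⟨hD, isTrivalued_realChar h, fun N => ?_, ?_, ?_, ?_⟩, b0, b1, b2⟩
  · have := norm_sum_range_char_le hψ N
    simp only [← realChar_cast h, ← Complex.ofReal_sum, Complex.norm_real] at this
    exact this
  · refine a0.congr fun N => sum_congr rfl fun i _ => ?_
    rw [pow_zero, mul_one]
  · refine a1.neg.congr fun N => ?_
    rw [← Finset.sum_neg_distrib]
    refine sum_congr rfl fun i _ => ?_
    rw [pow_one]; ring
  · refine a2.congr fun N => sum_congr rfl fun i _ => ?_
    rw [neg_sq]

end

/-! ### The smoothed character sum -/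

section

variable {D : ℕ} (ψ : DirichletCharacter ℂ D) (G : ℂ → ℂ) (k : ℕ)

/-- The sum over `d` of `ψ(d)/d · V(d² y)`. -/
def charV (y : ℝ) : ℂ :=
  ∑' d : ℕ+, ψ ((d : ℕ) : ZMod D) / (d : ℂ) * V G k ((d : ℝ) ^ 2 * y)

variable {ψ G k}

lemma sum_range_rpow_le {s : ℝ} (hs : 0 < s) (N : ℕ) :
    ∑ i ∈ range (N + 1), ((i + 1 : ℕ) : ℝ) ^ (-1 - s) ≤
      1 + (1 - ((N + 1 : ℕ) : ℝ) ^ (-s)) / s := by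
  induction N with
  | zero => simp
  | succ N ih =>
    rw [sum_range_succ]
    obtain ⟨m, hm⟩ : ∃ m : ℝ, m = ((N + 1 : ℕ) : ℝ) := ⟨_, rfl⟩
    have hm0 : 0 < m := by rw [hm]; positivity
    have hm1 : ((N + 1 + 1 : ℕ) : ℝ) = m + 1 := by rw [hm]; push_cast; ring
    rw [← hm] at ih
    rw [hm1]
    have h1 : 1 + s / (m + 1) ≤ ((m + 1) / m) ^ s := by
      rw [rpow_def_of_pos (by positivity)]
      have h2 := Real.one_sub_inv_le_log_of_pos (by positivity : 0 < (m + 1) / m)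
      have h3 : 1 - ((m + 1) / m)⁻¹ = 1 / (m + 1) := by field_simp; ring
      rw [h3] at h2
      calc 1 + s / (m + 1) = 1 / (m + 1) * s + 1 := by ring
        _ ≤ log ((m + 1) / m) * s + 1 := by gcongr
        _ ≤ _ := add_one_le_exp _
    have h4 : (m + 1) ^ (-1 - s) * s ≤ m ^ (-s) - (m + 1) ^ (-s) := by
      have h5 : m ^ (-s) = (m + 1) ^ (-s) * ((m + 1) / m) ^ s := by
        rw [Real.div_rpow (by positivity) hm0.le, rpow_neg hm0.le,
          rpow_neg (by positivity : (0 : ℝ) ≤ m + 1)]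
        have : 0 < (m + 1) ^ s := by positivity
        field_simp
      have h6 : (m + 1) ^ (-1 - s) = (m + 1) ^ (-s) * (m + 1)⁻¹ := by
        rw [sub_eq_add_neg, rpow_add (by positivity), rpow_neg_one, mul_comm]
      have h7 := mul_le_mul_of_nonneg_left h1 (by positivity : 0 ≤ (m + 1) ^ (-s))
      rw [h5, h6]
      calc _ = (m + 1) ^ (-s) * (1 + s / (m + 1)) - (m + 1) ^ (-s) := by ring
        _ ≤ _ := by linarith
    rw [← le_div_iff₀ hs] at h4
    have h8 : (1 - (m + 1) ^ (-s)) / s = (1 - m ^ (-s)) / s + (m ^ (-s) - (m + 1) ^ (-s)) / s := by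
      ring
    linarith

lemma tsum_pnat_rpow_le {σ : ℝ} (hσ : 0 < σ) (hσ1 : σ ≤ 1) :
    (Summable fun d : ℕ+ => (d : ℝ) ^ (-1 - 2 * σ)) ∧ ∑' d : ℕ+, (d : ℝ) ^ (-1 - 2 * σ) ≤ 2 / σ := by
  have h0 : ∀ i : ℕ, 0 ≤ ((i + 1 : ℕ) : ℝ) ^ (-1 - 2 * σ) := fun i => by positivity
  have hb : ∀ N, ∑ i ∈ range N, ((i + 1 : ℕ) : ℝ) ^ (-1 - 2 * σ) ≤ 2 / σ := by
    intro N
    have h1 := sum_range_rpow_le (by positivity : 0 < 2 * σ) N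
    rw [sum_range_succ] at h1
    have h2 : (1 - ((N + 1 : ℕ) : ℝ) ^ (-(2 * σ))) / (2 * σ) ≤ 1 / (2 * σ) := by
      gcongr
      have : 0 ≤ ((N + 1 : ℕ) : ℝ) ^ (-(2 * σ)) := by positivity
      linarith
    have h3 : 1 + 1 / (2 * σ) ≤ 2 / σ := by
      rw [← sub_nonneg]
      have : 2 / σ - (1 + 1 / (2 * σ)) = (3 - 2 * σ) / (2 * σ) := by field_simp; ring
      rw [this]
      exact div_nonneg (by linarith) (by positivity)
    linarith [h0 N]
  have hs := summable_of_sum_range_le h0 hb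
  have h4 : (fun d : ℕ+ => (d : ℝ) ^ (-1 - 2 * σ)) ∘ Equiv.pnatEquivNat.symm =
      fun i : ℕ => ((i + 1 : ℕ) : ℝ) ^ (-1 - 2 * σ) := rfl
  refine ⟨Equiv.pnatEquivNat.symm.summable_iff.1 (h4 ▸ hs), ?_⟩
  rw [← Equiv.pnatEquivNat.symm.tsum_eq]
  exact hs.tsum_le_of_sum_range_le hb

lemma exists_charV_bound (hG : IsAdmissibleWeight k G) (hk : 1 ≤ k) (hk2 : k ≤ 2) : ∃ C : ℝ, 0 ≤ C ∧
    ∀ {D : ℕ} (ψ : DirichletCharacter ℂ D) (y σ : ℝ), 0 < y → 0 < σ → σ ≤ 1 →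
      (Summable fun d : ℕ+ => ‖ψ ((d : ℕ) : ZMod D) / (d : ℂ) * V G k ((d : ℝ) ^ 2 * y)‖) ∧
      ‖charV ψ G k y‖ ≤ C * σ⁻¹ ^ 3 * y ^ (-σ) := by
  obtain ⟨C, hC, hV⟩ := exists_V_bound hG hk
  refine ⟨2 * C, by positivity, fun {D} ψ y σ hy hσ hσ1 => ?_⟩
  obtain ⟨h1, h2⟩ := tsum_pnat_rpow_le hσ hσ1
  have hb : ∀ d : ℕ+, ‖ψ ((d : ℕ) : ZMod D) / (d : ℂ) * V G k ((d : ℝ) ^ 2 * y)‖ ≤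
      (C * σ⁻¹ ^ 2 * y ^ (-σ)) * (d : ℝ) ^ (-1 - 2 * σ) := by
    intro d
    have hd : (0 : ℝ) < d := by exact_mod_cast d.pos
    have h3 := hV ((d : ℝ) ^ 2 * y) σ (by positivity) hσ hσ1
    have h4 : ‖ψ ((d : ℕ) : ZMod D) / (d : ℂ)‖ ≤ (d : ℝ) ^ (-1 : ℝ) := by
      rw [norm_div, rpow_neg_one, ← one_div]
      have : ‖(d : ℂ)‖ = d := by simp
      rw [this]
      gcongr
      exact DirichletCharacter.norm_le_one ψ _
    have h5 : ((d : ℝ) ^ 2 * y) ^ (-σ) = (d : ℝ) ^ (-(2 * σ)) * y ^ (-σ) := by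
      rw [mul_rpow (by positivity) hy.le, ← rpow_natCast, ← rpow_mul hd.le]
      congr 2; push_cast; ring
    have h6 : (σ ^ k)⁻¹ ≤ σ⁻¹ ^ 2 := by
      rw [← inv_pow]
      exact pow_le_pow_right₀ (by rw [one_le_inv₀ hσ]; exact hσ1) hk2
    rw [norm_mul]
    calc _ ≤ (d : ℝ) ^ (-1 : ℝ) * (C * ((d : ℝ) ^ (-(2 * σ)) * y ^ (-σ)) * σ⁻¹ ^ 2) := by
          rw [h5] at h3
          refine mul_le_mul h4 (h3.trans ?_) (norm_nonneg _) (by positivity)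
          gcongr
      _ = (C * σ⁻¹ ^ 2 * y ^ (-σ)) * ((d : ℝ) ^ (-1 : ℝ) * (d : ℝ) ^ (-(2 * σ))) := by ring
      _ = _ := by rw [← rpow_add hd]; ring_nf
  have hs := (h1.mul_left (C * σ⁻¹ ^ 2 * y ^ (-σ)))
  have hs2 := hs.of_nonneg_of_le (fun d => norm_nonneg _) hb
  refine ⟨hs2, ?_⟩
  calc ‖charV ψ G k y‖ ≤ ∑' d : ℕ+, (C * σ⁻¹ ^ 2 * y ^ (-σ)) * (d : ℝ) ^ (-1 - 2 * σ) :=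
        tsum_of_norm_bounded hs.hasSum hb
    _ ≤ (C * σ⁻¹ ^ 2 * y ^ (-σ)) * (2 / σ) := by
        rw [tsum_mul_left]; gcongr
    _ = _ := by rw [div_eq_mul_inv]; ring

lemma tendsto_charV {y : ℝ}
    (hs : Summable fun d : ℕ+ => ‖ψ ((d : ℕ) : ZMod D) / (d : ℂ) * V G k ((d : ℝ) ^ 2 * y)‖) :
    Tendsto (fun N => ∑ i ∈ range N, ψ ((i + 1 : ℕ) : ZMod D) / ((i + 1 : ℕ) : ℂ) *
      V G k (((i + 1 : ℕ) : ℝ) ^ 2 * y)) atTop (𝓝 (charV ψ G k y)) := by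
  have h1 := (Equiv.pnatEquivNat.symm.hasSum_iff (a := charV ψ G k y)).2 hs.of_norm.hasSum
  exact h1.tendsto_sum_nat

variable [NeZero D]

/-- The polynomial part of `V` produces the Taylor coefficients of `L(s, ψ)` at `1`; the rest is
small by the bound `‖charSum ψ N s‖ ≪ D ‖s‖` on `Re s = 1/2`. -/
lemma exists_charV_sub_bound (hG : IsAdmissibleWeight k G) : ∃ C : ℝ, 0 ≤ C ∧
    ∀ {D : ℕ} [NeZero D] {ψ : DirichletCharacter ℂ D}, ψ ≠ 1 → ∀ {y : ℝ}, 0 < y →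
      (Summable fun d : ℕ+ => ‖ψ ((d : ℕ) : ZMod D) / (d : ℂ) * V G k ((d : ℝ) ^ 2 * y)‖) →
      ∀ {P : ℝ → ℂ} {R : ℂ}, (∀ x : ℝ, 0 < x → V G k x = VRemainder G k x + P x) →
      Tendsto (fun N => ∑ i ∈ range N, ψ ((i + 1 : ℕ) : ZMod D) / ((i + 1 : ℕ) : ℂ) *
        P (((i + 1 : ℕ) : ℝ) ^ 2 * y)) atTop (𝓝 R) →
      ‖charV ψ G k y - R‖ ≤ C * (D * y ^ (1 / 4 : ℝ)) := by
  obtain ⟨C, hC, hb⟩ := exists_sum_VRemainder_bound hG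
  refine ⟨C * 8, by positivity, fun {D} _ {ψ} hψ {y} hy hs {P} {R} hP hR => ?_⟩
  have ht := (tendsto_charV hs).sub hR
  refine le_of_tendsto ht.norm (Eventually.of_forall fun N => ?_)
  have hx : ∀ i : ℕ, (0 : ℝ) < ((i + 1 : ℕ) : ℝ) ^ 2 * y := fun i => by positivity
  have e1 : (∑ i ∈ range N, ψ ((i + 1 : ℕ) : ZMod D) / ((i + 1 : ℕ) : ℂ) *
      V G k (((i + 1 : ℕ) : ℝ) ^ 2 * y)) - (∑ i ∈ range N,
        ψ ((i + 1 : ℕ) : ZMod D) / ((i + 1 : ℕ) : ℂ) * P (((i + 1 : ℕ) : ℝ) ^ 2 * y)) =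
      ∑ i ∈ range N, ψ ((i + 1 : ℕ) : ZMod D) / ((i + 1 : ℕ) : ℂ) *
        VRemainder G k (((i + 1 : ℕ) : ℝ) ^ 2 * y) := by
    rw [← sum_sub_distrib]
    refine sum_congr rfl fun i _ => ?_
    rw [hP _ (hx i)]; ring
  rw [e1]
  have h2 := hb (range N) (fun i => ψ ((i + 1 : ℕ) : ZMod D) / ((i + 1 : ℕ) : ℂ))
    (fun i => ((i + 1 : ℕ) : ℝ) ^ 2 * y) (8 * (D * y ^ (1 / 4 : ℝ))) (fun i _ => hx i) fun v => ?_
  · refine h2.trans_eq (by ring)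
  · set s : ℂ := 1 / 2 + 2 * v * Complex.I with hsdef
    have hre : s.re = 1 / 2 := by simp [hsdef]
    have hnorm : ‖s‖ ≤ 1 / 2 + 2 * |v| := by
      refine (norm_add_le _ _).trans ?_
      simp
    have e2 : ∑ i ∈ range N, ψ ((i + 1 : ℕ) : ZMod D) / ((i + 1 : ℕ) : ℂ) *
        ((((i + 1 : ℕ) : ℝ) ^ 2 * y : ℝ) : ℂ) ^ (-(((-(1 / 4) : ℝ) : ℂ) + v * Complex.I)) =
        (y : ℂ) ^ (-(((-(1 / 4) : ℝ) : ℂ) + v * Complex.I)) * charSum ψ N s := by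
      rw [charSum, mul_sum]
      refine sum_congr rfl fun i _ => ?_
      have hn : ((i + 1 : ℕ) : ℂ) ≠ 0 := by exact_mod_cast Nat.succ_ne_zero i
      rw [Complex.ofReal_mul, Complex.mul_cpow_ofReal_nonneg (by positivity) hy.le, Complex.ofReal_pow,
        Complex.ofReal_natCast, ← Complex.natCast_cpow_natCast_mul (i + 1) 2, 
        show -s = -1 + (2 : ℕ) * (-(((-(1 / 4) : ℝ) : ℂ) + v * Complex.I)) by
          rw [hsdef]; push_cast; ring, Complex.cpow_add _ _ hn, Complex.cpow_neg_one]
      ring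
    rw [e2, norm_mul, Complex.norm_cpow_eq_rpow_re_of_pos hy]
    have h3 := norm_charSum_le hψ (s := s) (by rw [hre]; norm_num) N
    have h4 : (-(((-(1 / 4) : ℝ) : ℂ) + v * Complex.I)).re = 1 / 4 := by simp
    rw [h4]
    rw [hre] at h3
    calc y ^ (1 / 4 : ℝ) * ‖charSum ψ N s‖
        ≤ y ^ (1 / 4 : ℝ) * (2 * D * (1 + (1 / 2 + 2 * |v|) / (1 / 2))) := by
          gcongr
          exact h3.trans (by gcongr)
      _ = (D * y ^ (1 / 4 : ℝ)) * (4 + 8 * |v|) := by ring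
      _ ≤ (D * y ^ (1 / 4 : ℝ)) * (8 * (1 + |v|)) := by gcongr; linarith
      _ = _ := by ring

end

/-! ### The truncated sum and its evaluation -/

/-- `pairSum` with the truncation `a₁, a₂ ≤ X / d`. -/
def truncPair (w : ℕ → ℝ) (X : ℝ) (d A : ℕ) : ℝ :=
  ∑ x ∈ A.divisorsAntidiagonal.filter (fun m : ℕ × ℕ => (m.1 : ℝ) ≤ X / d ∧ (m.2 : ℝ) ≤ X / d),
    w (d * x.1) * w (d * x.2)

open scoped Classical in
/-- The arithmetic weight of the tuple `(d, a, b, g, n)` in the diagonal sum. -/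
def fTrunc (χ : ℕ →* ℝ) (X : ℝ) (t : Tup) : ℝ :=
  (if (t.1 : ℝ) ≤ X ∧ ((t.2.1 * t.2.2.1 * t.2.2.2.1 : ℕ) : ℝ) ≤ X ^ 2 then
    truncPair (rho1Real χ) X t.1 (t.2.1 * t.2.2.1 * t.2.2.2.1) else 0) *
    ((moebius t.2.2.2.1 : ℝ) * χ t.2.2.2.1) * rConv χ t.2.2.1 *
    rConv χ (t.2.1 * t.2.2.2.1 * t.2.2.2.2) * rConv χ t.2.2.2.2 * ((tDen t : ℝ))⁻¹

section

variable {χ : ℕ →* ℝ}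

lemma abs_truncPair_le (w : ℕ → ℝ) (X : ℝ) (d A : ℕ) :
    |truncPair w X d A| ≤ pairSum (fun n => |w n|) d A := by
  refine (Finset.abs_sum_le_sum_abs _ _).trans
    ((Finset.sum_le_sum_of_subset_of_nonneg (Finset.filter_subset _ _)
      fun _ _ _ => abs_nonneg _).trans (sum_le_sum fun x _ => ?_))
  rw [abs_mul]

lemma abs_fTrunc_le (hχ : IsTrivalued χ) (X : ℝ) (t : Tup) : |fTrunc χ X t| ≤ FTup χ t := by
  have h2 := rConv_nonneg hχ t.2.2.1
  have h3 := rConv_nonneg hχ (t.2.1 * t.2.2.2.1 * t.2.2.2.2)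
  have h4 := rConv_nonneg hχ t.2.2.2.2
  rw [fTrunc, FTup, abs_mul, abs_mul, abs_mul, abs_mul, abs_mul, abs_mul, abs_of_nonneg h2,
    abs_of_nonneg h3, abs_of_nonneg h4, abs_of_nonneg (by positivity : (0 : ℝ) ≤ ((tDen t : ℝ))⁻¹)]
  have h5 := hχ.abs_le_one t.2.2.2.1
  have h0 := pairSum_abs_nonneg (rho1Real χ) t.1 (t.2.1 * t.2.2.1 * t.2.2.2.1)
  gcongr
  · split_ifs
    · exact abs_truncPair_le _ _ _ _
    · simpa using h0
  · exact mul_le_of_le_one_right (abs_nonneg _) h5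

lemma fTrunc_eq_zero_of_lt {X : ℝ} {t : Tup} (h : X < t.1) : fTrunc χ X t = 0 := by
  rw [fTrunc, if_neg (fun h' => absurd h'.1 (not_le.2 h))]
  simp

lemma tDen_eq_zero {t : Tup} (h : tN t = 0) : tDen t = 0 := by
  simp only [tN, tDen, mul_eq_zero, pow_eq_zero_iff two_ne_zero] at h ⊢
  exact h

lemma FTup_eq_zero {t : Tup} (h : tN t = 0) : FTup χ t = 0 := by
  rw [FTup, tDen_eq_zero h]; simp

lemma fTrunc_eq_zero {X : ℝ} {t : Tup} (h : tN t = 0) : fTrunc χ X t = 0 := by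
  rw [fTrunc, tDen_eq_zero h]; simp

lemma fTup_eq_zero {t : Tup} (h : tN t = 0) : fTup χ t = 0 := by
  rw [fTup, tDen_eq_zero h]; simp

/-- The truncations are invisible on the box. -/
lemma fTrunc_eq_fTup {D : ℕ} {X : ℝ} (hX : (D : ℝ) ^ 24 ≤ X) (hX1 : 1 ≤ X) {t : Tup}
    (ht : InBox D t) : fTrunc χ X t = fTup χ t := by
  by_cases h0 : tN t = 0
  · rw [fTrunc_eq_zero h0, fTup_eq_zero h0]
  obtain ⟨d, a, b, g, n⟩ := t
  obtain ⟨d0, a0, b0, g0, n0⟩ := tN_ne_zero.1 h0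
  simp only at d0 a0 b0 g0 n0
  obtain ⟨h1, -⟩ := ht
  simp only at h1
  have hA : 0 < a * b * g := Nat.pos_of_ne_zero (by simp [a0, b0, g0])
  have h1' : d * (a * b * g) ≤ D ^ 24 := le_trans (le_of_eq (by ring)) h1
  have h2 : ((d * (a * b * g) : ℕ) : ℝ) ≤ X := le_trans (by exact_mod_cast h1') hX
  have hd : (0 : ℝ) < d := by positivity
  have hd1 : (1 : ℝ) ≤ d := by exact_mod_cast Nat.pos_of_ne_zero d0
  have hA1 : (1 : ℝ) ≤ ((a * b * g : ℕ) : ℝ) := by exact_mod_cast hA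
  rw [Nat.cast_mul] at h2
  have h3 : (d : ℝ) ≤ X := le_trans (le_mul_of_one_le_right (by positivity) hA1) h2
  have h4 : ((a * b * g : ℕ) : ℝ) ≤ X := le_trans (le_mul_of_one_le_left (by positivity) hd1) h2
  have h5 : ((a * b * g : ℕ) : ℝ) ≤ X ^ 2 := by nlinarith
  have h6 : ((a * b * g : ℕ) : ℝ) ≤ X / d := by rw [le_div_iff₀ hd]; linarith
  rw [fTrunc, fTup, if_pos ⟨h3, h5⟩, truncPair, pairSum, Finset.filter_true_of_mem]
  intro x hx
  obtain ⟨hx1, hx2⟩ := Nat.mem_divisorsAntidiagonal.1 hx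
  constructor
  · refine le_trans ?_ h6
    exact_mod_cast Nat.le_of_dvd hA ⟨_, hx1.symm⟩
  · refine le_trans ?_ h6
    exact_mod_cast Nat.le_of_dvd hA ⟨x.1, by rw [← hx1, mul_comm]⟩

end

lemma summable_of_tsum_ofReal_le {ι : Type} {f : ι → ℝ} {c : ℝ} (hf : ∀ i, 0 ≤ f i) (hc : 0 ≤ c)
    (h : ∑' i, ofReal (f i) ≤ ofReal c) : Summable f ∧ ∑' i, f i ≤ c := by
  have hne : ∑' i, ofReal (f i) ≠ ⊤ := ne_top_of_le_ne_top ENNReal.ofReal_ne_top h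
  have hs : Summable f := (ENNReal.summable_toReal hne).congr fun i => ENNReal.toReal_ofReal (hf i)
  refine ⟨hs, ?_⟩
  rw [← ENNReal.ofReal_tsum_of_nonneg hf hs] at h
  exact (ENNReal.ofReal_le_ofReal_iff hc).1 h

/-- A termwise bound by a constant multiple of a nonnegative family with known total. -/
lemma norm_tsum_le_of_le_ofReal {ι : Type} {u : ι → ℂ} {F : ι → ℝ≥0∞} {c T : ℝ} (hc : 0 ≤ c)
    (hT : 0 ≤ T) (h : ∀ i, ofReal ‖u i‖ ≤ ofReal c * F i)
    (hF : ∑' i, F i ≤ ofReal T) : (Summable fun i => ‖u i‖) ∧ ‖∑' i, u i‖ ≤ c * T := by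
  have h1 := summable_of_tsum_ofReal_le (f := fun i => ‖u i‖) (c := c * T) (fun _ => norm_nonneg _)
    (by positivity) (by
      rw [ofReal_mul hc]
      calc _ ≤ ∑' i, ofReal c * F i := ENNReal.tsum_le_tsum h
        _ = ofReal c * ∑' i, F i := ENNReal.tsum_mul_left
        _ ≤ _ := by gcongr)
  exact ⟨h1.1, (norm_tsum_le_tsum_norm h1.1).trans h1.2⟩

/-- The product `a g n`. -/
def agn (t : Tup) : ℕ := t.2.1 * t.2.2.2.1 * t.2.2.2.2

/-- The product `b g² n`. -/
def bggn (t : Tup) : ℕ := t.2.2.1 * t.2.2.2.1 ^ 2 * t.2.2.2.2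

/-- The term of the diagonal sum, for a weight `W` in place of the smoothed character sum. -/
def diagW (χ : ℕ →* ℝ) (X Qv : ℝ) (W : ℝ → ℂ) (t : Tup) : ℂ :=
  (fTrunc χ X t : ℂ) * (W (agn t / Qv) * W (bggn t / Qv))

section

variable {χ : ℕ →* ℝ} {X Qv ℓ A : ℝ} {W : ℝ → ℂ}

lemma agn_pos {t : Tup} (h : tN t ≠ 0) : 0 < agn t := by
  obtain ⟨d0, a0, b0, g0, n0⟩ := tN_ne_zero.1 h
  exact Nat.pos_of_ne_zero (mul_ne_zero (mul_ne_zero a0 g0) n0)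

lemma bggn_pos {t : Tup} (h : tN t ≠ 0) : 0 < bggn t := by
  obtain ⟨d0, a0, b0, g0, n0⟩ := tN_ne_zero.1 h
  exact Nat.pos_of_ne_zero (mul_ne_zero (mul_ne_zero b0 (pow_ne_zero 2 g0)) n0)

lemma tN_le {t : Tup} (h : tN t ≠ 0) : tN t ≤ t.1 * (agn t * bggn t) := by
  have h1 : t.1 * (agn t * bggn t) = tN t * (t.2.2.2.1 ^ 2 * t.2.2.2.2) := by
    simp only [agn, bggn, tN]; ring
  obtain ⟨d0, a0, b0, g0, n0⟩ := tN_ne_zero.1 h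
  rw [h1]
  exact Nat.le_mul_of_pos_right _ (Nat.pos_of_ne_zero (mul_ne_zero (pow_ne_zero 2 g0) n0))

lemma rpow_neg_inv_ge {x ℓ c : ℝ} (hx : 0 < x) (hℓ : 0 < ℓ) (h : log x ≤ c * ℓ) :
    exp (-c) ≤ x ^ (-ℓ⁻¹) := by
  rw [rpow_def_of_pos hx, mul_neg]
  apply exp_le_exp.2
  rw [neg_le_neg_iff, ← div_eq_mul_inv, div_le_iff₀ hℓ]
  exact h

lemma rpow_inv_le {x ℓ c : ℝ} (hx : 0 < x) (hℓ : 0 < ℓ) (h : log x ≤ c * ℓ) :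
    x ^ ℓ⁻¹ ≤ exp c := by
  rw [rpow_def_of_pos hx]
  apply exp_le_exp.2
  rw [← div_eq_mul_inv, div_le_iff₀ hℓ]
  exact h

/-- The basic majorant of the diagonal terms. -/
lemma norm_diagW_le (hχ : IsTrivalued χ) (hQ : 0 < Qv) (hℓ : 0 < ℓ)
    (hXℓ : log X ≤ ℓ) (hQℓ : log Qv ≤ ℓ) (hA : 0 ≤ A)
    (hW : ∀ y, 0 < y → ‖W y‖ ≤ A * ℓ ^ 3 * y ^ (-ℓ⁻¹)) (t : Tup) :
    ofReal ‖diagW χ X Qv W t‖ ≤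
      ofReal (A ^ 2 * exp 3 * ℓ ^ 6) * FE χ ℓ⁻¹ t := by
  rw [FE, ← ofReal_mul (by positivity)]
  apply ofReal_le_ofReal
  have hF := FTup_nonneg hχ t
  by_cases h0 : tN t = 0
  · rw [diagW, fTrunc_eq_zero h0]; simp [FTup_eq_zero h0]
  by_cases hd : X < t.1
  · rw [diagW, fTrunc_eq_zero_of_lt hd]; simp; positivity
  rw [not_lt] at hd
  have ha : (0 : ℝ) < agn t := by exact_mod_cast agn_pos h0
  have hb : (0 : ℝ) < bggn t := by exact_mod_cast bggn_pos h0
  have hN : (0 : ℝ) < tN t := by positivity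
  have hd0 : (0 : ℝ) < t.1 := by
    have := (tN_ne_zero.1 h0).1
    positivity
  have e1 : ((agn t : ℝ) / Qv) ^ (-ℓ⁻¹) * ((bggn t : ℝ) / Qv) ^ (-ℓ⁻¹) =
      ((agn t : ℝ) * bggn t) ^ (-ℓ⁻¹) * (Qv ^ ℓ⁻¹ * Qv ^ ℓ⁻¹) := by
    rw [Real.div_rpow ha.le hQ.le, Real.div_rpow hb.le hQ.le, mul_rpow ha.le hb.le,
      rpow_neg hQ.le]
    field_simp
  have e2 : ((agn t : ℝ) * bggn t) ^ (-ℓ⁻¹) ≤ (tN t : ℝ) ^ (-ℓ⁻¹) * (t.1 : ℝ) ^ ℓ⁻¹ := by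
    have h1 : (tN t : ℝ) ≤ t.1 * ((agn t : ℝ) * bggn t) := by exact_mod_cast tN_le h0
    have h2 : (t.1 * ((agn t : ℝ) * bggn t)) ^ (-ℓ⁻¹) ≤ (tN t : ℝ) ^ (-ℓ⁻¹) :=
      Real.rpow_le_rpow_of_nonpos hN h1 (by have := inv_pos.2 hℓ; linarith)
    rw [mul_rpow hd0.le (by positivity)] at h2
    have h3 : (t.1 : ℝ) ^ (-ℓ⁻¹) * (t.1 : ℝ) ^ ℓ⁻¹ = 1 := by
      rw [← rpow_add hd0]; simp
    calc ((agn t : ℝ) * bggn t) ^ (-ℓ⁻¹)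
        = ((t.1 : ℝ) ^ (-ℓ⁻¹) * ((agn t : ℝ) * bggn t) ^ (-ℓ⁻¹)) * (t.1 : ℝ) ^ ℓ⁻¹ := by
          linear_combination (-((agn t : ℝ) * bggn t) ^ (-ℓ⁻¹)) * h3
      _ ≤ _ := by gcongr
  have e3 : (t.1 : ℝ) ^ ℓ⁻¹ ≤ exp 1 :=
    rpow_inv_le hd0 hℓ (by rw [one_mul]; exact (log_le_log hd0 hd).trans hXℓ)
  have e4 : Qv ^ ℓ⁻¹ ≤ exp 1 := rpow_inv_le hQ hℓ (by rwa [one_mul])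
  have hN' : 0 ≤ (tN t : ℝ) ^ (-ℓ⁻¹) := by positivity
  rw [diagW, norm_mul, norm_mul, Complex.norm_real, norm_eq_abs]
  calc |fTrunc χ X t| * (‖W (agn t / Qv)‖ * ‖W (bggn t / Qv)‖)
      ≤ FTup χ t * ((A * ℓ ^ 3 * ((agn t : ℝ) / Qv) ^ (-ℓ⁻¹)) *
          (A * ℓ ^ 3 * ((bggn t : ℝ) / Qv) ^ (-ℓ⁻¹))) := by
        gcongr
        · exact abs_fTrunc_le hχ X t
        · exact hW _ (by positivity)
        · exact hW _ (by positivity)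
    _ = FTup χ t * (A ^ 2 * ℓ ^ 6 * (((agn t : ℝ) * bggn t) ^ (-ℓ⁻¹) * (Qv ^ ℓ⁻¹ * Qv ^ ℓ⁻¹))) := by
        rw [← e1]; ring
    _ ≤ FTup χ t * (A ^ 2 * ℓ ^ 6 * (((tN t : ℝ) ^ (-ℓ⁻¹) * exp 1) *
          (exp 1 * exp 1))) := by
        gcongr
        exact e2.trans (by gcongr)
    _ = _ := by
        rw [show (3 : ℝ) = 1 + 1 + 1 by norm_num, exp_add, exp_add]; ring

/-- Pointwise comparison on the box. -/
lemma norm_mul_sub_le {W₁ W₂ e₁ e₂ : ℂ} {m₁ m₂ L E w r c : ℝ} (hL0 : 0 ≤ L) (hL : L ≤ 1)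
    (h1 : ‖W₁ - (2 * m₁ + L * e₁)‖ ≤ E) (h2 : ‖W₂ - (2 * m₂ + L * e₂)‖ ≤ E)
    (hw : ‖W₂‖ ≤ w) (hm₁ : |m₁| ≤ r) (hm₂ : |m₂| ≤ r) (he₁ : ‖e₁‖ ≤ c) (he₂ : ‖e₂‖ ≤ c) :
    ‖W₁ * W₂ - 4 * (m₁ * m₂)‖ ≤ E * (w + 2 * r + c) + L * (4 * r * c + c ^ 2) := by
  have hE : 0 ≤ E := (norm_nonneg _).trans h1
  have hr : 0 ≤ r := (abs_nonneg _).trans hm₁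
  have hc : 0 ≤ c := (norm_nonneg _).trans he₁
  have hn : ∀ m : ℝ, ‖(2 * m : ℂ)‖ = 2 * |m| := fun m => by simp
  have hLn : ‖(L : ℂ)‖ = L := by rw [Complex.norm_real, norm_of_nonneg hL0]
  have hR1 : ‖(2 * m₁ + L * e₁ : ℂ)‖ ≤ 2 * r + c := by
    refine (norm_add_le _ _).trans ?_
    rw [hn, norm_mul, hLn]
    have := mul_le_mul hL he₁ (norm_nonneg _) zero_le_one
    linarith
  have hid : W₁ * W₂ - 4 * (m₁ * m₂) = (W₁ - (2 * m₁ + L * e₁)) * W₂ +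
      (2 * m₁ + L * e₁) * (W₂ - (2 * m₂ + L * e₂)) +
      L * ((2 * m₁) * e₂ + (2 * m₂) * e₁ + L * (e₁ * e₂)) := by ring
  rw [hid]
  have hlast : ‖((2 * m₁) * e₂ + (2 * m₂) * e₁ + L * (e₁ * e₂) : ℂ)‖ ≤ 4 * r * c + c ^ 2 := by
    refine (norm_add₃_le).trans ?_
    rw [norm_mul (2 * (m₁ : ℂ)) e₂, norm_mul (2 * (m₂ : ℂ)) e₁, norm_mul (L : ℂ) _, norm_mul e₁ e₂, hn, hn,
      hLn]
    have a1 : 2 * |m₁| * ‖e₂‖ ≤ 2 * r * c := by gcongr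
    have a2 : 2 * |m₂| * ‖e₁‖ ≤ 2 * r * c := by gcongr
    have a3 : L * (‖e₁‖ * ‖e₂‖) ≤ 1 * (c * c) := by gcongr
    nlinarith
  refine (norm_add₃_le).trans ?_
  rw [norm_mul, norm_mul, norm_mul, hLn]
  have b1 : ‖W₁ - (2 * m₁ + L * e₁)‖ * ‖W₂‖ ≤ E * w := by gcongr
  have b2 : ‖(2 * m₁ + L * e₁ : ℂ)‖ * ‖W₂ - (2 * m₂ + L * e₂)‖ ≤ (2 * r + c) * E := by gcongr
  have b3 := mul_le_mul_of_nonneg_left hlast hL0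
  linarith

end

lemma mem_range_toTup {D : ℕ} (hD : 1 ≤ D) {t : Tup} (ht : InBox D t) (h0 : tN t ≠ 0) :
    t ∈ Set.range (FT.toTup (S := primesUpTo (D ^ 24))) := by
  obtain ⟨d, a, b, g, n⟩ := t
  obtain ⟨d0, a0, b0, g0, n0⟩ := tN_ne_zero.1 h0
  obtain ⟨h1, h2⟩ := ht
  simp only at d0 a0 b0 g0 n0 h1 h2
  have hM : 0 < d * a * b * g := Nat.pos_of_ne_zero (by simp [d0, a0, b0, g0])
  have key : ∀ m, m ≠ 0 → m ≤ D ^ 24 → m ∈ Nat.factoredNumbers (primesUpTo (D ^ 24)) := by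
    intro m hm hle
    refine ⟨hm, fun p hp => ?_⟩
    have hpp := Nat.prime_of_mem_primeFactorsList hp
    exact mem_filter.2 ⟨mem_Icc.2 ⟨hpp.one_le,
      (Nat.le_of_mem_primeFactorsList hp).trans hle⟩, hpp⟩
  have hle : ∀ m, m ∣ d * a * b * g → m ≤ D ^ 24 := fun m hm => (Nat.le_of_dvd hM hm).trans h1
  refine ⟨(⟨d, key d d0 (hle d ⟨a * b * g, by ring⟩)⟩, ⟨a, key a a0 (hle a ⟨d * b * g, by ring⟩)⟩,
    ⟨b, key b b0 (hle b ⟨d * a * g, by ring⟩)⟩, ⟨g, key g g0 (hle g ⟨d * a * b, by ring⟩)⟩,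
    ⟨n, key n n0 (h2.trans (Nat.pow_le_pow_right hD (by norm_num)))⟩), rfl⟩

/-- The arithmetic weight times the two linear forms in the logarithms that approximate the smoothed
character sums. -/
def mainTerm (χ : ℕ →* ℝ) (M l : ℝ) (t : Tup) : ℝ :=
  fTup χ t * ((M - l * logAGN t) * (M - l * logBGN t))

lemma box_bounds {D : ℕ} {ℓ : ℝ} (hDℓ : 24 * log D ≤ ℓ) {t : Tup} (ht : InBox D t)
    (h0 : tN t ≠ 0) : (agn t : ℝ) ≤ (D : ℝ) ^ 55 ∧ (bggn t : ℝ) ≤ (D : ℝ) ^ 55 ∧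
      log (agn t) ≤ 3 * ℓ ∧ log (bggn t) ≤ 3 * ℓ ∧ log (tN t) ≤ 2 * ℓ := by
  obtain ⟨d, a, b, g, n⟩ := t
  have ha := agn_pos h0
  have hb := bggn_pos h0
  have hN := Nat.pos_of_ne_zero h0
  obtain ⟨d0, a0, b0, g0, n0⟩ := tN_ne_zero.1 h0
  obtain ⟨h1, h2⟩ := ht
  simp only [agn, bggn, tN] at d0 a0 b0 g0 n0 h1 h2 ha hb hN ⊢
  have hlD : 0 ≤ log D := log_natCast_nonneg D
  have hM : 0 < d * a * b * g := Nat.pos_of_ne_zero (by simp [d0, a0, b0, g0])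
  have hD1 : 1 ≤ D := by
    rcases Nat.eq_zero_or_pos D with rfl | h
    · omega
    · exact h
  have e1 : a * g ≤ D ^ 24 := (Nat.le_of_dvd hM ⟨d * b, by ring⟩).trans h1
  have e2 : b * g ^ 2 ≤ D ^ 48 := by
    have : b * g ^ 2 ≤ (d * a * b * g) ^ 2 :=
      Nat.le_of_dvd (by positivity) ⟨(d * a) ^ 2 * b, by ring⟩
    calc _ ≤ (d * a * b * g) ^ 2 := this
      _ ≤ (D ^ 24) ^ 2 := Nat.pow_le_pow_left h1 2
      _ = D ^ 48 := by ring
  have f1 : a * g * n ≤ D ^ 31 := (Nat.mul_le_mul e1 h2).trans_eq (by ring)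
  have f2 : b * g ^ 2 * n ≤ D ^ 55 := (Nat.mul_le_mul e2 h2).trans_eq (by ring)
  have f3 : d * a * b * g * n ≤ D ^ 31 := (Nat.mul_le_mul h1 h2).trans_eq (by ring)
  have f1' : a * g * n ≤ D ^ 55 := f1.trans (Nat.pow_le_pow_right hD1 (by norm_num))
  have lg : ∀ m k : ℕ, 0 < m → m ≤ D ^ k → log (m : ℝ) ≤ k * log D := by
    intro m k hm hmk
    rw [← log_pow]
    exact log_le_log (by exact_mod_cast hm) (by exact_mod_cast hmk)
  have g1 := lg _ _ ha f1
  have g2 := lg _ _ hb f2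
  have g3 := lg _ _ hN f3
  push_cast at g1 g2 g3
  refine ⟨by exact_mod_cast f1', by exact_mod_cast f2, ?_, ?_, ?_⟩ <;> push_cast <;> linarith

lemma abs_mainTerm_le {χ : ℕ →* ℝ} (hχ : IsTrivalued χ) {M l B : ℝ} (hM : |M| ≤ B) (hl : |l| ≤ B)
    (t : Tup) : |mainTerm χ M l t| ≤ 2 * B ^ 2 * (FTup χ t * (1 + log (tN t)) ^ 2) := by
  have hB : 0 ≤ B := (abs_nonneg _).trans hM
  have hF := FTup_nonneg hχ t
  have hlN : 0 ≤ log (tN t) := log_natCast_nonneg _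
  by_cases h0 : tN t = 0
  · rw [mainTerm, fTup_eq_zero h0, zero_mul, abs_zero]; positivity
  have key : ∀ x c : ℝ, 0 ≤ x → x ≤ c → |M - l * x| ≤ B * (1 + c) := by
    intro x c hx hxc
    refine (abs_sub _ _).trans ?_
    rw [abs_mul, abs_of_nonneg hx]
    have := mul_le_mul hl hxc hx hB
    linarith
  have h1 : logAGN t ≤ log (tN t) := by
    refine log_le_log (by exact_mod_cast agn_pos h0) ?_
    exact_mod_cast Nat.le_of_dvd (Nat.pos_of_ne_zero h0) ⟨t.1 * t.2.2.1, by simp only [tN]; ring⟩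
  have h2 : logBGN t ≤ 2 * log (tN t) := by
    rw [show 2 * log (tN t) = log ((tN t : ℝ) ^ 2) by rw [log_pow]; norm_num]
    refine log_le_log (by exact_mod_cast bggn_pos h0) ?_
    exact_mod_cast Nat.le_of_dvd (pow_pos (Nat.pos_of_ne_zero h0) 2)
      ⟨t.1 ^ 2 * t.2.1 ^ 2 * t.2.2.1 * t.2.2.2.2, by simp only [tN]; ring⟩
  have k1 := key _ _ (logAGN_nonneg t) h1
  have k2 := key _ _ (logBGN_nonneg t) h2
  rw [mainTerm, abs_mul, abs_mul]
  calc _ ≤ FTup χ t * ((B * (1 + log (tN t))) * (B * (1 + 2 * log (tN t)))) := by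
        gcongr
        exact abs_fTup_le hχ t
    _ ≤ FTup χ t * ((B * (1 + log (tN t))) * (B * (2 * (1 + log (tN t))))) := by
        gcongr; linarith
    _ = _ := by ring

/-- Evaluation of the diagonal sum for a weight `W(y)` of size `y^{-1/ℓ}` that for small `y` is close
to `2 (M - l log (y Q))`: the terms outside the box are negligible, the terms in the box are replaced
by their main parts, and these are completed to a sum over all tuples of smooth numbers. -/
lemma exists_evaluation {A : ℝ} (hA : 1 ≤ A) : ∃ C : ℝ, 0 ≤ C ∧
    ∀ {χ : ℕ →* ℝ} {D : ℕ} {L L' L'' : ℝ}, CharData χ D L L' L'' → 3 ≤ D → L ≤ 1 →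
    ∀ {X Qv ℓ q M l : ℝ} {W e : ℝ → ℂ}, (D : ℝ) ^ 24 ≤ X → 1 ≤ Qv → 0 < q → q * D ≤ 40 * Qv →
      log X ≤ ℓ → log Qv ≤ ℓ → 24 * log D ≤ ℓ → |M| ≤ A * ℓ ^ 3 → |l| ≤ A * ℓ ^ 3 →
      (∀ y, 0 < y → ‖W y‖ ≤ A * ℓ ^ 3 * y ^ (-ℓ⁻¹)) →
      (∀ y, 0 < y → ‖W y - (2 * ((M - l * log (y * Qv) : ℝ) : ℂ) + L * e y)‖ ≤
        A * (D * y ^ (1 / 4 : ℝ))) →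
      (∀ y, 0 < y → ‖e y‖ ≤ A * (1 + |log y|) ^ 2) →
      ‖∑' t, diagW χ X Qv W t - 4 * ((∑' t : FT (primesUpTo (D ^ 24)), mainTerm χ M l t.toTup : ℝ) : ℂ)‖
        ≤ C * (L * ℓ ^ 34 + (D : ℝ) ^ 15 * q ^ (-(1 / 4) : ℝ) * ℓ ^ 28) := by
  obtain ⟨C₁, hC₁, hmaj⟩ := exists_majorant_log le_rfl
  obtain ⟨C₂, hC₂, hsm⟩ := exists_smooth_outside
  refine ⟨1440 * A ^ 2 * exp 2 * C₁ + A ^ 2 * exp 3 * C₁ + 8 * A ^ 2 * C₂,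
    by positivity, ?_⟩
  intro χ D L L' L'' h hD3 hL1 X Qv ℓ q M l W e hX hQ1 hq hqQ hXℓ hQℓ hDℓ hM hl hW hR he
  have hL0 := h.L_pos
  have hD3' : (3 : ℝ) ≤ D := by exact_mod_cast hD3
  have hlD : 1 ≤ log D := one_le_log (by linarith)
  have hℓ1 : 1 ≤ ℓ := by linarith
  have hℓ0 : 0 < ℓ := by linarith
  have hQ0 : 0 < Qv := by linarith
  have hX1 : 1 ≤ X := le_trans (one_le_pow₀ (by linarith)) hX
  have hℓinv : ℓ⁻¹ ≤ 1 := inv_le_one_of_one_le₀ hℓ1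
  obtain ⟨hT, hTo⟩ := hmaj h hL1 ℓ ℓ⁻¹ hℓ1 (by linarith) (by positivity) hℓinv
    (by rw [one_div, inv_inv, one_mul]; nlinarith)
  have hS := hsm h hL1 ℓ hℓ1 hDℓ
  set S : Set Tup := {t | InBox D t} with hSdef
  have hu := norm_diagW_le (χ := χ) h.tri hQ0 hℓ0 hXℓ hQℓ (by linarith : 0 ≤ A) hW
  set c₁ : ℝ := A ^ 2 * exp 3 * ℓ ^ 6 with hc₁
  have hc₁0 : 0 ≤ c₁ := by positivity
  obtain ⟨su, -⟩ := norm_tsum_le_of_le_ofReal hc₁0 (by positivity) hu hT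
  -- the terms outside the box
  obtain ⟨so, bo⟩ := norm_tsum_le_of_le_ofReal (u := Sᶜ.indicator (diagW χ X Qv W)) hc₁0
    (by positivity) (fun t => by
      by_cases ht : t ∈ Sᶜ
      · rw [Set.indicator_of_mem ht, Set.indicator_of_mem ht]; exact hu t
      · rw [Set.indicator_of_notMem ht]; simp) hTo
  -- the comparison on the box
  set E : ℝ := A * (40 * (D : ℝ) ^ 15 * q ^ (-(1 / 4) : ℝ)) with hE
  have hE0 : 0 ≤ E := by positivity
  set err : ℝ := E * (A * ℓ ^ 3 * exp 1 + 2 * (A * ℓ ^ 3 * (1 + 3 * ℓ)) + A * (5 * ℓ) ^ 2) +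
    L * (4 * (A * ℓ ^ 3 * (1 + 3 * ℓ)) * (A * (5 * ℓ) ^ 2) + (A * (5 * ℓ) ^ 2) ^ 2) with herr
  have herr0 : 0 ≤ err := by positivity
  have hbox : ∀ t ∈ S, tN t ≠ 0 → ‖diagW χ X Qv W t - 4 * (mainTerm χ M l t : ℂ)‖ ≤
      FTup χ t * err := by
    intro t ht h0
    obtain ⟨b1, b2, b3, b4, -⟩ := box_bounds hDℓ ht h0
    have ha : (0 : ℝ) < agn t := by exact_mod_cast agn_pos h0
    have hb : (0 : ℝ) < bggn t := by exact_mod_cast bggn_pos h0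
    have hsmall : ∀ m : ℝ, 0 < m → m ≤ (D : ℝ) ^ 55 →
        A * (D * (m / Qv) ^ (1 / 4 : ℝ)) ≤ E := by
      intro m hm hm2
      have h1 : m / Qv ≤ 40 ^ 4 * (D : ℝ) ^ 56 * q⁻¹ := by
        rw [div_le_iff₀ hQ0]
        have h2 : 1 ≤ 40 * q⁻¹ * Qv := by
          rw [mul_assoc, mul_comm q⁻¹, ← mul_assoc, ← div_eq_mul_inv, one_le_div hq]
          nlinarith
        calc m ≤ (D : ℝ) ^ 55 * 1 := by linarith
          _ ≤ ((40 ^ 3) * (D : ℝ) ^ 56) * (40 * q⁻¹ * Qv) := by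
              gcongr
              calc (D : ℝ) ^ 55 ≤ (D : ℝ) ^ 56 := pow_le_pow_right₀ (by linarith) (by norm_num)
                _ ≤ _ := le_mul_of_one_le_left (by positivity) (by norm_num)
          _ = _ := by ring
      have h3 : (40 ^ 4 * (D : ℝ) ^ 56 * q⁻¹) ^ (1 / 4 : ℝ) = 40 * (D : ℝ) ^ 14 * q ^ (-(1 / 4) : ℝ) := by
        rw [mul_rpow (by positivity) (by positivity), Real.inv_rpow hq.le, rpow_neg hq.le,
          show 40 ^ 4 * (D : ℝ) ^ 56 = (40 * (D : ℝ) ^ 14) ^ 4 by ring, ← rpow_natCast,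
          ← rpow_mul (by positivity)]
        norm_num
      have h4 : (m / Qv) ^ (1 / 4 : ℝ) ≤ 40 * (D : ℝ) ^ 14 * q ^ (-(1 / 4) : ℝ) := by
        rw [← h3]; gcongr
      calc A * (D * (m / Qv) ^ (1 / 4 : ℝ)) ≤ A * (D * (40 * (D : ℝ) ^ 14 * q ^ (-(1 / 4) : ℝ))) := by
            gcongr
        _ = E := by rw [hE]; ring
    have hm : ∀ x : ℝ, 0 ≤ x → x ≤ 3 * ℓ → |M - l * x| ≤ A * ℓ ^ 3 * (1 + 3 * ℓ) := by
      intro x hx hx2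
      refine (abs_sub _ _).trans ?_
      rw [abs_mul, abs_of_nonneg hx]
      have := mul_le_mul hl hx2 hx (by positivity)
      linarith
    have hlQ : 0 ≤ log Qv := log_nonneg hQ1
    have hev : ∀ m : ℕ, 0 < m → log m ≤ 3 * ℓ → ‖e (m / Qv)‖ ≤ A * (5 * ℓ) ^ 2 := by
      intro m hm hm2
      have hm' : (0 : ℝ) < m := by exact_mod_cast hm
      refine (he _ (by positivity)).trans ?_
      have hl0 : 0 ≤ log m := log_natCast_nonneg _
      have : |log (m / Qv)| ≤ 4 * ℓ := by
        rw [Real.log_div hm'.ne' hQ0.ne']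
        rw [abs_le]; constructor <;> linarith
      gcongr
      linarith
    have hyQ : ∀ m : ℝ, m / Qv * Qv = m := fun m => div_mul_cancel₀ m hQ0.ne'
    have r1 := hR (agn t / Qv) (by positivity)
    have r2 := hR (bggn t / Qv) (by positivity)
    rw [hyQ] at r1 r2
    have hw : ‖W (bggn t / Qv)‖ ≤ A * ℓ ^ 3 * exp 1 := by
      refine (hW _ (by positivity)).trans ?_
      gcongr
      rw [rpow_neg (by positivity), ← Real.inv_rpow (by positivity)]
      refine rpow_inv_le (by positivity) hℓ0 ?_
      rw [Real.log_inv, Real.log_div hb.ne' hQ0.ne', one_mul]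
      linarith [log_natCast_nonneg (bggn t)]
    have key := norm_mul_sub_le hL0.le hL1 (r1.trans (hsmall _ ha b1)) (r2.trans (hsmall _ hb b2)) hw
      (hm _ (log_natCast_nonneg _) b3) (hm _ (log_natCast_nonneg _) b4)
      (hev _ (agn_pos h0) b3) (hev _ (bggn_pos h0) b4)
    have hid : diagW χ X Qv W t - 4 * (mainTerm χ M l t : ℂ) = (fTup χ t : ℂ) *
        (W (agn t / Qv) * W (bggn t / Qv) - 4 * (((M - l * log (agn t) : ℝ) : ℂ) *
          ((M - l * log (bggn t) : ℝ) : ℂ))) := by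
      rw [diagW, fTrunc_eq_fTup hX hX1 ht, mainTerm, logAGN, logBGN]
      simp only [agn, bggn]
      push_cast
      ring
    rw [hid, norm_mul, Complex.norm_real, norm_eq_abs]
    exact mul_le_mul (abs_fTup_le h.tri t) key (norm_nonneg _) (FTup_nonneg h.tri t)
  have hbox2 : ∀ t, ofReal ‖S.indicator (fun t => diagW χ X Qv W t - 4 * (mainTerm χ M l t : ℂ)) t‖
      ≤ ofReal (err * exp 2) * FE χ ℓ⁻¹ t := by
    intro t
    by_cases ht : t ∈ S
    · rw [Set.indicator_of_mem ht, FE, ← ofReal_mul (by positivity)]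
      apply ofReal_le_ofReal
      by_cases h0 : tN t = 0
      · rw [diagW, fTrunc_eq_zero h0, mainTerm, fTup_eq_zero h0, FTup_eq_zero h0]; simp
      refine (hbox t ht h0).trans ?_
      have hF := FTup_nonneg h.tri t
      have hN := rpow_neg_inv_ge (x := (tN t : ℝ)) (by positivity) hℓ0 (box_bounds hDℓ ht h0).2.2.2.2
      have h1 : 1 ≤ exp 2 * (tN t : ℝ) ^ (-ℓ⁻¹) := by
        have := mul_le_mul_of_nonneg_left hN (exp_pos 2).le
        rwa [← exp_add, add_neg_cancel, Real.exp_zero] at this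
      calc FTup χ t * err = FTup χ t * err * 1 := by ring
        _ ≤ FTup χ t * err * (exp 2 * (tN t : ℝ) ^ (-ℓ⁻¹)) := by gcongr
        _ = _ := by ring
    · rw [Set.indicator_of_notMem ht]; simp
  obtain ⟨sb, bb⟩ := norm_tsum_le_of_le_ofReal (by positivity) (by positivity) hbox2 hT
  -- completion to smooth numbers
  have hsupp : Function.support (S.indicator (mainTerm χ M l)) ⊆
      Set.range (FT.toTup (S := primesUpTo (D ^ 24))) := by
    intro t ht
    have hts : t ∈ S := Set.mem_of_indicator_ne_zero ht
    refine mem_range_toTup (by omega) hts fun h0 => ht ?_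
    rw [Set.indicator_of_mem hts, mainTerm, fTup_eq_zero h0, zero_mul]
  have e1 : ∑' t : FT (primesUpTo (D ^ 24)), S.indicator (mainTerm χ M l) t.toTup =
      ∑' t, S.indicator (mainTerm χ M l) t := FT.toTup_injective.tsum_eq hsupp
  have sS : Summable (S.indicator (diagW χ X Qv W)) := su.of_norm.indicator S
  have sv4 : Summable fun t => 4 * ((S.indicator (mainTerm χ M l) t : ℝ) : ℂ) := by
    refine (sS.sub sb.of_norm).congr fun t => ?_
    by_cases ht : t ∈ S
    · simp only [Set.indicator_of_mem ht]; ring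
    · simp only [Set.indicator_of_notMem ht]; simp
  have sv : Summable (S.indicator (mainTerm χ M l)) := by
    have := (sv4.mul_left (1 / 4))
    rw [← Complex.summable_ofReal]
    exact this.congr fun t => by ring
  have hv : ∀ t : FT (primesUpTo (D ^ 24)),
      ofReal ‖((Sᶜ.indicator (mainTerm χ M l) t.toTup : ℝ) : ℂ)‖ ≤
      ofReal (2 * (A * ℓ ^ 3) ^ 2) * Sᶜ.indicator
        (fun t => ofReal (FTup χ t * (1 + log (tN t)) ^ 2)) t.toTup := by
    intro t
    by_cases ht : t.toTup ∈ Sᶜ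
    · rw [Set.indicator_of_mem ht, Set.indicator_of_mem ht, ← ofReal_mul (by positivity),
        Complex.norm_real, norm_eq_abs]
      exact ofReal_le_ofReal (abs_mainTerm_le h.tri hM hl _)
    · rw [Set.indicator_of_notMem ht]; simp
  obtain ⟨svo, bvo⟩ := norm_tsum_le_of_le_ofReal (by positivity) (by positivity) hv hS
  have d1 : ∑' t, diagW χ X Qv W t = ∑' t, S.indicator (diagW χ X Qv W) t +
      ∑' t, Sᶜ.indicator (diagW χ X Qv W) t := by
    rw [← sS.tsum_add so.of_norm]
    exact tsum_congr fun t => (congrFun (Set.indicator_self_add_compl S _) t).symm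
  have d2 : ∑' t, S.indicator (diagW χ X Qv W) t =
      ∑' t, S.indicator (fun t => diagW χ X Qv W t - 4 * (mainTerm χ M l t : ℂ)) t +
        4 * ((∑' t, S.indicator (mainTerm χ M l) t : ℝ) : ℂ) := by
    rw [Complex.ofReal_tsum, ← tsum_mul_left, ← sb.of_norm.tsum_add sv4]
    refine tsum_congr fun t => ?_
    by_cases ht : t ∈ S
    · simp only [Set.indicator_of_mem ht]; ring
    · simp only [Set.indicator_of_notMem ht]; simp
  have svo' : Summable fun t : FT (primesUpTo (D ^ 24)) => Sᶜ.indicator (mainTerm χ M l) t.toTup :=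
    Complex.summable_ofReal.1 svo.of_norm
  have d3 : ∑' t : FT (primesUpTo (D ^ 24)), mainTerm χ M l t.toTup =
      ∑' t, S.indicator (mainTerm χ M l) t +
      ∑' t : FT (primesUpTo (D ^ 24)), Sᶜ.indicator (mainTerm χ M l) t.toTup := by
    have sv' : Summable fun t : FT (primesUpTo (D ^ 24)) => S.indicator (mainTerm χ M l) t.toTup :=
      sv.comp_injective FT.toTup_injective
    rw [← e1, ← sv'.tsum_add svo']
    exact tsum_congr fun t => (congrFun (Set.indicator_self_add_compl S _) t.toTup).symm
  rw [d3, d1, d2]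
  push_cast only [Complex.ofReal_add]
  rw [← Complex.ofReal_tsum] at bvo
  have fin : ∀ a b c d : ℂ, ‖a + 4 * b + c - 4 * (b + d)‖ ≤ ‖a‖ + ‖c‖ + 4 * ‖d‖ := by
    intro a b c d
    rw [show a + 4 * b + c - 4 * (b + d) = a + c - 4 * d by ring]
    refine (norm_sub_le _ _).trans ?_
    have := norm_add_le a c
    rw [norm_mul]; norm_num; linarith
  refine (fin _ _ _ _).trans ((add_le_add (add_le_add bb bo) (mul_le_mul_of_nonneg_left bvo (by norm_num))).trans ?_)
  set B : ℝ := (D : ℝ) ^ 15 * q ^ (-(1 / 4) : ℝ) with hB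
  have hB0 : 0 ≤ B := by positivity
  have hexp : exp 1 ≤ 3 := by linarith [exp_one_lt_d9]
  have p24 : ℓ ^ 2 ≤ ℓ ^ 4 := pow_le_pow_right₀ hℓ1 (by norm_num)
  have p34 : ℓ ^ 3 ≤ ℓ ^ 4 := pow_le_pow_right₀ hℓ1 (by norm_num)
  have p46 : ℓ ^ 4 ≤ ℓ ^ 6 := pow_le_pow_right₀ hℓ1 (by norm_num)
  have p56 : ℓ ^ 5 ≤ ℓ ^ 6 := pow_le_pow_right₀ hℓ1 (by norm_num)
  have p30 : ℓ ^ 30 ≤ ℓ ^ 34 := pow_le_pow_right₀ hℓ1 (by norm_num)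
  have herr1 : err ≤ A ^ 2 * (1440 * (B * ℓ ^ 4) + 1025 * (L * ℓ ^ 6)) := by
    have t1 : A * ℓ ^ 3 * exp 1 + 2 * (A * ℓ ^ 3 * (1 + 3 * ℓ)) + A * (5 * ℓ) ^ 2 ≤
        A * (36 * ℓ ^ 4) := by
      have : ℓ ^ 3 * exp 1 + 2 * (ℓ ^ 3 * (1 + 3 * ℓ)) + (5 * ℓ) ^ 2 ≤ 36 * ℓ ^ 4 := by
        have h1 : ℓ ^ 3 * exp 1 ≤ ℓ ^ 4 * 3 := by gcongr
        have h2 : 2 * (ℓ ^ 3 * (1 + 3 * ℓ)) + (5 * ℓ) ^ 2 = 2 * ℓ ^ 3 + 6 * ℓ ^ 4 + 25 * ℓ ^ 2 := by ring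
        linarith
      have := mul_le_mul_of_nonneg_left this (by linarith : 0 ≤ A)
      linarith
    have t2 : 4 * (A * ℓ ^ 3 * (1 + 3 * ℓ)) * (A * (5 * ℓ) ^ 2) + (A * (5 * ℓ) ^ 2) ^ 2 ≤
        A ^ 2 * (1025 * ℓ ^ 6) := by
      have : 4 * (ℓ ^ 3 * (1 + 3 * ℓ)) * (5 * ℓ) ^ 2 + ((5 * ℓ) ^ 2) ^ 2 ≤ 1025 * ℓ ^ 6 := by
        have h2 : 4 * (ℓ ^ 3 * (1 + 3 * ℓ)) * (5 * ℓ) ^ 2 + ((5 * ℓ) ^ 2) ^ 2 =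
          100 * ℓ ^ 5 + 300 * ℓ ^ 6 + 625 * ℓ ^ 4 := by ring
        linarith
      have := mul_le_mul_of_nonneg_left this (sq_nonneg A)
      linarith
    have t3 := mul_le_mul_of_nonneg_left t1 hE0
    have t4 := mul_le_mul_of_nonneg_left t2 hL0.le
    have hEB : E = A * (40 * B) := by rw [hE, hB]; ring
    rw [herr]
    refine (add_le_add t3 t4).trans (le_of_eq ?_)
    rw [hEB]; ring
  calc err * exp 2 * (C₁ * ℓ ^ 24) + c₁ * (C₁ * (L * ℓ ^ 24)) +
        4 * (2 * (A * ℓ ^ 3) ^ 2 * (C₂ * (L * ℓ ^ 28)))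
      ≤ A ^ 2 * (1440 * (B * ℓ ^ 4) + 1025 * (L * ℓ ^ 6)) * exp 2 * (C₁ * ℓ ^ 24) +
        c₁ * (C₁ * (L * ℓ ^ 24)) + 4 * (2 * (A * ℓ ^ 3) ^ 2 * (C₂ * (L * ℓ ^ 28))) := by gcongr
    _ = 1440 * A ^ 2 * exp 2 * C₁ * (B * ℓ ^ 28) +
        1025 * (A ^ 2 * exp 2 * C₁ * L) * ℓ ^ 30 + (A ^ 2 * exp 3 * C₁ * L) * ℓ ^ 30 +
          8 * A ^ 2 * C₂ * (L * ℓ ^ 34) := by rw [hc₁]; ring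
    _ ≤ 1440 * A ^ 2 * exp 2 * C₁ * (B * ℓ ^ 28) +
        1440 * (A ^ 2 * exp 2 * C₁ * L) * ℓ ^ 34 + (A ^ 2 * exp 3 * C₁ * L) * ℓ ^ 34 +
          8 * A ^ 2 * C₂ * (L * ℓ ^ 34) := by gcongr; norm_num
    _ ≤ _ := by
        have u1 : 0 ≤ A ^ 2 * exp 3 * C₁ * (B * ℓ ^ 28) := by positivity
        have u2 : 0 ≤ A ^ 2 * C₂ * (B * ℓ ^ 28) := by positivity
        linarith

/-! ### The diagonal term as a sum over tuples -/

lemma card_divisors_le_two_mul_sqrt (n : ℕ) : (n.divisors.card : ℝ) ≤ 2 * sqrt n := by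
  have h : n.divisors ⊆ Icc 1 n.sqrt ∪ (Icc 1 n.sqrt).image (n / ·) := by
    intro d hd
    obtain ⟨⟨e, rfl⟩, hn⟩ := Nat.mem_divisors.1 hd
    have hd0 : 0 < d := Nat.pos_of_ne_zero (left_ne_zero_of_mul hn)
    have he0 : 0 < e := Nat.pos_of_ne_zero (right_ne_zero_of_mul hn)
    rw [Finset.mem_union]
    rcases le_total d e with hde | hde
    · exact Or.inl (mem_Icc.2 ⟨hd0, Nat.le_sqrt.2 (Nat.mul_le_mul_left d hde)⟩)
    · refine Or.inr (Finset.mem_image.2 ⟨e, mem_Icc.2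
        ⟨he0, Nat.le_sqrt.2 (Nat.mul_le_mul_right e hde)⟩, ?_⟩)
      exact Nat.mul_div_cancel d he0
  have h1 : n.divisors.card ≤ 2 * n.sqrt := by
    refine (Finset.card_le_card h).trans ((Finset.card_union_le _ _).trans ?_)
    have := Finset.card_image_le (s := Icc 1 n.sqrt) (f := (n / ·))
    simp only [Nat.card_Icc, Nat.add_sub_cancel] at this ⊢
    omega
  calc (n.divisors.card : ℝ) ≤ ((2 * n.sqrt : ℕ) : ℝ) := by exact_mod_cast h1
    _ = 2 * (n.sqrt : ℝ) := by push_cast; ring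
    _ ≤ _ := by gcongr; exact Real.nat_sqrt_le_real_sqrt

section

variable {D : ℕ} {ψ : DirichletCharacter ℂ D} {G : ℂ → ℂ} {k q : ℕ} {X : ℝ}

lemma rho2_eq (h : ψ.IsQuadratic) (A : ℕ) : rho2 ψ X A =
    ∑ d ∈ Icc 1 ⌊X⌋₊, ((1 / (d : ℝ) * truncPair (rho1Real (realChar ψ h)) X d A : ℝ) : ℂ) := by
  simp only [rho2, truncPair, rho1_eq h]
  push_cast
  rfl

/-- The part of the summand depending on `(a, b, g)` and `n` only. -/
def arithFactor (ψ : DirichletCharacter ℂ D) (X : ℝ) (t : ℕ × ℕ × ℕ) (n : ℕ) : ℂ :=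
  rho2 ψ X (t.1 * t.2.1 * t.2.2) * ((moebius t.2.2 : ℂ) * ψ (t.2.2 : ZMod D)) *
    oneConv ψ t.2.1 * oneConv ψ (t.1 * t.2.2 * n) * oneConv ψ n /
    ((t.1 * t.2.1 * t.2.2 ^ 2 * n : ℕ) : ℂ)

lemma diagTerm_eq (t : ℕ × ℕ × ℕ) (s : ℕ+ × ℕ+ × ℕ+) :
    diagTerm ψ G k q X t s = arithFactor ψ X t s.2.2 *
      ((ψ ((s.1 : ℕ) : ZMod D) / (s.1 : ℂ) *
          V G k ((s.1 : ℝ) ^ 2 * ((t.1 * t.2.2 * s.2.2 : ℕ) / Q q D))) *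
        (ψ ((s.2.1 : ℕ) : ZMod D) / (s.2.1 : ℂ) *
          V G k ((s.2.1 : ℝ) ^ 2 * ((t.2.1 * t.2.2 ^ 2 * s.2.2 : ℕ) / Q q D)))) := by
  obtain ⟨a, b, g⟩ := t
  obtain ⟨d₁, d, n⟩ := s
  simp only [diagTerm, arithFactor]
  have e1 : ((g : ℝ) ^ (3 / 2 : ℝ)) * sqrt ((a : ℝ) * ((a * g * n : ℕ) : ℝ) * ((n : ℕ) : ℝ)) =
      (a : ℝ) * g ^ 2 * (n : ℕ) := by
    have h1 : (a : ℝ) * ((a * g * n : ℕ) : ℝ) * ((n : ℕ) : ℝ) = ((a : ℝ) * (n : ℕ)) ^ 2 * g := by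
      push_cast; ring
    have hg : (0 : ℝ) ≤ g := Nat.cast_nonneg g
    rw [h1, Real.sqrt_mul (by positivity), Real.sqrt_sq (by positivity), Real.sqrt_eq_rpow]
    have h2 : (g : ℝ) ^ (3 / 2 : ℝ) * (g : ℝ) ^ (1 / 2 : ℝ) = (g : ℝ) ^ 2 := by
      rw [← Real.rpow_add_of_nonneg hg (by norm_num) (by norm_num)]; norm_num
    linear_combination ((a : ℝ) * (n : ℕ)) * h2
  have e1' := congrArg (fun x : ℝ => (x : ℂ)) e1
  push_cast at e1'
  have e2 : (d₁ : ℝ) ^ 2 * ((a * g * n : ℕ) : ℝ) / Q q D = (d₁ : ℝ) ^ 2 * (((a * g * n : ℕ) : ℝ) / Q q D) := by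
    ring
  have e3 : (d : ℝ) ^ 2 * b * (g : ℝ) ^ 2 * ((n : ℕ) : ℝ) / Q q D =
      (d : ℝ) ^ 2 * (((b * g ^ 2 * n : ℕ) : ℝ) / Q q D) := by
    push_cast; ring
  rw [e2, e3]
  have e4 : ((d₁ : ℂ) * (d : ℂ) * (b : ℂ) * (((g : ℝ) ^ (3 / 2 : ℝ) : ℝ) : ℂ))⁻¹ *
      ((sqrt ((a : ℝ) * ((a * g * n : ℕ) : ℝ) * ((n : ℕ) : ℝ)) : ℝ) : ℂ)⁻¹ =
      (d₁ : ℂ)⁻¹ * (d : ℂ)⁻¹ * ((a * b * g ^ 2 * n : ℕ) : ℂ)⁻¹ := by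
    rw [← mul_inv, ← mul_inv, ← mul_inv]
    congr 1
    push_cast
    linear_combination ((d₁ : ℂ) * (d : ℂ) * b) * e1'
  generalize ((g : ℝ) ^ (3 / 2 : ℝ)) = w at e4 ⊢
  simp only [div_eq_mul_inv]
  generalize V G k _ = v₁
  generalize V G k _ = v₂
  linear_combination (ψ ((d₁ : ℕ) : ZMod D) * ψ ((d : ℕ) : ZMod D) *
    ((moebius g : ℂ) * ψ (g : ZMod D)) * oneConv ψ b *
    (rho2 ψ X (a * b * g) * oneConv ψ (a * g * n) * oneConv ψ n) * v₁ * v₂) * e4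

lemma norm_oneConv_le (h : ψ.IsQuadratic) (n : ℕ) : ‖oneConv ψ n‖ ≤ 2 * sqrt n := by
  rw [oneConv_eq h, Complex.norm_real, norm_of_nonneg (rConv_nonneg (isTrivalued_realChar h) n)]
  exact (rConv_le_card (isTrivalued_realChar h) n).trans (card_divisors_le_two_mul_sqrt n)

lemma Q_pos (hq : 0 < q) (hD : 0 < D) : 0 < Q q D := by
  unfold Q
  have := Real.pi_pos
  positivity

lemma summable_diagTerm (hG : IsAdmissibleWeight k G) (hk : 1 ≤ k) (h : ψ.IsQuadratic) (hq : 0 < q)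
    (hD : 0 < D) {t : ℕ × ℕ × ℕ} (ht1 : 0 < t.1) (ht2 : 0 < t.2.1) (ht3 : 0 < t.2.2) :
    Summable (diagTerm ψ G k q X t) := by
  obtain ⟨C, hC, hV⟩ := exists_V_bound hG hk
  have hQ := Q_pos hq hD
  obtain ⟨a, b, g⟩ := t
  simp only at ht1 ht2 ht3
  have hd : Summable fun d : ℕ+ => ((d : ℝ) ^ 2)⁻¹ := by
    have := (Real.summable_nat_pow_inv (p := 2)).2 (by norm_num)
    exact this.comp_injective PNat.coe_injective
  set K : ℝ := ‖rho2 ψ X (a * b * g) * ((moebius g : ℂ) * ψ (g : ZMod D)) *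
    oneConv ψ b‖ * (2 * sqrt (a * g : ℕ)) * 2 * (C * Q q D) ^ 2 with hK
  have hK0 : 0 ≤ K := by positivity
  have hs := (hd.mul_of_nonneg (hd.mul_of_nonneg hd (fun d => by positivity) (fun d => by positivity))
    (fun d => by positivity) (fun x => by positivity)).mul_left K
  refine Summable.of_norm_bounded hs fun s => ?_
  obtain ⟨d₁, d, n⟩ := s
  rw [diagTerm_eq]
  simp only
  have hn : (0 : ℝ) < (n : ℕ) := by exact_mod_cast n.pos
  have hvb : ∀ (c : ℕ+) (m : ℕ), (n : ℕ) ≤ m → ‖ψ ((c : ℕ) : ZMod D) / (c : ℂ) *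
      V G k ((c : ℝ) ^ 2 * (m / Q q D))‖ ≤ ((c : ℝ) ^ 2)⁻¹ * (C * Q q D * ((n : ℕ) : ℝ)⁻¹) := by
    intro c m hnm
    have hc : (1 : ℝ) ≤ c := by exact_mod_cast (one_le : 1 ≤ c)
    have hm : ((n : ℕ) : ℝ) ≤ m := by exact_mod_cast hnm
    have h1 : ‖ψ ((c : ℕ) : ZMod D) / (c : ℂ)‖ ≤ 1 := by
      rw [norm_div]
      have : ‖(c : ℂ)‖ = c := by simp
      rw [this]
      exact div_le_one_of_le₀ ((DirichletCharacter.norm_le_one ψ _).trans hc) (by linarith)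
    have h2 := hV ((c : ℝ) ^ 2 * (m / Q q D)) 1 (by have : (0 : ℝ) < m := by linarith
                                                    positivity) one_pos le_rfl
    rw [norm_mul]
    calc _ ≤ 1 * (C * ((c : ℝ) ^ 2 * (m / Q q D)) ^ (-1 : ℝ) * (1 ^ k)⁻¹) := by gcongr
      _ = ((c : ℝ) ^ 2)⁻¹ * (C * Q q D * (m : ℝ)⁻¹) := by
          rw [rpow_neg_one, one_pow, inv_one, mul_inv, inv_div]; ring
      _ ≤ _ := by gcongr
  have hn1 : (n : ℕ) ≤ a * g * n := Nat.le_mul_of_pos_left _ (Nat.mul_pos ht1 ht3)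
  have hn2 : (n : ℕ) ≤ b * g ^ 2 * n := Nat.le_mul_of_pos_left _ (by positivity)
  have v1 := hvb d₁ _ hn1
  have v2 := hvb d _ hn2
  have hA : ‖arithFactor ψ X (a, b, g) n‖ ≤ ‖rho2 ψ X (a * b * g) *
      ((moebius g : ℂ) * ψ (g : ZMod D)) * oneConv ψ b‖ *
      (2 * sqrt (a * g : ℕ)) * 2 := by
    have e : arithFactor ψ X (a, b, g) n = (rho2 ψ X (a * b * g) *
        ((moebius g : ℂ) * ψ (g : ZMod D)) * oneConv ψ b) *
        (oneConv ψ (a * g * n) * oneConv ψ n / ((a * b * g ^ 2 * n : ℕ) : ℂ)) := by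
      simp only [arithFactor]; ring
    rw [e, norm_mul, mul_assoc _ (2 * sqrt _) 2]
    refine mul_le_mul_of_nonneg_left ?_ (norm_nonneg _)
    have h1 := norm_oneConv_le h (a * g * n)
    have h2 := norm_oneConv_le h n
    have h3 : ((n : ℕ) : ℝ) ≤ ‖((a * b * g ^ 2 * n : ℕ) : ℂ)‖ := by
      rw [Complex.norm_natCast]
      exact_mod_cast Nat.le_mul_of_pos_left _ (by positivity)
    rw [Nat.cast_mul, Real.sqrt_mul (by positivity)] at h1
    rw [norm_div, norm_mul]
    calc _ ≤ (2 * (sqrt (a * g : ℕ) * sqrt (n : ℕ))) * (2 * sqrt (n : ℕ)) / (n : ℕ) := by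
          gcongr
      _ = 2 * sqrt (a * g : ℕ) * 2 * ((sqrt (n : ℕ) * sqrt (n : ℕ)) / (n : ℕ)) := by ring
      _ = _ := by rw [Real.mul_self_sqrt hn.le, div_self hn.ne', mul_one]
  rw [norm_mul, norm_mul]
  calc _ ≤ (‖rho2 ψ X (a * b * g) *
      ((moebius g : ℂ) * ψ (g : ZMod D)) * oneConv ψ b‖ *
      (2 * sqrt (a * g : ℕ)) * 2) * ((((d₁ : ℝ) ^ 2)⁻¹ * (C * Q q D * ((n : ℕ) : ℝ)⁻¹)) *
        (((d : ℝ) ^ 2)⁻¹ * (C * Q q D * ((n : ℕ) : ℝ)⁻¹))) := by gcongr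
    _ = _ := by rw [hK]; ring

lemma fTrunc_eq (h : ψ.IsQuadratic) (t : ℕ × ℕ × ℕ) (ht : ((t.1 * t.2.1 * t.2.2 : ℕ) : ℝ) ≤ X ^ 2)
    (hX : 0 ≤ X) (n : ℕ) : arithFactor ψ X t n =
      ∑ d ∈ Icc 1 ⌊X⌋₊, (fTrunc (realChar ψ h) X (d, t.1, t.2.1, t.2.2, n) : ℂ) := by
  obtain ⟨a, b, g⟩ := t
  rw [arithFactor, rho2_eq h]
  simp only [sum_mul, Finset.sum_div]
  refine sum_congr rfl fun d hd => ?_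
  obtain ⟨hd1, hd2⟩ := mem_Icc.1 hd
  have hdX : (d : ℝ) ≤ X := (Nat.le_floor_iff hX).1 hd2
  rw [fTrunc, if_pos ⟨hdX, ht⟩]
  simp only [oneConv_eq h, ← realChar_cast h, tDen]
  push_cast
  simp only [div_eq_mul_inv, mul_inv]
  ring

/-- The diagonal term is a sum over tuples `(d, a, b, g, n)` of an arithmetic weight times two values
of the smoothed character sum. -/
lemma diagonal_eq (hG : IsAdmissibleWeight k G) (hk : 1 ≤ k) (hk2 : k ≤ 2) (h : ψ.IsQuadratic)
    (hq : 0 < q) (hD : 0 < D) (hX : 0 ≤ X)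
    (hs : Summable (diagW (realChar ψ h) X (Q q D) (charV ψ G k))) :
    diagonal ψ G k q X = ((k.factorial : ℂ)) ^ 2 * (1 + (-1) ^ (k + 1) * ψ (q : ZMod D)) ^ 2 *
      ∑' t, diagW (realChar ψ h) X (Q q D) (charV ψ G k) t := by
  rw [diagonal]
  congr 1
  have hQ := Q_pos hq hD
  obtain ⟨C, hC, hcV⟩ := exists_charV_bound hG hk hk2
  set u := diagW (realChar ψ h) X (Q q D) (charV ψ G k) with hu
  let E : (ℕ × ℕ × ℕ) × (ℕ × ℕ) ≃ Tup :=
    ⟨fun x => (x.2.2, x.1.1, x.1.2.1, x.1.2.2, x.2.1), fun t => ((t.2.1, t.2.2.1, t.2.2.2.1),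
      (t.2.2.2.2, t.1)), fun _ => rfl, fun _ => rfl⟩
  have hsE : Summable (u ∘ E) := E.summable_iff.2 hs
  have hzero : ∀ t, tN t = 0 → u t = 0 := fun t ht => by rw [hu, diagW, fTrunc_eq_zero ht]; simp
  have htri : ∀ t : ℕ × ℕ × ℕ, t ∈ triples X → 0 < t.1 ∧ 0 < t.2.1 ∧ 0 < t.2.2 ∧
      ((t.1 * t.2.1 * t.2.2 : ℕ) : ℝ) ≤ X ^ 2 := by
    intro t ht
    simp only [triples, mem_filter, Finset.mem_product, mem_Icc] at ht
    exact ⟨ht.1.1.1, ht.1.2.1.1, ht.1.2.2.1, ht.2⟩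
  rw [← E.tsum_eq]
  change _ = ∑' x, (u ∘ E) x
  rw [hsE.tsum_prod, tsum_eq_sum (s := triples X)]
  · refine sum_congr rfl fun t ht => ?_
    obtain ⟨h1, h2, h3, h4⟩ := htri t ht
    have hst := summable_diagTerm (X := X) hG hk h hq hD h1 h2 h3
    let F : ℕ+ × (ℕ+ × ℕ+) ≃ ℕ+ × ℕ+ × ℕ+ :=
      ⟨fun x => (x.2.1, x.2.2, x.1), fun s => (s.2.2, s.1, s.2.1), fun _ => rfl, fun _ => rfl⟩
    have hsF : Summable (diagTerm ψ G k q X t ∘ F) := F.summable_iff.2 hst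
    rw [← F.tsum_eq]
    change ∑' x, (diagTerm ψ G k q X t ∘ F) x = _
    rw [hsF.tsum_prod, (hsE.prod_factor t).tsum_prod]
    have e1 : ∀ n : ℕ, ∑' d, (u ∘ E) (t, (n, d)) = arithFactor ψ X t n *
        (charV ψ G k ((t.1 * t.2.2 * n : ℕ) / Q q D) *
          charV ψ G k ((t.2.1 * t.2.2 ^ 2 * n : ℕ) / Q q D)) := by
      intro n
      rw [tsum_eq_sum (s := Icc 1 ⌊X⌋₊), fTrunc_eq h t h4 hX, sum_mul]
      · rfl
      · intro d hd
        rw [mem_Icc, not_and_or] at hd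
        rcases hd with hd | hd
        · exact hzero _ (by
            have : d = 0 := by omega
            simp only [E, this, Equiv.coe_fn_mk, tN]; simp)
        · simp only [Function.comp_apply, hu, diagW]
          rw [fTrunc_eq_zero_of_lt (by
            simp only [E, Equiv.coe_fn_mk]
            exact (Nat.floor_lt hX).1 (not_le.1 hd))]
          simp
    have e2 : ∀ n : ℕ+, ∑' x, (diagTerm ψ G k q X t ∘ F) (n, x) = arithFactor ψ X t n *
        (charV ψ G k ((t.1 * t.2.2 * n : ℕ) / Q q D) *
          charV ψ G k ((t.2.1 * t.2.2 ^ 2 * n : ℕ) / Q q D)) := by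
      intro n
      have y1 : (0 : ℝ) < (t.1 * t.2.2 * n : ℕ) / Q q D := by
        have : 0 < t.1 * t.2.2 * n := Nat.mul_pos (Nat.mul_pos h1 h3) n.pos
        positivity
      have y2 : (0 : ℝ) < (t.2.1 * t.2.2 ^ 2 * n : ℕ) / Q q D := by
        have : 0 < t.2.1 * t.2.2 ^ 2 * n := Nat.mul_pos (Nat.mul_pos h2 (pow_pos h3 2)) n.pos
        positivity
      have s1 := (hcV ψ _ 1 y1 one_pos le_rfl).1
      have s2 := (hcV ψ _ 1 y2 one_pos le_rfl).1
      rw [charV, charV, tsum_mul_tsum_of_summable_norm s1 s2, ← tsum_mul_left]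
      exact tsum_congr fun x => diagTerm_eq t (F (n, x))
    simp only [e1, e2]
    refine PNat.coe_injective.tsum_eq (f := fun n : ℕ => arithFactor ψ X t n *
        (charV ψ G k ((t.1 * t.2.2 * n : ℕ) / Q q D) *
          charV ψ G k ((t.2.1 * t.2.2 ^ 2 * n : ℕ) / Q q D))) ?_
    intro n hn
    refine ⟨⟨n, Nat.pos_of_ne_zero ?_⟩, rfl⟩
    rintro rfl
    exact hn (by simp [arithFactor])
  · intro t ht
    rw [← tsum_zero (α := ℂ) (β := ℕ × ℕ)]
    refine tsum_congr fun x => ?_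
    by_cases h0 : tN (E (t, x)) = 0
    · exact hzero _ h0
    obtain ⟨d0, a0, b0, g0, n0⟩ := tN_ne_zero.1 h0
    have hnot : ¬ ((t.1 * t.2.1 * t.2.2 : ℕ) : ℝ) ≤ X ^ 2 := by
      intro hle
      apply ht
      have hfl : t.1 * t.2.1 * t.2.2 ≤ ⌊X ^ 2⌋₊ := Nat.le_floor hle
      have a1 : 0 < t.1 := Nat.pos_of_ne_zero a0
      have b1 : 0 < t.2.1 := Nat.pos_of_ne_zero b0
      have g1 : 0 < t.2.2 := Nat.pos_of_ne_zero g0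
      have hM : 0 < t.1 * t.2.1 * t.2.2 := by positivity
      simp only [triples, mem_filter, Finset.mem_product, mem_Icc]
      exact ⟨⟨⟨a1, (Nat.le_of_dvd hM ⟨t.2.1 * t.2.2, by ring⟩).trans hfl⟩,
        ⟨b1, (Nat.le_of_dvd hM ⟨t.1 * t.2.2, by ring⟩).trans hfl⟩,
        ⟨g1, (Nat.le_of_dvd hM ⟨t.1 * t.2.1, by ring⟩).trans hfl⟩⟩, hle⟩
    simp only [Function.comp_apply, hu, diagW]
    rw [fTrunc, if_neg (fun hh => hnot hh.2)]
    simp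

end

/-! ### Evaluation of the diagonal term -/

section

variable {G : ℂ → ℂ} {k : ℕ}

lemma norm_sq_factor_le (hk2 : k ≤ 2) {z : ℂ} (hz : ‖z‖ ≤ 1) :
    ‖((k.factorial : ℂ)) ^ 2 * (1 + (-1) ^ (k + 1) * z) ^ 2‖ ≤ 16 := by
  have h1 : ‖((k.factorial : ℂ))‖ ≤ 2 := by
    rw [Complex.norm_natCast]
    have : k.factorial ≤ 2 := (Nat.factorial_le hk2).trans (by norm_num)
    exact_mod_cast this
  have h2 : ‖1 + (-1) ^ (k + 1) * z‖ ≤ 2 := by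
    refine (norm_add_le _ _).trans ?_
    rw [norm_mul, norm_pow, norm_neg, norm_one, one_pow, one_mul]
    linarith
  rw [norm_mul, norm_pow, norm_pow]
  calc _ ≤ (2 : ℝ) ^ 2 * 2 ^ 2 := by gcongr
    _ = 16 := by norm_num

/-- Size and main part of the diagonal term, for either order `k` and with `ℓ = log (q X)`. -/
lemma exists_diagonal_evaluation (hG : IsAdmissibleWeight k G) (hk : 1 ≤ k) (hk2 : k ≤ 2) {A₀ : ℝ}
    {P : ℝ → ℂ} (hP : ∀ x : ℝ, 0 < x → V G k x = VRemainder G k x + P x) : ∃ C : ℝ, 0 ≤ C ∧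
    ∀ {D : ℕ} [NeZero D] {ψ : DirichletCharacter ℂ D} (h : ψ.IsQuadratic), ψ.Odd → 128 ≤ D →
      L1 ψ ≤ 1 → ∀ {q : ℕ} {X ℓ : ℝ}, (D : ℝ) ^ 24 ≤ q → (D : ℝ) ^ 24 ≤ X → ℓ = log (q * X) →
      (∀ t ∈ triples X, Summable (diagTerm ψ G k q X t)) ∧ ‖diagonal ψ G k q X‖ ≤ C * ℓ ^ 30 ∧
      ∀ {M l : ℝ} {e : ℝ → ℂ}, |M| ≤ A₀ * ℓ ^ 3 → |l| ≤ A₀ * ℓ ^ 3 →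
        (∀ y, 0 < y → ‖e y‖ ≤ A₀ * (1 + |log y|) ^ 2) →
        (∀ y, 0 < y → Tendsto (fun N => ∑ i ∈ range N, ψ ((i + 1 : ℕ) : ZMod D) /
          ((i + 1 : ℕ) : ℂ) * P (((i + 1 : ℕ) : ℝ) ^ 2 * y)) atTop
          (𝓝 (2 * ((M - l * log (y * Q q D) : ℝ) : ℂ) + L1 ψ * e y))) →
        ‖diagonal ψ G k q X - ((k.factorial : ℂ)) ^ 2 * (1 + (-1) ^ (k + 1) * ψ (q : ZMod D)) ^ 2 *
          (4 * ((∑' t : FT (primesUpTo (D ^ 24)), mainTerm (realChar ψ h) M l t.toTup : ℝ) : ℂ))‖ ≤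
          C * (L1 ψ * ℓ ^ 34 + (D : ℝ) ^ 15 * (q : ℝ) ^ (-(1 / 4) : ℝ) * ℓ ^ 28) := by
  obtain ⟨C₁, hC₁, hW⟩ := exists_charV_bound hG hk hk2
  obtain ⟨C₂, hC₂, hR⟩ := exists_charV_sub_bound hG
  obtain ⟨A, hA1, hA0, hAC₁, hAC₂⟩ : ∃ A : ℝ, 1 ≤ A ∧ A₀ ≤ A ∧ C₁ ≤ A ∧ C₂ ≤ A :=
    ⟨max (max 1 A₀) (max C₁ C₂), le_max_of_le_left (le_max_left _ _),
      le_max_of_le_left (le_max_right _ _), le_max_of_le_right (le_max_left _ _),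
      le_max_of_le_right (le_max_right _ _)⟩
  obtain ⟨C₃, hC₃, hev⟩ := exists_evaluation hA1
  obtain ⟨C₄, hC₄, hmaj⟩ := exists_majorant_log le_rfl
  refine ⟨16 * C₃ + 16 * (A ^ 2 * exp 3 * C₄), by positivity, ?_⟩
  intro D _ ψ h hodd hD hL1 q X ℓ hq hX hℓ
  have hψ := ne_one_of_odd hodd
  obtain ⟨hc, -⟩ := charData_realChar h hodd (by omega)
  have hL0 := hc.L_pos
  have hD' : (128 : ℝ) ≤ D := by exact_mod_cast hD
  have hDp : (1 : ℝ) ≤ (D : ℝ) ^ 24 := one_le_pow₀ (by linarith)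
  have hDD : (D : ℝ) ≤ (D : ℝ) ^ 24 := le_self_pow₀ (by linarith) (by norm_num)
  have hq1 : (1 : ℝ) ≤ q := by linarith
  have hX1 : (1 : ℝ) ≤ X := by linarith
  have hq0 : 0 < q := by exact_mod_cast (by linarith : (0 : ℝ) < q)
  have hlq : 0 ≤ log q := log_nonneg hq1
  have hlX : 0 ≤ log X := log_nonneg hX1
  have hsum : ℓ = log q + log X := by
    rw [hℓ, log_mul (by positivity) (by positivity)]
  have hlD : 24 * log D ≤ log X := by
    rw [show 24 * log D = log ((D : ℝ) ^ 24) by rw [log_pow]; norm_num]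
    exact log_le_log (by positivity) hX
  have hlD1 : 1 ≤ log D := one_le_log (by linarith)
  have hℓ1 : 1 ≤ ℓ := by linarith
  have hℓ0 : 0 < ℓ := by linarith
  have hQ := Q_pos hq0 (by omega : 0 < D)
  have hpi : 4 * Real.pi ^ 2 ≤ 40 := by
    have := Real.pi_lt_d2
    nlinarith [Real.pi_pos]
  have hpi1 : 1 ≤ 4 * Real.pi ^ 2 := by nlinarith [Real.pi_gt_three]
  have hqQ : (q : ℝ) * D ≤ 40 * Q q D := by
    have : (q : ℝ) * D = 4 * Real.pi ^ 2 * Q q D := by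
      rw [Q]; field_simp
    rw [this]; gcongr
  have hQ1 : 1 ≤ Q q D := by nlinarith
  have hQℓ : log (Q q D) ≤ ℓ := by
    rw [hℓ]
    refine log_le_log hQ ?_
    calc Q q D ≤ (q : ℝ) * D := div_le_self (by positivity) hpi1
      _ ≤ _ := by gcongr; linarith
  have hℓinv : ℓ⁻¹ ≤ 1 := inv_le_one_of_one_le₀ hℓ1
  have hWb : ∀ y, 0 < y → ‖charV ψ G k y‖ ≤ A * ℓ ^ 3 * y ^ (-ℓ⁻¹) := by
    intro y hy
    have := (hW ψ y ℓ⁻¹ hy (by positivity) hℓinv).2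
    rw [inv_inv] at this
    exact this.trans (by gcongr)
  have hT := (hmaj hc hL1 ℓ ℓ⁻¹ hℓ1 (by linarith) (by positivity) hℓinv
    (by rw [one_div, inv_inv, one_mul]; nlinarith)).1
  have hu := norm_diagW_le (χ := realChar ψ h) (X := X) hc.tri hQ hℓ0 (by linarith) hQℓ
    (by linarith : 0 ≤ A) hWb
  obtain ⟨su, bu⟩ := norm_tsum_le_of_le_ofReal (by positivity) (by positivity) hu hT
  have hdiag := diagonal_eq hG hk hk2 h hq0 (by omega) (by linarith) su.of_norm
  have hfac := norm_sq_factor_le hk2 (DirichletCharacter.norm_le_one ψ (q : ZMod D))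
  refine ⟨fun t ht => ?_, ?_, ?_⟩
  · simp only [triples, mem_filter, Finset.mem_product, mem_Icc] at ht
    exact summable_diagTerm hG hk h hq0 (by omega) ht.1.1.1 ht.1.2.1.1 ht.1.2.2.1
  · rw [hdiag, norm_mul]
    have h0 : 0 ≤ C₃ * ℓ ^ 30 := by positivity
    calc _ ≤ 16 * (A ^ 2 * exp 3 * ℓ ^ 6 * (C₄ * ℓ ^ 24)) := by gcongr
      _ = 16 * (A ^ 2 * exp 3 * C₄) * ℓ ^ 30 := by ring
      _ ≤ _ := by linarith
  · intro M l e hM hl he hlim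
    have hA0' : ∀ x : ℝ, 0 ≤ x → A₀ * x ≤ A * x := fun x hx => mul_le_mul_of_nonneg_right hA0 hx
    have key := hev hc (by omega) hL1 (W := charV ψ G k) (e := e) hX hQ1 (by linarith : (0 : ℝ) < q)
      hqQ (by linarith) hQℓ (by linarith) (hM.trans (hA0' _ (by positivity)))
      (hl.trans (hA0' _ (by positivity))) hWb (fun y hy => by
        refine (hR hψ hy (hW ψ y 1 hy one_pos le_rfl).1 hP (hlim y hy)).trans ?_
        gcongr) (fun y hy => (he y hy).trans (hA0' _ (by positivity)))
    rw [hdiag, ← mul_sub, norm_mul]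
    have h0 : 0 ≤ A ^ 2 * exp 3 * C₄ *
      (L1 ψ * ℓ ^ 34 + (D : ℝ) ^ 15 * (q : ℝ) ^ (-(1 / 4) : ℝ) * ℓ ^ 28) := by positivity
    calc _ ≤ 16 * (C₃ * (L1 ψ * ℓ ^ 34 + (D : ℝ) ^ 15 * (q : ℝ) ^ (-(1 / 4) : ℝ) * ℓ ^ 28)) := by
          gcongr
      _ ≤ _ := by linarith

end

/-! ### The smooth main term -/

section

variable {χ : ℕ →* ℝ} {D : ℕ} {L L' L'' : ℝ}

lemma prod_localFactor_bounds (hχ : IsTrivalued χ) {S : Finset ℕ} (hS : ∀ p ∈ S, p.Prime) :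
    0 < ∏ p ∈ S, localFactor χ p ∧ ∏ p ∈ S, localFactor χ p ≤ 1 := by
  have h : ∀ p ∈ S, 0 < localFactor χ p ∧ localFactor χ p ≤ 1 := fun p hp => by
    have := localFactor_bounds hχ (hS p hp)
    constructor <;> linarith
  exact ⟨Finset.prod_pos fun p hp => (h p hp).1,
    Finset.prod_le_one (fun p hp => (h p hp).1.le) fun p hp => (h p hp).2⟩

lemma sum_inv_sq_tail_le {m : ℕ} (hm : 1 ≤ m) (s : Finset ℕ) (hs : ∀ n ∈ s, m < n) :
    ∑ n ∈ s, ((n : ℝ)⁻¹) ^ 2 ≤ (m : ℝ)⁻¹ := by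
  have h1 : ∀ N, m ≤ N → ∑ n ∈ Ioc m N, ((n : ℝ)⁻¹) ^ 2 ≤ (m : ℝ)⁻¹ - (N : ℝ)⁻¹ := by
    intro N hN
    induction N, hN using Nat.le_induction with
    | base => simp
    | succ N hN ih =>
      rw [Finset.sum_Ioc_succ_top (by omega)]
      have hN0 : (0 : ℝ) < N := by exact_mod_cast (by omega : 0 < N)
      have : (((N + 1 : ℕ) : ℝ)⁻¹) ^ 2 ≤ (N : ℝ)⁻¹ - ((N + 1 : ℕ) : ℝ)⁻¹ := by
        push_cast
        rw [inv_sub_inv (by positivity) (by positivity), inv_pow, ← one_div,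
          div_le_div_iff₀ (by positivity) (by positivity)]
        nlinarith
      linarith
  calc _ ≤ ∑ n ∈ Ioc m (s.sup id + m), ((n : ℝ)⁻¹) ^ 2 := by
        refine Finset.sum_le_sum_of_subset_of_nonneg (fun n hn => Finset.mem_Ioc.2 ⟨hs n hn, ?_⟩)
          fun _ _ _ => by positivity
        have : n ≤ s.sup id := Finset.le_sup (f := id) hn
        omega
    _ ≤ _ := (h1 _ (by omega)).trans (by
        have : (0 : ℝ) ≤ ((s.sup id + m : ℕ) : ℝ)⁻¹ := by positivity
        linarith)

/-- Primes beyond `D^24` hardly affect the singular series. -/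
lemma exists_singular_tail : ∃ C : ℝ, 0 ≤ C ∧ ∀ {χ : ℕ →* ℝ} {D : ℕ} {L L' L'' : ℝ},
    CharData χ D L L' L'' → ∀ {X ℓ : ℝ}, (D : ℝ) ^ 24 ≤ X → log X ≤ ℓ → 1 ≤ ℓ →
      |∏ p ∈ primesUpTo (D ^ 24), localFactor χ p - ∏ p ∈ primesUpTo ⌊X⌋₊, localFactor χ p| ≤
        C * (L * ℓ) := by
  obtain ⟨C, hC, hb⟩ := exists_one_sub_localFactor_le
  refine ⟨C * (exp 1 * 12336 + 128), by positivity, ?_⟩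
  intro χ D L L' L'' h X ℓ hX hXℓ hℓ1
  have hL := h.L_pos
  have hD2 := h.two_le_cast
  have hD1 : 1 ≤ D := by have := h.two_le; omega
  have hX0 : 0 < X := lt_of_lt_of_le (by positivity) hX
  have hℓ0 : 0 < ℓ := by linarith
  have hfl : D ^ 24 ≤ ⌊X⌋₊ := Nat.le_floor (by exact_mod_cast hX)
  have hsub : primesUpTo (D ^ 24) ⊆ primesUpTo ⌊X⌋₊ :=
    Finset.filter_subset_filter _ (Finset.Icc_subset_Icc_right hfl)
  refine (prod_localFactor_sub_le h.tri hsub fun p hp => prime_of_mem_primesUpTo hp).trans ?_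
  set T := primesUpTo ⌊X⌋₊ \ primesUpTo (D ^ 24) with hT
  have hTm : ∀ p ∈ T, p.Prime ∧ D ^ 24 < p ∧ (p : ℝ) ≤ X := by
    intro p hp
    obtain ⟨h1, h2⟩ := Finset.mem_sdiff.1 hp
    have hpp := prime_of_mem_primesUpTo h1
    refine ⟨hpp, ?_, (Nat.le_floor_iff hX0.le).1 (le_of_mem_primesUpTo h1)⟩
    by_contra hle
    exact h2 (mem_filter.2 ⟨mem_Icc.2 ⟨hpp.one_le, not_lt.1 hle⟩, hpp⟩)
  have h1 : ∑ p ∈ T, ((p : ℝ)⁻¹) ^ 2 ≤ 128 * (L * ℓ) := by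
    refine (sum_inv_sq_tail_le (Nat.one_le_pow _ _ hD1) T fun p hp => (hTm p hp).2.1).trans ?_
    have h2 := h.L_ge
    have h3 : ((D ^ 24 : ℕ) : ℝ)⁻¹ ≤ (D : ℝ)⁻¹ := by
      push_cast
      exact inv_anti₀ (by positivity) (le_self_pow₀ (by linarith) (by norm_num))
    have h4 : (D : ℝ)⁻¹ = 128 * (1 / (128 * (D : ℝ))) := by field_simp
    nlinarith
  have h2 : ∑ p ∈ T, rConv χ p / p ≤ exp 1 * 12336 * (L * ℓ) := by
    have hσ : 0 < ℓ⁻¹ := by positivity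
    have hσ1 : ℓ⁻¹ ≤ 1 := inv_le_one_of_one_le₀ hℓ1
    have htail := h.tail_le hσ hσ1
    have hr : ∀ p ∈ T, 0 ≤ rConv χ p * (p : ℝ) ^ (-1 - ℓ⁻¹) := fun p _ =>
      mul_nonneg (rConv_nonneg h.tri p) (by positivity)
    have h3 : ∑ p ∈ T, rConv χ p * (p : ℝ) ^ (-1 - ℓ⁻¹) ≤ 12336 * L / ℓ⁻¹ := by
      rw [← ENNReal.ofReal_le_ofReal_iff (by positivity), ENNReal.ofReal_sum_of_nonneg hr]
      refine le_trans ?_ ((ENNReal.sum_le_tsum T).trans htail)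
      refine sum_le_sum fun p hp => ?_
      rw [if_pos, rE]
      exact lt_of_le_of_lt (Nat.pow_le_pow_right hD1 (by norm_num)) (hTm p hp).2.1
    rw [div_inv_eq_mul] at h3
    calc ∑ p ∈ T, rConv χ p / p ≤ ∑ p ∈ T, exp 1 * (rConv χ p * (p : ℝ) ^ (-1 - ℓ⁻¹)) := by
          refine sum_le_sum fun p hp => ?_
          obtain ⟨hpp, -, hpX⟩ := hTm p hp
          have hp0 : (0 : ℝ) < p := by exact_mod_cast hpp.pos
          have h4 := rpow_neg_inv_ge (c := 1) hp0 hℓ0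
            (by rw [one_mul]; exact (log_le_log hp0 hpX).trans hXℓ)
          have h5 := mul_le_mul_of_nonneg_left h4 (exp_pos 1).le
          rw [← exp_add, add_neg_cancel, Real.exp_zero] at h5
          rw [sub_eq_add_neg, rpow_add hp0, rpow_neg_one]
          have h6 : 0 ≤ rConv χ p * (p : ℝ)⁻¹ := mul_nonneg (rConv_nonneg h.tri p) (by positivity)
          calc rConv χ p / p = rConv χ p * (p : ℝ)⁻¹ * 1 := by ring
            _ ≤ rConv χ p * (p : ℝ)⁻¹ * (exp 1 * (p : ℝ) ^ (-ℓ⁻¹)) := by gcongr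
            _ = _ := by ring
      _ = exp 1 * ∑ p ∈ T, rConv χ p * (p : ℝ) ^ (-1 - ℓ⁻¹) := by rw [mul_sum]
      _ ≤ exp 1 * (12336 * L * ℓ) := by gcongr
      _ = _ := by ring
  calc ∑ p ∈ T, (1 - localFactor χ p) ≤ ∑ p ∈ T, C * primeWeight χ p :=
        sum_le_sum fun p hp => hb h.tri (hTm p hp).1
    _ = C * (∑ p ∈ T, rConv χ p / p + ∑ p ∈ T, ((p : ℝ)⁻¹) ^ 2) := by
        rw [← mul_sum, ← Finset.sum_add_distrib]; rfl
    _ ≤ C * (exp 1 * 12336 * (L * ℓ) + 128 * (L * ℓ)) := by gcongr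
    _ = _ := by ring

lemma tsum_mainTerm_zero (hχ : IsTrivalued χ) (M : ℝ) {S : Finset ℕ} (hS : ∀ p ∈ S, p.Prime) :
    ∑' t : FT S, mainTerm χ M 0 t.toTup = M ^ 2 * ∏ p ∈ S, localFactor χ p := by
  obtain ⟨C, -, h⟩ := exists_smooth_moments
  rw [← (h hχ S hS).2.1, ← tsum_mul_left]
  refine tsum_congr fun t => ?_
  rw [mainTerm]; ring

/-- Expansion of a sum of products of two linear forms in nonnegative weights. -/
lemma tsum_mul_linear_mul_linear {S : Finset ℕ} {w₁ w₂ : FT S → ℝ}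
    (hw₁ : ∀ t, 0 ≤ w₁ t) (hw₂ : ∀ t, 0 ≤ w₂ t) {f : FT S → ℝ}
    (hf : Summable fun t => |f t| * ((1 + w₁ t) * (1 + w₂ t))) (M l : ℝ) :
    ∑' t, f t * ((M - l * w₁ t) * (M - l * w₂ t)) = M ^ 2 * ∑' t, f t -
      M * l * (∑' t, f t * w₁ t + ∑' t, f t * w₂ t) + l ^ 2 * ∑' t, f t * (w₁ t * w₂ t) := by
  have hdom : ∀ w : FT S → ℝ, (∀ t, 0 ≤ w t ∧ w t ≤ (1 + w₁ t) * (1 + w₂ t)) →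
      Summable fun t => f t * w t := by
    intro w hw
    refine Summable.of_norm_bounded hf fun t => ?_
    rw [norm_mul, norm_eq_abs, norm_eq_abs, abs_of_nonneg (hw t).1]
    exact mul_le_mul_of_nonneg_left (hw t).2 (abs_nonneg _)
  have hp : ∀ t, 0 ≤ w₁ t * w₂ t := fun t => mul_nonneg (hw₁ t) (hw₂ t)
  have he : ∀ t, (1 + w₁ t) * (1 + w₂ t) = 1 + w₁ t + w₂ t + w₁ t * w₂ t := fun t => by ring
  have s0 : Summable f := by
    simpa using hdom (fun _ => 1) fun t =>
      ⟨zero_le_one, by rw [he]; linarith [hw₁ t, hw₂ t, hp t]⟩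
  have s1 := hdom w₁ fun t => ⟨hw₁ t, by rw [he]; linarith [hw₁ t, hw₂ t, hp t]⟩
  have s2 := hdom w₂ fun t => ⟨hw₂ t, by rw [he]; linarith [hw₁ t, hw₂ t, hp t]⟩
  have s12 := hdom (fun t => w₁ t * w₂ t) fun t =>
    ⟨hp t, by rw [he]; linarith [hw₁ t, hw₂ t, hp t]⟩
  rw [← s1.tsum_add s2, ← tsum_mul_left, ← tsum_mul_left, ← tsum_mul_left,
    ← (s0.mul_left _).tsum_sub ((s1.add s2).mul_left _),
    ← ((s0.mul_left _).sub ((s1.add s2).mul_left _)).tsum_add (s12.mul_left _)]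
  exact tsum_congr fun t => by ring

lemma abs_quadratic_sub_le {M l P T₁ T₂ T₃ B κ Λ : ℝ} (hP : 0 ≤ P) (hl : 0 ≤ l) (hM : 0 ≤ M)
    (hB : 0 ≤ B) (hκ : 0 ≤ κ) (hκ1 : κ ≤ 1) (hΛ : 0 ≤ Λ) (hΛl : Λ * l ≤ M)
    (h₁ : |T₁| ≤ B * κ * Λ * P) (h₂ : |T₂| ≤ B * κ * Λ * P)
    (h₃ : |T₃| ≤ ((B * κ * Λ) ^ 2 + 24 * (B * κ) * Λ ^ 2) * P) :
    |M ^ 2 * P - M * l * (T₁ + T₂) + l ^ 2 * T₃ - M ^ 2 * P| ≤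
      (2 * B + (B ^ 2 + 24 * B)) * κ * (M ^ 2 * P) := by
  have b1 : |M * l * (T₁ + T₂)| ≤ 2 * B * κ * (M ^ 2 * P) := by
    rw [abs_mul, abs_of_nonneg (mul_nonneg hM hl)]
    calc M * l * |T₁ + T₂| ≤ M * l * (B * κ * Λ * P + B * κ * Λ * P) := by
          gcongr
          exact (abs_add_le _ _).trans (add_le_add h₁ h₂)
      _ = 2 * B * κ * M * P * (Λ * l) := by ring
      _ ≤ 2 * B * κ * M * P * M := by gcongr
      _ = _ := by ring
  have hκ2 : κ ^ 2 ≤ κ := by rw [sq]; exact mul_le_of_le_one_left hκ hκ1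
  have b2 : |l ^ 2 * T₃| ≤ (B ^ 2 + 24 * B) * κ * (M ^ 2 * P) := by
    rw [abs_mul, abs_of_nonneg (sq_nonneg l)]
    calc l ^ 2 * |T₃| ≤ l ^ 2 * (((B * κ * Λ) ^ 2 + 24 * (B * κ) * Λ ^ 2) * P) := by gcongr
      _ = (B ^ 2 * κ ^ 2 + 24 * B * κ) * P * (Λ * l) ^ 2 := by ring
      _ ≤ (B ^ 2 * κ + 24 * B * κ) * P * M ^ 2 := by gcongr
      _ = _ := by ring
  rw [show M ^ 2 * P - M * l * (T₁ + T₂) + l ^ 2 * T₃ - M ^ 2 * P =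
    -(M * l * (T₁ + T₂)) + l ^ 2 * T₃ by ring]
  refine (abs_add_le _ _).trans ?_
  rw [abs_neg]
  linarith

/-- The smooth main term is `M²` times the singular series, up to a relative error `O(κ)`: a
logarithmic weight costs `∑ log p (r(p)/p + 1/p²) ≪ κ log D`, whereas `M ≥ l log D`. -/
lemma exists_tsum_mainTerm : ∃ C η₀ : ℝ, 0 ≤ C ∧ 0 < η₀ ∧ η₀ ≤ 1 ∧
    ∀ {χ : ℕ →* ℝ} {D : ℕ} {L L' L'' : ℝ}, CharData χ D L L' L'' → 128 ≤ D → L * log D ≤ η₀ →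
      ∀ {M l κ : ℝ}, κ = log (log (1 / (L * log D))) / log (1 / (L * log D)) →
        0 < l → log D * l ≤ M → κ ≤ 1 ∧ 0 ≤ κ ∧
        |∑' t : FT (primesUpTo (D ^ 24)), mainTerm χ M l t.toTup -
          M ^ 2 * ∏ p ∈ primesUpTo (D ^ 24), localFactor χ p| ≤
          C * κ * (M ^ 2 * ∏ p ∈ primesUpTo (D ^ 24), localFactor χ p) := by
  obtain ⟨C₁, η₀, hC₁, hη₀, hη₁, hlac⟩ := exists_lacunarity
  obtain ⟨C₂, hC₂, hmom⟩ := exists_smooth_moments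
  refine ⟨2 * (C₂ * C₁) + ((C₂ * C₁) ^ 2 + 24 * (C₂ * C₁)), η₀, by positivity, hη₀, hη₁, ?_⟩
  intro χ D L L' L'' h hD hη M l κ hκ hl hMl
  obtain ⟨hκ0, hκ1, hK⟩ := hlac h hD hη
  rw [← hκ] at hκ0 hκ1 hK
  refine ⟨hκ1, hκ0, ?_⟩
  have hSp : ∀ p ∈ primesUpTo (D ^ 24), p.Prime := fun p hp => prime_of_mem_primesUpTo hp
  have hle : ∀ p ∈ primesUpTo (D ^ 24), p ≤ D ^ 24 := fun p hp => le_of_mem_primesUpTo hp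
  generalize primesUpTo (D ^ 24) = S at *
  obtain ⟨m1, m2, m3, m4, m5⟩ := hmom h.tri S hSp
  obtain ⟨hP0, -⟩ := prod_localFactor_bounds h.tri hSp
  have hΛ : 0 ≤ log D := log_natCast_nonneg D
  have hK' : ∑ p ∈ S, log p ^ 2 * primeWeight χ p ≤
      24 * log D * ∑ p ∈ S, log p * primeWeight χ p := by
    rw [mul_sum]
    refine sum_le_sum fun p hp => ?_
    have h1 : log p ≤ 24 * log D := by
      rw [show 24 * log D = log ((D ^ 24 : ℕ) : ℝ) by
        rw [Nat.cast_pow, log_pow]; norm_num]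
      exact log_le_log (Nat.cast_pos.2 (hSp p hp).pos) (Nat.cast_le.2 (hle p hp))
    have h2 := mul_nonneg (log_natCast_nonneg p) (primeWeight_nonneg h.tri p)
    calc _ = log p * (log p * primeWeight χ p) := by ring
      _ ≤ _ := mul_le_mul_of_nonneg_right h1 h2
  have hK0 : 0 ≤ ∑ p ∈ S, log p * primeWeight χ p := Finset.sum_nonneg fun p _ =>
    mul_nonneg (log_natCast_nonneg p) (primeWeight_nonneg h.tri p)
  generalize ∑ p ∈ S, log p * primeWeight χ p = K at *
  have hCK : C₂ * K ≤ C₂ * C₁ * κ * log D := by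
    calc C₂ * K ≤ C₂ * (C₁ * κ * log D) := by gcongr
      _ = _ := by ring
  have hmain := tsum_mul_linear_mul_linear (fun t : FT S => logAGN_nonneg t.toTup)
    (fun t => logBGN_nonneg t.toTup) m1 M l
  rw [m2] at hmain
  have hmain' : ∑' t : FT S, mainTerm χ M l t.toTup = _ := hmain
  rw [hmain']
  have hPle := hP0.le
  refine abs_quadratic_sub_le hPle hl.le ((mul_nonneg hΛ hl.le).trans hMl) (by positivity) hκ0 hκ1
    hΛ hMl (m3.trans (mul_le_mul_of_nonneg_right hCK hPle))
    (m4.trans (mul_le_mul_of_nonneg_right hCK hPle))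
    (m5.trans (mul_le_mul_of_nonneg_right (add_le_add (by gcongr) ?_) hPle))
  calc _ ≤ C₂ * (24 * log D * K) := by gcongr
    _ = 24 * log D * (C₂ * K) := by ring
    _ ≤ 24 * log D * (C₂ * C₁ * κ * log D) := by gcongr
    _ = _ := by ring

end

/-! ### The error terms -/

section

/-- Bounds in terms of `log (q X)` give the error terms of the theorem. If `X ≤ q`, then
`log (q X) ≤ 2 log q` and `D^15 ≤ D^{-1/4} X^{3/4}`; otherwise
`q^{-1/4} D^{-1/4} X^{3/4} ≥ X^{1/4}`, and the trivial bound suffices. -/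
lemma exists_error_bound {C : ℝ} (hC : 0 ≤ C) : ∃ K : ℝ → ℝ, ∀ ε : ℝ, 0 < ε →
    ∀ {D q : ℕ} {X L T c : ℝ}, 128 ≤ D → (D : ℝ) ^ 24 ≤ q → (D : ℝ) ^ 24 ≤ X → 0 ≤ L → 34 ≤ c →
      T ≤ C * log (q * X) ^ 30 →
      T ≤ C * (L * log (q * X) ^ 34 +
        (D : ℝ) ^ 15 * (q : ℝ) ^ (-(1 / 4) : ℝ) * log (q * X) ^ 28) →
      T ≤ K ε * (L * log q ^ (c + ε)) +
        K ε * ((q : ℝ) ^ (-1 / 4 + ε) * (D : ℝ) ^ (-1 / 4 : ℝ) * X ^ (3 / 4 : ℝ)) := by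
  refine ⟨fun ε => C * (2 ^ 34 + 2 ^ 28 * (28 / ε) ^ 28 + 2 ^ 30 * 120 ^ 30), ?_⟩
  intro ε hε D q X L T c hD hq hX hL hc h1 h2
  have hD' : (128 : ℝ) ≤ D := by exact_mod_cast hD
  have hDD : (D : ℝ) ≤ (D : ℝ) ^ 24 := le_self_pow₀ (by linarith) (by norm_num)
  have hD0 : (0 : ℝ) < D := by linarith
  have hq0 : (0 : ℝ) < q := by linarith
  have hX0 : 0 < X := by linarith
  have hlq : 1 ≤ log q := by
    rw [le_log_iff_exp_le hq0]
    linarith [exp_one_lt_d9]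
  have hlX : 0 ≤ log X := log_nonneg (by linarith)
  have hℓ : log (q * X) = log q + log X := log_mul hq0.ne' hX0.ne'
  rw [hℓ] at h1 h2
  have hqε : (1 : ℝ) ≤ (q : ℝ) ^ ε := Real.one_le_rpow (by linarith) hε.le
  have hqsplit : (q : ℝ) ^ (-1 / 4 + ε) = (q : ℝ) ^ (-(1 / 4) : ℝ) * (q : ℝ) ^ ε := by
    rw [← rpow_add hq0]; norm_num [neg_div]
  have hE : 0 ≤ L * log q ^ (c + ε) := mul_nonneg hL (by positivity)
  set E := L * log q ^ (c + ε) with hEd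
  set F := (q : ℝ) ^ (-1 / 4 + ε) * (D : ℝ) ^ (-1 / 4 : ℝ) * X ^ (3 / 4 : ℝ) with hFd
  have hF : 0 ≤ F := by positivity
  rcases le_or_gt X q with hXq | hXq
  · have hle : log q + log X ≤ 2 * log q := by
      linarith [log_le_log hX0 hXq]
    have e1 : L * (log q + log X) ^ 34 ≤ 2 ^ 34 * E := by
      have : log q ^ 34 ≤ log q ^ (c + ε) := by
        rw [← rpow_natCast]
        exact Real.rpow_le_rpow_of_exponent_le hlq (by push_cast; linarith)
      calc _ ≤ L * (2 * log q) ^ 34 := by gcongr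
        _ = 2 ^ 34 * (L * log q ^ 34) := by rw [mul_pow]; ring
        _ ≤ _ := by rw [hEd]; gcongr
    have e2 : (log q + log X) ^ 28 ≤ 2 ^ 28 * (28 / ε) ^ 28 * (q : ℝ) ^ ε := by
      have h3 : log q ≤ (28 / ε) * (q : ℝ) ^ (ε / 28) := by
        have := Real.log_le_rpow_div hq0.le (show 0 < ε / 28 by positivity)
        calc _ ≤ _ := this
          _ = _ := by field_simp
      calc _ ≤ (2 * ((28 / ε) * (q : ℝ) ^ (ε / 28))) ^ 28 := by
            gcongr; linarith
        _ = 2 ^ 28 * (28 / ε) ^ 28 * ((q : ℝ) ^ (ε / 28)) ^ 28 := by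
            rw [mul_pow, mul_pow, mul_assoc]
        _ = _ := by
            rw [← rpow_natCast ((q : ℝ) ^ (ε / 28)), ← rpow_mul hq0.le]
            congr 2
            push_cast; ring
    have e3 : (D : ℝ) ^ 15 ≤ (D : ℝ) ^ (-1 / 4 : ℝ) * X ^ (3 / 4 : ℝ) := by
      have h3 : ((D : ℝ) ^ 24) ^ (3 / 4 : ℝ) = (D : ℝ) ^ (18 : ℝ) := by
        rw [← rpow_natCast (D : ℝ) 24, ← rpow_mul hD0.le]; norm_num
      calc (D : ℝ) ^ 15 = (D : ℝ) ^ (15 : ℝ) := by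
            rw [← rpow_natCast]; norm_num
        _ ≤ (D : ℝ) ^ (-1 / 4 + 18 : ℝ) :=
            Real.rpow_le_rpow_of_exponent_le (by linarith) (by norm_num)
        _ = (D : ℝ) ^ (-1 / 4 : ℝ) * ((D : ℝ) ^ 24) ^ (3 / 4 : ℝ) := by
            rw [h3, ← rpow_add hD0]
        _ ≤ _ := by gcongr
    have e4 : (D : ℝ) ^ 15 * (q : ℝ) ^ (-(1 / 4) : ℝ) * (log q + log X) ^ 28 ≤
        2 ^ 28 * (28 / ε) ^ 28 *
          F := by
      rw [hFd, hqsplit]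
      calc _ ≤ (D : ℝ) ^ (-1 / 4 : ℝ) * X ^ (3 / 4 : ℝ) * (q : ℝ) ^ (-(1 / 4) : ℝ) *
            (2 ^ 28 * (28 / ε) ^ 28 * (q : ℝ) ^ ε) := by gcongr
        _ = _ := by ring
    have k1 : C * 2 ^ 34 ≤ C * (2 ^ 34 + 2 ^ 28 * (28 / ε) ^ 28 + 2 ^ 30 * 120 ^ 30) :=
      mul_le_mul_of_nonneg_left (by have : 0 ≤ (28 / ε) ^ 28 := by positivity
                                    linarith) hC
    have k2 : C * (2 ^ 28 * (28 / ε) ^ 28) ≤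
        C * (2 ^ 34 + 2 ^ 28 * (28 / ε) ^ 28 + 2 ^ 30 * 120 ^ 30) :=
      mul_le_mul_of_nonneg_left (by linarith) hC
    calc T ≤ C * (2 ^ 34 * E + 2 ^ 28 * (28 / ε) ^ 28 *
          F) :=
          h2.trans (mul_le_mul_of_nonneg_left (add_le_add e1 e4) hC)
      _ = C * 2 ^ 34 * E + C * (2 ^ 28 * (28 / ε) ^ 28) *
          F := by ring
      _ ≤ _ := add_le_add (mul_le_mul_of_nonneg_right k1 hE) (mul_le_mul_of_nonneg_right k2 hF)
  · have hle : log q + log X ≤ 2 * log X := by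
      linarith [log_le_log hq0 hXq.le]
    have e2 : (log q + log X) ^ 30 ≤ 2 ^ 30 * 120 ^ 30 * X ^ (1 / 4 : ℝ) := by
      have h3 : log X ≤ 120 * X ^ (1 / 120 : ℝ) := by
        have := Real.log_le_rpow_div hX0.le (show (0 : ℝ) < 1 / 120 by norm_num)
        calc _ ≤ _ := this
          _ = _ := by rw [div_div_eq_mul_div, div_one, mul_comm]
      calc _ ≤ (2 * (120 * X ^ (1 / 120 : ℝ))) ^ 30 := by
            gcongr; linarith
        _ = 2 ^ 30 * 120 ^ 30 * (X ^ (1 / 120 : ℝ)) ^ 30 := by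
            rw [mul_pow, mul_pow, mul_assoc]
        _ = _ := by
            rw [← rpow_natCast (X ^ (1 / 120 : ℝ)), ← rpow_mul hX0.le]
            congr 2
            norm_num
    have e3 : X ^ (1 / 4 : ℝ) ≤
        F := by
      have h3 : X ^ (-(1 / 4) : ℝ) ≤ (q : ℝ) ^ (-(1 / 4) : ℝ) :=
        Real.rpow_le_rpow_of_nonpos hq0 hXq.le (by norm_num)
      have h4 : X ^ (-1 / 4 : ℝ) ≤ (D : ℝ) ^ (-1 / 4 : ℝ) :=
        Real.rpow_le_rpow_of_nonpos hD0 (hDD.trans hX) (by norm_num)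
      calc X ^ (1 / 4 : ℝ) = X ^ (-(1 / 4) : ℝ) * 1 * X ^ (-1 / 4 : ℝ) * X ^ (3 / 4 : ℝ) := by
            rw [mul_one, ← rpow_add hX0, ← rpow_add hX0]; norm_num
        _ ≤ (q : ℝ) ^ (-(1 / 4) : ℝ) * (q : ℝ) ^ ε * (D : ℝ) ^ (-1 / 4 : ℝ) * X ^ (3 / 4 : ℝ) := by
            gcongr
        _ = _ := by rw [hFd, hqsplit]
    have k0 : (0 : ℝ) ≤ (28 / ε) ^ 28 := by positivity
    have k1 : C * (2 ^ 30 * 120 ^ 30) ≤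
        C * (2 ^ 34 + 2 ^ 28 * (28 / ε) ^ 28 + 2 ^ 30 * 120 ^ 30) :=
      mul_le_mul_of_nonneg_left (by linarith) hC
    have k2 : 0 ≤ C * (2 ^ 34 + 2 ^ 28 * (28 / ε) ^ 28 + 2 ^ 30 * 120 ^ 30) := by positivity
    calc T ≤ C * (2 ^ 30 * 120 ^ 30 * X ^ (1 / 4 : ℝ)) :=
          h1.trans (mul_le_mul_of_nonneg_left e2 hC)
      _ = C * (2 ^ 30 * 120 ^ 30) * X ^ (1 / 4 : ℝ) := by ring
      _ ≤ C * (2 ^ 34 + 2 ^ 28 * (28 / ε) ^ 28 + 2 ^ 30 * 120 ^ 30) *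
          F := by gcongr
      _ ≤ _ := le_add_of_nonneg_left (mul_nonneg k2 hE)

/-- Passage from the primes up to `D ^ 24` to the singular series, which costs `O(L ℓ⁷)`. -/
lemma norm_sub_main_le {z c : ℂ} {W M θ P₀ P₁ C₁ C₂ B L ℓ F : ℝ} (hc : ‖c‖ ≤ 16)
    (hℓ : 1 ≤ ℓ) (hL : 0 ≤ L) (hF : 0 ≤ F) (hC₂ : 0 ≤ C₂) (hz : ‖z‖ ≤ C₁ * ℓ ^ 30)
    (hzW : ‖z - c * (4 * (W : ℂ))‖ ≤ C₁ * (L * ℓ ^ 34 + F)) (hW : W = M ^ 2 * P₀ * (1 + θ))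
    (hP : |P₀ - P₁| ≤ C₂ * (L * ℓ)) (hP0 : 0 ≤ P₁) (hP1 : P₁ ≤ 1) (hM : |M| ≤ 400 * ℓ ^ 3)
    (hθ : |1 + θ| ≤ B) :
    ‖z - c * 4 * P₁ * (1 + θ) * M ^ 2‖ ≤ (C₁ + 10240000 * B * (1 + C₂)) * ℓ ^ 30 ∧
      ‖z - c * 4 * P₁ * (1 + θ) * M ^ 2‖ ≤
        (C₁ + 10240000 * B * (1 + C₂)) * (L * ℓ ^ 34 + F) := by
  have hB : 0 ≤ B := (abs_nonneg _).trans hθ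
  have hM2 : M ^ 2 ≤ 160000 * ℓ ^ 6 := by
    rw [← sq_abs]
    calc |M| ^ 2 ≤ (400 * ℓ ^ 3) ^ 2 := by gcongr
      _ = _ := by ring
  have hmain : ∀ p : ℝ, ‖c * 4 * (p : ℂ) * (1 + θ) * (M : ℂ) ^ 2‖ ≤ 10240000 * B * |p| * ℓ ^ 6 := by
    intro p
    have e : ‖(1 + θ : ℂ)‖ = |1 + θ| := by
      rw [← norm_eq_abs, ← Complex.norm_real]; push_cast; rfl
    have e2 : ‖(M : ℂ) ^ 2‖ = M ^ 2 := by
      rw [norm_pow, Complex.norm_real, norm_eq_abs, sq_abs]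
    rw [norm_mul, norm_mul, norm_mul, norm_mul, e, e2, Complex.norm_real, norm_eq_abs,
      Complex.norm_ofNat]
    calc _ ≤ 16 * 4 * |p| * B * (160000 * ℓ ^ 6) := by gcongr
      _ = _ := by ring
  constructor
  · refine (norm_sub_le _ _).trans ?_
    have h1 := hmain P₁
    rw [abs_of_nonneg hP0] at h1
    have h2 : 10240000 * B * P₁ * ℓ ^ 6 ≤ 10240000 * B * (1 + C₂) * ℓ ^ 30 := by
      gcongr
      · linarith
      · norm_num
    calc _ ≤ _ := add_le_add hz (h1.trans h2)
      _ = _ := by ring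
  · have h1 : z - c * 4 * P₁ * (1 + θ) * (M : ℂ) ^ 2 =
        (z - c * (4 * (W : ℂ))) + c * 4 * ((P₀ - P₁ : ℝ) : ℂ) * (1 + θ) * (M : ℂ) ^ 2 := by
      rw [hW]; push_cast; ring
    rw [h1]
    have h2 : 10240000 * B * |P₀ - P₁| * ℓ ^ 6 ≤
        10240000 * B * (1 + C₂) * (L * ℓ ^ 34 + F) := by
      have h3 : |P₀ - P₁| * ℓ ^ 6 ≤ (1 + C₂) * (L * ℓ ^ 34 + F) := by
        calc |P₀ - P₁| * ℓ ^ 6 ≤ C₂ * (L * ℓ) * ℓ ^ 6 := by gcongr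
          _ = C₂ * (L * ℓ ^ 7) := by ring
          _ ≤ (1 + C₂) * (L * ℓ ^ 34 + F) := by
            have h5 : L * ℓ ^ 7 ≤ L * ℓ ^ 34 :=
              mul_le_mul_of_nonneg_left (pow_le_pow_right₀ hℓ (by norm_num)) hL
            have h6 : 0 ≤ L * ℓ ^ 7 := by positivity
            gcongr <;> linarith
      calc _ = 10240000 * B * (|P₀ - P₁| * ℓ ^ 6) := by ring
        _ ≤ 10240000 * B * ((1 + C₂) * (L * ℓ ^ 34 + F)) := by gcongr
        _ = _ := by ring
    calc _ ≤ _ := (norm_add_le _ _).trans (add_le_add hzW ((hmain _).trans h2))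
      _ = _ := by ring

end

/-! ### The two orders -/

section

variable {D : ℕ} {ψ : DirichletCharacter ℂ D}

lemma tendsto_charSum_quadratic (h : ψ.IsQuadratic) {L L' L'' : ℝ}
    (hc : CharData (realChar ψ h) D L L' L'') (c₀ c₁ c₂ : ℂ) :
    Tendsto (fun N => ∑ i ∈ range N, ψ ((i + 1 : ℕ) : ZMod D) / ((i + 1 : ℕ) : ℂ) *
      (c₀ + c₁ * (log ((i + 1 : ℕ) : ℝ) : ℂ) + c₂ * (log ((i + 1 : ℕ) : ℝ) : ℂ) ^ 2)) atTop
      (𝓝 (c₀ * L - c₁ * L' + c₂ * L'')) := by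
  have h0 := ((Complex.continuous_ofReal.tendsto _).comp hc.lim0).const_mul c₀
  have h1 := ((Complex.continuous_ofReal.tendsto _).comp hc.lim1).const_mul c₁
  have h2 := ((Complex.continuous_ofReal.tendsto _).comp hc.lim2).const_mul c₂
  have h3 := (h0.add h1).add h2
  rw [show c₀ * L - c₁ * L' + c₂ * L'' = c₀ * (L : ℂ) + c₁ * ((-L' : ℝ) : ℂ) + c₂ * (L'' : ℂ) by
    push_cast; ring]
  refine h3.congr fun N => ?_
  simp only [Function.comp, Complex.ofReal_sum, mul_sum, ← Finset.sum_add_distrib]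
  refine sum_congr rfl fun i _ => ?_
  rw [← realChar_cast h]
  push_cast
  ring

lemma log_sq_mul {y : ℝ} (hy : 0 < y) (i : ℕ) : log (((i + 1 : ℕ) : ℝ) ^ 2 * y) =
    log y + 2 * log ((i + 1 : ℕ) : ℝ) := by
  rw [log_mul (by positivity) hy.ne', log_pow]; push_cast; ring

lemma L1_le_one (h : ψ.IsQuadratic) [NeZero D] (hodd : ψ.Odd) (hD : 128 ≤ D)
    (hL : L1 ψ * log D ≤ 1) : L1 ψ ≤ 1 := by
  have hL0 := (charData_realChar h hodd (by omega)).1.L_pos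
  have hD' : (128 : ℝ) ≤ D := by exact_mod_cast hD
  have hlD : 1 ≤ log D := one_le_log (by linarith)
  exact (le_mul_of_one_le_right hL0.le hlD).trans hL

lemma logs_le {q : ℕ} {X : ℝ} (hD : 128 ≤ D) (hq : (D : ℝ) ^ 24 ≤ q) (hX : (D : ℝ) ^ 24 ≤ X) :
    1 ≤ log (q * X) ∧ log D ≤ log (q * X) ∧ log X ≤ log (q * X) ∧
      0 ≤ log (Q q D) ∧ log (Q q D) ≤ log (q * X) ∧ 24 * log D ≤ log q := by
  have hD' : (128 : ℝ) ≤ D := by exact_mod_cast hD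
  have hDD : (D : ℝ) ≤ (D : ℝ) ^ 24 := le_self_pow₀ (by linarith) (by norm_num)
  have hq0 : (0 : ℝ) < q := by linarith
  have hX0 : (0 : ℝ) < X := by linarith
  have hXle : X ≤ q * X := le_mul_of_one_le_left hX0.le (by linarith)
  have hlX : log X ≤ log (q * X) := log_le_log hX0 hXle
  have hlD : 1 ≤ log D := one_le_log (by linarith)
  have hDX : log D ≤ log X := log_le_log (by linarith) (hDD.trans hX)
  have hπ : 4 * Real.pi ^ 2 ≤ 64 := by
    nlinarith [Real.pi_le_four, Real.pi_pos]
  have hπ1 : 1 ≤ 4 * Real.pi ^ 2 := by nlinarith [Real.pi_gt_three]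
  refine ⟨by linarith, by linarith, hlX, log_nonneg ?_, log_le_log ?_ ?_, ?_⟩
  · rw [Q, one_le_div (by positivity)]
    nlinarith
  · rw [Q]; positivity
  · rw [Q]
    refine (div_le_self (by positivity) hπ1).trans ?_
    gcongr
    linarith
  · rw [show 24 * log D = log ((D : ℝ) ^ 24) by rw [log_pow]; norm_num]
    exact log_le_log (by positivity) hq

end

/-- The case `k = 1`, with error terms in powers of `log (q X)`. -/
lemma exists_order_one {G : ℂ → ℂ} (hG : IsAdmissibleWeight 1 G) : ∃ C : ℝ, 0 ≤ C ∧
    ∀ {D : ℕ} [NeZero D] {ψ : DirichletCharacter ℂ D}, ψ.IsQuadratic → ψ.Odd → 128 ≤ D →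
      L1 ψ * log D ≤ 1 → ∀ {q : ℕ} {X : ℝ}, (D : ℝ) ^ 24 ≤ q → (D : ℝ) ^ 24 ≤ X →
      (∀ t ∈ triples X, Summable (diagTerm ψ G 1 q X t)) ∧
      ∃ T : ℝ, T = ‖diagonal ψ G 1 q X -
          4 * (1 + ψ (q : ZMod D)) ^ 2 * singularSeries2 ψ X * deriv ψ.LFunction 1 ^ 2‖ ∧
        T ≤ C * log (q * X) ^ 30 ∧
        T ≤ C * (L1 ψ * log (q * X) ^ 34 +
          (D : ℝ) ^ 15 * (q : ℝ) ^ (-(1 / 4) : ℝ) * log (q * X) ^ 28) := by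
  have hγ0 := Real.one_half_lt_eulerMascheroniConstant
  have hγ1 := Real.eulerMascheroniConstant_lt_two_thirds
  obtain ⟨C₁, hC₁, hev⟩ := exists_diagonal_evaluation hG le_rfl (by norm_num) (A₀ := 400)
    (P := fun x => -2 * eulerMascheroniConstant - log x) fun x hx => V_one_eq hG hx
  obtain ⟨C₂, hC₂, htail⟩ := exists_singular_tail
  refine ⟨C₁ + 10240000 * 1 * (1 + C₂), by positivity, ?_⟩
  intro D _ ψ h hodd hD hLD q X hq hX
  obtain ⟨hc, -, hL', -⟩ := charData_realChar h hodd (by omega)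
  obtain ⟨hℓ1, hDℓ, hXℓ, -, -, -⟩ := logs_le hD hq hX
  obtain ⟨hsum, hb, hmain⟩ := hev h hodd hD (L1_le_one h hodd hD hLD) hq hX rfl
  refine ⟨hsum, _, rfl, ?_⟩
  have hD1 : (1 : ℝ) ≤ D := by exact_mod_cast (by omega : 1 ≤ D)
  rw [singularSeries2_eq h (by omega) ((le_self_pow₀ hD1 (by norm_num)).trans hX), ← hL']
  have hD0 : 0 ≤ log D := log_natCast_nonneg D
  obtain ⟨hM, -⟩ := hc.abs_deriv_le (by omega)
  have hM3 : |(deriv ψ.LFunction 1).re| ≤ 400 * log (q * X) ^ 3 := by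
    calc _ ≤ 100 * log D ^ 2 := hM
      _ ≤ 400 * log (q * X) ^ 2 := by gcongr; norm_num
      _ ≤ _ := by gcongr; norm_num
  have hS := fun p (hp : p ∈ primesUpTo (D ^ 24)) => prime_of_mem_primesUpTo hp
  have hW := tsum_mainTerm_zero hc.tri (deriv ψ.LFunction 1).re hS
  have hP := prod_localFactor_bounds hc.tri fun p (hp : p ∈ primesUpTo ⌊X⌋₊) =>
    prime_of_mem_primesUpTo hp
  have := norm_sub_main_le (θ := 0) (B := 1) (F := (D : ℝ) ^ 15 * (q : ℝ) ^ (-(1 / 4) : ℝ) *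
      log (q * X) ^ 28)
    (norm_sq_factor_le (k := 1) (by norm_num) (ψ.norm_le_one (q : ZMod D)))
    hℓ1 hc.L_pos.le (by positivity) hC₂ hb
    (hmain (M := (deriv ψ.LFunction 1).re) (l := 0)
      (e := fun y => -2 * eulerMascheroniConstant - log y) hM3 (by simp; positivity)
      (fun y hy => ?_) (fun y hy => ?_))
    (by rw [hW, add_zero, mul_one]) (htail hc hX hXℓ hℓ1) hP.1.le hP.2 hM3 (by norm_num)
  · have hc1 : ((Nat.factorial 1 : ℕ) : ℂ) ^ 2 * (1 + (-1) ^ (1 + 1) * ψ (q : ZMod D)) ^ 2 * 4 =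
        4 * (1 + ψ (q : ZMod D)) ^ 2 := by
      norm_num; ring
    rwa [hc1, Complex.ofReal_zero, add_zero, mul_one] at this
  · have e : ‖(-2 * eulerMascheroniConstant - log y : ℂ)‖ =
        |-2 * eulerMascheroniConstant - log y| := by
      rw [← norm_eq_abs, ← Complex.norm_real]; push_cast; rfl
    rw [e]
    have h1 : |-2 * eulerMascheroniConstant - log y| ≤
        2 * eulerMascheroniConstant + |log y| := by
      refine (abs_sub _ _).trans ?_
      rw [abs_mul, abs_of_pos (by linarith : 0 < eulerMascheroniConstant)]; norm_num
    nlinarith [abs_nonneg (log y)]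
  · have h1 := tendsto_charSum_quadratic h hc
      (-2 * eulerMascheroniConstant - log y) (-2) 0
    convert h1 using 1
    · funext N
      refine sum_congr rfl fun i _ => ?_
      rw [log_sq_mul hy]; push_cast; ring
    · congr 1; push_cast; ring

/-- The case `k = 2`, with error terms in powers of `log (q X)`. -/
lemma exists_order_two : ∃ (D₀ : ℕ) (η₀ : ℝ), 0 < η₀ ∧ 128 ≤ D₀ ∧ η₀ ≤ 1 ∧ ∃ C₀ : ℝ,
    ∀ {G : ℂ → ℂ}, IsAdmissibleWeight 2 G → ∃ C : ℝ, 0 ≤ C ∧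
    ∀ {D : ℕ} [NeZero D] {ψ : DirichletCharacter ℂ D}, ψ.IsQuadratic → ψ.Odd → D₀ ≤ D →
      L1 ψ * log D ≤ η₀ → ∀ {q : ℕ} {X : ℝ}, (D : ℝ) ^ 24 ≤ q → (D : ℝ) ^ 24 ≤ X →
      (∀ t ∈ triples X, Summable (diagTerm ψ G 2 q X t)) ∧
      ∃ θ : ℂ, ‖θ‖ ≤ C₀ * kappa ψ ∧
      ∃ T : ℝ, T = ‖diagonal ψ G 2 q X -
          16 * (1 - ψ (q : ZMod D)) ^ 2 * singularSeries2 ψ X * (1 + θ) * mainFactor ψ q ^ 2‖ ∧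
        T ≤ C * log (q * X) ^ 30 ∧
        T ≤ C * (L1 ψ * log (q * X) ^ 34 +
          (D : ℝ) ^ 15 * (q : ℝ) ^ (-(1 / 4) : ℝ) * log (q * X) ^ 28) := by
  have hγ0 := Real.one_half_lt_eulerMascheroniConstant
  have hγ1 := Real.eulerMascheroniConstant_lt_two_thirds
  obtain ⟨D₁, hge⟩ := CharData.exists_main_ge
  obtain ⟨C₀, η₁, hC₀, hη₁, hη₁1, hts⟩ := exists_tsum_mainTerm
  obtain ⟨C₂, hC₂, htail⟩ := exists_singular_tail
  refine ⟨max 128 D₁, min (1 / 40) η₁, by positivity, le_max_left _ _,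
    (min_le_left _ _).trans (by norm_num), C₀, ?_⟩
  intro G hG
  obtain ⟨h₂, hV⟩ := V_two_eq hG
  obtain ⟨C₁, hC₁, hev⟩ := exists_diagonal_evaluation hG (by norm_num) le_rfl (A₀ := 400 + ‖h₂‖)
    (P := fun x => h₂ + 2 * eulerMascheroniConstant * log x + (log x) ^ 2 / 2) hV
  refine ⟨C₁ + 10240000 * (1 + C₀) * (1 + C₂), by positivity, ?_⟩
  intro D _ ψ h hodd hD₀ hLD q X hq hX
  have hD : 128 ≤ D := (le_max_left _ _).trans hD₀
  obtain ⟨hc, -, hL', hL''⟩ := charData_realChar h hodd (by omega)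
  rw [mainFactor, ← hL', ← hL'']
  generalize (deriv ψ.LFunction 1).re = l, (iteratedDeriv 2 ψ.LFunction 1).re = l₂ at *
  obtain ⟨hℓ1, hDℓ, hXℓ, hQ0, hQℓ, hDq⟩ := logs_le hD hq hX
  have hLD40 := hLD.trans (min_le_left _ _)
  obtain ⟨hsum, hb, hmain⟩ := hev h hodd hD (L1_le_one h hodd hD (hLD40.trans (by norm_num))) hq hX rfl
  refine ⟨hsum, ?_⟩
  have hD1 : (1 : ℝ) ≤ D := by exact_mod_cast (by omega : 1 ≤ D)
  have hD0 : 0 ≤ log D := log_natCast_nonneg D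
  have hl : 1 / 4 ≤ l := hc.deriv_one_ge hLD40
  have hMge := hge hc ((le_max_right _ _).trans hD₀) hLD40 q hq
  obtain ⟨hl2, hm3⟩ := hc.abs_deriv_le (by omega)
  obtain ⟨M, hM⟩ : ∃ M, M = l₂ + (log (Q q D) - 2 * eulerMascheroniConstant) * l :=
    ⟨_, rfl⟩
  have hMF : (l₂ : ℂ) + ((log (Q q D) - 2 * eulerMascheroniConstant : ℝ) : ℂ) * l = M := by
    rw [hM]; push_cast; ring
  rw [hMF, singularSeries2_eq h (by omega) ((le_self_pow₀ hD1 (by norm_num)).trans hX)]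
  rw [← hM] at hMge
  have hMle : |M| ≤ 400 * log (q * X) ^ 3 := by
    rw [hM]
    have h1 : |log (Q q D) - 2 * eulerMascheroniConstant| ≤ 3 * log (q * X) := by
      rw [abs_le]; constructor <;> linarith
    refine (abs_add_le _ _).trans ?_
    rw [abs_mul]
    calc _ ≤ 100 * log (q * X) ^ 3 + 3 * log (q * X) * (100 * log (q * X) ^ 2) := by
          gcongr
          · exact hm3.trans (by gcongr)
          · exact hl2.trans (by gcongr)
      _ = _ := by ring
  have hlle : |l| ≤ 400 * log (q * X) ^ 3 := by
    calc _ ≤ 100 * log D ^ 2 := hl2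
      _ ≤ 400 * log (q * X) ^ 2 := by gcongr; norm_num
      _ ≤ _ := by gcongr; norm_num
  have hA : 400 * log (q * X) ^ 3 ≤ (400 + ‖h₂‖) * log (q * X) ^ 3 := by
    gcongr; linarith [norm_nonneg h₂]
  have hlim : ∀ y : ℝ, 0 < y → Tendsto (fun N => ∑ i ∈ range N,
      ψ ((i + 1 : ℕ) : ZMod D) / ((i + 1 : ℕ) : ℂ) *
        (h₂ + 2 * eulerMascheroniConstant * log (((i + 1 : ℕ) : ℝ) ^ 2 * y) +
          (log (((i + 1 : ℕ) : ℝ) ^ 2 * y)) ^ 2 / 2)) atTop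
      (𝓝 (2 * ((M - l * log (y * Q q D) : ℝ) : ℂ) +
        L1 ψ * (h₂ + 2 * eulerMascheroniConstant * log y + (log y) ^ 2 / 2))) := by
    intro y hy
    have hQ : 0 < Q q D := by
      have : (0 : ℝ) < q := lt_of_lt_of_le (by positivity) hq
      exact Q_pos (by exact_mod_cast this) (by omega)
    have h1 := tendsto_charSum_quadratic h hc
      (h₂ + 2 * eulerMascheroniConstant * log y + (log y) ^ 2 / 2)
      (4 * eulerMascheroniConstant + 2 * log y) 2
    rw [log_mul hy.ne' hQ.ne', hM]
    convert h1 using 1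
    · funext N
      refine sum_congr rfl fun i _ => ?_
      rw [log_sq_mul hy]; push_cast; ring
    · congr 1; push_cast; ring
  have he : ∀ y : ℝ, 0 < y → ‖(h₂ + 2 * eulerMascheroniConstant * log y +
      (log y) ^ 2 / 2 : ℂ)‖ ≤ (400 + ‖h₂‖) * (1 + |log y|) ^ 2 := by
    intro y _
    have e1 : ‖(2 * eulerMascheroniConstant * log y : ℂ)‖ =
        2 * eulerMascheroniConstant * |log y| := by
      rw [norm_mul, norm_mul, Complex.norm_real, Complex.norm_real, Complex.norm_ofNat,
        norm_eq_abs, norm_eq_abs,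
        abs_of_pos (by linarith : 0 < eulerMascheroniConstant)]
    have e2 : ‖((log y : ℂ)) ^ 2 / 2‖ = |log y| ^ 2 / 2 := by
      rw [norm_div, norm_pow, Complex.norm_real, Complex.norm_ofNat, norm_eq_abs]
    refine norm_add₃_le.trans ?_
    rw [e1, e2]
    have ha := abs_nonneg (log y)
    have h3 : ‖h₂‖ ≤ ‖h₂‖ * (1 + |log y|) ^ 2 :=
      le_mul_of_one_le_right (norm_nonneg _) (by nlinarith)
    nlinarith
  have hz := hmain (hMle.trans hA) (hlle.trans hA) he hlim
  have hP₁ := prod_localFactor_bounds hc.tri fun p (hp : p ∈ primesUpTo ⌊X⌋₊) =>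
    prime_of_mem_primesUpTo hp
  have hP₀ := (prod_localFactor_bounds hc.tri fun p (hp : p ∈ primesUpTo (D ^ 24)) =>
    prime_of_mem_primesUpTo hp).1
  have hlM : log D * l ≤ M := by
    refine le_trans ?_ hMge
    rw [mul_div_right_comm]
    exact mul_le_mul_of_nonneg_right (by linarith) (by linarith)
  have hM0 : 0 < M := by
    have hlq : 0 < log q := by
      have : 0 < log D := Real.log_pos (by exact_mod_cast (by omega : 1 < D))
      linarith
    exact lt_of_lt_of_le (by positivity) hMge
  obtain ⟨hκ1, hκ0, hW⟩ := hts hc hD (hLD.trans (min_le_right _ _)) (κ := kappa ψ) rfl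
    (by linarith : 0 < l) hlM
  have htl := htail hc hX hXℓ hℓ1
  generalize (∏ p ∈ primesUpTo (D ^ 24), localFactor (realChar ψ h) p) = P₀ at *
  generalize (∏ p ∈ primesUpTo ⌊X⌋₊, localFactor (realChar ψ h) p) = P₁ at *
  generalize (∑' t : FT (primesUpTo (D ^ 24)),
    mainTerm (realChar ψ h) M l t.toTup) = W at *
  have hMP : 0 < M ^ 2 * P₀ := by positivity
  -- the relative deviation of the main term from `M ^ 2` times the singular product
  have hθ : |W / (M ^ 2 * P₀) - 1| ≤ C₀ * kappa ψ := by
    rw [div_sub_one hMP.ne', abs_div, abs_of_pos hMP, div_le_iff₀ hMP]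
    exact hW
  refine ⟨((W / (M ^ 2 * P₀) - 1 : ℝ) : ℂ), by rwa [Complex.norm_real, norm_eq_abs],
    _, rfl, ?_⟩
  have := norm_sub_main_le (θ := W / (M ^ 2 * P₀) - 1) (B := 1 + C₀)
    (F := (D : ℝ) ^ 15 * (q : ℝ) ^ (-(1 / 4) : ℝ) * log (q * X) ^ 28)
    (norm_sq_factor_le (k := 2) le_rfl (ψ.norm_le_one (q : ZMod D)))
    hℓ1 hc.L_pos.le (by positivity) hC₂ hb hz
    (by rw [add_sub_cancel]; field_simp) htl hP₁.1.le hP₁.2 hMle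
    ((abs_add_le _ _).trans (by
      rw [abs_one]
      have : C₀ * kappa ψ ≤ C₀ := mul_le_of_le_one_right hC₀ hκ1
      linarith))
  have hc2 : ((Nat.factorial 2 : ℕ) : ℂ) ^ 2 * (1 + (-1) ^ (2 + 1) * ψ (q : ZMod D)) ^ 2 * 4 =
      16 * (1 - ψ (q : ZMod D)) ^ 2 := by
    norm_num [Nat.factorial]; ring
  rwa [hc2] at this

end SecondMoment

end

theorem proposition6p1 :
    -- `D ≥ D₀` is "D large" and `L(1,ψ) log D ≤ δ` is "L(1,ψ) log D = o(1)"
    ∃ (D₀ : ℕ) (δ : ℝ), 0 < δ ∧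
    -- the case `k = 1`
    (∀ G : ℂ → ℂ, IsAdmissibleWeight 1 G →
      ∃ K K' : ℝ → ℝ, ∀ ε : ℝ, 0 < ε → ∀ A : ℝ, 0 < A →
      ∀ (D : ℕ) [NeZero D] (ψ : DirichletCharacter ℂ D) (q : ℕ) (X : ℝ),
        D₀ ≤ D → ψ.IsQuadratic → ψ.Odd → ψ.IsPrimitive →
        L1 ψ * Real.log D ≤ δ →
        q.Prime → (D : ℝ) ^ 24 ≤ q → (D : ℝ) ^ 24 ≤ X →
        (∀ t ∈ triples X, Summable (diagTerm ψ G 1 q X t)) ∧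
        ‖diagonal ψ G 1 q X
            - 4 * (1 + ψ (q : ZMod D)) ^ 2 * singularSeries2 ψ X * deriv ψ.LFunction 1 ^ 2‖
          ≤ K ε * (L1 ψ * Real.log q ^ (37 + ε))
            + K' A * Real.log q ^ (-A)
            + K ε * ((q : ℝ) ^ (-1 / 4 + ε) * (D : ℝ) ^ (-1 / 4 : ℝ) * X ^ (3 / 4 : ℝ))) ∧
    -- the case `k = 2`
    (∀ G : ℂ → ℂ, IsAdmissibleWeight 2 G →
      ∃ (K₀ : ℝ) (K : ℝ → ℝ), ∀ ε : ℝ, 0 < ε →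
      ∀ (D : ℕ) [NeZero D] (ψ : DirichletCharacter ℂ D) (q : ℕ) (X : ℝ),
        D₀ ≤ D → ψ.IsQuadratic → ψ.Odd → ψ.IsPrimitive →
        L1 ψ * Real.log D ≤ δ →
        q.Prime → (D : ℝ) ^ 24 ≤ q → (D : ℝ) ^ 24 ≤ X →
        (∀ t ∈ triples X, Summable (diagTerm ψ G 2 q X t)) ∧
        ∃ θ : ℂ, ‖θ‖ ≤ K₀ * kappa ψ ∧
        ‖diagonal ψ G 2 q X
            - 16 * (1 - ψ (q : ZMod D)) ^ 2 * singularSeries2 ψ X * (1 + θ) * mainFactor ψ q ^ 2‖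
          ≤ K ε * (L1 ψ * Real.log q ^ (39 + ε))
            + K ε * ((q : ℝ) ^ (-1 / 4 + ε) * (D : ℝ) ^ (-1 / 4 : ℝ) * X ^ (3 / 4 : ℝ))) := by
  obtain ⟨D₀, δ, hδ, hD₀, hδ1, C₀, h2⟩ := exists_order_two
  refine ⟨D₀, δ, hδ, fun G hG => ?_, fun G hG => ?_⟩
  · obtain ⟨C, hC, h1⟩ := exists_order_one hG
    obtain ⟨K, hK⟩ := exists_error_bound hC
    refine ⟨K, fun _ => 0, ?_⟩
    intro ε hε A _ D _ ψ q X hD hψ hodd _ hL _ hq hX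
    have hD128 := hD₀.trans hD
    obtain ⟨hsum, T, hT, hT1, hT2⟩ := h1 hψ hodd hD128 (hL.trans hδ1) hq hX
    refine ⟨hsum, ?_⟩
    rw [← hT, zero_mul, add_zero]
    exact hK ε hε hD128 hq hX (charData_realChar hψ hodd (by omega)).1.L_pos.le (by norm_num)
      hT1 hT2
  · obtain ⟨C, hC, h2⟩ := h2 hG
    obtain ⟨K, hK⟩ := exists_error_bound hC
    refine ⟨C₀, K, ?_⟩
    intro ε hε D _ ψ q X hD hψ hodd _ hL _ hq hX
    have hD128 := hD₀.trans hD
    obtain ⟨hsum, θ, hθ, T, hT, hT1, hT2⟩ := h2 hψ hodd hD hL hq hX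
    refine ⟨hsum, θ, hθ, ?_⟩
    rw [← hT]
    exact hK ε hε hD128 hq hX (charData_realChar hψ hodd (by omega)).1.L_pos.le (by norm_num)
      hT1 hT2
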